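/- **Theorem (Zeroth-order saddlepoint approximation, fully identifiable case).** *Setup.* Let $D\subset\mathbb R^p$ be open and, for $\theta\in D$, let $Y_\theta$ be a random vector in $\mathbb R^m$. Write $M_0(s;\theta)=\mathbb E\,e^{sY_\theta}$, $K_0=\log M_0$, $\mathcal S=\{(s,\theta): \theta\in D,\ M_0(s;\theta)<\infty\}$ (real $s$), and assume that for every $\theta\in D$ some $(s,\theta)$ lies in the interior $\mathcal S^\circ$. Let $X_\theta$ be the sum of $n$ independent copies of $Y_\theta$, with CGF $K=nK_0$, and write $x=ny$. The saddlepoint $\hat s=\hat s(\theta;x)$ is the solution of $K'(\hat s;\theta)=x$ (equivalently $K_0'(\hat s;\theta)=y$), where $'$ is the gradient in $s$; $\mathcal Y^o$ is the set of $(y,\theta)$ for which it exists with $(\hat s,\theta)\in\mathcal S^\circ$. Put $$\hat L^*(\theta;x)=\exp\bigl(K(\hat s;\theta)-\hat s x\bigr),\qquad \hat L(\theta;x)=\frac{\hat L^*(\theta;x)}{\sqrt{\det(2\pi K''(\hat s;\theta))}}.$$ Let $L(\theta;x)$ be the true likelihood. Assume one of the following two cases. * *Absolutely continuous case:* there is a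 continuous $\delta:\mathcal S^\circ\to(0,\infty)$ with $|M_0(s+i\phi;\theta)/M_0(s;\theta)|\le(1+\delta(s,\theta)|\phi|^2)^{-\delta(s,\theta)}$ for all $(s,\theta)\in\mathcal S^\circ$, $\phi\in\mathbb R^m$. Here $L(\theta;\cdot)$ is the continuous density of $X_\theta$ (its existence for the relevant $\theta$ and all large $n$ is part of the conclusions), and every $x\in\mathbb R^m$ is admissible. * *Integer-valued case:* $Y_\theta\in\mathbb Z^m$, and $|M_0(s+i\phi;\theta)|<M_0(s;\theta)$ for all $(s,\theta)\in\mathcal S^\circ$, $\phi\in[-\pi,\pi]^m\setminus\{0\}$. Here $L(\theta;x)=\mathbb P(X_\theta=x)$, and the admissible $x$ are those in $\mathbb Z^m$. In both cases assume moreover that there is a continuous $\gamma:\mathcal S^\circ\to(0,\infty)$ such that all partial derivatives of $M_0$ of order $k$ in $\theta$ and $\ell$ in $s$, for $k\in\{0,1\}$, $1\le k+\ell\le6$ and for $k=2$, $0\le\ell\le2$, exist at $(s+i\phi;\theta)$ for $(s,\theta)\in\mathcal S^\circ$, $\phi\in\mathbb R^m$, are jointly continuous there, and are bounded in modulus by $\gamma(s,\theta)(1+|\phi|)^{\gamma(s,\theta)}$.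 *(a) Gradient.* $\nabla_\theta\log\hat L^*(\theta;x)=\nabla_\theta\log L(\theta;x)+O(1)$ as $n\to\infty$ for $(y,\theta)\in\mathcal Y^o$ (with $x=ny$ admissible), uniformly for $(y,\theta)$ in compact subsets of $\mathcal Y^o$ and all sufficiently large $n$, including the assertion that $L(\theta;x)>0$ and that both gradients exist. For (b)–(d) let $(s_0,\theta_0)\in\mathcal S^\circ$, $y_0=K_0'(s_0;\theta_0)$, $\nabla_\theta K_0(s_0;\theta_0)=0$, put $A=K_0''(s_0;\theta_0)$, $B=\nabla_s\nabla_\theta K_0(s_0;\theta_0)$ and assume that $H=\nabla_\theta^T\nabla_\theta K_0(s_0;\theta_0)-B^TA^{-1}B$ is negative definite. *(b) MLE.* There are $n_0$ and open neighbourhoods $U\subset D$ of $\theta_0$ and $V\subset\mathbb R^m$ of $y_0$ with $V\times U\subset\mathcal Y^o$ such that for all $n\ge n_0$, $y\in V$, the functions $\theta\mapsto\hat L^*(\theta;x)$ and $\theta\mapsto\hat L(\theta;x)$ and, if $x=ny$ is admissible, $\theta\mapsto L(\theta;x)$ (which is positive on $U$) have unique local maximisers $\hat\theta^*_U(x)$,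 $\hat\theta_U(x)$, $\theta_U(x)$ in $U$; these depend measurably on $x$, and $|\hat\theta^*_U(x)-\theta_U(x)|=O(1/n)$, uniformly over $n\ge n_0$, $y\in V$ with $x$ admissible. *(c) Posterior.* Let the prior on $D$ have a probability density that is continuous and positive at $\theta_0$, and let $x=ny_0$. For some open neighbourhood $U\subset D$ of $\theta_0$, the posterior on $U$ built from $\hat L^*$ (density proportional to $\hat L^*(\theta;x)\mathbf 1_{\theta\in U}$ with respect to the prior) is well defined for large $n$, and under it $\sqrt n(\Theta-\theta_0)\to\mathcal N(0,-H^{-1})$ in distribution. The same holds, with the same $U$, for the posteriors built from $\hat L$ and from $L$ (for $L$, along those $n$ for which $ny_0$ is admissible). *(d) Sampling distribution.* Let $U$ be as in (b), and let $\chi_n$ be admissible random observations with $(\chi_n-ny_0)/\sqrt n\to\mathcal N(0,\Sigma)$ in distribution, $\Sigma$ positive semi-definite. Then, extending the local maximisers of (b) measurably in any way to the remaining $x$, $$\bigl(\sqrt n(\theta_U(\chi_n)-\theta_0),\ \sqrt n(\hat\theta_U(\chi_n)-\theta_0),\ \sqrt n(\hat\theta^*_U(\chi_n)-\theta_0)\bigr)\to(Z,Z,Z)$$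 in distribution, where $Z\sim\mathcal N(0,H^{-1}B^TA^{-1}\Sigma A^{-1}BH^{-1})$. *(e) Exponential families.* Let $N\subset\mathbb R^m$ be open and, for $\eta\in N$, let $X_\eta$ have density $L(\eta;x)=h(x)\exp(\eta x-\rho(\eta))$, with $h\ge0$ measurable, with respect to a fixed measure on $\mathbb R^m$. Let $x$ satisfy $h(x)>0$ and be such that the saddlepoint equation of $X_\eta$ at $x$ has a solution for each $\eta\in N$, so that $\hat L^*(\cdot\,;x)$ is defined on $N$. Then $\eta\in N$ maximises $\hat L^*(\cdot\,;x)$ over $N$ if and only if it maximises the true likelihood $L(\cdot\,;x)$ over $N$; and if the CGFs of all $X_\eta$ have positive definite Hessian in the interior of their domains, a maximiser of $\hat L^*(\cdot\,;x)$ is the only maximiser of $L(\cdot\,;x)$, i.e. the exact MLE. -/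

import Mathlib

open MeasureTheory ProbabilityTheory Filter Topology Set

namespace Saddlepoint

/-- Euclidean space `ℝᵈ`. Row and column vectors are identified, `s x` is `inner ℝ s x`. -/
abbrev E (d : ℕ) : Type := EuclideanSpace ℝ (Fin d)

/-- The `i`-th standard unit vector. -/
noncomputable def unitVec {d : ℕ} (i : Fin d) : E d := EuclideanSpace.single i 1

/-! ### Generating functions and the saddlepoint of a single law `ν` on `ℝᵐ` -/

/-- The set of real `s` with `𝔼 exp(s X) < ∞`, where `X ∼ ν`. -/
def mgfDomain {m : ℕ} (ν : Measure (E m)) : Set (E m) :=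
  {s | Integrable (fun y => Real.exp (inner ℝ s y)) ν}

/-- The moment generating function `M(s) = 𝔼 exp(s X)`, for `X ∼ ν`. -/
noncomputable def mgf {m : ℕ} (ν : Measure (E m)) (s : E m) : ℝ :=
  ∫ y, Real.exp (inner ℝ s y) ∂ν

/-- The moment generating function `M(s + iφ)` at a complex argument. -/
noncomputable def cmgf {m : ℕ} (ν : Measure (E m)) (s φ : E m) : ℂ :=
  ∫ y, Complex.exp ((inner ℝ s y : ℝ) + (inner ℝ φ y : ℝ) * Complex.I) ∂ν

/-- The cumulant generating function `K = log M`. -/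
noncomputable def cgf {m : ℕ} (ν : Measure (E m)) (s : E m) : ℝ := Real.log (mgf ν s)

/-- The second-order partial derivative `∂_u ∂_v f` at the point `q`. -/
noncomputable def secondPD {W : Type*} [NormedAddCommGroup W] [NormedSpace ℝ W]
    (f : W → ℝ) (q u v : W) : ℝ :=
  lineDeriv ℝ (fun r => lineDeriv ℝ f r v) q u

/-- The Hessian `K''(s)`. -/
noncomputable def cgfHess {m : ℕ} (ν : Measure (E m)) (s : E m) : Matrix (Fin m) (Fin m) ℝ :=
  Matrix.of fun i j => secondPD (cgf ν) s (unitVec i) (unitVec j)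

/-- `s` solves the saddlepoint equation `K'(s) = x`. At a boundary point of the convex set where
`M < ∞`, the gradient is understood as the derivative from within this set; at interior points it
is the ordinary gradient. -/
def IsSaddlepoint {m : ℕ} (ν : Measure (E m)) (x s : E m) : Prop :=
  s ∈ mgfDomain ν ∧ HasFDerivWithinAt (cgf ν) (innerSL ℝ x) (mgfDomain ν) s

/-- The saddlepoint `ŝ(x)`, an arbitrary vector if the saddlepoint equation has no solution. -/
noncomputable def saddlepoint {m : ℕ} (ν : Measure (E m)) (x : E m) : E m :=
  Classical.epsilon (IsSaddlepoint ν x)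

/-- The zeroth-order saddlepoint approximation `exp (K(ŝ) - ŝ x)`. -/
noncomputable def zerothSPA {m : ℕ} (ν : Measure (E m)) (x : E m) : ℝ :=
  Real.exp (cgf ν (saddlepoint ν x) - inner ℝ (saddlepoint ν x) x)

/-- The saddlepoint approximation `exp (K(ŝ) - ŝ x) / √(det (2π K''(ŝ)))`. -/
noncomputable def spa {m : ℕ} (ν : Measure (E m)) (x : E m) : ℝ :=
  Real.exp (cgf ν (saddlepoint ν x) - inner ℝ (saddlepoint ν x) x) /
    Real.sqrt (((2 * Real.pi) • cgfHess ν (saddlepoint ν x)).det)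

/-- The law of `Y⁽¹⁾ + ⋯ + Y⁽ⁿ⁾` for independent `Y⁽ⁱ⁾ ∼ ν`. -/
noncomputable def sumLaw {m : ℕ} (ν : Measure (E m)) (n : ℕ) : Measure (E m) :=
  (Measure.pi fun _ : Fin n => ν).map fun y => ∑ i, y i

/-- `f` is a continuous probability density of `ν` with respect to Lebesgue measure. -/
def IsContDensity {m : ℕ} (ν : Measure (E m)) (f : E m → ℝ) : Prop :=
  Continuous f ∧ (∀ x, 0 ≤ f x) ∧ ν = volume.withDensity fun x => ENNReal.ofReal (f x)

open Classical in
/-- The (unique) continuous density of `ν`, and `0` if there is none; so `contDensity ν x > 0`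
includes the assertion that `ν` has a continuous density. -/
noncomputable def contDensity {m : ℕ} (ν : Measure (E m)) (x : E m) : ℝ :=
  if h : ∃ f, IsContDensity ν f then h.choose x else 0

/-! ### Parametric models -/

/-- The set `𝒮` of all `(s, θ)` with `θ ∈ D` and `𝔼 exp(s Y_θ) < ∞`, where `Y_θ ∼ μ θ`. -/
def jointDomain {m p : ℕ} (D : Set (E p)) (μ : E p → Measure (E m)) : Set (E m × E p) :=
  {q | q.2 ∈ D ∧ q.1 ∈ mgfDomain (μ q.2)}

/-- A parametric family of probability laws `μ θ` of `Y_θ ∈ ℝᵐ`, with `θ` in an open set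
`D ⊆ ℝᵖ`, such that every `θ ∈ D` occurs in the interior of `𝒮`. -/
structure IsModel {m p : ℕ} (D : Set (E p)) (μ : E p → Measure (E m)) : Prop where
  isOpen : IsOpen D
  isProbabilityMeasure : ∀ θ ∈ D, IsProbabilityMeasure (μ θ)
  exists_interior : ∀ θ ∈ D, ∃ s, (s, θ) ∈ interior (jointDomain D μ)

/-- The set `𝒴ᵒ` of all `(y, θ)` whose saddlepoint satisfies `(ŝ₀(θ; y), θ) ∈ interior 𝒮`. -/
def saddleRegion {m p : ℕ} (D : Set (E p)) (μ : E p → Measure (E m)) : Set (E m × E p) :=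
  {q | ∃ s, IsSaddlepoint (μ q.2) q.1 s ∧ (s, q.2) ∈ interior (jointDomain D μ)}

/-- Iterated partial derivative along a list of directions, the head of the list being the
outermost derivative. -/
noncomputable def iterPD {W : Type*} [NormedAddCommGroup W] [NormedSpace ℝ W] :
    List W → (W → ℂ) → W → ℂ
  | [], F => F
  | v :: vs, F => fun q => lineDeriv ℝ (iterPD vs F) q v

/-- The outermost derivative in `iterPD vs F q` exists. -/
def HasIterPD {W : Type*} [NormedAddCommGroup W] [NormedSpace ℝ W] :
    List W → (W → ℂ) → W → Prop
  | [], _, _ => True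
  | v :: vs, F, q => LineDifferentiableAt ℝ (iterPD vs F) q v

/-- The directions of `∂^{k+ℓ} / ∂θ_{i₁} ⋯ ∂θ_{i_k} ∂s_{j₁} ⋯ ∂s_{j_ℓ}`. -/
noncomputable def pdDirections {m p : ℕ} (i : List (Fin p)) (j : List (Fin m)) :
    List (E m × E p) :=
  (i.map fun a => ((0 : E m), unitVec a)) ++ j.map fun b => (unitVec b, (0 : E p))

/-- The function `(s, θ) ↦ M₀(s + iφ; θ)`. As `M₀` is holomorphic in its first argument, its
partial derivatives in the complex variables `s_j` are those in the real parts of `s_j`. -/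
noncomputable def jointMGF {m p : ℕ} (μ : E p → Measure (E m)) (φ : E m) (q : E m × E p) : ℂ :=
  cmgf (μ q.2) q.1 φ

/-- Decay bound: for some continuous `δ > 0` on `interior 𝒮`,
`|M₀(s+iφ;θ) / M₀(s;θ)| ≤ (1 + δ(s,θ)|φ|²)^{-δ(s,θ)}`. -/
def DecayBound {m p : ℕ} (D : Set (E p)) (μ : E p → Measure (E m)) : Prop :=
  ∃ δ : E m × E p → ℝ, ContinuousOn δ (interior (jointDomain D μ)) ∧
    ∀ q ∈ interior (jointDomain D μ), 0 < δ q ∧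
      ∀ φ : E m, ‖cmgf (μ q.2) q.1 φ / (mgf (μ q.2) q.1 : ℂ)‖ ≤
        (1 + δ q * ‖φ‖ ^ 2) ^ (-δ q)

/-- Growth bound: for some continuous `γ > 0` on `interior 𝒮`, all partial derivatives of order
`k` in `θ` and `ℓ` in `s`, with `k ≤ 1 ≤ k + ℓ ≤ 6` or `k = 2, ℓ ≤ 2`, exist, are jointly
continuous, and are bounded by `γ(s,θ) (1 + |φ|)^{γ(s,θ)}` at `(s + iφ, θ)`. -/
def GrowthBound {m p : ℕ} (D : Set (E p)) (μ : E p → Measure (E m)) : Prop :=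
  ∃ γ : E m × E p → ℝ, ContinuousOn γ (interior (jointDomain D μ)) ∧
    (∀ q ∈ interior (jointDomain D μ), 0 < γ q) ∧
    ∀ (i : List (Fin p)) (j : List (Fin m)),
      (i.length ≤ 1 ∧ 1 ≤ i.length + j.length ∧ i.length + j.length ≤ 6) ∨
        (i.length = 2 ∧ j.length ≤ 2) →
      (∀ q ∈ interior (jointDomain D μ), ∀ φ : E m,
        HasIterPD (pdDirections i j) (jointMGF μ φ) q ∧
        ‖iterPD (pdDirections i j) (jointMGF μ φ) q‖ ≤ γ q * (1 + ‖φ‖) ^ γ q) ∧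
      ContinuousOn (fun r : (E m × E p) × E m => iterPD (pdDirections i j) (jointMGF μ r.2) r.1)
        (interior (jointDomain D μ) ×ˢ univ)

/-- The integer lattice `ℤᵐ` in `ℝᵐ`. -/
def intLattice (m : ℕ) : Set (E m) := {x | ∀ i, ∃ k : ℤ, x i = k}

/-- The laws `μ θ` are supported on `ℤᵐ`. -/
def IsIntegerValued {m p : ℕ} (D : Set (E p)) (μ : E p → Measure (E m)) : Prop :=
  ∀ θ ∈ D, ∀ᵐ y ∂μ θ, y ∈ intLattice m

/-- Non-lattice condition in the integer-valued case: `|M₀(s+iφ;θ)| < M₀(s;θ)` for all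
`(s,θ) ∈ interior 𝒮` and `φ ∈ [-π,π]ᵐ \ {0}`. -/
def NonLattice {m p : ℕ} (D : Set (E p)) (μ : E p → Measure (E m)) : Prop :=
  ∀ q ∈ interior (jointDomain D μ), ∀ φ : E m,
    (∀ i, φ i ∈ Icc (-Real.pi) Real.pi) → φ ≠ 0 → ‖cmgf (μ q.2) q.1 φ‖ < mgf (μ q.2) q.1

/-! ### Likelihoods for the sum `X_θ` of `n` independent copies of `Y_θ` -/

/-- The true likelihood `L_n(θ; x)` in the absolutely continuous case. -/
noncomputable def densityLik {m p : ℕ} (μ : E p → Measure (E m)) (n : ℕ) (θ : E p) (x : E m) : ℝ :=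
  contDensity (sumLaw (μ θ) n) x

/-- The true likelihood `L_n(θ; x) = ℙ(X_θ = x)` in the integer-valued case. -/
noncomputable def pmfLik {m p : ℕ} (μ : E p → Measure (E m)) (n : ℕ) (θ : E p) (x : E m) : ℝ :=
  (sumLaw (μ θ) n).real {x}

/-- The zeroth-order likelihood `L̂*_n(θ; x)`. -/
noncomputable def zerothLik {m p : ℕ} (μ : E p → Measure (E m)) (n : ℕ) (θ : E p) (x : E m) : ℝ :=
  zerothSPA (sumLaw (μ θ) n) x

/-- The saddlepoint likelihood `L̂_n(θ; x)`. -/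
noncomputable def spaLik {m p : ℕ} (μ : E p → Measure (E m)) (n : ℕ) (θ : E p) (x : E m) : ℝ :=
  spa (sumLaw (μ θ) n) x

/-! ### Full identifiability -/

/-- `K₀` as a function of `(s, θ)`. -/
noncomputable def jointCGF {m p : ℕ} (μ : E p → Measure (E m)) (q : E m × E p) : ℝ :=
  cgf (μ q.2) q.1

/-- `A = K₀''(s; θ)`. -/
noncomputable def matA {m p : ℕ} (μ : E p → Measure (E m)) (s : E m) (θ : E p) :
    Matrix (Fin m) (Fin m) ℝ := cgfHess (μ θ) s

/-- `B = ∇_s ∇_θ K₀(s; θ)`, with entries `∂²K₀ / ∂s_i ∂θ_j`. -/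
noncomputable def matB {m p : ℕ} (μ : E p → Measure (E m)) (s : E m) (θ : E p) :
    Matrix (Fin m) (Fin p) ℝ :=
  Matrix.of fun i j => secondPD (jointCGF μ) (s, θ) (unitVec i, 0) (0, unitVec j)

/-- `H = ∇_θᵀ ∇_θ K₀ - Bᵀ A⁻¹ B` at `(s; θ)`. -/
noncomputable def matH {m p : ℕ} (μ : E p → Measure (E m)) (s : E m) (θ : E p) :
    Matrix (Fin p) (Fin p) ℝ :=
  (Matrix.of fun i j => secondPD (jointCGF μ) (s, θ) (0, unitVec i) (0, unitVec j)) -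
    (matB μ s θ).transpose * (matA μ s θ)⁻¹ * matB μ s θ

/-- The fully identifiable case: `y₀ = K₀'(s₀; θ₀)` with `(s₀, θ₀) ∈ interior 𝒮`,
`∇_θ K₀(s₀; θ₀) = 0`, and `H` is negative definite. -/
structure FullyIdentifiable {m p : ℕ} (D : Set (E p)) (μ : E p → Measure (E m))
    (s₀ : E m) (θ₀ : E p) (y₀ : E m) : Prop where
  mem_interior : (s₀, θ₀) ∈ interior (jointDomain D μ)
  saddlepoint_eq : IsSaddlepoint (μ θ₀) y₀ s₀
  critical : ∀ j, lineDeriv ℝ (jointCGF μ) (s₀, θ₀) ((0 : E m), unitVec j) = 0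
  negDef : (-matH μ s₀ θ₀).PosDef

/-! ### The conclusions

In all of these, `L n θ x` is the true likelihood and `adm` is the set of admissible
observations `x`: all of `ℝᵐ` in the absolutely continuous case, `ℤᵐ` in the integer case. -/

/-- `∇_θ log L̂*(θ; ny) = ∇_θ log L(θ; ny) + O(1)`, uniformly for `(y, θ)` in a compact subset of
`𝒴ᵒ` (in particular, for a single `(y, θ)`), including the existence of the gradients. -/
def GradientConclusion {m p : ℕ} (D : Set (E p)) (μ : E p → Measure (E m))
    (L : ℕ → E p → E m → ℝ) (adm : Set (E m)) : Prop :=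
  ∀ C ⊆ saddleRegion D μ, IsCompact C → ∃ (n₀ : ℕ) (c : ℝ), ∀ n ≥ n₀, ∀ y θ, (y, θ) ∈ C →
    (n : ℝ) • y ∈ adm →
      0 < L n θ ((n : ℝ) • y) ∧
      DifferentiableAt ℝ (fun θ' => Real.log (L n θ' ((n : ℝ) • y))) θ ∧
      DifferentiableAt ℝ (fun θ' => Real.log (zerothLik μ n θ' ((n : ℝ) • y))) θ ∧
      ‖gradient (fun θ' => Real.log (zerothLik μ n θ' ((n : ℝ) • y))) θ -
        gradient (fun θ' => Real.log (L n θ' ((n : ℝ) • y))) θ‖ ≤ c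

/-- `θ` is the unique local maximiser of `f` in `U`. -/
def IsUniqueLocalMaxIn {p : ℕ} (f : E p → ℝ) (U : Set (E p)) (θ : E p) : Prop :=
  θ ∈ U ∧ IsLocalMax f θ ∧ ∀ θ' ∈ U, IsLocalMax f θ' → θ' = θ

/-- `T n x` is a measurable function of `x` that, for `n ≥ n₀`, `y ∈ V` and admissible `x = ny`,
equals the unique local maximiser in `U` of `θ ↦ L n θ x`; its other values are arbitrary. -/
def IsMLEIn {m p : ℕ} (L : ℕ → E p → E m → ℝ) (adm : Set (E m)) (U : Set (E p))
    (V : Set (E m)) (n₀ : ℕ) (T : ℕ → E m → E p) : Prop :=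
  (∀ n, Measurable (T n)) ∧ ∀ n ≥ n₀, ∀ y ∈ V, (n : ℝ) • y ∈ adm →
    IsUniqueLocalMaxIn (fun θ => L n θ ((n : ℝ) • y)) U (T n ((n : ℝ) • y))

/-- The joint sampling limit of the true MLE `T`, the saddlepoint MLE `T₁` and the zeroth-order
MLE `T₀` in `U`: if the observations `χ_n` (with laws `Q n`) satisfy
`(χ_n - n y₀) / √n → N(0, Σ)` in distribution, then
`√n (T(χ_n) - θ₀, T₁(χ_n) - θ₀, T₀(χ_n) - θ₀) → (Z, Z, Z)` in distribution, where
`Z ∼ N(0, H⁻¹ Bᵀ A⁻¹ Σ A⁻¹ B H⁻¹)`. -/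
def SamplingConclusion {m p : ℕ} (μ : E p → Measure (E m)) (adm : Set (E m))
    (s₀ : E m) (θ₀ : E p) (y₀ : E m) (T T₁ T₀ : ℕ → E m → E p) : Prop :=
  ∀ (S : Matrix (Fin m) (Fin m) ℝ) (Q : ℕ → ProbabilityMeasure (E m)), S.PosSemidef →
    (∀ n, ∀ᵐ x ∂(Q n : Measure (E m)), x ∈ adm) →
    TendstoInDistribution (fun (n : ℕ) (x : E m) => (√(n : ℝ))⁻¹ • (x - (n : ℝ) • y₀)) atTop
      (id : E m → E m) (fun n => (Q n : Measure (E m))) (multivariateGaussian 0 S) →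
    TendstoInDistribution
      (fun (n : ℕ) (x : E m) =>
        (√(n : ℝ) • (T n x - θ₀), √(n : ℝ) • (T₁ n x - θ₀), √(n : ℝ) • (T₀ n x - θ₀)))
      atTop (fun z : E p => (z, z, z)) (fun n => (Q n : Measure (E m)))
      (multivariateGaussian 0
        ((matH μ s₀ θ₀)⁻¹ * (matB μ s₀ θ₀).transpose * (matA μ s₀ θ₀)⁻¹ * S *
          (matA μ s₀ θ₀)⁻¹ * matB μ s₀ θ₀ * (matH μ s₀ θ₀)⁻¹))

/-- Existence and uniqueness of the local MLEs in suitable neighbourhoods `U` of `θ₀` and `V` of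
`y₀`, the `O(1/n)` bound between the zeroth-order and the true local MLE, and the joint limit of
their sampling distributions. -/
def MLEConclusion {m p : ℕ} (D : Set (E p)) (μ : E p → Measure (E m))
    (L : ℕ → E p → E m → ℝ) (adm : Set (E m)) (s₀ : E m) (θ₀ : E p) (y₀ : E m) : Prop :=
  ∃ (U : Set (E p)) (V : Set (E m)) (n₀ : ℕ) (c : ℝ),
    IsOpen U ∧ θ₀ ∈ U ∧ U ⊆ D ∧ IsOpen V ∧ y₀ ∈ V ∧
    -- all likelihoods are well defined for `n ≥ n₀`, `y ∈ V`, `θ ∈ U`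
    V ×ˢ U ⊆ saddleRegion D μ ∧
    (∀ n ≥ n₀, ∀ y ∈ V, ∀ θ ∈ U, (n : ℝ) • y ∈ adm → 0 < L n θ ((n : ℝ) • y)) ∧
    -- the unique local maximisers in `U` exist
    (∃ T, IsMLEIn L adm U V n₀ T) ∧
    (∃ T₁, IsMLEIn (spaLik μ) univ U V n₀ T₁) ∧
    (∃ T₀, IsMLEIn (zerothLik μ) univ U V n₀ T₀) ∧
    ∀ T T₁ T₀ : ℕ → E m → E p, IsMLEIn L adm U V n₀ T →
      IsMLEIn (spaLik μ) univ U V n₀ T₁ → IsMLEIn (zerothLik μ) univ U V n₀ T₀ →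
      (∀ n ≥ n₀, ∀ y ∈ V, (n : ℝ) • y ∈ adm →
        ‖T₀ n ((n : ℝ) • y) - T n ((n : ℝ) • y)‖ ≤ c / n) ∧
      SamplingConclusion μ adm s₀ θ₀ y₀ T T₁ T₀

/-- The posterior distribution on `U` for the prior `ρ` and the likelihood function `ℓ`:
density `ℓ(θ) 1{θ ∈ U} / ∫_U ℓ dρ` with respect to `ρ`. -/
noncomputable def posterior {p : ℕ} (ρ : Measure (E p)) (ℓ : E p → ℝ) (U : Set (E p)) :
    Measure (E p) :=
  (∫⁻ θ in U, ENNReal.ofReal (ℓ θ) ∂ρ)⁻¹ •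
    (ρ.restrict U).withDensity fun θ => ENNReal.ofReal (ℓ θ)

/-- Along the filter `l` on `ℕ`, the posterior `Π_n` for the likelihood `ℓ n` is eventually a
probability measure, and `√n (Θ - θ₀) → N(0, S)` in distribution under `Π_n`. -/
def PosteriorLimit {p : ℕ} (l : Filter ℕ) (ρ : Measure (E p)) (ℓ : ℕ → E p → ℝ)
    (U : Set (E p)) (θ₀ : E p) (S : Matrix (Fin p) (Fin p) ℝ) : Prop :=
  ∃ P : ℕ → ProbabilityMeasure (E p),
    (∀ᶠ n in l, (P n : Measure (E p)) = posterior ρ (ℓ n) U) ∧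
    TendstoInDistribution (fun (n : ℕ) (θ : E p) => √(n : ℝ) • (θ - θ₀)) l
      (id : E p → E p) (fun n => (P n : Measure (E p))) (multivariateGaussian 0 S)

/-- For a prior `ρ` on `D` with a density that is continuous and positive at `θ₀`, and
observation `x = n y₀`, there is a neighbourhood `U` of `θ₀` such that the posteriors on `U`
obtained from the zeroth-order, the saddlepoint and the true likelihood all satisfy
`√n (Θ - θ₀) → N(0, -H⁻¹)` (for the true likelihood, along those `n` for which `n y₀` is an
admissible observation). -/
def PosteriorConclusion {m p : ℕ} (D : Set (E p)) (μ : E p → Measure (E m))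
    (L : ℕ → E p → E m → ℝ) (adm : Set (E m)) (s₀ : E m) (θ₀ : E p) (y₀ : E m) : Prop :=
  ∀ (ρ : Measure (E p)) (f : E p → ℝ), IsProbabilityMeasure ρ → ρ Dᶜ = 0 → Measurable f →
    (∀ θ, 0 ≤ f θ) → ρ = volume.withDensity (fun θ => ENNReal.ofReal (f θ)) →
    ContinuousAt f θ₀ → 0 < f θ₀ →
    ∃ U : Set (E p), IsOpen U ∧ θ₀ ∈ U ∧ U ⊆ D ∧
      PosteriorLimit atTop ρ (fun n θ => zerothLik μ n θ ((n : ℝ) • y₀)) U θ₀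
        (-(matH μ s₀ θ₀)⁻¹) ∧
      PosteriorLimit atTop ρ (fun n θ => spaLik μ n θ ((n : ℝ) • y₀)) U θ₀
        (-(matH μ s₀ θ₀)⁻¹) ∧
      PosteriorLimit (atTop ⊓ 𝓟 {n : ℕ | (n : ℝ) • y₀ ∈ adm}) ρ
        (fun n θ => L n θ ((n : ℝ) • y₀)) U θ₀ (-(matH μ s₀ θ₀)⁻¹)

/-! ### Exponential families -/

/-- The likelihood `h(x) exp(η x - ρ(η))` of the sufficient statistic of an exponential family
with natural parameter `η`. -/
noncomputable def expFamLik {m : ℕ} (h ρ : E m → ℝ) (η x : E m) : ℝ :=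
  h x * Real.exp (inner ℝ η x - ρ η)

/-- The law of the sufficient statistic, with density `expFamLik h ρ η` with respect to the base
measure `base` (such as Lebesgue measure, or counting measure on `ℤᵐ`). -/
noncomputable def expFamLaw {m : ℕ} (base : Measure (E m)) (h ρ : E m → ℝ) (η : E m) :
    Measure (E m) :=
  base.withDensity fun x => ENNReal.ofReal (expFamLik h ρ η x)

end Saddlepoint

namespace Saddlepoint

/-! ### Exponential moments -/

/-! Put ψ(y, θ) = K₀(ŝ; θ) - ŝy (`logZeroth`). Parts (a) to (d) all rest on one statement,
`LikExpansion`: near each point of 𝒴ᵒ, each of the three likelihoods at an admissible x = ny equals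
aₙ exp(nψ + eₙ), where aₙ > 0 does not depend on (y, θ) and eₙ is bounded together with its first
two derivatives, uniformly in n. The error is 0 for L̂* and -½ log det K₀''(ŝ) for L̂; for L it is
the logarithm of a Fourier integral.

That integral comes from tilting by the saddlepoint and Fourier inversion: up to powers of n and 2π,
L is exp(nψ) Pₙ(ŝ, θ), where Pₙ (`invFactor`) integrates the n-th power of N(u/√n), and N
(`normMGF`) is the characteristic function of the tilted and centred law of Y. Centring makes N - 1
vanish to second order at φ = 0 for every (s, θ), so its (s, θ)-derivatives are O(|φ|²) times a
polynomial as well. At φ = u/√n this cancels the factors n that arise from differentiating an n-th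
power, and the n - 2 powers of N that are left decay fast enough in u to absorb every polynomial
(`exists_pow_le_of_decay`). By dominated convergence Pₙ has a positive Gaussian limit, so log Pₙ
inherits the C² bounds. The two cases of the theorem differ only in the range of φ, the source of
the decay and the inversion formula; `IsInvertible` collects what they share.

The map (s, θ) ↦ (K₀'(s; θ), θ) is a local C² diffeomorphism because K₀'' is positive definite, and
convexity of K₀ makes the saddlepoint unique; so ŝ and ψ are C² on the open set 𝒴ᵒ. By the envelope
theorem ∇_θ ψ = ∇_θ K₀ at ŝ, and one more differentiation gives the θ-Hessian H and the mixed
derivative BᵀA⁻¹.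

Now (a) says that ∇eₙ is bounded. For (b), negative definiteness of H makes ψ + eₙ/n strongly
concave in θ near (y₀, θ₀) for large n; critical points exist, are unique, and move by O(1/n) when
the gradient is perturbed by O(1/n). For (d), the critical point is linear in y to first order, with
derivative -H⁻¹BᵀA⁻¹ for all three likelihoods, and the delta method applies. For (c), the
likelihood ratio against θ₀ at θ₀ + u/√n tends to exp(uᵀHu/2) and is dominated by a Gaussian, which
is Laplace's method.

For (e), tilting an exponential family by s translates η to η + s. The function minimised in the
saddlepoint problem for η is therefore one fixed function of η + s, plus ηx - ρ(η); its minimal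
value is the same for all η, so L̂* and L are the same function of η up to a positive constant. -/

/-- The moment `𝔼 g(X) exp((s + iφ) X)` for `X ∼ ν`. -/
noncomputable def expMoment {m : ℕ} (ν : Measure (E m)) (g : E m → ℂ) (s φ : E m) : ℂ :=
  ∫ y, g y * Complex.exp ((inner ℝ s y : ℝ) + (inner ℝ φ y : ℝ) * Complex.I) ∂ν

/-- `g(X) exp(s X)` is integrable for all `s` in the set `O`. -/
def ExpIntegrableOn {m : ℕ} (ν : Measure (E m)) (g : E m → ℂ) (O : Set (E m)) : Prop :=
  Measurable g ∧ ∀ s ∈ O, Integrable (fun y => ‖g y‖ * Real.exp (inner ℝ s y)) ν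

lemma norm_cexp_inner {m : ℕ} (s φ y : E m) :
    ‖Complex.exp ((inner ℝ s y : ℝ) + (inner ℝ φ y : ℝ) * Complex.I)‖ =
      Real.exp (inner ℝ s y) := by
  rw [Complex.norm_exp]; simp

lemma ExpIntegrableOn.integrable {m : ℕ} {ν : Measure (E m)} {g : E m → ℂ} {O : Set (E m)}
    (h : ExpIntegrableOn ν g O) {s : E m} (hs : s ∈ O) (φ : E m) :
    Integrable (fun y => g y * Complex.exp ((inner ℝ s y : ℝ) + (inner ℝ φ y : ℝ) * Complex.I))
      ν := by
  refine (h.2 s hs).mono' ?_ (ae_of_all _ fun y => ?_)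
  · have := h.1
    exact (by fun_prop : Measurable _).aestronglyMeasurable
  · rw [norm_mul, norm_cexp_inner]

lemma exp_abs_le (a : ℝ) : Real.exp |a| ≤ Real.exp a + Real.exp (-a) := by
  rcases abs_cases a with ⟨h, _⟩ | ⟨h, _⟩ <;> rw [h] <;> linarith [Real.exp_pos a, Real.exp_pos (-a)]

/-- The common step for derivatives in real (`c = 1`) and imaginary (`c = i`) directions. -/
lemma ExpIntegrableOn.hasDerivAt_aux {m : ℕ} {ν : Measure (E m)} {g : E m → ℂ} {O : Set (E m)}
    (hO : IsOpen O) (h : ExpIntegrableOn ν g O) {s : E m} (hs : s ∈ O) (φ v : E m) (c : ℂ)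
    (hc : ‖c‖ ≤ 1) :
    Integrable (fun y => c * (inner ℝ v y : ℝ) * g y *
      Complex.exp ((inner ℝ s y : ℝ) + (inner ℝ φ y : ℝ) * Complex.I)) ν ∧
    HasDerivAt (fun t : ℝ => ∫ y, g y * Complex.exp ((inner ℝ s y : ℝ) +
        (inner ℝ φ y : ℝ) * Complex.I + t * (c * (inner ℝ v y : ℝ))) ∂ν)
      (∫ y, c * (inner ℝ v y : ℝ) * g y *
        Complex.exp ((inner ℝ s y : ℝ) + (inner ℝ φ y : ℝ) * Complex.I) ∂ν) 0 := by
  have hg := h.1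
  have hcont : Tendsto (fun t : ℝ => s + t • v) (𝓝 0) (𝓝 s) := by
    have : Continuous fun t : ℝ => s + t • v := by fun_prop
    simpa using this.tendsto 0
  have hcont' : Tendsto (fun t : ℝ => s - t • v) (𝓝 0) (𝓝 s) := by
    have : Continuous fun t : ℝ => s - t • v := by fun_prop
    simpa using this.tendsto 0
  obtain ⟨r, hr, hball⟩ := Metric.eventually_nhds_iff.1
    ((hcont.eventually (hO.mem_nhds hs)).and (hcont'.eventually (hO.mem_nhds hs)))
  obtain ⟨h1, h2⟩ := hball (y := r / 2) (by simp [abs_of_pos hr]; linarith)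
  -- The shifts s ± (r/2)v = s ± 2εv stay in `O`. For |t| ≤ ε the factor exp(2ε|vy|) they provide
  -- splits in two: one exp(ε|vy|) pays for the perturbation by t, the other for the linear factor
  -- |vy|.
  set ε := r / 4 with hε
  have hε0 : 0 < ε := by positivity
  have key := hasDerivAt_integral_of_dominated_loc_of_deriv_le (μ := ν) (𝕜 := ℝ)
    (F := fun t y => g y * Complex.exp ((inner ℝ s y : ℝ) +
        (inner ℝ φ y : ℝ) * Complex.I + t * (c * (inner ℝ v y : ℝ))))
    (F' := fun t y => c * (inner ℝ v y : ℝ) * g y * Complex.exp ((inner ℝ s y : ℝ) +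
        (inner ℝ φ y : ℝ) * Complex.I + t * (c * (inner ℝ v y : ℝ)))) (x₀ := 0)
    (bound := fun y => ε⁻¹ * (‖g y‖ * Real.exp (inner ℝ (s + (r / 2) • v) y) +
        ‖g y‖ * Real.exp (inner ℝ (s - (r / 2) • v) y)))
    (Metric.ball_mem_nhds 0 hε0) ?_ ?_ ?_ ?_ ?_ ?_
  · simpa using key
  · exact Eventually.of_forall fun t => (by fun_prop : Measurable _).aestronglyMeasurable
  · simpa using h.integrable hs φ
  · exact (by fun_prop : Measurable _).aestronglyMeasurable
  · refine ae_of_all _ fun y t ht => ?_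
    rw [norm_mul, norm_mul, norm_mul, Complex.norm_exp]
    have ht' : |t| ≤ ε := by simpa using (Metric.mem_ball.1 ht).le
    set a : ℝ := inner ℝ v y
    have e1 : ((inner ℝ s y : ℝ) + (inner ℝ φ y : ℝ) * Complex.I + t * (c * (a : ℂ))).re
        ≤ inner ℝ s y + |ε * a| := by
      have : (t * (c * (a : ℂ))).re ≤ |ε * a| := by
        refine (Complex.re_le_norm _).trans ?_
        rw [norm_mul, norm_mul, abs_mul, abs_of_pos hε0, Complex.norm_real, Complex.norm_real]
        have := mul_le_mul hc (le_refl |a|) (abs_nonneg a) zero_le_one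
        simp only [Real.norm_eq_abs]
        calc |t| * (‖c‖ * |a|) ≤ ε * (1 * |a|) := by gcongr
          _ = ε * |a| := by ring
      simp only [Complex.add_re, Complex.ofReal_re, Complex.mul_re, Complex.ofReal_im,
        Complex.I_re, Complex.I_im] at this ⊢
      linarith
    have e2 : |a| ≤ ε⁻¹ * Real.exp |ε * a| := by
      rw [abs_mul, abs_of_pos hε0, inv_mul_eq_div, le_div_iff₀ hε0]
      linarith [Real.add_one_le_exp (ε * |a|)]
    have e3 : Real.exp |ε * a| * Real.exp (inner ℝ s y + |ε * a|) ≤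
        Real.exp (inner ℝ (s + (r / 2) • v) y) + Real.exp (inner ℝ (s - (r / 2) • v) y) := by
      have : inner ℝ (s + (r / 2) • v) y = inner ℝ s y + (2 * ε) * a := by
        rw [inner_add_left, inner_smul_left]; simp [hε, a]; left; ring
      rw [this]
      have : inner ℝ (s - (r / 2) • v) y = inner ℝ s y + -((2 * ε) * a) := by
        rw [inner_sub_left, inner_smul_left]; simp [hε, a, sub_eq_add_neg]; left; ring
      rw [this, Real.exp_add, Real.exp_add, Real.exp_add]
      have := exp_abs_le ((2 * ε) * a)
      have e4 : Real.exp |2 * ε * a| = Real.exp |ε * a| * Real.exp |ε * a| := by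
        rw [← Real.exp_add, mul_assoc, abs_mul]; congr 1; simp; ring
      rw [e4] at this
      nlinarith [Real.exp_pos (inner ℝ s y)]
    calc ‖c‖ * ‖((a : ℝ) : ℂ)‖ * ‖g y‖ * Real.exp _
        ≤ 1 * (ε⁻¹ * Real.exp |ε * a|) * ‖g y‖ * Real.exp (inner ℝ s y + |ε * a|) := by
          rw [Complex.norm_real, Real.norm_eq_abs]
          gcongr
      _ = ε⁻¹ * ‖g y‖ * (Real.exp |ε * a| * Real.exp (inner ℝ s y + |ε * a|)) := by ring
      _ ≤ ε⁻¹ * ‖g y‖ * (Real.exp (inner ℝ (s + (r / 2) • v) y) +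
            Real.exp (inner ℝ (s - (r / 2) • v) y)) := by gcongr
      _ = _ := by ring
  · exact ((h.2 _ h1).add (h.2 _ h2)).const_mul _
  · refine ae_of_all _ fun y t _ => ?_
    have : HasDerivAt (fun t : ℝ => (inner ℝ s y : ℝ) +
        (inner ℝ φ y : ℝ) * Complex.I + t * (c * (inner ℝ v y : ℝ)))
        (1 * (c * (inner ℝ v y : ℝ))) t :=
      ((hasDerivAt_id t).ofReal_comp.mul_const _).const_add _
    have := (this.cexp).const_mul (g y)
    convert! this using 1
    ring

/-- The weight `g(y) · (v y)`. -/
noncomputable def mulInner {m : ℕ} (v : E m) (g : E m → ℂ) : E m → ℂ :=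
  fun y => (inner ℝ v y : ℝ) * g y

lemma ExpIntegrableOn.mulInner {m : ℕ} {ν : Measure (E m)} {g : E m → ℂ} {O : Set (E m)}
    (hO : IsOpen O) (h : ExpIntegrableOn ν g O) (v : E m) :
    ExpIntegrableOn ν (mulInner v g) O := by
  have hg := h.1
  refine ⟨by unfold Saddlepoint.mulInner; fun_prop, fun s hs => ?_⟩
  have := (h.hasDerivAt_aux hO hs 0 v 1 (by simp)).1.norm
  refine this.congr (ae_of_all _ fun y => ?_)
  simp only [norm_mul, norm_cexp_inner, Saddlepoint.mulInner]
  simp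

lemma ExpIntegrableOn.hasLineDerivAt_left {m : ℕ} {ν : Measure (E m)} {g : E m → ℂ}
    {O : Set (E m)} (hO : IsOpen O) (h : ExpIntegrableOn ν g O) {s : E m} (hs : s ∈ O)
    (φ v : E m) :
    HasLineDerivAt ℝ (fun s => expMoment ν g s φ) (expMoment ν (Saddlepoint.mulInner v g) s φ)
      s v := by
  have := (h.hasDerivAt_aux hO hs φ v 1 (by simp)).2
  unfold HasLineDerivAt expMoment Saddlepoint.mulInner
  refine (this.congr_deriv ?_).congr_of_eventuallyEq (Eventually.of_forall fun t => ?_)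
  · congr 1; funext y; ring
  · simp only [inner_add_left, inner_smul_left, conj_trivial, Complex.ofReal_add,
      Complex.ofReal_mul]
    congr 1; funext y; congr 2; ring

lemma ExpIntegrableOn.hasLineDerivAt_right {m : ℕ} {ν : Measure (E m)} {g : E m → ℂ}
    {O : Set (E m)} (hO : IsOpen O) (h : ExpIntegrableOn ν g O) {s : E m} (hs : s ∈ O)
    (φ v : E m) :
    HasLineDerivAt ℝ (fun φ => expMoment ν g s φ)
      (Complex.I * expMoment ν (Saddlepoint.mulInner v g) s φ) φ v := by
  have := (h.hasDerivAt_aux hO hs φ v Complex.I (by simp)).2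
  unfold HasLineDerivAt expMoment Saddlepoint.mulInner
  rw [← integral_const_mul]
  refine (this.congr_deriv ?_).congr_of_eventuallyEq (Eventually.of_forall fun t => ?_)
  · congr 1; funext y; ring
  · simp only [inner_add_left, inner_smul_left, conj_trivial, Complex.ofReal_add,
      Complex.ofReal_mul]
    congr 1; funext y; congr 2; ring

lemma expIntegrableOn_one {m : ℕ} {ν : Measure (E m)} {O : Set (E m)} (hO : O ⊆ mgfDomain ν) :
    ExpIntegrableOn ν (fun _ => 1) O :=
  ⟨measurable_const, fun s hs => by
    have : Integrable (fun y => Real.exp (inner ℝ s y)) ν := hO hs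
    simpa using this⟩

lemma cmgf_eq_expMoment {m : ℕ} (ν : Measure (E m)) (s φ : E m) :
    cmgf ν s φ = expMoment ν (fun _ => 1) s φ := by simp [cmgf, expMoment]

lemma ofReal_mgf {m : ℕ} (ν : Measure (E m)) (s : E m) : (mgf ν s : ℂ) = cmgf ν s 0 := by
  unfold mgf cmgf
  rw [← integral_complex_ofReal]
  congr 1; funext y; simp

/-- The real moment `𝔼 g(X) exp(s X)`. -/
noncomputable def realMoment {m : ℕ} (ν : Measure (E m)) (g : E m → ℝ) (s : E m) : ℝ :=
  ∫ y, g y * Real.exp (inner ℝ s y) ∂ν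

lemma mgf_eq_realMoment {m : ℕ} (ν : Measure (E m)) : mgf ν = realMoment ν (fun _ => 1) := by
  funext s; simp [mgf, realMoment]

lemma ofReal_realMoment {m : ℕ} (ν : Measure (E m)) (g : E m → ℝ) (s : E m) :
    (realMoment ν g s : ℂ) = expMoment ν (fun y => g y) s 0 := by
  unfold realMoment expMoment
  rw [← integral_complex_ofReal]
  congr 1; funext y; simp

lemma hasLineDerivAt_realMoment {m : ℕ} {ν : Measure (E m)} {g : E m → ℝ} {O : Set (E m)}
    (hO : IsOpen O) (h : ExpIntegrableOn ν (fun y => g y) O) {s : E m} (hs : s ∈ O) (v : E m) :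
    HasLineDerivAt ℝ (realMoment ν g) (realMoment ν (fun y => inner ℝ v y * g y) s) s v := by
  have h1 := h.hasLineDerivAt_left hO hs 0 v
  have h2 : HasLineDerivAt ℝ (fun s => (expMoment ν (fun y => (g y : ℂ)) s 0).re)
      (expMoment ν (Saddlepoint.mulInner v fun y => (g y : ℂ)) s 0).re s v :=
    (Complex.reCLM.hasFDerivAt.comp_hasDerivAt (0 : ℝ) h1)
  have h3 : expMoment ν (Saddlepoint.mulInner v fun y => (g y : ℂ)) s 0 =
      (realMoment ν (fun y => inner ℝ v y * g y) s : ℂ) := by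
    rw [ofReal_realMoment]; simp [expMoment, Saddlepoint.mulInner]
  rw [h3, Complex.ofReal_re] at h2
  simpa only [← ofReal_realMoment, Complex.ofReal_re] using h2

lemma mgf_pos {m : ℕ} {ν : Measure (E m)} [NeZero ν] {s : E m} (hs : s ∈ mgfDomain ν) :
    0 < mgf ν s := integral_exp_pos hs

/-! ### The Hessian of the cumulant generating function -/

lemma hasLineDerivAt_cgf {m : ℕ} {ν : Measure (E m)} [NeZero ν] {s : E m}
    (hs : s ∈ interior (mgfDomain ν)) (v : E m) :
    HasLineDerivAt ℝ (cgf ν) (realMoment ν (fun y => inner ℝ v y) s / mgf ν s) s v := by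
  have h1 := hasLineDerivAt_realMoment (g := fun _ => 1) isOpen_interior
    (by simpa using expIntegrableOn_one interior_subset) hs v
  rw [← mgf_eq_realMoment] at h1
  have h0 := (mgf_pos (interior_subset hs)).ne'
  have := HasDerivAt.log h1 (by simpa using h0)
  simpa [HasLineDerivAt, cgf] using this

lemma expIntegrableOn_inner {m : ℕ} (ν : Measure (E m)) (v : E m) :
    ExpIntegrableOn ν (fun y => ((inner ℝ v y : ℝ) : ℂ)) (interior (mgfDomain ν)) := by
  have := (expIntegrableOn_one interior_subset).mulInner (ν := ν) isOpen_interior v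
  unfold Saddlepoint.mulInner at this
  simpa using this

lemma expIntegrableOn_inner_mul {m : ℕ} (ν : Measure (E m)) (v w : E m) :
    ExpIntegrableOn ν (fun y => ((inner ℝ v y * inner ℝ w y : ℝ) : ℂ))
      (interior (mgfDomain ν)) := by
  have := (expIntegrableOn_inner ν w).mulInner isOpen_interior v
  unfold Saddlepoint.mulInner at this
  simpa using this

/-- The covariance of `v X` and `w X` under the law tilted by `exp(s X)`. -/
noncomputable def tiltedCov {m : ℕ} (ν : Measure (E m)) (s v w : E m) : ℝ :=
  realMoment ν (fun y => inner ℝ v y * inner ℝ w y) s / mgf ν s -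
    realMoment ν (fun y => inner ℝ v y) s / mgf ν s *
      (realMoment ν (fun y => inner ℝ w y) s / mgf ν s)

lemma hasLineDerivAt_tiltedMean {m : ℕ} {ν : Measure (E m)} [NeZero ν] {s : E m}
    (hs : s ∈ interior (mgfDomain ν)) (v w : E m) :
    HasLineDerivAt ℝ (fun s => realMoment ν (fun y => inner ℝ w y) s / mgf ν s)
      (tiltedCov ν s v w) s v := by
  have h1 := hasLineDerivAt_realMoment (g := fun _ => 1) isOpen_interior
    (by simpa using expIntegrableOn_one interior_subset) hs v
  rw [← mgf_eq_realMoment] at h1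
  have h2 := hasLineDerivAt_realMoment isOpen_interior (expIntegrableOn_inner ν w) hs v
  have h0 := (mgf_pos (interior_subset hs)).ne'
  have := HasDerivAt.div h2 h1 (by simpa using h0)
  unfold HasLineDerivAt
  refine this.congr_deriv ?_
  simp only [zero_smul, add_zero, mul_one, tiltedCov]
  field_simp

/-- Identifies the Hessian of K with the covariance matrix of the tilted law, from which symmetry,
bilinearity and the meaning of degeneracy are read off. -/
lemma secondPD_cgf {m : ℕ} {ν : Measure (E m)} [NeZero ν] {s : E m}
    (hs : s ∈ interior (mgfDomain ν)) (v w : E m) :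
    secondPD (cgf ν) s v w = tiltedCov ν s v w := by
  unfold secondPD
  have : (fun r => lineDeriv ℝ (cgf ν) r w) =ᶠ[𝓝 s]
      fun r => realMoment ν (fun y => inner ℝ w y) r / mgf ν r := by
    filter_upwards [isOpen_interior.mem_nhds hs] with r hr
    exact (hasLineDerivAt_cgf hr w).lineDeriv
  rw [this.lineDeriv_eq]
  exact (hasLineDerivAt_tiltedMean hs v w).lineDeriv

lemma ExpIntegrableOn.integrable_real {m : ℕ} {ν : Measure (E m)} {g : E m → ℝ} {O : Set (E m)}
    (h : ExpIntegrableOn ν (fun y => g y) O) {s : E m} (hs : s ∈ O) :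
    Integrable (fun y => g y * Real.exp (inner ℝ s y)) ν := by
  have := (h.integrable hs 0).re
  refine this.congr (ae_of_all _ fun y => ?_)
  simp [← Complex.ofReal_exp]

lemma sum_unitVec {m : ℕ} (v : E m) : ∑ i, v i • (unitVec i : E m) = v := by
  ext j
  simp [unitVec, Pi.single_apply]

lemma inner_eq_sum {m : ℕ} (v y : E m) :
    (inner ℝ v y : ℝ) = ∑ i, v i * inner ℝ (unitVec i : E m) y := by
  conv_lhs => rw [← sum_unitVec v]
  rw [sum_inner]
  simp [inner_smul_left]

lemma realMoment_inner {m : ℕ} {ν : Measure (E m)} {s : E m}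
    (hs : s ∈ interior (mgfDomain ν)) (v : E m) :
    realMoment ν (fun y => inner ℝ v y) s =
      ∑ i, v i * realMoment ν (fun y => inner ℝ (unitVec i : E m) y) s := by
  unfold realMoment
  simp_rw [← integral_const_mul]
  rw [← integral_finsetSum]
  · congr 1; funext y; rw [inner_eq_sum v y, Finset.sum_mul]; simp [mul_assoc]
  · intro i _
    exact ((expIntegrableOn_inner ν _).integrable_real hs).const_mul _

lemma realMoment_inner_mul {m : ℕ} {ν : Measure (E m)} {s : E m}
    (hs : s ∈ interior (mgfDomain ν)) (v w : E m) :
    realMoment ν (fun y => inner ℝ v y * inner ℝ w y) s =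
      ∑ i, ∑ j, v i * w j *
        realMoment ν (fun y => inner ℝ (unitVec i : E m) y * inner ℝ (unitVec j : E m) y) s := by
  unfold realMoment
  simp_rw [← integral_const_mul]
  have hint : ∀ i j, Integrable (fun y => v i * w j * (inner ℝ (unitVec i : E m) y *
      inner ℝ (unitVec j : E m) y * Real.exp (inner ℝ s y))) ν := fun i j =>
    ((expIntegrableOn_inner_mul ν _ _).integrable_real hs).const_mul _
  simp_rw [← integral_finsetSum _ fun j _ => hint _ j]
  rw [← integral_finsetSum _ fun i _ => integrable_finsetSum _ fun j _ => hint i j]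
  · congr 1; funext y
    rw [inner_eq_sum v y, inner_eq_sum w y, Finset.sum_mul_sum, Finset.sum_mul]
    refine Finset.sum_congr rfl fun i _ => ?_
    rw [Finset.sum_mul]
    refine Finset.sum_congr rfl fun j _ => ?_
    ring

lemma tiltedCov_eq_sum {m : ℕ} {ν : Measure (E m)} [NeZero ν] {s : E m}
    (hs : s ∈ interior (mgfDomain ν)) (v w : E m) :
    tiltedCov ν s v w = ∑ i, ∑ j, v i * w j * cgfHess ν s i j := by
  unfold cgfHess
  simp only [Matrix.of_apply, secondPD_cgf hs]
  simp only [tiltedCov]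
  rw [realMoment_inner_mul hs, realMoment_inner hs v, realMoment_inner hs w, Finset.sum_div,
    Finset.sum_div, Finset.sum_div, Finset.sum_mul_sum, ← Finset.sum_sub_distrib]
  refine Finset.sum_congr rfl fun i _ => ?_
  rw [Finset.sum_div, ← Finset.sum_sub_distrib]
  refine Finset.sum_congr rfl fun j _ => ?_
  ring

lemma tiltedCov_eq_dotProduct {m : ℕ} {ν : Measure (E m)} [NeZero ν] {s : E m}
    (hs : s ∈ interior (mgfDomain ν)) (v w : E m) :
    tiltedCov ν s v w = v.ofLp ⬝ᵥ (cgfHess ν s).mulVec w.ofLp := by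
  rw [tiltedCov_eq_sum hs]
  simp only [dotProduct, Matrix.mulVec, Finset.mul_sum]
  refine Finset.sum_congr rfl fun i _ => Finset.sum_congr rfl fun j _ => ?_
  ring

lemma tiltedCov_comm {m : ℕ} (ν : Measure (E m)) (s v w : E m) :
    tiltedCov ν s v w = tiltedCov ν s w v := by
  unfold tiltedCov
  simp_rw [mul_comm (inner ℝ v _ : ℝ)]
  ring

lemma cgfHess_isHermitian {m : ℕ} {ν : Measure (E m)} [NeZero ν] {s : E m}
    (hs : s ∈ interior (mgfDomain ν)) : (cgfHess ν s).IsHermitian := by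
  ext i j
  simp only [cgfHess, Matrix.conjTranspose_apply, Matrix.of_apply, secondPD_cgf hs, star_trivial]
  exact tiltedCov_comm _ _ _ _

lemma tiltedCov_pos_of_posDef {m : ℕ} {ν : Measure (E m)} [NeZero ν] {s : E m}
    (hs : s ∈ interior (mgfDomain ν)) (h : (cgfHess ν s).PosDef) {v : E m} (hv : v ≠ 0) :
    0 < tiltedCov ν s v v := by
  rw [tiltedCov_eq_dotProduct hs]
  have := h.dotProduct_mulVec_pos (x := v.ofLp) (fun h0 => hv (by ext i; simp [h0]))
  simpa using this

lemma posDef_of_tiltedCov_pos {m : ℕ} {ν : Measure (E m)} [NeZero ν] {s : E m}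
    (hs : s ∈ interior (mgfDomain ν)) (h : ∀ v ≠ 0, 0 < tiltedCov ν s v v) :
    (cgfHess ν s).PosDef := by
  refine Matrix.PosDef.of_dotProduct_mulVec_pos (cgfHess_isHermitian hs) fun x hx => ?_
  have := h (WithLp.toLp 2 x) (fun h0 => hx (by simpa using h0))
  rw [tiltedCov_eq_dotProduct hs] at this
  simpa using this

/-- The tilted variance vanishes only if `v X` is almost surely constant. -/
lemma ae_eq_of_tiltedCov_le_zero {m : ℕ} {ν : Measure (E m)} [NeZero ν] {s : E m}
    (hs : s ∈ interior (mgfDomain ν)) {v : E m} (h : tiltedCov ν s v v ≤ 0) :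
    ∃ k : ℝ, ∀ᵐ y ∂ν, inner ℝ v y = k := by
  set M := mgf ν s
  have hM : 0 < M := mgf_pos (interior_subset hs)
  set k := realMoment ν (fun y => inner ℝ v y) s / M with hk
  refine ⟨k, ?_⟩
  have i0 : Integrable (fun y => Real.exp (inner ℝ s y)) ν :=
    interior_subset (s := mgfDomain ν) hs
  have i1 := (expIntegrableOn_inner ν v).integrable_real hs
  have i2 := (expIntegrableOn_inner_mul ν v v).integrable_real hs
  -- As k is the tilted mean of vX, integrating this expansion gives M times the tilted variance.
  -- The integrand is non-negative, so it vanishes almost everywhere once the variance is at most 0.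
  have e : ∀ y, (inner ℝ v y - k) ^ 2 * Real.exp (inner ℝ s y) =
      inner ℝ v y * inner ℝ v y * Real.exp (inner ℝ s y) -
        2 * k * (inner ℝ v y * Real.exp (inner ℝ s y)) + k ^ 2 * Real.exp (inner ℝ s y) := by
    intro y; ring
  have hint : Integrable (fun y => (inner ℝ v y - k) ^ 2 * Real.exp (inner ℝ s y)) ν := by
    simp_rw [e]
    exact (i2.sub (i1.const_mul _)).add (i0.const_mul _)
  have hval : ∫ y, (inner ℝ v y - k) ^ 2 * Real.exp (inner ℝ s y) ∂ν ≤ 0 := by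
    simp_rw [e]
    have i3 : Integrable (fun y => inner ℝ v y * inner ℝ v y * Real.exp (inner ℝ s y) -
      2 * k * (inner ℝ v y * Real.exp (inner ℝ s y))) ν := i2.sub (i1.const_mul _)
    rw [integral_add i3 (i0.const_mul _),
      integral_sub i2 (i1.const_mul _), integral_const_mul, integral_const_mul]
    have h1 : ∫ y, inner ℝ v y * Real.exp (inner ℝ s y) ∂ν = k * M := by
      rw [hk]; field_simp; rfl
    have h2 : ∫ y, inner ℝ v y * inner ℝ v y * Real.exp (inner ℝ s y) ∂ν =
        (tiltedCov ν s v v + k * k) * M := by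
      unfold tiltedCov
      rw [← hk]
      field_simp
      simp only [realMoment, M, sub_add_cancel]
      exact (div_mul_cancel₀ _ hM.ne').symm
    have h3 : ∫ y, Real.exp (inner ℝ s y) ∂ν = M := rfl
    rw [h1, h2, h3]
    nlinarith
  have hnn : 0 ≤ fun y => (inner ℝ v y - k) ^ 2 * Real.exp (inner ℝ s y) := fun y => by
    simp only [Pi.zero_apply]; positivity
  have hz := (integral_eq_zero_iff_of_nonneg hnn hint).1
    (le_antisymm hval (integral_nonneg hnn))
  filter_upwards [hz] with y hy
  simpa [(Real.exp_pos _).ne', sub_eq_zero] using hy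

/-! ### Convexity and uniqueness of the saddlepoint -/

/-- Convexity of exp at the two exponents. With k = l = 0 it shows that the domain is convex; with
k, l the two values of the CGF it replaces Hölder's inequality. -/
lemma exp_inner_combo_le {m : ℕ} (s t y : E m) (a b k l : ℝ) (ha : 0 ≤ a) (hb : 0 ≤ b)
    (hab : a + b = 1) :
    Real.exp (inner ℝ (a • s + b • t) y - (a * k + b * l)) ≤
      a * Real.exp (inner ℝ s y - k) + b * Real.exp (inner ℝ t y - l) := by
  have := convexOn_exp.2 (mem_univ (inner ℝ s y - k)) (mem_univ (inner ℝ t y - l)) ha hb hab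
  simp only [smul_eq_mul] at this
  refine le_trans (le_of_eq ?_) this
  rw [inner_add_left, inner_smul_left, inner_smul_left]
  congr 1; simp; ring

/-- Divided by its own integral, each of exp(sX) and exp(tX) has integral 1, so by
`exp_inner_combo_le` the integral at the convex combination, normalised by the combined exponent, is
at most a + b = 1. Taking logarithms gives convexity. -/
lemma convexOn_cgf {m : ℕ} (ν : Measure (E m)) [NeZero ν] :
    ConvexOn ℝ (mgfDomain ν) (cgf ν) := by
  have hdom : ∀ s ∈ mgfDomain ν, ∀ t ∈ mgfDomain ν, ∀ a b : ℝ, 0 ≤ a → 0 ≤ b → a + b = 1 →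
      a • s + b • t ∈ mgfDomain ν := by
    intro s hs t ht a b ha hb hab
    refine ((hs.const_mul a).add (ht.const_mul b)).mono'
      (by fun_prop : Measurable _).aestronglyMeasurable (ae_of_all _ fun y => ?_)
    have := exp_inner_combo_le s t y a b 0 0 ha hb hab
    simpa using this
  refine ⟨fun s hs t ht a b ha hb hab => hdom s hs t ht a b ha hb hab,
    fun s hs t ht a b ha hb hab => ?_⟩
  have hd := hdom s hs t ht a b ha hb hab
  have hint : ∀ r ∈ mgfDomain ν, ∀ c, Integrable (fun y => Real.exp (inner ℝ r y - c)) ν ∧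
      ∫ y, Real.exp (inner ℝ r y - c) ∂ν = mgf ν r * Real.exp (-c) := by
    intro r hr c
    simp_rw [sub_eq_add_neg, Real.exp_add]
    exact ⟨Integrable.mul_const hr _, integral_mul_const _ _⟩
  have hone : ∀ r ∈ mgfDomain ν, mgf ν r * Real.exp (-cgf ν r) = 1 := by
    intro r hr
    rw [Real.exp_neg, cgf, Real.exp_log (mgf_pos hr)]
    exact mul_inv_cancel₀ (mgf_pos hr).ne'
  have h := integral_mono (hint _ hd (a * cgf ν s + b * cgf ν t)).1
    (((hint s hs (cgf ν s)).1.const_mul a).add ((hint t ht (cgf ν t)).1.const_mul b))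
    (fun y => exp_inner_combo_le s t y a b _ _ ha hb hab)
  rw [(hint _ hd _).2] at h
  simp only [Pi.add_apply] at h
  rw [integral_add ((hint s hs (cgf ν s)).1.const_mul a) ((hint t ht (cgf ν t)).1.const_mul b),
    integral_const_mul, integral_const_mul, (hint s hs _).2, (hint t ht _).2, hone s hs,
    hone t ht, mul_one, mul_one, hab, Real.exp_neg, ← div_eq_mul_inv,
    div_le_one (Real.exp_pos _)] at h
  have := Real.log_le_log (mgf_pos hd) h
  rwa [Real.log_exp] at this

/-- A critical point of the convex function K(s) - sx is a global minimiser. As s may lie on the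
boundary, the derivative is only used along the segment from s to t, which stays in the convex
domain; the slopes there are at most K(t) - K(s). -/
lemma IsSaddlepoint.le {m : ℕ} {ν : Measure (E m)} [NeZero ν] {x s : E m}
    (h : IsSaddlepoint ν x s) {t : E m} (ht : t ∈ mgfDomain ν) :
    cgf ν s - inner ℝ s x ≤ cgf ν t - inner ℝ t x := by
  have hconv := convexOn_cgf ν
  obtain ⟨hs, hd⟩ := h
  have hmem : ∀ a ∈ Icc (0 : ℝ) 1, s + a • (t - s) ∈ mgfDomain ν := by
    intro a ha
    have := hconv.1 hs ht (sub_nonneg.2 ha.2) ha.1 (by ring)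
    convert this using 1
    module
  have hline : HasDerivWithinAt (fun a : ℝ => s + a • (t - s)) (t - s) (Icc 0 1) 0 := by
    simpa using (((hasDerivAt_id (0 : ℝ)).smul_const (t - s)).const_add s).hasDerivWithinAt
  have hd' : HasFDerivWithinAt (cgf ν) (innerSL ℝ x) (mgfDomain ν) (s + (0 : ℝ) • (t - s)) := by
    simpa using hd
  have h1 := hd'.comp_hasDerivWithinAt (0 : ℝ) hline (fun a ha => hmem a ha)
  have h2 := h1.mono (Ioc_subset_Icc_self)
  rw [hasDerivWithinAt_iff_tendsto_slope' (by simp)] at h2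
  have h3 : innerSL ℝ x (t - s) ≤ cgf ν t - cgf ν s := by
    have : (𝓝[Ioc (0 : ℝ) 1] 0).NeBot := by
      rw [nhdsWithin_Ioc_eq_nhdsGT zero_lt_one]; infer_instance
    refine le_of_tendsto h2 (eventually_nhdsWithin_of_forall fun a ha => ?_)
    have hc := hconv.2 hs ht (sub_nonneg.2 ha.2) ha.1.le (by ring)
    rw [show (1 - a) • s + a • t = s + a • (t - s) by module] at hc
    simp only [slope, Function.comp_apply, zero_smul, add_zero, vsub_eq_sub, smul_eq_mul,
      sub_zero] at hc ⊢
    rw [inv_mul_le_iff₀ ha.1]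
    linarith
  rw [innerSL_apply_apply, inner_sub_right, real_inner_comm, real_inner_comm s] at h3
  linarith

/-- Two minimisers of `K(s) - s x` coincide if one of them is interior with positive definite
Hessian. -/
lemma eq_of_isMinOn {m : ℕ} {ν : Measure (E m)} [NeZero ν] {x s t : E m}
    (hs : s ∈ interior (mgfDomain ν)) (ht : t ∈ mgfDomain ν) (hpos : (cgfHess ν s).PosDef)
    (hmin : ∀ r ∈ mgfDomain ν, cgf ν s - inner ℝ s x ≤ cgf ν r - inner ℝ r x)
    (hmint : cgf ν t - inner ℝ t x ≤ cgf ν s - inner ℝ s x) : s = t := by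
  by_contra hne
  have hconv := convexOn_cgf ν
  set v := t - s with hv
  have hv0 : v ≠ 0 := sub_ne_zero.2 (Ne.symm hne)
  have hcont : Continuous fun a : ℝ => s + a • v := by fun_prop
  set h : ℝ → ℝ := fun a => cgf ν (s + a • v) - inner ℝ (s + a • v) x with hh
  set h' : ℝ → ℝ := fun a => realMoment ν (fun y => inner ℝ v y) (s + a • v) /
    mgf ν (s + a • v) - inner ℝ v x with hh'
  have hint : ∀ᶠ a in 𝓝 (0 : ℝ), s + a • v ∈ interior (mgfDomain ν) :=
    hcont.continuousAt.eventually (isOpen_interior.mem_nhds (by simpa using hs))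
  have hder : ∀ a, s + a • v ∈ interior (mgfDomain ν) → HasDerivAt h (h' a) a := by
    intro a ha
    have h1 := hasLineDerivAt_cgf ha v
    unfold HasLineDerivAt at h1
    have h2 : HasDerivAt (fun b => cgf ν (s + a • v + (b - a) • v))
        (realMoment ν (fun y => inner ℝ v y) (s + a • v) / mgf ν (s + a • v)) a := by
      have := HasDerivAt.comp_sub_const (f := fun t : ℝ => cgf ν (s + a • v + t • v)) a a
        (by simpa using h1)
      simpa using this
    have h3 : HasDerivAt (fun b : ℝ => inner ℝ (s + b • v) x) (inner ℝ v x) a := by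
      have h4 : (fun b : ℝ => (inner ℝ (s + b • v) x : ℝ)) =
          fun b => inner ℝ s x + b * inner ℝ v x := by
        funext b; rw [inner_add_left, inner_smul_left]; simp
      rw [h4]
      simpa using ((hasDerivAt_id a).mul_const (inner ℝ v x : ℝ)).const_add (inner ℝ s x : ℝ)
    have h5 : (fun b : ℝ => cgf ν (s + a • v + (b - a) • v)) = fun b => cgf ν (s + b • v) := by
      funext b; congr 1; module
    rw [h5] at h2
    exact h2.sub h3
  -- A convex function whose minimum is attained at both ends of a segment is constant on it.
  have hconst : ∀ a ∈ Icc (0 : ℝ) 1, h a = h 0 := by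
    intro a ha
    have hc := hconv.2 (interior_subset hs) ht (sub_nonneg.2 ha.2) ha.1 (by ring)
    have hm := hconv.1 (interior_subset hs) ht (sub_nonneg.2 ha.2) ha.1 (by ring)
    have e : (1 - a) • s + a • t = s + a • v := by rw [hv]; module
    rw [e] at hc hm
    have e2 : (inner ℝ (s + a • v) x : ℝ) = (1 - a) * inner ℝ s x + a * inner ℝ t x := by
      rw [← e, inner_add_left, inner_smul_left, inner_smul_left]; simp
    have := hmin _ hm
    simp only [hh, zero_smul, add_zero, smul_eq_mul] at hc ⊢
    refine le_antisymm ?_ this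
    rw [e2]
    nlinarith [ha.1, mul_le_mul_of_nonneg_left hmint ha.1]
  -- The far end t may be a boundary point, so differentiability is only available near s. Vanishing
  -- of h' to the right of 0 suffices: it forces h''(0) = 0, while h''(0) is the tilted variance in
  -- the direction v.
  have hzero : ∀ᶠ a in 𝓝[>] (0 : ℝ), h' a = 0 := by
    filter_upwards [mem_nhdsWithin_of_mem_nhds hint, Ioo_mem_nhdsGT zero_lt_one] with a ha ha1
    have h1 := hder a ha
    have h2 : h =ᶠ[𝓝 a] fun _ => h 0 := by
      filter_upwards [Ioo_mem_nhds ha1.1 ha1.2] with b hb using hconst b ⟨hb.1.le, hb.2.le⟩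
    exact h1.unique ((hasDerivAt_const a (h 0)).congr_of_eventuallyEq h2)
  have hd2 : HasDerivAt h' (tiltedCov ν s v v) 0 :=
    HasDerivAt.sub_const (inner ℝ v x) (hasLineDerivAt_tiltedMean hs v v)
  have h0 : h' 0 = 0 := by
    have := hd2.continuousAt.continuousWithinAt (s := Ioi 0)
    exact tendsto_nhds_unique this (tendsto_const_nhds.congr' (by
      filter_upwards [hzero] with a ha using ha.symm))
  have hd3 : HasDerivWithinAt h' 0 (Ioi 0) 0 :=
    (hasDerivWithinAt_const 0 _ (0 : ℝ)).congr_of_eventuallyEq hzero h0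
  have := (uniqueDiffWithinAt_Ioi (0 : ℝ)).eq_deriv _ hd2.hasDerivWithinAt hd3
  exact (tiltedCov_pos_of_posDef hs hpos hv0).ne' this

end Saddlepoint

namespace Saddlepoint

/-! ### Exponential families -/

lemma measurable_expFamLik {m : ℕ} {h ρ : E m → ℝ} (hh : Measurable h) (η : E m) :
    Measurable (expFamLik h ρ η) := by unfold expFamLik; fun_prop

/-- Exponential tilting translates the natural parameter; only the normalising constant still
remembers the original η. -/
lemma expFamLik_mul_exp {m : ℕ} (h ρ : E m → ℝ) (η s y : E m) :
    expFamLik h ρ η y * Real.exp (inner ℝ s y) =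
      Real.exp (-ρ η) * (h y * Real.exp (inner ℝ (η + s) y)) := by
  unfold expFamLik
  rw [inner_add_left, Real.exp_add, Real.exp_sub, Real.exp_neg]
  field_simp

lemma expFamLik_nonneg {m : ℕ} {h ρ : E m → ℝ} (hpos : ∀ x, 0 ≤ h x) (η y : E m) :
    0 ≤ expFamLik h ρ η y := mul_nonneg (hpos y) (Real.exp_pos _).le

lemma mem_mgfDomain_expFamLaw {m : ℕ} {base : Measure (E m)} {h ρ : E m → ℝ}
    (hh : Measurable h) (hpos : ∀ x, 0 ≤ h x) (η s : E m) :
    s ∈ mgfDomain (expFamLaw base h ρ η) ↔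
      Integrable (fun y => h y * Real.exp (inner ℝ (η + s) y)) base := by
  have hm : Measurable fun y => ENNReal.ofReal (expFamLik h ρ η y) :=
    (measurable_expFamLik hh η).ennreal_ofReal
  have : s ∈ mgfDomain (expFamLaw base h ρ η) ↔
      Integrable (fun y => Real.exp (inner ℝ s y)) (expFamLaw base h ρ η) := Iff.rfl
  rw [this, expFamLaw, integrable_withDensity_iff hm (ae_of_all _ fun _ => ENNReal.ofReal_lt_top)]
  simp_rw [ENNReal.toReal_ofReal (expFamLik_nonneg hpos η _), mul_comm (Real.exp _),
    expFamLik_mul_exp]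
  exact integrable_const_mul_iff (IsUnit.mk0 _ (Real.exp_pos _).ne') _

lemma mgf_expFamLaw {m : ℕ} {base : Measure (E m)} {h ρ : E m → ℝ}
    (hh : Measurable h) (hpos : ∀ x, 0 ≤ h x) (η s : E m) :
    mgf (expFamLaw base h ρ η) s =
      Real.exp (-ρ η) * ∫ y, h y * Real.exp (inner ℝ (η + s) y) ∂base := by
  have hm : Measurable fun y => ENNReal.ofReal (expFamLik h ρ η y) :=
    (measurable_expFamLik hh η).ennreal_ofReal
  unfold mgf expFamLaw
  rw [integral_withDensity_eq_integral_toReal_smul hm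
    (ae_of_all _ fun _ => ENNReal.ofReal_lt_top)]
  simp_rw [ENNReal.toReal_ofReal (expFamLik_nonneg hpos η _), smul_eq_mul, expFamLik_mul_exp]
  rw [integral_const_mul]

lemma zero_mem_mgfDomain {m : ℕ} (ν : Measure (E m)) [IsFiniteMeasure ν] :
    (0 : E m) ∈ mgfDomain ν := by
  have : Integrable (fun y => Real.exp (inner ℝ (0 : E m) y)) ν := by simp
  exact this

lemma cgf_zero {m : ℕ} (ν : Measure (E m)) [IsProbabilityMeasure ν] :
    cgf ν 0 = 0 := by simp [cgf, mgf]

lemma cgf_expFamLaw {m : ℕ} {base : Measure (E m)} {h ρ : E m → ℝ}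
    (hh : Measurable h) (hpos : ∀ x, 0 ≤ h x) {η s : E m}
    [IsProbabilityMeasure (expFamLaw base h ρ η)] (hs : s ∈ mgfDomain (expFamLaw base h ρ η)) :
    cgf (expFamLaw base h ρ η) s =
      Real.log (∫ y, h y * Real.exp (inner ℝ (η + s) y) ∂base) - ρ η := by
  have h1 := mgf_pos hs
  rw [mgf_expFamLaw hh hpos] at h1
  have h2 := (pos_iff_pos_of_mul_pos h1).1 (Real.exp_pos _)
  rw [cgf, mgf_expFamLaw hh hpos, Real.log_mul (Real.exp_pos _).ne' h2.ne', Real.log_exp]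
  ring

/-- In the variable t = η + s the saddlepoint objective is κ(t) + ηx - ρ(η), with κ independent of
η. All saddlepoints, translated by their η, minimise the same κ over the same set, so its value c at
them does not depend on η. -/
lemma exists_zerothSPA_expFamLaw {m : ℕ} {base : Measure (E m)} {h ρ : E m → ℝ} {N : Set (E m)}
    (hh : Measurable h) (hpos : ∀ x, 0 ≤ h x)
    (hprob : ∀ η ∈ N, IsProbabilityMeasure (expFamLaw base h ρ η)) {x : E m}
    (hsad : ∀ η ∈ N, ∃ s, IsSaddlepoint (expFamLaw base h ρ η) x s) :
    ∃ c : ℝ, ∀ η ∈ N, zerothSPA (expFamLaw base h ρ η) x =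
      Real.exp (c + (inner ℝ η x - ρ η)) := by
  rcases N.eq_empty_or_nonempty with rfl | ⟨η₀, hη₀⟩
  · exact ⟨0, by simp⟩
  let t : E m → E m := fun η => η + saddlepoint (expFamLaw base h ρ η) x
  let κ : E m → ℝ := fun r => Real.log (∫ y, h y * Real.exp (inner ℝ r y) ∂base) - inner ℝ r x
  have hspec : ∀ η ∈ N, IsSaddlepoint (expFamLaw base h ρ η) x
      (saddlepoint (expFamLaw base h ρ η) x) := fun η hη => Classical.epsilon_spec (hsad η hη)
  -- The translated saddlepoint of η' lies in the domain of the law of η and competes there with the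
  -- saddlepoint of η.
  have hle : ∀ η ∈ N, ∀ η' ∈ N, κ (t η) ≤ κ (t η') := by
    intro η hη η' hη'
    have := hprob η hη
    have := hprob η' hη'
    have hm' := (mem_mgfDomain_expFamLaw hh hpos η' _).1 (hspec η' hη').1
    have hm : t η' - η ∈ mgfDomain (expFamLaw base h ρ η) := by
      rw [mem_mgfDomain_expFamLaw hh hpos, add_sub_cancel]; exact hm'
    have h1 := (hspec η hη).le hm
    rw [cgf_expFamLaw hh hpos hm, cgf_expFamLaw hh hpos (hspec η hη).1, add_sub_cancel,
      inner_sub_left] at h1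
    simp only [κ, t, inner_add_left] at h1 ⊢
    linarith
  refine ⟨κ (t η₀), fun η hη => ?_⟩
  have := hprob η hη
  rw [zerothSPA, cgf_expFamLaw hh hpos (hspec η hη).1,
    le_antisymm (hle η₀ hη₀ η hη) (hle η hη η₀ hη₀)]
  congr 1
  simp only [κ, t, inner_add_left]
  ring

theorem exponential_family {m : ℕ} (base : Measure (E m)) (h ρ : E m → ℝ) (N : Set (E m))
    (hN : IsOpen N) (hh : Measurable h) (hpos : ∀ x, 0 ≤ h x)
    (hprob : ∀ η ∈ N, IsProbabilityMeasure (expFamLaw base h ρ η)) (x : E m) (hx : 0 < h x)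
    (hsad : ∀ η ∈ N, ∃ s, IsSaddlepoint (expFamLaw base h ρ η) x s) :
    (∀ η ∈ N,
      IsMaxOn (fun η' => zerothSPA (expFamLaw base h ρ η') x) N η ↔
        IsMaxOn (fun η' => expFamLik h ρ η' x) N η) ∧
    ((∀ η ∈ N, ∀ s ∈ interior (mgfDomain (expFamLaw base h ρ η)),
        (cgfHess (expFamLaw base h ρ η) s).PosDef) →
      ∀ η₁ ∈ N, ∀ η₂ ∈ N,
        IsMaxOn (fun η' => zerothSPA (expFamLaw base h ρ η') x) N η₁ →
        IsMaxOn (fun η' => expFamLik h ρ η' x) N η₂ → η₁ = η₂) := by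
  obtain ⟨c, hc⟩ := exists_zerothSPA_expFamLaw hh hpos hprob hsad
  have hz : ∀ η ∈ N, (IsMaxOn (fun η' => zerothSPA (expFamLaw base h ρ η') x) N η ↔
      ∀ η' ∈ N, inner ℝ η' x - ρ η' ≤ inner ℝ η x - ρ η) := by
    intro η hη
    rw [isMaxOn_iff]
    refine forall₂_congr fun η' hη' => ?_
    rw [hc η hη, hc η' hη', Real.exp_le_exp, add_le_add_iff_left]
  have hl : ∀ η ∈ N, (IsMaxOn (fun η' => expFamLik h ρ η' x) N η ↔
      ∀ η' ∈ N, inner ℝ η' x - ρ η' ≤ inner ℝ η x - ρ η) := by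
    intro η _
    rw [isMaxOn_iff]
    refine forall₂_congr fun η' _ => ?_
    rw [expFamLik, expFamLik, mul_le_mul_iff_right₀ hx, Real.exp_le_exp]
  refine ⟨fun η hη => (hz η hη).trans (hl η hη).symm, fun hpd η₁ h₁ η₂ h₂ hm₁ hm₂ => ?_⟩
  rw [hz η₁ h₁] at hm₁
  rw [hl η₂ h₂] at hm₂
  have := hprob η₁ h₁
  set ν := expFamLaw base h ρ η₁ with hν
  -- All laws with parameter in N have total mass 1, so the normaliser determines the CGF at r as
  -- ρ(η₁ + r) - ρ(η₁). Maximising ηx - ρ(η) near η₁ is thus minimising K(r) - rx near r = 0.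
  have hdom : ∀ r, η₁ + r ∈ N → r ∈ mgfDomain ν ∧ cgf ν r = ρ (η₁ + r) - ρ η₁ := by
    intro r hr
    have := hprob _ hr
    have h0 := zero_mem_mgfDomain (expFamLaw base h ρ (η₁ + r))
    have h1 : r ∈ mgfDomain ν := by
      rw [mem_mgfDomain_expFamLaw hh hpos] at h0 ⊢
      simpa using h0
    refine ⟨h1, ?_⟩
    have h2 := cgf_expFamLaw hh hpos h0
    rw [cgf_zero] at h2
    rw [hν, cgf_expFamLaw hh hpos h1]
    simp only [add_zero] at h2
    linarith
  have hnear : ∀ᶠ r in 𝓝 (0 : E m), η₁ + r ∈ N :=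
    (by fun_prop : Continuous fun r : E m => η₁ + r).continuousAt.eventually
      (hN.mem_nhds (by simpa using h₁))
  have hint : (0 : E m) ∈ interior (mgfDomain ν) :=
    mem_interior_iff_mem_nhds.2 (by filter_upwards [hnear] with r hr using (hdom r hr).1)
  have hmem₂ : η₁ + (η₂ - η₁) ∈ N := by simpa using h₂
  have hgconv : ConvexOn ℝ (mgfDomain ν) fun r => cgf ν r - inner ℝ r x := by
    refine (convexOn_cgf ν).sub ⟨(convexOn_cgf ν).1, fun a _ b _ u v _ _ _ => ?_⟩
    beta_reduce
    rw [inner_add_left, inner_smul_left, inner_smul_left]; simp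
  -- Maximality over the open set N is a local statement about r = 0; convexity makes it global.
  -- Then η₂ - η₁ is a second minimiser, and strict convexity at the interior point 0 excludes it
  -- unless it is 0.
  have hmin : IsMinOn (fun r => cgf ν r - inner ℝ r x) (mgfDomain ν) 0 := by
    refine IsMinOn.of_isLocalMinOn_of_convexOn (interior_subset hint) ?_ hgconv
    refine (IsMinFilter.filter_mono ?_ inf_le_left)
    filter_upwards [hnear] with r hr
    have := hm₁ _ hr
    simp only [cgf_zero, inner_zero_left, (hdom r hr).2]
    rw [inner_add_left] at this
    linarith
  have := eq_of_isMinOn hint (hdom _ hmem₂).1 (hpd η₁ h₁ 0 hint)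
    (fun r hr => isMinOn_iff.1 hmin r hr) (x := x) (by
      rw [(hdom _ hmem₂).2, cgf_zero, inner_zero_left, inner_sub_left]
      have := hm₂ η₁ h₁
      simp only [add_sub_cancel]
      linarith)
  exact (sub_eq_zero.1 this.symm).symm

end Saddlepoint

namespace Saddlepoint

/-! ### Functions with continuous partial derivatives -/

section Partial

variable {W F ι : Type*} [NormedAddCommGroup W] [NormedSpace ℝ W] [NormedAddCommGroup F]
  [NormedSpace ℝ F] [Fintype ι]

lemma hasDerivAt_line {f : W → F} {f' : F} {q v : W} {t : ℝ}
    (h : HasLineDerivAt ℝ f f' (q + t • v) v) :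
    HasDerivAt (fun a : ℝ => f (q + a • v)) f' t := by
  have h1 : HasDerivAt (fun a : ℝ => f (q + t • v + a • v)) f' (t - t) := by
    simpa [HasLineDerivAt] using h
  have h2 := HasDerivAt.comp_sub_const (f := fun a : ℝ => f (q + t • v + a • v)) t t h1
  refine h2.congr_of_eventuallyEq (Eventually.of_forall fun a => ?_)
  simp only
  congr 1
  module

/-- Mean value inequality applied to f minus the linear function with slope c. -/
lemma norm_sub_line_le {f f' : W → F} {q v : W} {C : ℝ} {c : F} {t : ℝ}
    (h : ∀ a ∈ uIcc 0 t, HasLineDerivAt ℝ f (f' (q + a • v)) (q + a • v) v)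
    (hC : ∀ a ∈ uIcc 0 t, ‖f' (q + a • v) - c‖ ≤ C) :
    ‖f (q + t • v) - f q - t • c‖ ≤ C * |t| := by
  have key := Convex.norm_image_sub_le_of_norm_hasDerivWithin_le
    (f := fun a : ℝ => f (q + a • v) - a • c) (f' := fun a => f' (q + a • v) - c)
    (s := uIcc 0 t) (x := 0) (y := t) (C := C)
    (fun a ha => ((hasDerivAt_line (h a ha)).sub (by
      simpa using (hasDerivAt_id a).smul_const c)).hasDerivWithinAt)
    hC (convex_uIcc 0 t) left_mem_uIcc right_mem_uIcc
  simp only [zero_smul, add_zero, sub_zero, Real.norm_eq_abs] at key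
  convert! key using 2
  abel

/-- Coordinates are moved one at a time, by induction on the set S of coordinates already moved.
Each single increment is compared with the partial derivative at q itself, which costs only
continuity of that partial derivative at q. -/
lemma hasFDerivAt_of_hasLineDerivAt {Ω : Set W} (hΩ : IsOpen Ω) (e : ι → W)
    (c : ι → W →L[ℝ] ℝ) (hc : ∀ w, ∑ i, c i w • e i = w) {f : W → F} {f' : ι → W → F}
    (hf : ∀ i, ∀ r ∈ Ω, HasLineDerivAt ℝ f (f' i r) r (e i)) {q : W} (hq : q ∈ Ω)
    (hcont : ∀ i, ContinuousAt (f' i) q) :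
    HasFDerivAt f (∑ i, (c i).smulRight (f' i q)) q := by
  classical
  have key : ∀ S : Finset ι, ∀ ε > 0, ∀ᶠ w in 𝓝 (0 : W),
      ‖f (q + ∑ i ∈ S, c i w • e i) - f q - ∑ i ∈ S, c i w • f' i q‖ ≤ ε * ‖w‖ := by
    intro S
    induction S using Finset.induction_on with
    | empty => intro ε hε; simp; exact Eventually.of_forall fun w => by positivity
    | insert j S hj ih =>
      intro ε hε
      -- With this d the error of the new coordinate is at most ε/2 · ‖w‖; the other half is left
      -- for the induction hypothesis. The summand 1 guards against ‖c j‖ = 0.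
      set d : ℝ := ε / (2 * (‖c j‖ + 1)) with hd
      have hd0 : 0 < d := by positivity
      obtain ⟨ρ, hρ, hball⟩ := Metric.eventually_nhds_iff.1
        ((hΩ.eventually_mem hq).and ((hcont j).eventually (Metric.closedBall_mem_nhds _ hd0)))
      have hsmall : ∀ᶠ w in 𝓝 (0 : W), ‖∑ i ∈ S, c i w • e i‖ + ‖c j w • e j‖ < ρ := by
        have : Continuous fun w : W => ‖∑ i ∈ S, c i w • e i‖ + ‖c j w • e j‖ := by fun_prop
        exact this.continuousAt.eventually_lt continuousAt_const (by simpa using hρ)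
      filter_upwards [ih (ε / 2) (by positivity), hsmall] with w h1 h2
      have hin : ∀ a ∈ uIcc 0 (c j w), dist (q + ∑ i ∈ S, c i w • e i + a • e j) q < ρ := by
        intro a ha
        rw [dist_eq_norm, add_assoc, add_sub_cancel_left]
        refine (norm_add_le _ _).trans_lt (lt_of_le_of_lt ?_ h2)
        rw [norm_smul, norm_smul]
        have : |a| ≤ |c j w| := by
          rcases mem_uIcc.1 ha with ⟨x, y⟩ | ⟨x, y⟩
          · rw [abs_of_nonneg x, abs_of_nonneg (x.trans y)]; exact y
          · rw [abs_of_nonpos y, abs_of_nonpos (x.trans y)]; linarith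
        simp only [Real.norm_eq_abs]
        gcongr
      have h3 := norm_sub_line_le (f := f) (f' := f' j) (q := q + ∑ i ∈ S, c i w • e i)
        (v := e j) (C := d) (c := f' j q) (t := c j w)
        (fun a ha => hf j _ (hball (hin a ha)).1)
        (fun a ha => by
          have := (hball (hin a ha)).2
          rwa [dist_eq_norm] at this)
      rw [Finset.sum_insert hj, Finset.sum_insert hj]
      have e1 : f (q + (c j w • e j + ∑ i ∈ S, c i w • e i)) - f q -
          (c j w • f' j q + ∑ i ∈ S, c i w • f' i q) =
          (f (q + ∑ i ∈ S, c i w • e i + c j w • e j) - f (q + ∑ i ∈ S, c i w • e i) -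
            c j w • f' j q) +
          (f (q + ∑ i ∈ S, c i w • e i) - f q - ∑ i ∈ S, c i w • f' i q) := by
        rw [add_comm (c j w • e j), ← add_assoc]; abel
      rw [e1]
      have h4 : |c j w| ≤ ‖c j‖ * ‖w‖ := (c j).le_opNorm w
      have h5 : d * |c j w| ≤ ε / 2 * ‖w‖ := by
        calc d * |c j w| ≤ d * ((‖c j‖ + 1) * ‖w‖) := by
              gcongr; nlinarith [norm_nonneg w, norm_nonneg (c j)]
          _ = ε / 2 * ‖w‖ := by rw [hd]; field_simp
      calc _ ≤ d * |c j w| + ε / 2 * ‖w‖ := (norm_add_le _ _).trans (add_le_add h3 h1)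
        _ ≤ ε * ‖w‖ := by linarith
  rw [hasFDerivAt_iff_isLittleO_nhds_zero, Asymptotics.isLittleO_iff]
  intro ε hε
  filter_upwards [key Finset.univ ε hε] with w hw
  rw [hc w] at hw
  simpa [sum_apply] using hw

lemma contDiffOn_one_of_hasLineDerivAt {Ω : Set W} (hΩ : IsOpen Ω) (e : ι → W)
    (c : ι → W →L[ℝ] ℝ) (hc : ∀ w, ∑ i, c i w • e i = w) {f : W → F} {f' : ι → W → F}
    (hf : ∀ i, ∀ r ∈ Ω, HasLineDerivAt ℝ f (f' i r) r (e i))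
    (hcont : ∀ i, ContinuousOn (f' i) Ω) : ContDiffOn ℝ 1 f Ω := by
  have hd : ∀ q ∈ Ω, HasFDerivAt f (∑ i, (c i).smulRight (f' i q)) q := fun q hq =>
    hasFDerivAt_of_hasLineDerivAt hΩ e c hc hf hq fun i => (hcont i).continuousAt (hΩ.mem_nhds hq)
  rw [show (1 : WithTop ℕ∞) = 0 + 1 by simp, contDiffOn_succ_iff_fderiv_of_isOpen hΩ]
  refine ⟨fun q hq => (hd q hq).differentiableAt.differentiableWithinAt, by simp, ?_⟩
  rw [contDiffOn_zero]
  refine ContinuousOn.congr (f := fun q => ∑ i, (c i).smulRight (f' i q)) ?_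
    fun q hq => (hd q hq).fderiv
  refine continuousOn_finsetSum _ fun i _ => ?_
  exact ((ContinuousLinearMap.smulRightL ℝ W F (c i)).continuous.comp_continuousOn (hcont i))

/-- Bounds of the first two derivatives of a `C²` function in terms of partial derivatives. -/
lemma contDiffOn_two_of_hasLineDerivAt {Ω : Set W} (hΩ : IsOpen Ω) (e : ι → W)
    (c : ι → W →L[ℝ] ℝ) (hc : ∀ w, ∑ i, c i w • e i = w) {f : W → F} {f' : ι → W → F}
    {f'' : ι → ι → W → F}
    (hf : ∀ i, ∀ r ∈ Ω, HasLineDerivAt ℝ f (f' i r) r (e i))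
    (hf' : ∀ i j, ∀ r ∈ Ω, HasLineDerivAt ℝ (f' i) (f'' i j r) r (e j))
    (hcont : ∀ i j, ContinuousOn (f'' i j) Ω) :
    ContDiffOn ℝ 2 f Ω ∧
    (∀ q ∈ Ω, ‖fderiv ℝ f q‖ ≤ ∑ i, ‖c i‖ * ‖f' i q‖) ∧
    ∀ q ∈ Ω, ‖fderiv ℝ (fderiv ℝ f) q‖ ≤ ∑ i, ‖c i‖ * ∑ j, ‖c j‖ * ‖f'' i j q‖ := by
  have h1 : ∀ i, ContDiffOn ℝ 1 (f' i) Ω := fun i =>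
    contDiffOn_one_of_hasLineDerivAt hΩ e c hc (hf' i) (hcont i)
  have hd : ∀ q ∈ Ω, HasFDerivAt f (∑ i, (c i).smulRight (f' i q)) q := fun q hq =>
    hasFDerivAt_of_hasLineDerivAt hΩ e c hc hf hq fun i =>
      (h1 i).continuousOn.continuousAt (hΩ.mem_nhds hq)
  have hd2 : ∀ i, ∀ q ∈ Ω, HasFDerivAt (f' i) (∑ j, (c j).smulRight (f'' i j q)) q :=
    fun i q hq => hasFDerivAt_of_hasLineDerivAt hΩ e c hc (hf' i) hq fun j =>
      (hcont i j).continuousAt (hΩ.mem_nhds hq)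
  have hb : ∀ (g : ι → F), ‖∑ i, (c i).smulRight (g i)‖ ≤ ∑ i, ‖c i‖ * ‖g i‖ := fun g =>
    (norm_sum_le _ _).trans (Finset.sum_le_sum fun i _ =>
      (ContinuousLinearMap.norm_smulRight_apply _ _).le)
  refine ⟨?_, fun q hq => ?_, fun q hq => ?_⟩
  · rw [show (2 : WithTop ℕ∞) = 1 + 1 from one_add_one_eq_two.symm,
      contDiffOn_succ_iff_fderiv_of_isOpen hΩ]
    refine ⟨fun q hq => (hd q hq).differentiableAt.differentiableWithinAt, by simp, ?_⟩
    refine ContDiffOn.congr (f := fun q => ∑ i, (c i).smulRight (f' i q)) ?_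
      fun q hq => (hd q hq).fderiv
    refine ContDiffOn.sum fun i _ => ?_
    exact (ContinuousLinearMap.smulRightL ℝ W F (c i)).contDiff.comp_contDiffOn (h1 i)
  · rw [(hd q hq).fderiv]; exact hb _
  · have heq : fderiv ℝ f =ᶠ[𝓝 q] fun q => ∑ i, (c i).smulRight (f' i q) := by
      filter_upwards [hΩ.mem_nhds hq] with r hr using (hd r hr).fderiv
    have : HasFDerivAt (fun q => ∑ i, (c i).smulRight (f' i q))
        (∑ i, (ContinuousLinearMap.smulRightL ℝ W F (c i)).comp
          (∑ j, (c j).smulRight (f'' i j q))) q := by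
      refine HasFDerivAt.fun_sum fun i _ => ?_
      exact ((ContinuousLinearMap.smulRightL ℝ W F (c i)).hasFDerivAt
        (x := f' i q)).comp q (hd2 i q hq)
    rw [heq.fderiv_eq, this.fderiv]
    refine (norm_sum_le Finset.univ fun i => (ContinuousLinearMap.smulRightL ℝ W F (c i)).comp
      (∑ j, (c j).smulRight (f'' i j q))).trans (Finset.sum_le_sum fun i _ => ?_)
    refine (ContinuousLinearMap.opNorm_comp_le _ _).trans ?_
    refine mul_le_mul ?_ (hb _) (norm_nonneg _) (norm_nonneg _)
    exact ContinuousLinearMap.opNorm_le_bound (ContinuousLinearMap.smulRightL ℝ W F (c i))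
      (norm_nonneg _) fun x => by
      rw [ContinuousLinearMap.smulRightL_apply_apply, ContinuousLinearMap.norm_smulRight_apply]

/-- Existence and equality of the mixed partial derivative in the other order. -/
lemma hasLineDerivAt_comm {Ω : Set W} (hΩ : IsOpen Ω) {f fa fb fab : W → F} {a b : W}
    (ha : ∀ r ∈ Ω, HasLineDerivAt ℝ f (fa r) r a) (hb : ∀ r ∈ Ω, HasLineDerivAt ℝ f (fb r) r b)
    (hab : ∀ r ∈ Ω, HasLineDerivAt ℝ fa (fab r) r b) (hcont : ContinuousOn fab Ω) {q : W}
    (hq : q ∈ Ω) : HasLineDerivAt ℝ fb (fab q) q a := by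
  unfold HasLineDerivAt
  rw [hasDerivAt_iff_isLittleO_nhds_zero, Asymptotics.isLittleO_iff]
  intro ε hε
  obtain ⟨ρ, hρ, hball⟩ := Metric.eventually_nhds_iff.1
    ((hΩ.eventually_mem hq).and ((hcont.continuousAt (hΩ.mem_nhds hq)).eventually
      (Metric.closedBall_mem_nhds _ hε)))
  set δ : ℝ := ρ / (2 * (‖a‖ + ‖b‖ + 1)) with hδ
  have hδ0 : 0 < δ := by positivity
  have hin : ∀ x y : ℝ, |x| ≤ δ → |y| ≤ δ → dist (q + x • a + y • b) q < ρ := by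
    intro x y hx hy
    rw [dist_eq_norm, add_assoc, add_sub_cancel_left]
    calc ‖x • a + y • b‖ ≤ |x| * ‖a‖ + |y| * ‖b‖ := by
          refine (norm_add_le _ _).trans ?_
          rw [norm_smul, norm_smul]; rfl
      _ ≤ δ * ‖a‖ + δ * ‖b‖ := by gcongr
      _ ≤ δ * (‖a‖ + ‖b‖ + 1) := by nlinarith
      _ = ρ / 2 := by rw [hδ]; field_simp
      _ < ρ := by linarith
  have habs : ∀ x y : ℝ, x ∈ uIcc 0 y → |x| ≤ |y| := by
    intro x y hx
    rcases mem_uIcc.1 hx with ⟨h1, h2⟩ | ⟨h1, h2⟩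
    · rw [abs_of_nonneg h1, abs_of_nonneg (h1.trans h2)]; exact h2
    · rw [abs_of_nonpos h2, abs_of_nonpos (h1.trans h2)]; linarith
  -- Schwarz's argument: the mixed second difference is xy · `fab q` up to ε|x||y|, by two
  -- applications of the mean value inequality, in direction b inside and in direction a outside.
  have hmv : ∀ x : ℝ, |x| ≤ δ → ∀ y : ℝ, |y| ≤ δ →
      ‖f (q + x • a + y • b) - f (q + y • b) - f (q + x • a) + f q - (x * y) • fab q‖ ≤
        ε * |y| * |x| := by
    intro x hx y hy
    have h1 : ∀ z ∈ uIcc 0 x, ‖fa (q + z • a + y • b) - fa (q + z • a) - y • fab q‖ ≤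
        ε * |y| := by
      intro z hz
      have hz' := (habs z x hz).trans hx
      refine norm_sub_line_le (f' := fab) (fun w hw => hab _ (hball (hin z w hz'
        ((habs w y hw).trans hy))).1) fun w hw => ?_
      have := (hball (hin z w hz' ((habs w y hw).trans hy))).2
      rwa [dist_eq_norm] at this
    have h2 := norm_sub_line_le (f := fun r => f (r + y • b) - f r)
      (f' := fun r => fa (r + y • b) - fa r) (q := q) (v := a) (t := x) (c := y • fab q)
      (C := ε * |y|) (fun z hz => by
        have hz' := (habs z x hz).trans hx
        have e1 := ha _ (hball (hin z y hz' hy)).1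
        have e2 := ha _ (hball (hin z 0 hz' (by simp [hδ0.le]))).1
        simp only [zero_smul, add_zero] at e2
        refine HasDerivAt.sub ?_ e2
        unfold HasLineDerivAt at e1
        refine e1.congr_of_eventuallyEq (Eventually.of_forall fun t => ?_)
        simp only
        congr 1
        abel) h1
    convert! h2 using 2
    rw [smul_smul]; abel
  filter_upwards [Metric.closedBall_mem_nhds (0 : ℝ) hδ0] with x hx
  have hx' : |x| ≤ δ := by simpa using hx
  have hbx := hb (q + x • a) (hball (by simpa using hin x 0 hx' (by simp [hδ0.le]))).1
  have hb0 := hb q hq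
  -- Dividing the mixed difference by y and letting y → 0 with x fixed turns it into the increment
  -- of `fb` along a. The bound survives the limit and says that `fb` is differentiable in direction
  -- a.
  have hlim : HasDerivAt (fun y : ℝ => f (q + x • a + y • b) - f (q + y • b) - f (q + x • a) +
      f q - (x * y) • fab q) (fb (q + x • a) - fb q - x • fab q) 0 := by
    have h3 : HasDerivAt (fun y : ℝ => (x * y) • fab q) (x • fab q) 0 := by
      simpa using (((hasDerivAt_id (0 : ℝ)).const_mul x).smul_const (fab q))
    exact (((hbx.sub hb0).sub_const _).add_const _).sub h3
  have hslope := hlim.tendsto_slope_zero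
  simp only [zero_add, mul_zero, zero_smul, add_zero, sub_zero] at hslope
  have hz : f (q + x • a) - f q - f (q + x • a) + f q = 0 := by abel
  simp only [hz, sub_zero] at hslope
  simp only [zero_smul, add_zero, zero_add]
  refine le_of_tendsto hslope.norm ?_
  filter_upwards [mem_nhdsWithin_of_mem_nhds (Metric.closedBall_mem_nhds (0 : ℝ) hδ0),
    self_mem_nhdsWithin] with y hy hy0
  have hy' : |y| ≤ δ := by simpa using hy
  have hypos : 0 < |y| := abs_pos.2 hy0
  rw [norm_smul, norm_inv, Real.norm_eq_abs, Real.norm_eq_abs, inv_mul_le_iff₀ hypos]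
  refine (hmv x hx' y hy').trans (le_of_eq ?_)
  ring

end Partial

end Saddlepoint

namespace Saddlepoint

/-! ### Bounds for the first two derivatives -/

section C2Bound

variable {W W' F G : Type*} [NormedAddCommGroup W] [NormedSpace ℝ W] [NormedAddCommGroup W']
  [NormedSpace ℝ W'] [NormedAddCommGroup F] [NormedSpace ℝ F] [NormedAddCommGroup G]
  [NormedSpace ℝ G]

/-- `f` is `C²` on `Ω`, and `b₀`, `b₁`, `b₂` bound the norms of `f` and its derivatives there. -/
structure C2Bound (Ω : Set W) (f : W → F) (b₀ b₁ b₂ : ℝ) : Prop where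
  contDiffOn : ContDiffOn ℝ 2 f Ω
  le₀ : ∀ q ∈ Ω, ‖f q‖ ≤ b₀
  le₁ : ∀ q ∈ Ω, ‖fderiv ℝ f q‖ ≤ b₁
  le₂ : ∀ q ∈ Ω, ‖fderiv ℝ (fderiv ℝ f) q‖ ≤ b₂

variable {Ω : Set W} {f g : W → F} {a₀ a₁ a₂ b₀ b₁ b₂ : ℝ}

lemma hasFDerivAt_of_contDiffOn (hΩ : IsOpen Ω) (hf : ContDiffOn ℝ 2 f Ω) {q : W} (hq : q ∈ Ω) :
    HasFDerivAt f (fderiv ℝ f q) q :=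
  ((hf.contDiffAt (hΩ.mem_nhds hq)).differentiableAt (by norm_num)).hasFDerivAt

lemma contDiffOn_fderiv (hΩ : IsOpen Ω) (hf : ContDiffOn ℝ 2 f Ω) :
    ContDiffOn ℝ 1 (fderiv ℝ f) Ω :=
  hf.fderiv_of_isOpen hΩ (by norm_num [one_add_one_eq_two])

lemma hasFDerivAt_fderiv (hΩ : IsOpen Ω) (hf : ContDiffOn ℝ 2 f Ω) {q : W} (hq : q ∈ Ω) :
    HasFDerivAt (fderiv ℝ f) (fderiv ℝ (fderiv ℝ f) q) q :=
  (((contDiffOn_fderiv hΩ hf).contDiffAt (hΩ.mem_nhds hq)).differentiableAt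
    (by norm_num)).hasFDerivAt

lemma continuousOn_fderiv_fderiv (hΩ : IsOpen Ω) (hf : ContDiffOn ℝ 2 f Ω) :
    ContinuousOn (fderiv ℝ (fderiv ℝ f)) Ω :=
  ((contDiffOn_fderiv hΩ hf).fderiv_of_isOpen (m := 0) hΩ (by norm_num)).continuousOn

/-- Allows each closure property to be checked on explicit candidates for the two derivatives
instead of on iterated `fderiv` terms. -/
lemma C2Bound.of_hasFDerivAt (hΩ : IsOpen Ω) (hc : ContDiffOn ℝ 2 f Ω) {f' : W → W →L[ℝ] F}
    {f'' : W → W →L[ℝ] W →L[ℝ] F} (h' : ∀ q ∈ Ω, HasFDerivAt f (f' q) q)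
    (h'' : ∀ q ∈ Ω, HasFDerivAt f' (f'' q) q) (h₀ : ∀ q ∈ Ω, ‖f q‖ ≤ b₀)
    (h₁ : ∀ q ∈ Ω, ‖f' q‖ ≤ b₁) (h₂ : ∀ q ∈ Ω, ‖f'' q‖ ≤ b₂) : C2Bound Ω f b₀ b₁ b₂ := by
  refine ⟨hc, h₀, fun q hq => by rw [(h' q hq).fderiv]; exact h₁ q hq, fun q hq => ?_⟩
  have : fderiv ℝ f =ᶠ[𝓝 q] f' := by
    filter_upwards [hΩ.mem_nhds hq] with r hr using (h' r hr).fderiv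
  rw [this.fderiv_eq, (h'' q hq).fderiv]
  exact h₂ q hq

lemma norm_le_of_apply₂ {A : W →L[ℝ] W →L[ℝ] F} {b : ℝ} (hb : 0 ≤ b)
    (h : ∀ v w, ‖A v w‖ ≤ b * ‖v‖ * ‖w‖) : ‖A‖ ≤ b :=
  ContinuousLinearMap.opNorm_le_bound₂ A hb h

lemma C2Bound.norm_apply_le (h : C2Bound Ω f b₀ b₁ b₂) {q : W} (hq : q ∈ Ω) (v : W) :
    ‖fderiv ℝ f q v‖ ≤ b₁ * ‖v‖ :=
  ((fderiv ℝ f q).le_opNorm v).trans (mul_le_mul_of_nonneg_right (h.3 q hq) (norm_nonneg v))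

lemma C2Bound.norm_apply₂_le (h : C2Bound Ω f b₀ b₁ b₂) {q : W} (hq : q ∈ Ω) (v w : W) :
    ‖fderiv ℝ (fderiv ℝ f) q v w‖ ≤ b₂ * ‖v‖ * ‖w‖ :=
  ((fderiv ℝ (fderiv ℝ f) q).le_opNorm₂ v w).trans (by gcongr; exact h.4 q hq)

lemma C2Bound.mono (h : C2Bound Ω f b₀ b₁ b₂) (h₀ : b₀ ≤ a₀) (h₁ : b₁ ≤ a₁) (h₂ : b₂ ≤ a₂) :
    C2Bound Ω f a₀ a₁ a₂ :=
  ⟨h.1, fun q hq => (h.2 q hq).trans h₀, fun q hq => (h.3 q hq).trans h₁,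
    fun q hq => (h.4 q hq).trans h₂⟩

lemma C2Bound.subset {Ω' : Set W} (h : C2Bound Ω f b₀ b₁ b₂) (hΩ : Ω' ⊆ Ω) :
    C2Bound Ω' f b₀ b₁ b₂ :=
  ⟨h.1.mono hΩ, fun q hq => h.2 q (hΩ hq), fun q hq => h.3 q (hΩ hq), fun q hq => h.4 q (hΩ hq)⟩

lemma C2Bound.congr (hΩ : IsOpen Ω) (h : C2Bound Ω f b₀ b₁ b₂) (hfg : EqOn g f Ω) :
    C2Bound Ω g b₀ b₁ b₂ := by
  have h1 : ∀ q ∈ Ω, g =ᶠ[𝓝 q] f := fun q hq => by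
    filter_upwards [hΩ.mem_nhds hq] with r hr using hfg hr
  refine ⟨h.1.congr hfg, fun q hq => by rw [hfg hq]; exact h.2 q hq, fun q hq => ?_,
    fun q hq => ?_⟩
  · rw [(h1 q hq).fderiv_eq]; exact h.3 q hq
  · rw [(h1 q hq).fderiv.fderiv_eq]; exact h.4 q hq

lemma C2Bound.const (c : F) : C2Bound Ω (fun _ => c) ‖c‖ 0 0 := by
  have h1 : fderiv ℝ (fun _ : W => c) = fun _ => 0 := by funext q; simp
  refine ⟨contDiffOn_const, fun q _ => le_rfl, fun q _ => by simp, fun q _ => ?_⟩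
  rw [h1, fderiv_const_apply]
  exact (norm_zero (E := W →L[ℝ] W →L[ℝ] F)).le

lemma C2Bound.add (hΩ : IsOpen Ω) (hf : C2Bound Ω f a₀ a₁ a₂) (hg : C2Bound Ω g b₀ b₁ b₂) :
    C2Bound Ω (fun q => f q + g q) (a₀ + b₀) (a₁ + b₁) (a₂ + b₂) :=
  .of_hasFDerivAt hΩ (hf.1.add hg.1)
    (fun _ hq => (hasFDerivAt_of_contDiffOn hΩ hf.1 hq).add (hasFDerivAt_of_contDiffOn hΩ hg.1 hq))
    (fun _ hq => (hasFDerivAt_fderiv hΩ hf.1 hq).add (hasFDerivAt_fderiv hΩ hg.1 hq))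
    (fun q hq => (norm_add_le _ _).trans (add_le_add (hf.2 q hq) (hg.2 q hq)))
    (fun q hq => (norm_add_le _ _).trans (add_le_add (hf.3 q hq) (hg.3 q hq)))
    (fun q hq => (norm_add_le (fderiv ℝ (fderiv ℝ f) q) _).trans
      (add_le_add (hf.4 q hq) (hg.4 q hq)))

lemma C2Bound.clm_comp (hΩ : IsOpen Ω) (hf : C2Bound Ω f a₀ a₁ a₂) (L : F →L[ℝ] G) :
    C2Bound Ω (fun q => L (f q)) (‖L‖ * a₀) (‖L‖ * a₁) (‖L‖ * a₂) := by
  refine .of_hasFDerivAt hΩ (L.contDiff.comp_contDiffOn hf.1)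
    (f' := fun q => L.comp (fderiv ℝ f q))
    (f'' := fun q => (ContinuousLinearMap.compL ℝ W F G L).comp (fderiv ℝ (fderiv ℝ f) q))
    (fun q hq => L.hasFDerivAt.comp q (hasFDerivAt_of_contDiffOn hΩ hf.1 hq))
    (fun q hq => ((ContinuousLinearMap.compL ℝ W F G L).hasFDerivAt
      (x := fderiv ℝ f q)).comp q (hasFDerivAt_fderiv hΩ hf.1 hq))
    (fun q hq => (L.le_opNorm _).trans (by gcongr; exact hf.2 q hq))
    (fun q hq => (L.opNorm_comp_le _).trans (by gcongr; exact hf.3 q hq)) fun q hq => ?_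
  refine (ContinuousLinearMap.opNorm_comp_le _ _).trans
    (mul_le_mul ?_ (hf.4 q hq) (norm_nonneg _) (norm_nonneg _))
  exact ContinuousLinearMap.opNorm_le_bound (ContinuousLinearMap.compL ℝ W F G L) (norm_nonneg _)
    fun x => L.opNorm_comp_le x

lemma C2Bound.const_smul {𝕜 : Type*} [RCLike 𝕜] [NormedSpace 𝕜 F] [IsScalarTower ℝ 𝕜 F]
    (hΩ : IsOpen Ω) (hf : C2Bound Ω f a₀ a₁ a₂) (c : 𝕜) :
    C2Bound Ω (fun q => c • f q) (‖c‖ * a₀) (‖c‖ * a₁) (‖c‖ * a₂) :=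
  .of_hasFDerivAt hΩ (hf.1.const_smul c)
    (fun q hq => (hasFDerivAt_of_contDiffOn hΩ hf.1 hq).const_smul c)
    (fun q hq => (hasFDerivAt_fderiv hΩ hf.1 hq).const_smul c)
    (fun q hq => by simp only [norm_smul]; gcongr; exact hf.2 q hq)
    (fun q hq => by simp only [norm_smul]; gcongr; exact hf.3 q hq)
    (fun q hq => by
      refine norm_le_of_apply₂ (mul_nonneg (norm_nonneg c) ((norm_nonneg (fderiv ℝ
        (fderiv ℝ f) q)).trans (hf.4 q hq))) fun v w => ?_
      have := hf.norm_apply₂_le hq v w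
      simp only [smul_apply, norm_smul]
      calc _ ≤ ‖c‖ * (a₂ * ‖v‖ * ‖w‖) := by gcongr
        _ = _ := by ring)

lemma C2Bound.sum {ι : Type*} (hΩ : IsOpen Ω) (S : Finset ι) {f : ι → W → F} {b₀ b₁ b₂ : ι → ℝ}
    (h : ∀ i ∈ S, C2Bound Ω (f i) (b₀ i) (b₁ i) (b₂ i)) :
    C2Bound Ω (fun q => ∑ i ∈ S, f i q) (∑ i ∈ S, b₀ i) (∑ i ∈ S, b₁ i) (∑ i ∈ S, b₂ i) := by
  classical
  induction S using Finset.induction_on with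
  | empty => simpa using C2Bound.const (Ω := Ω) (0 : F)
  | insert j S hj ih =>
    simp only [Finset.sum_insert hj]
    exact (h j (Finset.mem_insert_self _ _)).add hΩ (ih fun i hi => h i (Finset.mem_insert_of_mem hi))

lemma C2Bound.mul {𝕜 : Type*} [RCLike 𝕜] {f g : W → 𝕜} (hΩ : IsOpen Ω)
    (hf : C2Bound Ω f a₀ a₁ a₂) (hg : C2Bound Ω g b₀ b₁ b₂) :
    C2Bound Ω (fun q => f q * g q) (a₀ * b₀) (a₀ * b₁ + b₀ * a₁)
      (a₀ * b₂ + 2 * (a₁ * b₁) + b₀ * a₂) := by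
  -- Non-negativity of the bounds can only be inferred from a point of Ω; on the empty set there is
  -- nothing to prove.
  rcases Ω.eq_empty_or_nonempty with rfl | ⟨q₀, hq₀⟩
  · exact ⟨fun x hx => hx.elim, fun x hx => hx.elim, fun x hx => hx.elim, fun x hx => hx.elim⟩
  have ha0 := (norm_nonneg _).trans (hf.2 q₀ hq₀)
  have hb0 := (norm_nonneg _).trans (hg.2 q₀ hq₀)
  have ha1 := (norm_nonneg _).trans (hf.3 q₀ hq₀)
  have hb1 := (norm_nonneg _).trans (hg.3 q₀ hq₀)
  refine .of_hasFDerivAt hΩ (hf.1.mul hg.1)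
    (f' := fun q => f q • fderiv ℝ g q + g q • fderiv ℝ f q)
    (fun q hq => (hasFDerivAt_of_contDiffOn hΩ hf.1 hq).mul (hasFDerivAt_of_contDiffOn hΩ hg.1 hq))
    (fun q hq => ((hasFDerivAt_of_contDiffOn hΩ hf.1 hq).smul (hasFDerivAt_fderiv hΩ hg.1 hq)).add
      ((hasFDerivAt_of_contDiffOn hΩ hg.1 hq).smul (hasFDerivAt_fderiv hΩ hf.1 hq)))
    (fun q hq => ?_) (fun q hq => ?_) (fun q hq => ?_)
  · rw [norm_mul]; exact mul_le_mul (hf.2 q hq) (hg.2 q hq) (norm_nonneg _) ha0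
  · refine (norm_add_le _ _).trans (add_le_add ?_ ?_) <;> rw [norm_smul]
    · exact mul_le_mul (hf.2 q hq) (hg.3 q hq) (norm_nonneg _) ha0
    · exact mul_le_mul (hg.2 q hq) (hf.3 q hq) (norm_nonneg _) hb0
  · have ha2 := (norm_nonneg (fderiv ℝ (fderiv ℝ f) q)).trans (hf.4 q hq)
    have hb2 := (norm_nonneg (fderiv ℝ (fderiv ℝ g) q)).trans (hg.4 q hq)
    refine norm_le_of_apply₂ (by positivity) fun v w => ?_
    have e1 := mul_le_mul (hf.2 q hq) (hg.norm_apply₂_le hq v w) (norm_nonneg _) ha0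
    have e2 := mul_le_mul (hf.norm_apply_le hq v) (hg.norm_apply_le hq w) (norm_nonneg _)
      (by positivity)
    have e3 := mul_le_mul (hg.2 q hq) (hf.norm_apply₂_le hq v w) (norm_nonneg _) hb0
    have e4 := mul_le_mul (hg.norm_apply_le hq v) (hf.norm_apply_le hq w) (norm_nonneg _)
      (by positivity)
    simp only [add_apply, smul_apply, ContinuousLinearMap.smulRight_apply, smul_eq_mul]
    refine (norm_add_le _ _).trans ((add_le_add (norm_add_le _ _) (norm_add_le _ _)).trans ?_)
    simp only [norm_mul]
    nlinarith

/-- Composition with a function of one (real or complex) variable. -/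
lemma C2Bound.scalar_comp {𝕜 : Type*} [RCLike 𝕜] {f : W → 𝕜} (hΩ : IsOpen Ω)
    (hf : C2Bound Ω f a₀ a₁ a₂) {h h' h'' : 𝕜 → 𝕜} {c₀ c₁ c₂ : ℝ}
    (hc : ContDiffOn ℝ 2 (fun q => h (f q)) Ω)
    (hh : ∀ q ∈ Ω, HasDerivAt h (h' (f q)) (f q)) (hh' : ∀ q ∈ Ω, HasDerivAt h' (h'' (f q)) (f q))
    (h₀ : ∀ q ∈ Ω, ‖h (f q)‖ ≤ c₀) (h₁ : ∀ q ∈ Ω, ‖h' (f q)‖ ≤ c₁)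
    (h₂ : ∀ q ∈ Ω, ‖h'' (f q)‖ ≤ c₂) :
    C2Bound Ω (fun q => h (f q)) c₀ (c₁ * a₁) (c₂ * a₁ ^ 2 + c₁ * a₂) := by
  rcases Ω.eq_empty_or_nonempty with rfl | ⟨q₀, hq₀⟩
  · exact ⟨fun x hx => hx.elim, fun x hx => hx.elim, fun x hx => hx.elim, fun x hx => hx.elim⟩
  have hc1 := (norm_nonneg _).trans (h₁ q₀ hq₀)
  have hc2 := (norm_nonneg _).trans (h₂ q₀ hq₀)
  have ha1 := (norm_nonneg _).trans (hf.3 q₀ hq₀)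
  have hcomp : ∀ (k k' : 𝕜 → 𝕜), (∀ q ∈ Ω, HasDerivAt k (k' (f q)) (f q)) → ∀ q ∈ Ω,
      HasFDerivAt (fun q => k (f q)) (k' (f q) • fderiv ℝ f q) q := fun k k' hk q hq =>
    (hk q hq).comp_hasFDerivAt_of_eq q (hasFDerivAt_of_contDiffOn hΩ hf.1 hq) rfl
  refine .of_hasFDerivAt hΩ hc (hcomp h h' hh)
    (fun q hq => (hcomp h' h'' hh' q hq).smul (hasFDerivAt_fderiv hΩ hf.1 hq)) h₀
    (fun q hq => ?_) (fun q hq => ?_)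
  · rw [norm_smul]; exact mul_le_mul (h₁ q hq) (hf.3 q hq) (norm_nonneg _) hc1
  · have ha2 := (norm_nonneg (fderiv ℝ (fderiv ℝ f) q)).trans (hf.4 q hq)
    refine norm_le_of_apply₂ (by positivity) fun v w => ?_
    have e1 := mul_le_mul (h₁ q hq) (hf.norm_apply₂_le hq v w) (norm_nonneg _) hc1
    have e2 := mul_le_mul (hf.norm_apply_le hq v) (hf.norm_apply_le hq w) (norm_nonneg _)
      (by positivity)
    have e3 := mul_le_mul (h₂ q hq) e2 (by positivity) hc2
    simp only [add_apply, smul_apply, ContinuousLinearMap.smulRight_apply, smul_eq_mul]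
    refine (norm_add_le _ _).trans ?_
    simp only [norm_mul]
    nlinarith

/-- Composition with a `C²` map of the argument. -/
lemma C2Bound.comp {Ω' : Set W'} (hΩ : IsOpen Ω) (hΩ' : IsOpen Ω') (hf : C2Bound Ω f a₀ a₁ a₂)
    {k : W' → W} (hk : C2Bound Ω' k b₀ b₁ b₂) (hmaps : MapsTo k Ω' Ω) :
    C2Bound Ω' (fun q => f (k q)) a₀ (a₁ * b₁) (a₂ * b₁ ^ 2 + a₁ * b₂) := by
  rcases Ω'.eq_empty_or_nonempty with rfl | ⟨q₀, hq₀⟩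
  · exact ⟨fun x hx => hx.elim, fun x hx => hx.elim, fun x hx => hx.elim, fun x hx => hx.elim⟩
  have ha1 := (norm_nonneg _).trans (hf.3 _ (hmaps hq₀))
  have ha2 := (norm_nonneg (fderiv ℝ (fderiv ℝ f) (k q₀))).trans (hf.4 _ (hmaps hq₀))
  have hb1 := (norm_nonneg _).trans (hk.3 _ hq₀)
  refine .of_hasFDerivAt hΩ' (hf.1.comp hk.1 hmaps)
    (fun q hq => (hasFDerivAt_of_contDiffOn hΩ hf.1 (hmaps hq)).comp q
      (hasFDerivAt_of_contDiffOn hΩ' hk.1 hq))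
    (fun q hq => ((hasFDerivAt_fderiv hΩ hf.1 (hmaps hq)).comp q
      (hasFDerivAt_of_contDiffOn hΩ' hk.1 hq)).clm_comp (hasFDerivAt_fderiv hΩ' hk.1 hq))
    (fun q hq => hf.2 _ (hmaps hq)) (fun q hq => ?_) (fun q hq => ?_)
  · exact (ContinuousLinearMap.opNorm_comp_le _ _).trans
      (mul_le_mul (hf.3 _ (hmaps hq)) (hk.3 q hq) (norm_nonneg _) ha1)
  · have e1 := hf.3 _ (hmaps hq)
    have e2 := hf.4 _ (hmaps hq)
    have e3 := hk.3 q hq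
    have e4 := hk.4 q hq
    have ha2' := mul_nonneg ha2 (sq_nonneg b₁)
    have hb2 := (norm_nonneg (fderiv ℝ (fderiv ℝ k) q)).trans e4
    refine ContinuousLinearMap.opNorm_le_bound _ (by positivity) fun v => ?_
    refine ContinuousLinearMap.opNorm_le_bound _ (by positivity) fun w => ?_
    have n1 : ‖fderiv ℝ (fderiv ℝ f) (k q) (fderiv ℝ k q v) (fderiv ℝ k q w)‖ ≤
        a₂ * (b₁ * ‖v‖) * (b₁ * ‖w‖) := by
      refine (ContinuousLinearMap.le_opNorm₂ _ _ _).trans ?_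
      gcongr
      · exact (ContinuousLinearMap.le_opNorm _ _).trans (by gcongr)
      · exact (ContinuousLinearMap.le_opNorm _ _).trans (by gcongr)
    have n2 : ‖fderiv ℝ f (k q) (fderiv ℝ (fderiv ℝ k) q v w)‖ ≤ a₁ * (b₂ * ‖v‖ * ‖w‖) := by
      refine (ContinuousLinearMap.le_opNorm _ _).trans ?_
      gcongr
      exact (ContinuousLinearMap.le_opNorm₂ _ _ _).trans (by gcongr)
    calc _ ≤ ‖fderiv ℝ f (k q) (fderiv ℝ (fderiv ℝ k) q v w)‖ +
          ‖fderiv ℝ (fderiv ℝ f) (k q) (fderiv ℝ k q v) (fderiv ℝ k q w)‖ := by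
          refine le_trans (le_of_eq ?_) (norm_add_le _ _)
          simp
      _ ≤ _ := by linarith

/-- A `C²` function has bounded derivatives locally. -/
lemma exists_ball_c2Bound (hΩ : IsOpen Ω) (hf : ContDiffOn ℝ 2 f Ω) {q : W} (hq : q ∈ Ω) :
    ∃ B, ∃ r > 0, Metric.ball q r ⊆ Ω ∧ C2Bound (Metric.ball q r) f B B B := by
  have c0 := (hf.continuousOn.continuousAt (hΩ.mem_nhds hq)).norm
  have c1 := ((contDiffOn_fderiv hΩ hf).continuousOn.continuousAt (hΩ.mem_nhds hq)).norm
  have c2 := (continuous_norm (E := W →L[ℝ] W →L[ℝ] F)).continuousAt.comp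
    ((continuousOn_fderiv_fderiv hΩ hf).continuousAt (hΩ.mem_nhds hq))
  set B := max (‖f q‖ + 1) (max (‖fderiv ℝ f q‖ + 1) (‖fderiv ℝ (fderiv ℝ f) q‖ + 1))
  have l0 : ‖f q‖ < B := lt_max_of_lt_left (lt_add_one _)
  have l1 : ‖fderiv ℝ f q‖ < B := lt_max_of_lt_right (lt_max_of_lt_left (lt_add_one _))
  have l2 : ‖fderiv ℝ (fderiv ℝ f) q‖ < B :=
    lt_max_of_lt_right (lt_max_of_lt_right (lt_add_one _))
  obtain ⟨r, hr, hb⟩ := Metric.eventually_nhds_iff_ball.1 ((((hΩ.eventually_mem hq).and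
    (c0.eventually_lt_const l0)).and (c1.eventually_lt_const l1)).and (c2.eventually_lt_const l2))
  have hsub : Metric.ball q r ⊆ Ω := fun x hx => (hb x hx).1.1.1
  exact ⟨B, r, hr, hsub, hf.mono hsub, fun x hx => (hb x hx).1.1.2.le,
    fun x hx => (hb x hx).1.2.le, fun x hx => (hb x hx).2.le⟩

/-- Differentiation under the integral sign. -/
lemma C2Bound.integral {α : Type*} [MeasurableSpace α] {μ : Measure α} [CompleteSpace F]
    (hΩ : IsOpen Ω) {f : α → W → F} {b₀ b₁ b₂ : α → ℝ}
    (hf : ∀ᵐ a ∂μ, C2Bound Ω (f a) (b₀ a) (b₁ a) (b₂ a))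
    (m₀ : ∀ q ∈ Ω, AEStronglyMeasurable (fun a => f a q) μ)
    (m₁ : ∀ q ∈ Ω, AEStronglyMeasurable (fun a => fderiv ℝ (f a) q) μ)
    (m₂ : ∀ q ∈ Ω, AEStronglyMeasurable (fun a => fderiv ℝ (fderiv ℝ (f a)) q) μ)
    (i₀ : Integrable b₀ μ) (i₁ : Integrable b₁ μ) (i₂ : Integrable b₂ μ) :
    C2Bound Ω (fun q => ∫ a, f a q ∂μ) (∫ a, b₀ a ∂μ) (∫ a, b₁ a ∂μ) (∫ a, b₂ a ∂μ) := by
  have d1 : ∀ q ∈ Ω, HasFDerivAt (fun q => ∫ a, f a q ∂μ) (∫ a, fderiv ℝ (f a) q ∂μ) q :=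
    fun q hq => hasFDerivAt_integral_of_dominated_of_fderiv_le (bound := b₁)
      (F := fun q a => f a q) (F' := fun q a => fderiv ℝ (f a) q) (hΩ.mem_nhds hq)
      (by filter_upwards [hΩ.mem_nhds hq] with r hr using m₀ r hr)
      (i₀.mono' (m₀ q hq) (hf.mono fun a ha => ha.2 q hq)) (m₁ q hq)
      (hf.mono fun a ha r hr => ha.3 r hr) i₁
      (hf.mono fun a ha r hr => hasFDerivAt_of_contDiffOn hΩ ha.1 hr)
  have d2 : ∀ q ∈ Ω, HasFDerivAt (fun q => ∫ a, fderiv ℝ (f a) q ∂μ)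
      (∫ a, fderiv ℝ (fderiv ℝ (f a)) q ∂μ) q :=
    fun q hq => hasFDerivAt_integral_of_dominated_of_fderiv_le (bound := b₂)
      (F := fun q a => fderiv ℝ (f a) q) (F' := fun q a => fderiv ℝ (fderiv ℝ (f a)) q)
      (hΩ.mem_nhds hq)
      (by filter_upwards [hΩ.mem_nhds hq] with r hr using m₁ r hr)
      (i₁.mono' (m₁ q hq) (hf.mono fun a ha => ha.3 q hq)) (m₂ q hq)
      (hf.mono fun a ha r hr => ha.4 r hr) i₂
      (hf.mono fun a ha r hr => hasFDerivAt_fderiv hΩ ha.1 hr)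
  have hcont : ContinuousOn (fun q => ∫ a, fderiv ℝ (fderiv ℝ (f a)) q ∂μ) Ω := fun q hq =>
    (continuousAt_of_dominated (bound := b₂)
      (by filter_upwards [hΩ.mem_nhds hq] with r hr using m₂ r hr)
      (by filter_upwards [hΩ.mem_nhds hq] with r hr using hf.mono fun a ha => ha.4 r hr) i₂
      (hf.mono fun a ha => (continuousOn_fderiv_fderiv hΩ ha.1).continuousAt
        (hΩ.mem_nhds hq))).continuousWithinAt
  refine .of_hasFDerivAt hΩ ?_ d1 d2
    (fun q hq => norm_integral_le_of_norm_le i₀ (hf.mono fun a ha => ha.2 q hq))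
    (fun q hq => norm_integral_le_of_norm_le i₁ (hf.mono fun a ha => ha.3 q hq))
    (fun q hq => norm_integral_le_of_norm_le i₂ (hf.mono fun a ha => ha.4 q hq))
  rw [show (2 : WithTop ℕ∞) = 1 + 1 from one_add_one_eq_two.symm,
    contDiffOn_succ_iff_fderiv_of_isOpen hΩ]
  refine ⟨fun q hq => (d1 q hq).differentiableAt.differentiableWithinAt, by simp, ?_⟩
  refine ContDiffOn.congr ?_ fun q hq => (d1 q hq).fderiv
  rw [show (1 : WithTop ℕ∞) = 0 + 1 by simp, contDiffOn_succ_iff_fderiv_of_isOpen hΩ]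
  refine ⟨fun q hq => (d2 q hq).differentiableAt.differentiableWithinAt, by simp, ?_⟩
  rw [contDiffOn_zero]
  exact hcont.congr fun q hq => (d2 q hq).fderiv

/-- The derivatives in the second variable of a jointly `C²` function depend continuously on the
first variable. -/
lemma continuousOn_fderiv_param {Θ : Set W'} (hΘ : IsOpen Θ) (hΩ : IsOpen Ω) {f : W' → W → F}
    (hf : ContDiffOn ℝ 2 (fun z : W' × W => f z.1 z.2) (Θ ×ˢ Ω)) {q : W} (hq : q ∈ Ω) :
    ContinuousOn (fun a => f a q) Θ ∧ ContinuousOn (fun a => fderiv ℝ (f a) q) Θ ∧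
    ContinuousOn (fun a => fderiv ℝ (fderiv ℝ (f a)) q) Θ ∧ ∀ a ∈ Θ, ContDiffOn ℝ 2 (f a) Ω := by
  have hΘΩ : IsOpen (Θ ×ˢ Ω) := hΘ.prod hΩ
  set J : W →L[ℝ] W' × W := ContinuousLinearMap.inr ℝ W' W
  have hinr : ∀ a r, HasFDerivAt (fun r : W => (a, r)) J r := fun a r => hasFDerivAt_prodMk_right a r
  have e1 : ∀ a ∈ Θ, ∀ r ∈ Ω, HasFDerivAt (f a)
      ((fderiv ℝ (fun z : W' × W => f z.1 z.2) (a, r)).comp J) r := fun a ha r hr =>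
    (hasFDerivAt_of_contDiffOn hΘΩ hf (q := (a, r)) ⟨ha, hr⟩).comp r (hinr a r)
  have e2 : ∀ a ∈ Θ, ∀ r ∈ Ω, HasFDerivAt (fderiv ℝ (f a))
      (((ContinuousLinearMap.compL ℝ W (W' × W) F).flip J).comp
        ((fderiv ℝ (fderiv ℝ (fun z : W' × W => f z.1 z.2)) (a, r)).comp J)) r := by
    intro a ha r hr
    have h1 := (hasFDerivAt_fderiv hΘΩ hf (q := (a, r)) ⟨ha, hr⟩).comp r (hinr a r)
    have h2 := (((ContinuousLinearMap.compL ℝ W (W' × W) F).flip J).hasFDerivAt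
      (x := fderiv ℝ (fun z : W' × W => f z.1 z.2) (a, r))).comp r h1
    refine h2.congr_of_eventuallyEq ?_
    filter_upwards [hΩ.mem_nhds hr] with x hx
    exact (e1 a ha x hx).fderiv
  have hmaps : MapsTo (fun a => (a, q)) Θ (Θ ×ˢ Ω) := fun a ha => ⟨ha, hq⟩
  have hpair : ContinuousOn (fun a : W' => (a, q)) Θ := by fun_prop
  refine ⟨hf.continuousOn.comp hpair hmaps, ?_, ?_, fun a ha => ?_⟩
  · have h1 := (contDiffOn_fderiv hΘΩ hf).continuousOn.comp hpair hmaps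
    refine ContinuousOn.congr (((ContinuousLinearMap.compL ℝ W (W' × W) F).flip
      J).continuous.comp_continuousOn h1) fun a ha => (e1 a ha q hq).fderiv
  · have h1 := (continuousOn_fderiv_fderiv hΘΩ hf).comp hpair hmaps
    have h2 := ((ContinuousLinearMap.compL ℝ W (W' × W) (W' × W →L[ℝ] F)).flip
      J).continuous.comp_continuousOn h1
    refine ContinuousOn.congr ((ContinuousLinearMap.compL ℝ W (W' × W →L[ℝ] F) (W →L[ℝ] F)
      ((ContinuousLinearMap.compL ℝ W (W' × W) F).flip J)).continuous.comp_continuousOn h2)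
      fun a ha => (e2 a ha q hq).fderiv
  · exact hf.comp (g := fun z : W' × W => f z.1 z.2) (f := fun r => (a, r)) (by fun_prop)
      fun r hr => ⟨ha, hr⟩

end C2Bound

end Saddlepoint

namespace Saddlepoint

/-! ### Regularity of the joint moment generating function -/

section Regularity

variable {m p : ℕ} {D : Set (E p)} {μ : E p → Measure (E m)}

/-- The monomial `y ↦ ∏ y_b` over the list of indices `b`. -/
noncomputable def monomial : List (Fin m) → E m → ℂ
  | [] => fun _ => 1
  | b :: bs => mulInner (unitVec b) (monomial bs)

/-- The moment `𝔼 ∏ Y_b exp((s + iφ) Y)`, as a function of `((s, θ), φ)`. -/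
noncomputable def jointMoment (μ : E p → Measure (E m)) (j : List (Fin m))
    (z : (E m × E p) × E m) : ℂ :=
  expMoment (μ z.1.2) (monomial j) z.1.1 z.2

lemma IsModel.neZero (hM : IsModel D μ) {q : E m × E p} (hq : q ∈ interior (jointDomain D μ)) :
    NeZero (μ q.2) :=
  have := hM.isProbabilityMeasure q.2 (interior_subset hq).1
  inferInstance

lemma mem_interior_mgfDomain {q : E m × E p} (hq : q ∈ interior (jointDomain D μ)) :
    q.1 ∈ interior (mgfDomain (μ q.2)) := by
  rw [mem_interior_iff_mem_nhds] at hq ⊢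
  have : Continuous fun s : E m => (s, q.2) := by fun_prop
  filter_upwards [this.continuousAt.preimage_mem_nhds hq] with s hs using hs.2

lemma expIntegrableOn_monomial (ν : Measure (E m)) (j : List (Fin m)) :
    ExpIntegrableOn ν (monomial j) (interior (mgfDomain ν)) := by
  induction j with
  | nil => exact expIntegrableOn_one interior_subset
  | cons b bs ih => exact ih.mulInner isOpen_interior _

lemma hasLineDerivAt_jointMoment_fst {q : E m × E p} (hq : q ∈ interior (jointDomain D μ))
    (φ : E m) (j : List (Fin m)) (b : Fin m) :
    HasLineDerivAt ℝ (fun q => jointMoment μ j (q, φ)) (jointMoment μ (b :: j) (q, φ)) q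
      (unitVec b, 0) := by
  have := (expIntegrableOn_monomial (μ q.2) j).hasLineDerivAt_left isOpen_interior
    (mem_interior_mgfDomain hq) φ (unitVec b)
  unfold HasLineDerivAt at this ⊢
  simpa [jointMoment, monomial] using this

lemma hasLineDerivAt_jointMoment_snd {q : E m × E p} (hq : q ∈ interior (jointDomain D μ))
    (φ : E m) (j : List (Fin m)) (b : Fin m) :
    HasLineDerivAt ℝ (jointMoment μ j) (Complex.I * jointMoment μ (b :: j) (q, φ)) (q, φ)
      (0, unitVec b) := by
  have := (expIntegrableOn_monomial (μ q.2) j).hasLineDerivAt_right isOpen_interior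
    (mem_interior_mgfDomain hq) φ (unitVec b)
  unfold HasLineDerivAt at this ⊢
  simpa [jointMoment, monomial] using this

/-- Differentiation in s under the integral needs no hypothesis at interior points. The formal
iterated derivatives of the growth bound therefore become moments, which can also be differentiated
in φ. -/
lemma iterPD_eq_jointMoment (φ : E m) (j : List (Fin m)) :
    ∀ q ∈ interior (jointDomain D μ),
      iterPD (pdDirections [] j) (jointMGF μ φ) q = jointMoment μ j (q, φ) := by
  induction j with
  | nil =>
    intro q _
    simp [pdDirections, iterPD, jointMGF, jointMoment, monomial, cmgf_eq_expMoment]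
  | cons b bs ih =>
    intro q hq
    have h1 : iterPD (pdDirections [] bs) (jointMGF μ φ) =ᶠ[𝓝 q]
        fun q => jointMoment μ bs (q, φ) := by
      filter_upwards [isOpen_interior.mem_nhds hq] with r hr using ih r hr
    change lineDeriv ℝ (iterPD (pdDirections [] bs) (jointMGF μ φ)) q (unitVec b, 0) = _
    rw [h1.lineDeriv_eq]
    exact (hasLineDerivAt_jointMoment_fst hq φ bs b).lineDeriv

/-- The first derivative in `θ_a` of `jointMoment μ j`. -/
noncomputable def jointMomentD (μ : E p → Measure (E m)) (a : Fin p) (j : List (Fin m))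
    (z : (E m × E p) × E m) : ℂ :=
  iterPD (pdDirections [a] j) (jointMGF μ z.2) z.1

/-- The second derivative in `θ_c`, `θ_a` of `jointMoment μ j`. -/
noncomputable def jointMomentDD (μ : E p → Measure (E m)) (c a : Fin p) (j : List (Fin m))
    (z : (E m × E p) × E m) : ℂ :=
  iterPD (pdDirections [c, a] j) (jointMGF μ z.2) z.1

lemma hasLineDerivAt_left_of_section {X Y F : Type*} [NormedAddCommGroup X] [NormedSpace ℝ X]
    [NormedAddCommGroup Y] [NormedSpace ℝ Y] [NormedAddCommGroup F] [NormedSpace ℝ F]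
    {f : X × Y → F} {f' : F} {x : X} {y : Y} {v : X} :
    HasLineDerivAt ℝ f f' (x, y) (v, 0) ↔ HasLineDerivAt ℝ (fun x => f (x, y)) f' x v := by
  simp [HasLineDerivAt]

/-- The directions of the partial derivatives in `((s, θ), φ)`. -/
noncomputable def stdDirection (m p : ℕ) :
    (Fin m ⊕ Fin p) ⊕ Fin m → (E m × E p) × E m
  | .inl (.inl b) => ((unitVec b, 0), 0)
  | .inl (.inr a) => ((0, unitVec a), 0)
  | .inr b => (0, unitVec b)

/-- The coordinates of `((s, θ), φ)`. -/
noncomputable def stdCoord (m p : ℕ) :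
    (Fin m ⊕ Fin p) ⊕ Fin m → ((E m × E p) × E m) →L[ℝ] ℝ
  | .inl (.inl b) => (EuclideanSpace.proj b).comp
      ((ContinuousLinearMap.fst ℝ (E m) (E p)).comp (ContinuousLinearMap.fst ℝ _ _))
  | .inl (.inr a) => (EuclideanSpace.proj a).comp
      ((ContinuousLinearMap.snd ℝ (E m) (E p)).comp (ContinuousLinearMap.fst ℝ _ _))
  | .inr b => (EuclideanSpace.proj b).comp (ContinuousLinearMap.snd ℝ _ _)

lemma sum_stdCoord (w : (E m × E p) × E m) : ∑ i, stdCoord m p i w • stdDirection m p i = w := by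
  have h1 := sum_unitVec w.1.1
  have h2 := sum_unitVec w.1.2
  have h3 := sum_unitVec w.2
  obtain ⟨⟨x, y⟩, z⟩ := w
  simp only at h1 h2 h3
  rw [Fintype.sum_sum_type, Fintype.sum_sum_type]
  simp only [stdCoord, stdDirection]
  ext i <;> simp [Prod.fst_sum, Prod.snd_sum, h1, h2, h3]

/-- The first partial derivatives of `jointMoment μ j`. -/
noncomputable def partial₁ (μ : E p → Measure (E m)) (j : List (Fin m)) :
    (Fin m ⊕ Fin p) ⊕ Fin m → (E m × E p) × E m → ℂ
  | .inl (.inl b) => jointMoment μ (b :: j)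
  | .inl (.inr a) => jointMomentD μ a j
  | .inr b => fun z => Complex.I * jointMoment μ (b :: j) z

/-- The second partial derivatives of `jointMoment μ j`. -/
noncomputable def partial₂ (μ : E p → Measure (E m)) (j : List (Fin m)) :
    (Fin m ⊕ Fin p) ⊕ Fin m → (Fin m ⊕ Fin p) ⊕ Fin m → (E m × E p) × E m → ℂ
  | .inl (.inl b), i => partial₁ μ (b :: j) i
  | .inr b, i => fun z => Complex.I * partial₁ μ (b :: j) i z
  | .inl (.inr a), .inl (.inl b) => jointMomentD μ a (b :: j)
  | .inl (.inr a), .inl (.inr c) => jointMomentDD μ c a j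
  | .inl (.inr a), .inr b => fun z => Complex.I * jointMomentD μ a (b :: j) z

/-- The set of all `((s, θ), φ)` with `(s, θ)` in the interior of `𝒮`. -/
abbrev complexDomain (D : Set (E p)) (μ : E p → Measure (E m)) : Set ((E m × E p) × E m) :=
  interior (jointDomain D μ) ×ˢ univ

lemma isOpen_complexDomain : IsOpen (complexDomain D μ) := isOpen_interior.prod isOpen_univ

lemma hasLineDerivAt_const_mul {W : Type*} [NormedAddCommGroup W] [NormedSpace ℝ W]
    {f : W → ℂ} {f' : ℂ} {q v : W} (h : HasLineDerivAt ℝ f f' q v) (c : ℂ) :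
    HasLineDerivAt ℝ (fun q => c * f q) (c * f') q v :=
  HasDerivAt.const_mul c h

/-- Derivatives in s and φ come from the integral; only the θ-derivative has to be taken from the
growth bound, and together with at most five s-derivatives it stays within total order six. -/
lemma hasLineDerivAt_partial₁ (hG : GrowthBound D μ) {j : List (Fin m)} (hj : j.length ≤ 5)
    (i : (Fin m ⊕ Fin p) ⊕ Fin m) {z : (E m × E p) × E m} (hz : z ∈ complexDomain D μ) :
    HasLineDerivAt ℝ (jointMoment μ j) (partial₁ μ j i z) z (stdDirection m p i) := by
  obtain ⟨γ, _, _, h⟩ := hG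
  obtain ⟨q, φ⟩ := z
  have hq : q ∈ interior (jointDomain D μ) := hz.1
  match i with
  | .inl (.inl b) =>
    exact hasLineDerivAt_left_of_section.2 (hasLineDerivAt_jointMoment_fst hq φ j b)
  | .inr b => exact hasLineDerivAt_jointMoment_snd hq φ j b
  | .inl (.inr a) =>
    refine hasLineDerivAt_left_of_section.2 ?_
    have h1 := ((h [a] j (Or.inl (by simp; omega))).1 q hq φ).1
    have h2 : iterPD (pdDirections [] j) (jointMGF μ φ) =ᶠ[𝓝 q]
        fun q => jointMoment μ j (q, φ) := by
      filter_upwards [isOpen_interior.mem_nhds hq] with r hr using iterPD_eq_jointMoment φ j r hr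
    change LineDifferentiableAt ℝ (iterPD (pdDirections [] j) (jointMGF μ φ)) q (0, unitVec a)
      at h1
    have h3 := h1.hasLineDerivAt
    exact h3.congr_of_eventuallyEq h2.symm

/-- The growth bound says nothing about order zero, whence the lower bound on the length. -/
lemma continuousOn_jointMoment (hG : GrowthBound D μ) {j : List (Fin m)} (h1 : 1 ≤ j.length)
    (h6 : j.length ≤ 6) : ContinuousOn (jointMoment μ j) (complexDomain D μ) := by
  obtain ⟨γ, _, _, h⟩ := hG
  refine (h [] j (Or.inl (by simp; omega))).2.congr fun z hz => ?_
  exact (iterPD_eq_jointMoment z.2 j z.1 hz.1).symm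

lemma continuousOn_jointMomentD (hG : GrowthBound D μ) (a : Fin p) {j : List (Fin m)}
    (h5 : j.length ≤ 5) : ContinuousOn (jointMomentD μ a j) (complexDomain D μ) := by
  obtain ⟨γ, _, _, h⟩ := hG
  exact (h [a] j (Or.inl (by simp; omega))).2

lemma continuousOn_partial₁ (hG : GrowthBound D μ) {j : List (Fin m)} (hj : j.length ≤ 5)
    (i : (Fin m ⊕ Fin p) ⊕ Fin m) : ContinuousOn (partial₁ μ j i) (complexDomain D μ) := by
  match i with
  | .inl (.inl b) => exact continuousOn_jointMoment hG (by simp) (by simp; omega)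
  | .inl (.inr a) => exact continuousOn_jointMomentD hG a hj
  | .inr b =>
    exact continuousOn_const.mul (continuousOn_jointMoment hG (by simp) (by simp; omega))

/-- In the growth bound θ-derivatives are always outermost, so an s- or φ-derivative of a
θ-derivative is not directly available; `hasLineDerivAt_comm` supplies it from the opposite order.
The limit two on the length is the one that accompanies two θ-derivatives. -/
lemma hasLineDerivAt_partial₂ (hG : GrowthBound D μ) {j : List (Fin m)} (hj : j.length ≤ 2)
    (i k : (Fin m ⊕ Fin p) ⊕ Fin m) {z : (E m × E p) × E m} (hz : z ∈ complexDomain D μ) :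
    HasLineDerivAt ℝ (partial₁ μ j i) (partial₂ μ j i k z) z (stdDirection m p k) := by
  match i, k with
  | .inl (.inl b), k => exact hasLineDerivAt_partial₁ hG (by simp; omega) k hz
  | .inr b, k =>
    exact hasLineDerivAt_const_mul (hasLineDerivAt_partial₁ hG (by simp; omega) k hz) _
  | .inl (.inr a), .inl (.inl b) =>
    exact hasLineDerivAt_comm isOpen_complexDomain
      (fun r hr => hasLineDerivAt_partial₁ hG (by omega) (.inl (.inl b)) hr)
      (fun r hr => hasLineDerivAt_partial₁ hG (by omega) (.inl (.inr a)) hr)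
      (fun r hr => hasLineDerivAt_partial₁ hG (j := b :: j) (by simp; omega) (.inl (.inr a)) hr)
      (continuousOn_jointMomentD hG a (by simp; omega)) hz
  | .inl (.inr a), .inr b =>
    exact hasLineDerivAt_comm isOpen_complexDomain
      (fun r hr => hasLineDerivAt_partial₁ hG (by omega) (.inr b) hr)
      (fun r hr => hasLineDerivAt_partial₁ hG (by omega) (.inl (.inr a)) hr)
      (fun r hr => hasLineDerivAt_const_mul (hasLineDerivAt_partial₁ hG (j := b :: j)
        (by simp; omega) (.inl (.inr a)) hr) _)
      (continuousOn_const.mul (continuousOn_jointMomentD hG a (by simp; omega))) hz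
  | .inl (.inr a), .inl (.inr c) =>
    obtain ⟨γ, _, _, h⟩ := hG
    obtain ⟨q, φ⟩ := z
    refine hasLineDerivAt_left_of_section.2 ?_
    have h1 := ((h [c, a] j (Or.inr (by simp; omega))).1 q hz.1 φ).1
    change LineDifferentiableAt ℝ (iterPD (pdDirections [a] j) (jointMGF μ φ)) q (0, unitVec c)
      at h1
    exact h1.hasLineDerivAt

lemma continuousOn_partial₂ (hG : GrowthBound D μ) {j : List (Fin m)} (hj : j.length ≤ 2)
    (i k : (Fin m ⊕ Fin p) ⊕ Fin m) :
    ContinuousOn (partial₂ μ j i k) (complexDomain D μ) := by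
  match i, k with
  | .inl (.inl b), k => exact continuousOn_partial₁ hG (by simp; omega) k
  | .inr b, k => exact continuousOn_const.mul (continuousOn_partial₁ hG (by simp; omega) k)
  | .inl (.inr a), .inl (.inl b) => exact continuousOn_jointMomentD hG a (by simp; omega)
  | .inl (.inr a), .inr b =>
    exact continuousOn_const.mul (continuousOn_jointMomentD hG a (by simp; omega))
  | .inl (.inr a), .inl (.inr c) =>
    obtain ⟨γ, _, _, h⟩ := hG
    exact (h [c, a] j (Or.inr (by simp; omega))).2

lemma contDiffOn_jointMoment (hG : GrowthBound D μ) {j : List (Fin m)} (hj : j.length ≤ 2) :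
    ContDiffOn ℝ 2 (jointMoment μ j) (complexDomain D μ) :=
  (contDiffOn_two_of_hasLineDerivAt isOpen_complexDomain (stdDirection m p) (stdCoord m p)
    sum_stdCoord (fun i _ hr => hasLineDerivAt_partial₁ hG (by omega) i hr)
    (fun i k _ hr => hasLineDerivAt_partial₂ hG hj i k hr)
    (fun i k => continuousOn_partial₂ hG hj i k)).1

/-- A local polynomial bound, with the same constants for all relevant derivatives. -/
lemma exists_norm_partial_le (hG : GrowthBound D μ) {q₀ : E m × E p}
    (hq₀ : q₀ ∈ interior (jointDomain D μ)) :
    ∃ (C : ℝ) (k : ℕ), 1 ≤ C ∧ ∀ᶠ q in 𝓝 q₀, q ∈ interior (jointDomain D μ) ∧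
      ∀ φ : E m, (∀ j : List (Fin m), 1 ≤ j.length → j.length ≤ 6 →
          ‖jointMoment μ j (q, φ)‖ ≤ C * (1 + ‖φ‖) ^ k) ∧
        (∀ (a : Fin p) (j : List (Fin m)), j.length ≤ 5 →
          ‖jointMomentD μ a j (q, φ)‖ ≤ C * (1 + ‖φ‖) ^ k) ∧
        (∀ (c a : Fin p) (j : List (Fin m)), j.length ≤ 2 →
          ‖jointMomentDD μ c a j (q, φ)‖ ≤ C * (1 + ‖φ‖) ^ k) := by
  obtain ⟨γ, hγc, hγ0, h⟩ := hG
  have hγ := hγc.continuousAt (isOpen_interior.mem_nhds hq₀)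
  -- By continuity γ stays below γ(q₀) + 1 near q₀; rounding this exponent up makes the bound a
  -- polynomial with fixed constants.
  refine ⟨γ q₀ + 1, ⌈γ q₀ + 1⌉₊, by linarith [hγ0 q₀ hq₀], ?_⟩
  filter_upwards [hγ.eventually_lt_const (lt_add_one _),
    isOpen_interior.eventually_mem hq₀] with q hq hq'
  have key : ∀ φ : E m, γ q * (1 + ‖φ‖) ^ γ q ≤
      (γ q₀ + 1) * (1 + ‖φ‖) ^ ⌈γ q₀ + 1⌉₊ := by
    intro φ
    have h1 : (1 : ℝ) ≤ 1 + ‖φ‖ := by linarith [norm_nonneg φ]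
    have h2 : (1 + ‖φ‖) ^ γ q ≤ (1 + ‖φ‖) ^ ⌈γ q₀ + 1⌉₊ := by
      rw [← Real.rpow_natCast]
      exact Real.rpow_le_rpow_of_exponent_le h1 (hq.le.trans (Nat.le_ceil _))
    exact mul_le_mul hq.le h2 (by positivity) (by linarith [hγ0 q₀ hq₀])
  refine ⟨hq', fun φ => ⟨fun j h1 h6 => ?_, fun a j h5 => ?_, fun c a j h2 => ?_⟩⟩
  · rw [← iterPD_eq_jointMoment φ j q hq']
    exact ((h [] j (Or.inl (by simp; omega))).1 q hq' φ).2.trans (key φ)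
  · exact ((h [a] j (Or.inl (by simp; omega))).1 q hq' φ).2.trans (key φ)
  · exact ((h [c, a] j (Or.inr (by simp; omega))).1 q hq' φ).2.trans (key φ)

/-- Substitute for the growth bound at order zero: the modulus of the transform is largest at φ = 0.
-/
lemma norm_jointMoment_nil_le (z : (E m × E p) × E m) :
    ‖jointMoment μ [] z‖ ≤ mgf (μ z.1.2) z.1.1 := by
  unfold jointMoment expMoment mgf
  refine (norm_integral_le_integral_norm _).trans (le_of_eq ?_)
  congr 1; funext y
  rw [norm_mul, norm_cexp_inner]; simp [monomial]

lemma jointMoment_nil_zero (q : E m × E p) :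
    jointMoment μ [] (q, 0) = (mgf (μ q.2) q.1 : ℂ) := by
  rw [ofReal_mgf, cmgf_eq_expMoment]; rfl

/-- Local `C²` bounds of the moments, polynomial in `φ`. -/
lemma exists_c2Bound_jointMoment (hG : GrowthBound D μ) {q₀ : E m × E p}
    (hq₀ : q₀ ∈ interior (jointDomain D μ)) :
    ∃ (C : ℝ) (k : ℕ) (r : ℝ), 1 ≤ C ∧ 0 < r ∧
      Metric.ball q₀ r ⊆ interior (jointDomain D μ) ∧
      ∀ (φ : E m) (j : List (Fin m)), j.length ≤ 2 →
        C2Bound (Metric.ball q₀ r) (fun q => jointMoment μ j (q, φ)) (C * (1 + ‖φ‖) ^ k)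
          (C * (1 + ‖φ‖) ^ k) (C * (1 + ‖φ‖) ^ k) := by
  obtain ⟨C₁, k, hC₁, hev⟩ := exists_norm_partial_le hG hq₀
  have hcont : ContinuousAt (fun q : E m × E p => ‖jointMoment μ [] (q, 0)‖) q₀ := by
    have h1 := (contDiffOn_jointMoment hG (j := []) (by simp)).continuousOn.continuousAt
      (isOpen_complexDomain.mem_nhds (x := (q₀, (0 : E m))) ⟨hq₀, mem_univ _⟩)
    exact (h1.comp_of_eq (by fun_prop : ContinuousAt (fun q : E m × E p => (q, (0 : E m))) q₀)
      rfl).norm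
  set C₂ := ‖jointMoment μ [] (q₀, 0)‖ + 1
  obtain ⟨r, hr, hb⟩ := Metric.eventually_nhds_iff_ball.1
    (hev.and (hcont.eventually_lt_const (lt_add_one _)))
  set κ : ℝ := ∑ i, ‖stdCoord m p i‖ with hκ
  have hκ0 : 0 ≤ κ := Finset.sum_nonneg fun i _ => norm_nonneg _
  have hC₂ : 0 < C₂ := by positivity
  have hsub : Metric.ball q₀ r ⊆ interior (jointDomain D μ) := fun q hq => (hb q hq).1.1
  -- The factor (1 + κ)² dominates 1, κ and κ², the sums of coordinate norms that enter at orders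
  -- zero, one and two; C₂ covers the moment of order zero.
  refine ⟨(1 + κ) ^ 2 * (C₁ + C₂), k, r, by nlinarith, hr, hsub, fun φ j hj => ?_⟩
  have hpos : (0 : ℝ) < (1 + ‖φ‖) ^ k := by positivity
  have hb1 : ∀ (j : List (Fin m)), j.length ≤ 5 → ∀ i, ∀ q ∈ Metric.ball q₀ r,
      ‖partial₁ μ j i (q, φ)‖ ≤ C₁ * (1 + ‖φ‖) ^ k := by
    intro j hj i q hq
    match i with
    | .inl (.inl b) => exact ((hb q hq).1.2 φ).1 _ (by simp) (by simp; omega)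
    | .inl (.inr a) => exact ((hb q hq).1.2 φ).2.1 a _ hj
    | .inr b =>
      simp only [partial₁, norm_mul, Complex.norm_I, one_mul]
      exact ((hb q hq).1.2 φ).1 _ (by simp) (by simp; omega)
  have hb2 : ∀ i k', ∀ q ∈ Metric.ball q₀ r,
      ‖partial₂ μ j i k' (q, φ)‖ ≤ C₁ * (1 + ‖φ‖) ^ k := by
    intro i k' q hq
    match i, k' with
    | .inl (.inl b), k' => exact hb1 _ (by simp; omega) k' q hq
    | .inr b, k' =>
      simp only [partial₂, norm_mul, Complex.norm_I, one_mul]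
      exact hb1 _ (by simp; omega) k' q hq
    | .inl (.inr a), .inl (.inl b) => exact ((hb q hq).1.2 φ).2.1 a _ (by simp; omega)
    | .inl (.inr a), .inl (.inr c) => exact ((hb q hq).1.2 φ).2.2 c a _ hj
    | .inl (.inr a), .inr b =>
      simp only [partial₂, norm_mul, Complex.norm_I, one_mul]
      exact ((hb q hq).1.2 φ).2.1 a _ (by simp; omega)
  have key := contDiffOn_two_of_hasLineDerivAt (Ω := Metric.ball q₀ r) (ι := Fin m ⊕ Fin p)
    (f := fun q => jointMoment μ j (q, φ)) (f' := fun i q => partial₁ μ j (.inl i) (q, φ))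
    (f'' := fun i k q => partial₂ μ j (.inl i) (.inl k) (q, φ)) Metric.isOpen_ball
    (fun i => (stdDirection m p (.inl i)).1)
    (fun i => (stdCoord m p (.inl i)).comp (ContinuousLinearMap.inl ℝ (E m × E p) (E m)))
    (fun w => by
      have h1 := congrArg Prod.fst (sum_stdCoord (m := m) (p := p) (w, 0))
      rw [Fintype.sum_sum_type] at h1
      simpa [Prod.fst_sum, stdCoord, stdDirection] using h1)
    (fun i q hq => by
      have h1 := hasLineDerivAt_partial₁ hG (j := j) (by omega) (.inl i) (z := (q, φ))
        ⟨hsub hq, mem_univ _⟩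
      match i with
      | .inl b => exact hasLineDerivAt_left_of_section.1 h1
      | .inr a => exact hasLineDerivAt_left_of_section.1 h1)
    (fun i k q hq => by
      have h1 := hasLineDerivAt_partial₂ hG (j := j) hj (.inl i) (.inl k) (z := (q, φ))
        ⟨hsub hq, mem_univ _⟩
      match k with
      | .inl b => exact hasLineDerivAt_left_of_section.1 h1
      | .inr a => exact hasLineDerivAt_left_of_section.1 h1)
    (fun i k => (continuousOn_partial₂ hG hj (.inl i) (.inl k)).comp (by fun_prop)
      fun q hq => ⟨hsub hq, mem_univ _⟩)
  have hc : ∀ i, ‖(stdCoord m p (.inl i)).comp (ContinuousLinearMap.inl ℝ (E m × E p) (E m))‖ ≤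
      ‖stdCoord m p (.inl i)‖ := fun i =>
    (ContinuousLinearMap.opNorm_comp_le _ _).trans
      (mul_le_of_le_one_right (norm_nonneg _) (ContinuousLinearMap.norm_inl_le_one ℝ _ _))
  have hκ' : ∑ i, ‖stdCoord m p (.inl i)‖ ≤ κ := by
    rw [hκ, Fintype.sum_sum_type (fun i => ‖stdCoord m p i‖)]
    exact le_add_of_nonneg_right (Finset.sum_nonneg fun i _ => norm_nonneg _)
  set X := C₁ * (1 + ‖φ‖) ^ k with hX
  have hX0 : 0 ≤ X := by positivity
  have hsum : ∀ g : Fin m ⊕ Fin p → ℝ, ∀ Y, 0 ≤ Y → (∀ i, 0 ≤ g i) → (∀ i, g i ≤ Y) →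
      ∑ i, ‖(stdCoord m p (.inl i)).comp (ContinuousLinearMap.inl ℝ (E m × E p) (E m))‖ * g i ≤
        κ * Y := by
    intro g Y hY hg0 hg
    calc _ ≤ ∑ i, ‖stdCoord m p (.inl i)‖ * Y :=
          Finset.sum_le_sum fun i _ => mul_le_mul (hc i) (hg i) (hg0 i) (norm_nonneg _)
      _ ≤ κ * Y := by rw [← Finset.sum_mul]; gcongr
  have hCle : ∀ t : ℝ, t ≤ (1 + κ) ^ 2 → t * X ≤ (1 + κ) ^ 2 * (C₁ + C₂) * (1 + ‖φ‖) ^ k := by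
    intro t ht
    calc t * X ≤ (1 + κ) ^ 2 * ((C₁ + C₂) * (1 + ‖φ‖) ^ k) := by
          gcongr; rw [hX]; gcongr; linarith
      _ = _ := by ring
  refine ⟨key.1, fun q hq => ?_, fun q hq => ?_, fun q hq => ?_⟩
  · rcases Nat.eq_zero_or_pos j.length with h0 | h0
    · rw [List.length_eq_zero_iff] at h0
      subst h0
      have h1 := (hb q hq).2.le
      rw [jointMoment_nil_zero, Complex.norm_real, Real.norm_eq_abs] at h1
      have h3 : (1 : ℝ) ≤ (1 + ‖φ‖) ^ k := one_le_pow₀ (by linarith [norm_nonneg φ])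
      have h4 : C₂ ≤ (1 + κ) ^ 2 * (C₁ + C₂) := by
        have h5 : (1 : ℝ) ≤ (1 + κ) ^ 2 := one_le_pow₀ (by linarith)
        nlinarith
      calc _ ≤ C₂ := (norm_jointMoment_nil_le _).trans ((le_abs_self _).trans h1)
        _ ≤ (1 + κ) ^ 2 * (C₁ + C₂) * 1 := by linarith
        _ ≤ _ := by gcongr
    · have h1 := ((hb q hq).1.2 φ).1 j h0 (by omega)
      refine h1.trans ((le_of_eq (one_mul X).symm).trans (hCle 1 (by nlinarith)))
  · refine (key.2.1 q hq).trans ((hsum _ X hX0 (fun i => norm_nonneg _)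
      fun i => hb1 j (by omega) (.inl i) q hq).trans (hCle κ (by nlinarith)))
  · refine (key.2.2 q hq).trans ((hsum _ (κ * X) (by positivity)
      (fun i => Finset.sum_nonneg fun k _ => by positivity) fun i => hsum _ X hX0
        (fun k => norm_nonneg _) fun k => hb2 (.inl i) (.inl k) q hq).trans ?_)
    rw [← mul_assoc]
    exact hCle _ (by nlinarith)

end Regularity

end Saddlepoint

namespace Saddlepoint

/-! ### `C²` bounds that are polynomial in a parameter -/

section PolyC2

variable {α W : Type*} [NormedAddCommGroup W] [NormedSpace ℝ W]

/-- The functions `f a` have `C²` bounds on `Ω` that are polynomial in `ω a`. -/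
def PolyC2 (ω : α → ℝ) (Ω : Set W) (f : α → W → ℂ) : Prop :=
  ∃ (C : ℝ) (k : ℕ), 0 ≤ C ∧ ∀ a, C2Bound Ω (f a) (C * ω a ^ k) (C * ω a ^ k) (C * ω a ^ k)

variable {ω : α → ℝ} {Ω : Set W} {f g : α → W → ℂ}

lemma PolyC2.of_c2Bound {h : W → ℂ} {B : ℝ} (hh : C2Bound Ω h B B B) :
    PolyC2 ω Ω (fun _ => h) := by
  refine ⟨|B|, 0, abs_nonneg _, fun a => hh.mono ?_ ?_ ?_⟩ <;> simpa using le_abs_self B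

lemma PolyC2.scalar (hω : ∀ a, 1 ≤ ω a) {c : α → ℂ} (hc : ∀ a, ‖c a‖ ≤ ω a) :
    PolyC2 ω Ω (fun a _ => c a) := by
  refine ⟨1, 1, zero_le_one, fun a => (C2Bound.const (c a)).mono ?_ ?_ ?_⟩
  · simpa using hc a
  · simpa using zero_le_one.trans (hω a)
  · simpa using zero_le_one.trans (hω a)

lemma PolyC2.add (hω : ∀ a, 1 ≤ ω a) (hΩ : IsOpen Ω) (hf : PolyC2 ω Ω f) (hg : PolyC2 ω Ω g) :
    PolyC2 ω Ω (fun a q => f a q + g a q) := by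
  obtain ⟨C, k, hC, hf⟩ := hf
  obtain ⟨C', k', hC', hg⟩ := hg
  refine ⟨C + C', max k k', by positivity, fun a => ?_⟩
  have h1 : ω a ^ k ≤ ω a ^ max k k' := pow_le_pow_right₀ (hω a) (le_max_left _ _)
  have h2 : ω a ^ k' ≤ ω a ^ max k k' := pow_le_pow_right₀ (hω a) (le_max_right _ _)
  have h3 : C * ω a ^ k + C' * ω a ^ k' ≤ (C + C') * ω a ^ max k k' := by
    rw [add_mul]; gcongr
  exact ((hf a).add hΩ (hg a)).mono h3 h3 h3

lemma PolyC2.mul (hω : ∀ a, 1 ≤ ω a) (hΩ : IsOpen Ω) (hf : PolyC2 ω Ω f) (hg : PolyC2 ω Ω g) :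
    PolyC2 ω Ω (fun a q => f a q * g a q) := by
  obtain ⟨C, k, hC, hf⟩ := hf
  obtain ⟨C', k', hC', hg⟩ := hg
  -- Four is the number 1 + 2 + 1 of terms in the Leibniz rule for the second derivative.
  refine ⟨4 * (C * C'), k + k', by positivity, fun a => ?_⟩
  have h0 : 0 ≤ C * C' * ω a ^ (k + k') :=
    mul_nonneg (by positivity) (pow_nonneg (zero_le_one.trans (hω a)) _)
  have h1 : C * ω a ^ k * (C' * ω a ^ k') = C * C' * ω a ^ (k + k') := by rw [pow_add]; ring
  have h2 : C' * ω a ^ k' * (C * ω a ^ k) = C * C' * ω a ^ (k + k') := by rw [pow_add]; ring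
  refine ((hf a).mul hΩ (hg a)).mono ?_ ?_ ?_ <;> simp only [h1, h2] <;> linarith

lemma PolyC2.sum {ι : Type*} (hω : ∀ a, 1 ≤ ω a) (hΩ : IsOpen Ω) (S : Finset ι)
    {f : ι → α → W → ℂ} (hf : ∀ i ∈ S, PolyC2 ω Ω (f i)) :
    PolyC2 ω Ω (fun a q => ∑ i ∈ S, f i a q) := by
  classical
  induction S using Finset.induction_on with
  | empty =>
    simp only [Finset.sum_empty]
    exact PolyC2.scalar hω (c := fun _ => 0) fun a => by simpa using zero_le_one.trans (hω a)
  | insert j S hj ih =>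
    simp only [Finset.sum_insert hj]
    exact (hf j (Finset.mem_insert_self _ _)).add hω hΩ
      (ih fun i hi => hf i (Finset.mem_insert_of_mem hi))

/-- A non-positive real part bounds the exponential by 1, so derivatives grow only through those of
the exponent, by the first power at order one and the square at order two. -/
lemma PolyC2.cexp (hω : ∀ a, 1 ≤ ω a) (hΩ : IsOpen Ω) (hf : PolyC2 ω Ω f)
    (hre : ∀ a, ∀ q ∈ Ω, (f a q).re ≤ 0) : PolyC2 ω Ω (fun a q => Complex.exp (f a q)) := by
  obtain ⟨C, k, hC, hf⟩ := hf
  refine ⟨1 + C + C ^ 2, 2 * k, by positivity, fun a => ?_⟩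
  have hb : ∀ q ∈ Ω, ‖Complex.exp (f a q)‖ ≤ 1 := fun q hq => by
    rw [Complex.norm_exp]; exact Real.exp_le_one_iff.2 (hre a q hq)
  have h1 : (1 : ℝ) ≤ ω a ^ (2 * k) := one_le_pow₀ (hω a)
  have h2 : ω a ^ k ≤ ω a ^ (2 * k) := pow_le_pow_right₀ (hω a) (by omega)
  have h3 : (C * ω a ^ k) ^ 2 = C ^ 2 * ω a ^ (2 * k) := by ring
  have h4 : C * ω a ^ k ≤ C * ω a ^ (2 * k) := by gcongr
  have h5 : 0 ≤ C * ω a ^ (2 * k) := by positivity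
  have h6 : 0 ≤ C ^ 2 * ω a ^ (2 * k) := by positivity
  have h7 : (1 + C + C ^ 2) * ω a ^ (2 * k) =
    ω a ^ (2 * k) + C * ω a ^ (2 * k) + C ^ 2 * ω a ^ (2 * k) := by ring
  refine ((hf a).scalar_comp hΩ (Complex.contDiff_exp.comp_contDiffOn (hf a).1)
    (fun q _ => Complex.hasDerivAt_exp _) (fun q _ => Complex.hasDerivAt_exp _) hb hb hb).mono
    ?_ ?_ ?_ <;> rw [h7] <;> try rw [h3]
  all_goals linarith

end PolyC2

/-! ### The normalised moment generating function -/

section Normalised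

variable {m p : ℕ} {D : Set (E p)} {μ : E p → Measure (E m)}

/-- `M₀(s; θ)` at `q = (s, θ)`. -/
noncomputable def jointReal (μ : E p → Measure (E m)) (q : E m × E p) : ℝ := mgf (μ q.2) q.1

/-- The gradient `K₀'(s; θ)` at `q = (s, θ)`. -/
noncomputable def cgfGrad (μ : E p → Measure (E m)) (q : E m × E p) : E m :=
  WithLp.toLp 2 fun b => (jointMoment μ [b] (q, 0)).re / jointReal μ q

/-- `M₀(s + iφ; θ) / M₀(s; θ) · exp(-iφ K₀'(s; θ))`. -/
noncomputable def normMGF (μ : E p → Measure (E m)) (φ : E m) (q : E m × E p) : ℂ :=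
  (jointReal μ q : ℂ)⁻¹ * jointMoment μ [] (q, φ) *
    Complex.exp (-((inner ℝ φ (cgfGrad μ q) : ℝ) : ℂ) * Complex.I)

lemma IsModel.jointReal_pos (hM : IsModel D μ) {q : E m × E p}
    (hq : q ∈ interior (jointDomain D μ)) : 0 < jointReal μ q :=
  have := hM.neZero hq
  mgf_pos (interior_subset (mem_interior_mgfDomain hq))

lemma ofReal_jointReal (q : E m × E p) : (jointReal μ q : ℂ) = jointMoment μ [] (q, 0) :=
  (jointMoment_nil_zero q).symm

lemma contDiffOn_jointMoment_section (hG : GrowthBound D μ) {j : List (Fin m)}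
    (hj : j.length ≤ 2) (φ : E m) :
    ContDiffOn ℝ 2 (fun q => jointMoment μ j (q, φ)) (interior (jointDomain D μ)) :=
  (contDiffOn_jointMoment hG hj).comp (f := fun q => (q, φ)) (by fun_prop)
    fun _ hq => ⟨hq, mem_univ _⟩

lemma contDiffOn_jointReal (hG : GrowthBound D μ) :
    ContDiffOn ℝ 2 (jointReal μ) (interior (jointDomain D μ)) := by
  have h := Complex.reCLM.contDiff.comp_contDiffOn
    (contDiffOn_jointMoment_section hG (j := []) (by simp) 0)
  refine h.congr fun q _ => ?_
  simp [← ofReal_jointReal]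

lemma IsModel.contDiffOn_cgfGrad_apply (hM : IsModel D μ) (hG : GrowthBound D μ) (b : Fin m) :
    ContDiffOn ℝ 2 (fun q => cgfGrad μ q b) (interior (jointDomain D μ)) := by
  have h := Complex.reCLM.contDiff.comp_contDiffOn
    (contDiffOn_jointMoment_section hG (j := [b]) (by simp) 0)
  exact ContDiffOn.div h (contDiffOn_jointReal hG) fun q hq => (hM.jointReal_pos hq).ne'

lemma IsModel.contDiffOn_cgfGrad (hM : IsModel D μ) (hG : GrowthBound D μ) :
    ContDiffOn ℝ 2 (cgfGrad μ) (interior (jointDomain D μ)) :=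
  contDiffOn_euclidean.2 fun b => hM.contDiffOn_cgfGrad_apply hG b

lemma ofReal_realMoment_inner (q : E m × E p) (b : Fin m) :
    (realMoment (μ q.2) (fun y => inner ℝ (unitVec b : E m) y) q.1 : ℂ) =
      jointMoment μ [b] (q, 0) := by
  rw [ofReal_realMoment]; simp only [jointMoment, monomial]; unfold Saddlepoint.mulInner; simp

lemma ofReal_realMoment_inner_mul (q : E m × E p) (b c : Fin m) :
    (realMoment (μ q.2) (fun y => inner ℝ (unitVec b : E m) y * inner ℝ (unitVec c : E m) y)
      q.1 : ℂ) = jointMoment μ [b, c] (q, 0) := by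
  rw [ofReal_realMoment]; simp only [jointMoment, monomial]; unfold Saddlepoint.mulInner; simp

lemma cgfGrad_apply (q : E m × E p) (b : Fin m) :
    cgfGrad μ q b =
      realMoment (μ q.2) (fun y => inner ℝ (unitVec b : E m) y) q.1 / mgf (μ q.2) q.1 := by
  simp [cgfGrad, ← ofReal_realMoment_inner, jointReal]

lemma jointMoment_single (hM : IsModel D μ) {q : E m × E p}
    (hq : q ∈ interior (jointDomain D μ)) (b : Fin m) :
    jointMoment μ [b] (q, 0) = (cgfGrad μ q b : ℂ) * jointReal μ q := by
  have : mgf (μ q.2) q.1 ≠ 0 := (hM.jointReal_pos hq).ne'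
  rw [cgfGrad_apply, ← ofReal_realMoment_inner, ← Complex.ofReal_mul, jointReal,
    div_mul_cancel₀ _ this]

lemma jointMoment_pair (hM : IsModel D μ) {q : E m × E p}
    (hq : q ∈ interior (jointDomain D μ)) (b c : Fin m) :
    jointMoment μ [b, c] (q, 0) =
      ((tiltedCov (μ q.2) q.1 (unitVec b) (unitVec c) + cgfGrad μ q b * cgfGrad μ q c : ℝ) : ℂ) *
        jointReal μ q := by
  have : mgf (μ q.2) q.1 ≠ 0 := (hM.jointReal_pos hq).ne'
  rw [cgfGrad_apply, cgfGrad_apply, ← ofReal_realMoment_inner_mul, ← Complex.ofReal_mul, tiltedCov,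
    sub_add_cancel, jointReal, div_mul_cancel₀ _ this]

lemma hasDerivAt_jointMoment (hG : GrowthBound D μ) {j : List (Fin m)} (hj : j.length ≤ 2)
    {q : E m × E p} (hq : q ∈ interior (jointDomain D μ)) (φ : E m) (t : ℝ) :
    HasDerivAt (fun t : ℝ => jointMoment μ j (q, t • φ))
      (Complex.I * ∑ b, φ b * jointMoment μ (b :: j) (q, t • φ)) t := by
  have h1 := hasFDerivAt_of_hasLineDerivAt isOpen_complexDomain (stdDirection m p) (stdCoord m p)
    sum_stdCoord (fun i _ hr => hasLineDerivAt_partial₁ hG (by omega : j.length ≤ 5) i hr)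
    (q := (q, t • φ)) ⟨hq, mem_univ _⟩ (fun i => (continuousOn_partial₁ hG (by omega) i).continuousAt
      (isOpen_complexDomain.mem_nhds ⟨hq, mem_univ _⟩))
  have h2 : HasDerivAt (fun t : ℝ => (q, t • φ)) ((0 : E m × E p), φ) t := by
    refine (hasDerivAt_const t q).prodMk ?_
    simpa using (hasDerivAt_id t).smul_const φ
  have h3 := h1.comp_hasDerivAt t h2
  refine h3.congr_deriv ?_
  rw [sum_apply, Fintype.sum_sum_type]
  simp only [ContinuousLinearMap.smulRight_apply]
  have h4 : ∀ i : Fin m ⊕ Fin p, stdCoord m p (.inl i) ((0 : E m × E p), φ) = 0 := by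
    intro i; rcases i with i | i <;> simp [stdCoord]
  simp only [h4, zero_smul, Finset.sum_const_zero, zero_add, Finset.mul_sum]
  refine Finset.sum_congr rfl fun b _ => ?_
  simp only [stdCoord, partial₁, ContinuousLinearMap.comp_apply, ContinuousLinearMap.coe_snd',
    PiLp.proj_apply, Complex.real_smul]
  ring

/-- The coefficients of the second derivative of `t ↦ normMGF μ (t φ) q`. -/
noncomputable def normCoeff (μ : E p → Measure (E m)) (b c : Fin m) (φ : E m) (q : E m × E p) : ℂ :=
  (jointReal μ q : ℂ)⁻¹ * (-jointMoment μ [c, b] (q, φ) +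
    2 * (cgfGrad μ q c : ℂ) * jointMoment μ [b] (q, φ) +
    -((cgfGrad μ q b : ℂ) * (cgfGrad μ q c : ℂ)) * jointMoment μ [] (q, φ)) *
    Complex.exp (-((inner ℝ φ (cgfGrad μ q) : ℝ) : ℂ) * Complex.I)

lemma inner_euclidean (x y : E m) : (inner ℝ x y : ℝ) = ∑ b, x b * y b := by
  simp [PiLp.inner_apply, mul_comm]

/-- The derivative of `t ↦ normMGF μ (t φ) q`. -/
noncomputable def normMGFDeriv (μ : E p → Measure (E m)) (φ : E m) (q : E m × E p) (t : ℝ) : ℂ :=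
  (jointReal μ q : ℂ)⁻¹ * (Complex.I * ∑ b, φ b * jointMoment μ [b] (q, t • φ) -
    Complex.I * (inner ℝ φ (cgfGrad μ q) : ℝ) * jointMoment μ [] (q, t • φ)) *
    Complex.exp (-((inner ℝ (t • φ) (cgfGrad μ q) : ℝ) : ℂ) * Complex.I)

lemma hasDerivAt_cexp_inner (φ y : E m) (t : ℝ) :
    HasDerivAt (fun t : ℝ => Complex.exp (-((inner ℝ (t • φ) y : ℝ) : ℂ) * Complex.I))
      (-Complex.I * (inner ℝ φ y : ℝ) *
        Complex.exp (-((inner ℝ (t • φ) y : ℝ) : ℂ) * Complex.I)) t := by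
  have h1 : HasDerivAt (fun t : ℝ => -((inner ℝ (t • φ) y : ℝ) : ℂ) * Complex.I)
      (-((inner ℝ φ y : ℝ) : ℂ) * Complex.I) t := by
    simp only [inner_smul_left, conj_trivial]
    simpa using (((hasDerivAt_id t).mul_const (inner ℝ φ y : ℝ)).ofReal_comp.neg.mul_const
      Complex.I)
  refine h1.cexp.congr_deriv ?_
  ring

lemma hasDerivAt_normMGF (hG : GrowthBound D μ) {q : E m × E p}
    (hq : q ∈ interior (jointDomain D μ)) (φ : E m) (t : ℝ) :
    HasDerivAt (fun t : ℝ => normMGF μ (t • φ) q) (normMGFDeriv μ φ q t) t := by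
  have h1 := ((hasDerivAt_jointMoment hG (j := []) (by simp) hq φ t).const_mul
    (jointReal μ q : ℂ)⁻¹).mul (hasDerivAt_cexp_inner φ (cgfGrad μ q) t)
  refine h1.congr_deriv ?_
  simp only [normMGFDeriv]
  ring

/-- The two cross terms of the product rule agree after summation over b and c, which is why
`normCoeff` has a factor 2 on only one of them. -/
lemma hasDerivAt_normMGFDeriv (hG : GrowthBound D μ) {q : E m × E p}
    (hq : q ∈ interior (jointDomain D μ)) (φ : E m) (t : ℝ) :
    HasDerivAt (normMGFDeriv μ φ q)
      (∑ b, ∑ c, (φ b * φ c : ℂ) * normCoeff μ b c (t • φ) q) t := by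
  have h1 : HasDerivAt (fun t : ℝ => ∑ b, (φ b : ℂ) * jointMoment μ [b] (q, t • φ))
      (∑ b, (φ b : ℂ) * (Complex.I * ∑ c, φ c * jointMoment μ [c, b] (q, t • φ))) t :=
    HasDerivAt.fun_sum fun b _ => (hasDerivAt_jointMoment hG (j := [b]) (by simp) hq φ t).const_mul _
  have h2 := hasDerivAt_jointMoment hG (j := []) (by simp) hq φ t
  have h3 := (((h1.const_mul Complex.I).sub (h2.const_mul
    (Complex.I * (inner ℝ φ (cgfGrad μ q) : ℝ)))).const_mul (jointReal μ q : ℂ)⁻¹).mul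
    (hasDerivAt_cexp_inner φ (cgfGrad μ q) t)
  refine h3.congr_deriv ?_
  simp only [Pi.sub_apply]
  have e1 : ((inner ℝ φ (cgfGrad μ q) : ℝ) : ℂ) = ∑ c, (φ c : ℂ) * (cgfGrad μ q c : ℂ) := by
    rw [inner_euclidean]; push_cast; rfl
  set ex := Complex.exp (-((inner ℝ (t • φ) (cgfGrad μ q) : ℝ) : ℂ) * Complex.I)
  set J0 := jointMoment μ [] (q, t • φ)
  set S1 := ∑ b, (φ b : ℂ) * jointMoment μ [b] (q, t • φ)
  set κ := ∑ c, (φ c : ℂ) * (cgfGrad μ q c : ℂ) with hκ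
  have e2 : ∑ b, ∑ c, (φ b * φ c : ℂ) * normCoeff μ b c (t • φ) q =
      (jointReal μ q : ℂ)⁻¹ * (-(∑ b, (φ b : ℂ) * ∑ c, φ c * jointMoment μ [c, b] (q, t • φ)) +
        2 * (S1 * κ) - κ * κ * J0) * ex := by
    have s1 : S1 * κ = ∑ b, ∑ c, (φ b : ℂ) * jointMoment μ [b] (q, t • φ) *
        ((φ c : ℂ) * (cgfGrad μ q c : ℂ)) := Finset.sum_mul_sum _ _ _ _
    have s2 : κ * κ = ∑ b, ∑ c, (φ b : ℂ) * (cgfGrad μ q b : ℂ) *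
        ((φ c : ℂ) * (cgfGrad μ q c : ℂ)) := Finset.sum_mul_sum _ _ _ _
    rw [s1, s2]
    simp only [Finset.mul_sum, Finset.sum_mul, ← Finset.sum_neg_distrib, ← Finset.sum_add_distrib,
      ← Finset.sum_sub_distrib]
    refine Finset.sum_congr rfl fun b _ => Finset.sum_congr rfl fun c _ => ?_
    simp only [normCoeff]
    ring
  have e3 : ∑ b, (φ b : ℂ) * (Complex.I * ∑ c, φ c * jointMoment μ [c, b] (q, t • φ)) =
      Complex.I * ∑ b, (φ b : ℂ) * ∑ c, φ c * jointMoment μ [c, b] (q, t • φ) := by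
    rw [Finset.mul_sum]; exact Finset.sum_congr rfl fun b _ => by ring
  rw [e2, e3, e1]
  linear_combination ((jointReal μ q : ℂ)⁻¹ * ((∑ b, (φ b : ℂ) * ∑ c, φ c *
    jointMoment μ [c, b] (q, t • φ)) - 2 * κ * S1 + κ * κ * J0) * ex) * Complex.I_sq

/-- Fundamental theorem of calculus for (1 - t) g'(t) + g(t), whose derivative is the remainder
integrand. -/
lemma taylor_integral {g g' g'' : ℝ → ℂ} (h1 : ∀ t, HasDerivAt g (g' t) t)
    (h2 : ∀ t, HasDerivAt g' (g'' t) t) (hc : Continuous g'') :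
    g 1 = g 0 + g' 0 + ∫ t in (0 : ℝ)..1, ((1 - t : ℝ) : ℂ) * g'' t := by
  have hd : ∀ t : ℝ, HasDerivAt (fun t : ℝ => ((1 - t : ℝ) : ℂ) * g' t + g t)
      (((1 - t : ℝ) : ℂ) * g'' t) t := by
    intro t
    have h3 : HasDerivAt (fun t : ℝ => ((1 - t : ℝ) : ℂ)) (-1) t := by
      simpa using ((hasDerivAt_id t).const_sub 1).ofReal_comp
    refine ((h3.mul (h2 t)).add (h1 t)).congr_deriv ?_
    ring
  rw [intervalIntegral.integral_eq_sub_of_hasDerivAt (fun t _ => hd t)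
    (Continuous.intervalIntegrable (by fun_prop) _ _)]
  simp
  ring

lemma normMGF_zero (hM : IsModel D μ) {q : E m × E p}
    (hq : q ∈ interior (jointDomain D μ)) : normMGF μ 0 q = 1 := by
  have : (jointReal μ q : ℂ) ≠ 0 := Complex.ofReal_ne_zero.2 (hM.jointReal_pos hq).ne'
  simp [normMGF, ← ofReal_jointReal, this]

/-- The phase in `normMGF` centres the tilted law, so the linear term vanishes at every (s, θ), not
only at a base point. This is what makes the (s, θ)-derivatives of `normMGF` - 1 quadratically small
in φ too. -/
lemma normMGFDeriv_zero (hM : IsModel D μ) {q : E m × E p}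
    (hq : q ∈ interior (jointDomain D μ)) (φ : E m) : normMGFDeriv μ φ q 0 = 0 := by
  simp only [normMGFDeriv, zero_smul, jointMoment_single hM hq, ← ofReal_jointReal,
    inner_euclidean]
  push_cast
  have : ∑ b, (φ b : ℂ) * ((cgfGrad μ q b : ℂ) * jointReal μ q) =
      (∑ b, (φ b : ℂ) * (cgfGrad μ q b : ℂ)) * jointReal μ q := by
    rw [Finset.sum_mul]; exact Finset.sum_congr rfl fun b _ => by ring
  rw [this]
  ring

/-- The parameter is put first to match `continuousOn_fderiv_param`; the map T covers the frequency
φ itself, the ray t ↦ tφ and the rescaling u ↦ u/√n at once. -/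
lemma contDiffOn_jointMoment_swap {X : Type*} [NormedAddCommGroup X] [NormedSpace ℝ X]
    (hG : GrowthBound D μ) {j : List (Fin m)}
    (hj : j.length ≤ 2) {T : X → E m} (hT : ContDiff ℝ 2 T) :
    ContDiffOn ℝ 2 (fun z : X × (E m × E p) => jointMoment μ j (z.2, T z.1))
      (univ ×ˢ interior (jointDomain D μ)) :=
  (contDiffOn_jointMoment hG hj).comp (f := fun z : X × (E m × E p) => (z.2, T z.1))
    (by fun_prop) fun _ hz => ⟨hz.2, mem_univ _⟩

lemma contDiffOn_comp_snd {X W F : Type*} [NormedAddCommGroup X] [NormedSpace ℝ X]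
    [NormedAddCommGroup W] [NormedSpace ℝ W] [NormedAddCommGroup F] [NormedSpace ℝ F]
    {f : W → F} {Ω : Set W} (hf : ContDiffOn ℝ 2 f Ω) :
    ContDiffOn ℝ 2 (fun z : X × W => f z.2) (univ ×ˢ Ω) :=
  hf.comp (f := fun z : X × W => z.2) (by fun_prop) fun _ hz => hz.2

lemma contDiff_ofReal_two : ContDiff ℝ 2 (fun x : ℝ => (x : ℂ)) := Complex.ofRealCLM.contDiff

lemma IsModel.contDiffOn_inv (hM : IsModel D μ) (hG : GrowthBound D μ) :
    ContDiffOn ℝ 2 (fun q => (jointReal μ q : ℂ)⁻¹) (interior (jointDomain D μ)) :=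
  (contDiff_ofReal_two.comp_contDiffOn (contDiffOn_jointReal hG)).inv fun _ hq =>
    Complex.ofReal_ne_zero.2 (hM.jointReal_pos hq).ne'

lemma IsModel.contDiffOn_phase {X : Type*} [NormedAddCommGroup X] [NormedSpace ℝ X]
    (hM : IsModel D μ) (hG : GrowthBound D μ) {T : X → E m} (hT : ContDiff ℝ 2 T) :
    ContDiffOn ℝ 2 (fun z : X × (E m × E p) =>
      Complex.exp (-((inner ℝ (T z.1) (cgfGrad μ z.2) : ℝ) : ℂ) * Complex.I))
      (univ ×ˢ interior (jointDomain D μ)) := by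
  have h1 : ContDiffOn ℝ 2 (fun z : X × (E m × E p) => (inner ℝ (T z.1) (cgfGrad μ z.2) : ℝ))
      (univ ×ˢ interior (jointDomain D μ)) :=
    ContDiffOn.inner ℝ (hT.comp contDiff_fst).contDiffOn
      (contDiffOn_comp_snd (hM.contDiffOn_cgfGrad hG))
  exact Complex.contDiff_exp.comp_contDiffOn
    ((contDiff_ofReal_two.comp_contDiffOn h1).neg.mul contDiffOn_const)

lemma IsModel.contDiffOn_normMGF {X : Type*} [NormedAddCommGroup X] [NormedSpace ℝ X]
    (hM : IsModel D μ) (hG : GrowthBound D μ) {T : X → E m} (hT : ContDiff ℝ 2 T) :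
    ContDiffOn ℝ 2 (fun z : X × (E m × E p) => normMGF μ (T z.1) z.2)
      (univ ×ˢ interior (jointDomain D μ)) :=
  ((contDiffOn_comp_snd (hM.contDiffOn_inv hG)).mul
    (contDiffOn_jointMoment_swap hG (by simp) hT)).mul (hM.contDiffOn_phase hG hT)

lemma IsModel.contDiffOn_ofReal_cgfGrad (hM : IsModel D μ) (hG : GrowthBound D μ) (b : Fin m) :
    ContDiffOn ℝ 2 (fun q => (cgfGrad μ q b : ℂ)) (interior (jointDomain D μ)) :=
  contDiff_ofReal_two.comp_contDiffOn (hM.contDiffOn_cgfGrad_apply hG b)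

lemma IsModel.contDiffOn_normCoeff {X : Type*} [NormedAddCommGroup X] [NormedSpace ℝ X]
    (hM : IsModel D μ) (hG : GrowthBound D μ) {T : X → E m} (hT : ContDiff ℝ 2 T) (b c : Fin m) :
    ContDiffOn ℝ 2 (fun z : X × (E m × E p) => normCoeff μ b c (T z.1) z.2)
      (univ ×ˢ interior (jointDomain D μ)) := by
  have hb := contDiffOn_comp_snd (X := X) (hM.contDiffOn_ofReal_cgfGrad hG b)
  have hc := contDiffOn_comp_snd (X := X) (hM.contDiffOn_ofReal_cgfGrad hG c)
  exact ((contDiffOn_comp_snd (hM.contDiffOn_inv hG)).mul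
    (((contDiffOn_jointMoment_swap hG (by simp) hT).neg.add
      ((contDiffOn_const.mul hc).mul (contDiffOn_jointMoment_swap hG (by simp) hT))).add
      ((hb.mul hc).neg.mul (contDiffOn_jointMoment_swap hG (by simp) hT)))).mul
    (hM.contDiffOn_phase hG hT)

/-- Taylor's formula for `normMGF`. -/
lemma IsModel.normMGF_eq (hM : IsModel D μ) (hG : GrowthBound D μ) {q : E m × E p}
    (hq : q ∈ interior (jointDomain D μ)) (φ : E m) :
    normMGF μ φ q = 1 + ∫ t in (0 : ℝ)..1, ((1 - t : ℝ) : ℂ) *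
      ∑ b, ∑ c, (φ b * φ c : ℂ) * normCoeff μ b c (t • φ) q := by
  have hc : ∀ b c, Continuous fun t : ℝ => normCoeff μ b c (t • φ) q := fun b c => by
    have h1 := (continuousOn_fderiv_param (f := fun (t : ℝ) q => normCoeff μ b c (t • φ) q)
      isOpen_univ isOpen_interior (hM.contDiffOn_normCoeff hG (T := fun t : ℝ => t • φ)
        (by fun_prop) b c) hq).1
    exact continuousOn_univ.1 h1
  have := taylor_integral (hasDerivAt_normMGF hG hq φ) (hasDerivAt_normMGFDeriv hG hq φ)
    (continuous_finsetSum _ fun b _ => continuous_finsetSum _ fun c _ =>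
      continuous_const.mul (hc b c))
  simpa [normMGF_zero hM hq, normMGFDeriv_zero hM hq] using this

end Normalised

end Saddlepoint

/-! ### Local bounds and quadratic approximation of the normalised generating function -/

namespace Saddlepoint

variable {m p : ℕ} {D : Set (E p)} {μ : E p → Measure (E m)}

lemma norm_coord_le (φ : E m) (b : Fin m) : ‖(φ b : ℂ)‖ ≤ ‖φ‖ := by
  rw [Complex.norm_real]; exact PiLp.norm_apply_le φ b

lemma norm_coord_mul_le (φ : E m) (b c : Fin m) : ‖(φ b * φ c : ℂ)‖ ≤ ‖φ‖ ^ 2 := by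
  rw [norm_mul, sq]
  exact mul_le_mul (norm_coord_le φ b) (norm_coord_le φ c) (norm_nonneg _) (norm_nonneg _)

/-- Near each interior point, `normMGF` and `normCoeff` have `C²` bounds that are polynomial in
`1 + |φ|`. -/
lemma IsModel.exists_polyC2 (hM : IsModel D μ) (hG : GrowthBound D μ) {q₀ : E m × E p}
    (hq₀ : q₀ ∈ interior (jointDomain D μ)) :
    ∃ r > 0, Metric.ball q₀ r ⊆ interior (jointDomain D μ) ∧
      PolyC2 (fun φ : E m => 1 + ‖φ‖) (Metric.ball q₀ r) (normMGF μ) ∧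
      ∀ b c, PolyC2 (fun φ : E m => 1 + ‖φ‖) (Metric.ball q₀ r) (normCoeff μ b c) := by
  obtain ⟨C, k, r₁, hC, hr₁, hb₁, hJ⟩ := exists_c2Bound_jointMoment hG hq₀
  obtain ⟨B₂, r₂, hr₂, hb₂, hI⟩ := exists_ball_c2Bound isOpen_interior (hM.contDiffOn_inv hG) hq₀
  choose B₃ r₃ hr₃ hb₃ hK using fun b =>
    exists_ball_c2Bound isOpen_interior (hM.contDiffOn_ofReal_cgfGrad hG b) hq₀
  -- A common radius for the finitely many coordinates; for m = 0 there are none and any positive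
  -- radius serves.
  obtain ⟨r₄, hr₄, hr₄'⟩ : ∃ r > 0, ∀ b, r ≤ r₃ b := by
    rcases isEmpty_or_nonempty (Fin m) with h | h
    · exact ⟨1, one_pos, fun b => h.elim b⟩
    · exact ⟨Finset.univ.inf' Finset.univ_nonempty r₃,
        (Finset.lt_inf'_iff _).2 fun b _ => hr₃ b, fun b => Finset.inf'_le _ (Finset.mem_univ b)⟩
  set r := min r₁ (min r₂ r₄)
  have h1 : Metric.ball q₀ r ⊆ Metric.ball q₀ r₁ := Metric.ball_subset_ball (min_le_left _ _)
  have h2 : Metric.ball q₀ r ⊆ Metric.ball q₀ r₂ :=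
    Metric.ball_subset_ball ((min_le_right _ _).trans (min_le_left _ _))
  have h3 : ∀ b, Metric.ball q₀ r ⊆ Metric.ball q₀ (r₃ b) := fun b =>
    Metric.ball_subset_ball (((min_le_right _ _).trans (min_le_right _ _)).trans (hr₄' b))
  have hω : ∀ φ : E m, 1 ≤ 1 + ‖φ‖ := fun φ => by linarith [norm_nonneg φ]
  have hΩ : IsOpen (Metric.ball q₀ r) := Metric.isOpen_ball
  have pJ : ∀ j : List (Fin m), j.length ≤ 2 → PolyC2 (fun φ : E m => 1 + ‖φ‖)
      (Metric.ball q₀ r) (fun φ q => jointMoment μ j (q, φ)) := fun j hj =>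
    ⟨C, k, by linarith, fun φ => (hJ φ j hj).subset h1⟩
  have pI : PolyC2 (fun φ : E m => 1 + ‖φ‖) (Metric.ball q₀ r)
    (fun _ q => (jointReal μ q : ℂ)⁻¹) := .of_c2Bound (hI.subset h2)
  have pK : ∀ b, PolyC2 (fun φ : E m => 1 + ‖φ‖) (Metric.ball q₀ r)
    (fun _ q => (cgfGrad μ q b : ℂ)) := fun b => .of_c2Bound ((hK b).subset (h3 b))
  have pS : ∀ z : ℂ, ‖z‖ ≤ 1 → PolyC2 (fun φ : E m => 1 + ‖φ‖) (Metric.ball q₀ r)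
    (fun _ _ => z) := fun z hz => .scalar hω fun φ => hz.trans (hω φ)
  have pE : PolyC2 (fun φ : E m => 1 + ‖φ‖) (Metric.ball q₀ r) (fun φ q =>
      Complex.exp (-((inner ℝ φ (cgfGrad μ q) : ℝ) : ℂ) * Complex.I)) := by
    refine PolyC2.cexp hω hΩ ?_ fun φ q _ => by simp
    have : PolyC2 (fun φ : E m => 1 + ‖φ‖) (Metric.ball q₀ r) (fun (φ : E m) q =>
        (∑ b, (φ b : ℂ) * (cgfGrad μ q b : ℂ)) * (-Complex.I)) :=
      (PolyC2.sum hω hΩ _ fun b _ => (PolyC2.scalar hω (c := fun φ : E m => (φ b : ℂ)) fun φ =>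
        (norm_coord_le φ b).trans (by linarith)).mul hω hΩ (pK b)).mul hω hΩ (pS _ (by simp))
    convert this using 3 with φ q
    rw [inner_euclidean]; push_cast; ring
  refine ⟨r, lt_min hr₁ (lt_min hr₂ hr₄), h1.trans hb₁, (pI.mul hω hΩ (pJ [] (by simp))).mul hω hΩ pE,
    fun b c => ?_⟩
  have := (pI.mul hω hΩ ((((pS (-1) (by simp)).mul hω hΩ (pJ [c, b] (by simp))).add hω hΩ
    (((pK c).add hω hΩ (pK c)).mul hω hΩ (pJ [b] (by simp)))).add hω hΩ
    ((((pS (-1) (by simp)).mul hω hΩ (pK b)).mul hω hΩ (pK c)).mul hω hΩ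
      (pJ [] (by simp))))).mul hω hΩ pE
  convert this using 3 with φ q
  simp only [normCoeff]
  ring

/-- Near each interior point, `normMGF - 1` has `C²` bounds `O(|φ|²(1 + |φ|)ᵏ)`. -/
lemma IsModel.exists_c2Bound_normMGF_sub_one (hM : IsModel D μ) (hG : GrowthBound D μ)
    {q₀ : E m × E p} (hq₀ : q₀ ∈ interior (jointDomain D μ)) :
    ∃ (C : ℝ) (k : ℕ) (r : ℝ), 0 ≤ C ∧ 0 < r ∧ Metric.ball q₀ r ⊆ interior (jointDomain D μ) ∧
      ∀ φ : E m, C2Bound (Metric.ball q₀ r) (fun q => normMGF μ φ q - 1)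
        (C * (‖φ‖ ^ 2 * (1 + ‖φ‖) ^ k)) (C * (‖φ‖ ^ 2 * (1 + ‖φ‖) ^ k))
        (C * (‖φ‖ ^ 2 * (1 + ‖φ‖) ^ k)) := by
  obtain ⟨r, hr, hb, -, hp⟩ := hM.exists_polyC2 hG hq₀
  choose C k hC hp using hp
  have hΩ : IsOpen (Metric.ball q₀ r) := Metric.isOpen_ball
  set K := ∑ b, ∑ c, k b c
  refine ⟨∑ b, ∑ c, C b c, K, r, Finset.sum_nonneg fun b _ => Finset.sum_nonneg fun c _ => hC b c,
    hr, hb, fun φ => ?_⟩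
  have hk : ∀ b c, k b c ≤ K := fun b c =>
    (Finset.single_le_sum (f := fun c => k b c) (by simp) (Finset.mem_univ c)).trans
      (Finset.single_le_sum (f := fun b => ∑ c, k b c) (by simp) (Finset.mem_univ b))
  set ω := ‖φ‖ ^ 2 * (1 + ‖φ‖) ^ K
  have hcont : ContDiffOn ℝ 2 (fun z : ℝ × (E m × E p) => ((1 - z.1 : ℝ) : ℂ) *
      ∑ b, ∑ c, (φ b * φ c : ℂ) * normCoeff μ b c (z.1 • φ) z.2)
      (univ ×ˢ Metric.ball q₀ r) := by
    refine ContDiffOn.mul (contDiff_ofReal_two.comp (by fun_prop)).contDiffOn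
      (ContDiffOn.sum fun b _ => ContDiffOn.sum fun c _ => contDiffOn_const.mul
        ((hM.contDiffOn_normCoeff hG (T := fun t : ℝ => t • φ) (by fun_prop) b c).mono
          (prod_mono subset_rfl hb)))
  have hcc := fun q (hq : q ∈ Metric.ball q₀ r) => continuousOn_fderiv_param
    (f := fun (t : ℝ) q => ((1 - t : ℝ) : ℂ) *
      ∑ b, ∑ c, (φ b * φ c : ℂ) * normCoeff μ b c (t • φ) q) isOpen_univ hΩ hcont hq
  -- The Taylor remainder is differentiated in (s, θ) under the t-integral. The factors φ_b φ_c do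
  -- not depend on (s, θ), so |φ|² survives in all derivatives, and |tφ| ≤ |φ| makes the bound
  -- uniform in t.
  have hbound : ∀ t ∈ Ioc (0 : ℝ) 1, C2Bound (Metric.ball q₀ r) (fun q => ((1 - t : ℝ) : ℂ) *
      ∑ b, ∑ c, (φ b * φ c : ℂ) * normCoeff μ b c (t • φ) q)
      ((∑ b, ∑ c, C b c) * ω) ((∑ b, ∑ c, C b c) * ω) ((∑ b, ∑ c, C b c) * ω) := by
    intro t ht
    have h1 : ∀ b c, C2Bound (Metric.ball q₀ r)
        (fun q => ((1 - t : ℝ) : ℂ) * ((φ b * φ c : ℂ) * normCoeff μ b c (t • φ) q))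
        (C b c * ω) (C b c * ω) (C b c * ω) := by
      intro b c
      have h2 := (hp b c (t • φ)).const_smul hΩ (((1 - t : ℝ) : ℂ) * (φ b * φ c : ℂ))
      have h3 : ‖((1 - t : ℝ) : ℂ) * (φ b * φ c : ℂ)‖ * (C b c * (1 + ‖t • φ‖) ^ k b c) ≤
          C b c * ω := by
        have e1 : ‖((1 - t : ℝ) : ℂ) * (φ b * φ c : ℂ)‖ ≤ ‖φ‖ ^ 2 := by
          rw [norm_mul, Complex.norm_real, Real.norm_of_nonneg (by linarith [ht.2])]
          exact (mul_le_of_le_one_left (norm_nonneg _) (by linarith [ht.1])).trans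
            (norm_coord_mul_le φ b c)
        have e2 : ‖t • φ‖ ≤ ‖φ‖ := by
          rw [norm_smul, Real.norm_of_nonneg ht.1.le]
          exact mul_le_of_le_one_left (norm_nonneg _) ht.2
        have e3 : (1 + ‖t • φ‖) ^ k b c ≤ (1 + ‖φ‖) ^ K :=
          (pow_le_pow_left₀ (by positivity) (by linarith) _).trans
            (pow_le_pow_right₀ (by linarith [norm_nonneg φ]) (hk b c))
        calc _ ≤ ‖φ‖ ^ 2 * (C b c * (1 + ‖φ‖) ^ K) := by
              have := hC b c
              gcongr
          _ = _ := by ring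
      refine (h2.mono h3 h3 h3).congr hΩ fun q _ => ?_
      simp only [smul_eq_mul]; ring
    have h2 := C2Bound.sum hΩ Finset.univ fun b _ => C2Bound.sum hΩ Finset.univ fun c _ => h1 b c
    simp only [← Finset.sum_mul] at h2
    refine h2.congr hΩ fun q _ => ?_
    simp only [Finset.mul_sum]
  have hint := C2Bound.integral (μ := volume.restrict (Ioc (0 : ℝ) 1)) hΩ
    (f := fun t q => ((1 - t : ℝ) : ℂ) *
      ∑ b, ∑ c, (φ b * φ c : ℂ) * normCoeff μ b c (t • φ) q)
    ((ae_restrict_mem measurableSet_Ioc).mono hbound)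
    (fun q hq => (continuousOn_univ.1 (hcc q hq).1).aestronglyMeasurable)
    (fun q hq => (continuousOn_univ.1 (hcc q hq).2.1).aestronglyMeasurable)
    (fun q hq => (continuousOn_univ.1 (hcc q hq).2.2.1).aestronglyMeasurable)
    (integrable_const _) (integrable_const _) (integrable_const _)
  simp only [integral_const, measureReal_restrict_apply MeasurableSet.univ, univ_inter,
    Real.volume_real_Ioc, sub_zero, max_eq_left zero_le_one, one_smul] at hint
  refine hint.congr hΩ fun q hq => ?_
  simp only [hM.normMGF_eq hG (hb hq) φ, add_sub_cancel_left,
    intervalIntegral.integral_of_le zero_le_one]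

/-- At φ = 0 the second moments combine with the products of the means, with weights -1, 2 and -1,
to minus the covariance. -/
lemma normCoeff_zero (hM : IsModel D μ) {q : E m × E p} (hq : q ∈ interior (jointDomain D μ))
    (b c : Fin m) :
    normCoeff μ b c 0 q = -(tiltedCov (μ q.2) q.1 (unitVec b) (unitVec c) : ℂ) := by
  have : (jointReal μ q : ℂ) ≠ 0 := Complex.ofReal_ne_zero.2 (hM.jointReal_pos hq).ne'
  simp only [normCoeff, jointMoment_single hM hq, jointMoment_pair hM hq, ← ofReal_jointReal,
    inner_zero_left, tiltedCov_comm (μ q.2) q.1 (unitVec c) (unitVec b)]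
  push_cast
  field_simp
  simp
  ring

/-- The quadratic approximation of `normMGF` near `φ = 0`. -/
lemma IsModel.normMGF_approx (hM : IsModel D μ) (hG : GrowthBound D μ) {q₀ : E m × E p}
    (hq₀ : q₀ ∈ interior (jointDomain D μ)) {ε : ℝ} (hε : 0 < ε) :
    ∃ r > 0, ∀ q ∈ Metric.ball q₀ r, ∀ φ : E m, ‖φ‖ < r →
      ‖normMGF μ φ q - 1 + (1 / 2 * tiltedCov (μ q₀.2) q₀.1 φ φ : ℝ)‖ ≤ ε * ‖φ‖ ^ 2 := by
  -- The double sum over coordinates has m² terms; the summand 1 covers m = 0. The coefficients are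
  -- compared jointly in (φ, q) with their value at (0, q₀), so the quadratic form can be frozen at
  -- q₀.
  set η := ε / (m ^ 2 + 1 : ℝ)
  have hη : 0 < η := by positivity
  have hcont : ∀ b c, ∀ᶠ z in 𝓝 ((0 : E m), q₀),
      dist (normCoeff μ b c z.1 z.2) (normCoeff μ b c 0 q₀) < η := fun b c => by
    have h1 := (hM.contDiffOn_normCoeff hG (T := fun φ : E m => φ) contDiff_id b c).continuousOn
    have h2 := h1.continuousAt ((isOpen_univ.prod isOpen_interior).mem_nhds
      (x := ((0 : E m), q₀)) ⟨mem_univ _, hq₀⟩)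
    exact Metric.tendsto_nhds.1 h2 η hη
  have hall := (Filter.eventually_all.2 fun b => Filter.eventually_all.2 fun c => hcont b c).and
    ((continuous_snd.tendsto ((0 : E m), q₀)).eventually (isOpen_interior.eventually_mem hq₀))
  obtain ⟨r, hr, hball⟩ := Metric.eventually_nhds_iff_ball.1 hall
  refine ⟨r, hr, fun q hq φ hφ => ?_⟩
  have hmem : ∀ ψ : E m, ‖ψ‖ < r → (ψ, q) ∈ Metric.ball ((0 : E m), q₀) r := fun ψ hψ => by
    rw [Metric.mem_ball, Prod.dist_eq]
    exact max_lt (by simpa using hψ) hq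
  have hq' : q ∈ interior (jointDomain D μ) := (hball _ (hmem φ hφ)).2
  have := hM.neZero hq₀
  have hcov : ((1 / 2 * tiltedCov (μ q₀.2) q₀.1 φ φ : ℝ) : ℂ) = ∫ t in (0 : ℝ)..1,
      ((1 - t : ℝ) : ℂ) * ∑ b, ∑ c, (φ b * φ c : ℂ) * (-normCoeff μ b c 0 q₀) := by
    rw [intervalIntegral.integral_mul_const, tiltedCov_eq_sum (mem_interior_mgfDomain hq₀)]
    have h1 : ∫ t in (0 : ℝ)..1, ((1 - t : ℝ) : ℂ) = 1 / 2 := by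
      rw [intervalIntegral.integral_ofReal, intervalIntegral.integral_sub (by simp) (by simp)]
      norm_num
    rw [h1]
    push_cast
    simp only [normCoeff_zero hM hq₀, neg_neg, ← secondPD_cgf (mem_interior_mgfDomain hq₀)]
    simp [cgfHess]
  have hci : ∀ b c, Continuous fun t : ℝ => normCoeff μ b c (t • φ) q := fun b c =>
    continuousOn_univ.1 (continuousOn_fderiv_param (f := fun (t : ℝ) q => normCoeff μ b c (t • φ) q)
      isOpen_univ isOpen_interior (hM.contDiffOn_normCoeff hG (T := fun t : ℝ => t • φ)
        (by fun_prop) b c) hq').1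
  have hint1 : IntervalIntegrable (fun t : ℝ => ((1 - t : ℝ) : ℂ) *
      ∑ b, ∑ c, (φ b * φ c : ℂ) * normCoeff μ b c (t • φ) q) volume 0 1 :=
    Continuous.intervalIntegrable (by
      refine Continuous.mul (by fun_prop) (continuous_finsetSum _ fun b _ =>
        continuous_finsetSum _ fun c _ => continuous_const.mul (hci b c))) _ _
  have hint2 : IntervalIntegrable (fun t : ℝ => ((1 - t : ℝ) : ℂ) *
      ∑ b, ∑ c, (φ b * φ c : ℂ) * (-normCoeff μ b c 0 q₀)) volume 0 1 :=
    Continuous.intervalIntegrable (by fun_prop) _ _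
  rw [hM.normMGF_eq hG hq' φ, add_sub_cancel_left, hcov, ← intervalIntegral.integral_add hint1 hint2]
  have hle : ∀ t ∈ uIoc (0 : ℝ) 1, ‖((1 - t : ℝ) : ℂ) *
      (∑ b, ∑ c, (φ b * φ c : ℂ) * normCoeff μ b c (t • φ) q) + ((1 - t : ℝ) : ℂ) *
      (∑ b, ∑ c, (φ b * φ c : ℂ) * (-normCoeff μ b c 0 q₀))‖ ≤ ε * ‖φ‖ ^ 2 := by
    intro t ht
    rw [uIoc_of_le zero_le_one] at ht
    have e2 : ‖t • φ‖ < r := by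
      rw [norm_smul, Real.norm_of_nonneg ht.1.le]
      exact (mul_le_of_le_one_left (norm_nonneg _) ht.2).trans_lt hφ
    rw [← mul_add, ← Finset.sum_add_distrib]
    simp only [← Finset.sum_add_distrib, ← mul_add]
    rw [norm_mul, Complex.norm_real, Real.norm_of_nonneg (by linarith [ht.2])]
    refine (mul_le_of_le_one_left (norm_nonneg _) (by linarith [ht.1])).trans ?_
    have e3 : ∀ b c, ‖(φ b * φ c : ℂ) * (normCoeff μ b c (t • φ) q + -normCoeff μ b c 0 q₀)‖ ≤
        ‖φ‖ ^ 2 * η := fun b c => by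
      rw [norm_mul, ← sub_eq_add_neg, ← dist_eq_norm]
      exact mul_le_mul (norm_coord_mul_le φ b c) ((hball _ (hmem _ e2)).1 b c).le dist_nonneg
        (by positivity)
    calc _ ≤ ∑ b : Fin m, ∑ c : Fin m, ‖φ‖ ^ 2 * η :=
          (norm_sum_le _ _).trans (Finset.sum_le_sum fun b _ => (norm_sum_le _ _).trans
            (Finset.sum_le_sum fun c _ => e3 b c))
      _ = (m ^ 2 * η) * ‖φ‖ ^ 2 := by simp; ring
      _ ≤ _ := by
          gcongr
          simp only [η]
          rw [mul_div_assoc', div_le_iff₀ (by positivity)]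
          nlinarith
  have := intervalIntegral.norm_integral_le_of_norm_le_const hle
  simpa using this

end Saddlepoint

/-! ### Positive definiteness of K₀'' and decay in the frequency, in both cases -/

namespace Saddlepoint

variable {m p : ℕ} {D : Set (E p)} {μ : E p → Measure (E m)}

/-- If the Hessian degenerates in direction v, then vX is almost surely constant and the tilted
characteristic function has full modulus on the whole line through v, which meets every
neighbourhood of 0 outside 0. -/
lemma cgfHess_posDef_of_norm_cmgf_lt {ν : Measure (E m)} [NeZero ν] {s : E m}
    (hs : s ∈ interior (mgfDomain ν)) {S : Set (E m)} (hS : S ∈ 𝓝 0)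
    (h : ∀ φ ∈ S, φ ≠ 0 → ‖cmgf ν s φ‖ < mgf ν s) : (cgfHess ν s).PosDef := by
  refine posDef_of_tiltedCov_pos hs fun v hv => ?_
  by_contra! hle
  obtain ⟨k, hk⟩ := ae_eq_of_tiltedCov_le_zero hs hle
  have ht : Tendsto (fun t : ℝ => t • v) (𝓝[≠] 0) (𝓝 0) := by
    have : Tendsto (fun t : ℝ => t • v) (𝓝 0) (𝓝 ((0 : ℝ) • v)) :=
      (continuous_id.smul continuous_const).tendsto 0
    rw [zero_smul] at this
    exact this.mono_left nhdsWithin_le_nhds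
  obtain ⟨t, htS, ht0⟩ := ((ht.eventually_mem hS).and self_mem_nhdsWithin).exists
  refine (h (t • v) htS (smul_ne_zero ht0 hv)).ne ?_
  have h1 : cmgf ν s (t • v) = Complex.exp ((t * k : ℝ) * Complex.I) * (mgf ν s : ℂ) := by
    rw [mgf, ← integral_complex_ofReal, ← integral_const_mul, cmgf]
    refine integral_congr_ae ?_
    filter_upwards [hk] with y hy
    rw [inner_smul_left, hy, conj_trivial, Complex.ofReal_exp, ← Complex.exp_add, add_comm]
  rw [h1, norm_mul, Complex.norm_exp_ofReal_mul_I, one_mul, Complex.norm_real,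
    Real.norm_of_nonneg (mgf_pos (interior_subset hs)).le]

lemma norm_normMGF (hM : IsModel D μ) {q : E m × E p} (hq : q ∈ interior (jointDomain D μ))
    (φ : E m) : ‖normMGF μ φ q‖ = ‖cmgf (μ q.2) q.1 φ‖ / mgf (μ q.2) q.1 := by
  have h1 : jointMoment μ [] (q, φ) = cmgf (μ q.2) q.1 φ := by
    rw [cmgf_eq_expMoment]; rfl
  rw [normMGF, norm_mul, norm_mul, h1, norm_inv, Complex.norm_real,
    Real.norm_of_nonneg (hM.jointReal_pos hq).le, ← Complex.ofReal_neg,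
    Complex.norm_exp_ofReal_mul_I, mul_one, inv_mul_eq_div, jointReal]

/-- Uniform decay of `normMGF` on the set `S` of frequencies, near `q₀`. -/
def LocalDecay (μ : E p → Measure (E m)) (S : Set (E m)) (q₀ : E m × E p) : Prop :=
  ∃ δ > 0, ∃ r > 0, ∀ q ∈ Metric.ball q₀ r, ∀ φ ∈ S,
    ‖normMGF μ φ q‖ ≤ (1 + δ * ‖φ‖ ^ 2) ^ (-δ)

/-- The decay weakens when δ shrinks, in the base and in the exponent alike; hence a local lower
bound can replace the continuous function δ. -/
lemma one_add_mul_rpow_neg_anti {d e x : ℝ} (hd : 0 < d) (hde : d ≤ e) (hx : 0 ≤ x) :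
    (1 + e * x) ^ (-e) ≤ (1 + d * x) ^ (-d) := by
  have h1 : 0 < 1 + d * x := by positivity
  have h2 : 1 + d * x ≤ 1 + e * x := by gcongr
  rw [Real.rpow_neg (h1.le.trans h2), Real.rpow_neg h1.le]
  refine inv_anti₀ (by positivity) ?_
  exact (Real.rpow_le_rpow h1.le h2 hd.le).trans
    (Real.rpow_le_rpow_of_exponent_le (by nlinarith [mul_nonneg hd.le hx]) hde)

lemma DecayBound.localDecay (hM : IsModel D μ) (hd : DecayBound D μ) {q₀ : E m × E p}
    (hq₀ : q₀ ∈ interior (jointDomain D μ)) : LocalDecay μ univ q₀ := by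
  obtain ⟨δ, hδc, hδ⟩ := hd
  have hpos := (hδ q₀ hq₀).1
  obtain ⟨r, hr, hb⟩ := Metric.eventually_nhds_iff_ball.1
    ((isOpen_interior.eventually_mem hq₀).and
      ((hδc.continuousAt (isOpen_interior.mem_nhds hq₀)).eventually_const_lt (half_lt_self hpos)))
  refine ⟨δ q₀ / 2, by positivity, r, hr, fun q hq φ _ => ?_⟩
  have h1 := (hδ q (hb q hq).1).2 φ
  have hM0 : 0 < mgf (μ q.2) q.1 := hM.jointReal_pos (hb q hq).1
  rw [norm_div, Complex.norm_real, Real.norm_of_nonneg hM0.le] at h1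
  rw [norm_normMGF hM (hb q hq).1]
  exact h1.trans (one_add_mul_rpow_neg_anti (by positivity) (hb q hq).2.le (by positivity))

lemma DecayBound.posDef (hM : IsModel D μ) (hd : DecayBound D μ) {q : E m × E p}
    (hq : q ∈ interior (jointDomain D μ)) : (cgfHess (μ q.2) q.1).PosDef := by
  have := hM.neZero hq
  refine cgfHess_posDef_of_norm_cmgf_lt (mem_interior_mgfDomain hq) univ_mem fun φ _ hφ => ?_
  obtain ⟨δ, -, hδ⟩ := hd
  obtain ⟨hpos, h⟩ := hδ q hq
  have h1 := h φ
  have hM0 : 0 < mgf (μ q.2) q.1 := hM.jointReal_pos hq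
  rw [norm_div, Complex.norm_real, Real.norm_of_nonneg hM0.le] at h1
  rw [← div_lt_one hM0]
  have hφ' : 0 < ‖φ‖ := norm_pos_iff.2 hφ
  exact h1.trans_lt (Real.rpow_lt_one_of_one_lt_of_neg (by simp; positivity) (by simpa))

/-- The cube `[-π, π]ᵐ`. -/
def cube (m : ℕ) : Set (E m) := {φ | ∀ i, φ i ∈ Icc (-Real.pi) Real.pi}

lemma isCompact_cube : IsCompact (cube m) := by
  have h1 : IsClosed (cube m) := by
    rw [cube, ofPred_forall]
    exact isClosed_iInter fun i => isClosed_Icc.preimage (by fun_prop : Continuous fun φ : E m => φ i)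
  have h2 : Bornology.IsBounded (cube m) := by
    rw [isBounded_iff_forall_norm_le]
    refine ⟨√(∑ _ : Fin m, Real.pi ^ 2), fun φ hφ => ?_⟩
    rw [EuclideanSpace.norm_eq]
    refine Real.sqrt_le_sqrt (Finset.sum_le_sum fun i _ => ?_)
    rw [Real.norm_eq_abs, sq_abs]
    exact sq_le_sq' (hφ i).1 (hφ i).2
  exact Metric.isCompact_of_isClosed_isBounded h1 h2

lemma cube_mem_nhds : cube m ∈ 𝓝 (0 : E m) := by
  refine mem_of_superset (Metric.ball_mem_nhds _ Real.pi_pos) fun φ hφ i => ?_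
  rw [mem_ball_zero_iff] at hφ
  exact abs_le.1 ((PiLp.norm_apply_le φ i).trans hφ.le)

lemma NonLattice.posDef (hM : IsModel D μ) (hn : NonLattice D μ) {q : E m × E p}
    (hq : q ∈ interior (jointDomain D μ)) : (cgfHess (μ q.2) q.1).PosDef :=
  have := hM.neZero hq
  cgfHess_posDef_of_norm_cmgf_lt (mem_interior_mgfDomain hq) cube_mem_nhds
    fun φ hφ hφ0 => hn q hq φ hφ hφ0

/-- A function that is positive and homogeneous of degree two is bounded below by a multiple of
the square of the norm. -/
lemma exists_pos_mul_sq_le {F : Type*} [NormedAddCommGroup F] [NormedSpace ℝ F]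
    [FiniteDimensional ℝ F] {f : F → ℝ} (hc : Continuous f)
    (hh : ∀ (t : ℝ) v, f (t • v) = t ^ 2 * f v) (hpos : ∀ v ≠ 0, 0 < f v) :
    ∃ κ > 0, ∀ v, κ * ‖v‖ ^ 2 ≤ f v := by
  have h0 : f 0 = 0 := by simpa using hh 0 0
  rcases (Metric.sphere (0 : F) 1).eq_empty_or_nonempty with h | h
  · refine ⟨1, one_pos, fun v => ?_⟩
    by_cases hv : v = 0
    · simp [hv, h0]
    · have : ‖v‖⁻¹ • v ∈ Metric.sphere (0 : F) 1 := by
        simp [norm_smul, inv_mul_cancel₀ (norm_ne_zero_iff.2 hv)]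
      rw [h] at this; exact this.elim
  · obtain ⟨u, hu, hmin⟩ := (isCompact_sphere (0 : F) 1).exists_isMinOn h hc.continuousOn
    have hu0 : u ≠ 0 := fun h => by simp [h] at hu
    refine ⟨f u, hpos u hu0, fun v => ?_⟩
    by_cases hv : v = 0
    · simp [hv, h0]
    · have hv' : ‖v‖ ≠ 0 := norm_ne_zero_iff.2 hv
      have : ‖v‖⁻¹ • v ∈ Metric.sphere (0 : F) 1 := by simp [norm_smul, inv_mul_cancel₀ hv']
      have h1 : f u ≤ f (‖v‖⁻¹ • v) := hmin this
      rw [hh, inv_pow, inv_mul_eq_div, le_div_iff₀ (by positivity)] at h1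
      exact h1

lemma tiltedCov_smul_smul {ν : Measure (E m)} [NeZero ν] {s : E m}
    (hs : s ∈ interior (mgfDomain ν)) (t : ℝ) (v : E m) :
    tiltedCov ν s (t • v) (t • v) = t ^ 2 * tiltedCov ν s v v := by
  simp only [tiltedCov_eq_sum hs, Finset.mul_sum, PiLp.smul_apply, smul_eq_mul]
  exact Finset.sum_congr rfl fun i _ => Finset.sum_congr rfl fun j _ => by ring

lemma continuous_tiltedCov {ν : Measure (E m)} [NeZero ν] {s : E m}
    (hs : s ∈ interior (mgfDomain ν)) : Continuous fun v => tiltedCov ν s v v := by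
  simp only [tiltedCov_eq_sum hs]
  fun_prop

lemma exists_tiltedCov_lower {ν : Measure (E m)} [NeZero ν] {s : E m}
    (hs : s ∈ interior (mgfDomain ν)) (h : (cgfHess ν s).PosDef) :
    ∃ κ > 0, ∀ v, κ * ‖v‖ ^ 2 ≤ tiltedCov ν s v v :=
  exists_pos_mul_sq_le (continuous_tiltedCov hs) (tiltedCov_smul_smul hs)
    fun _ hv => tiltedCov_pos_of_posDef hs h hv

/-- From log(1 + t) ≤ t and √c · √c = c. It brings the Gaussian decay of the lattice case into the
form assumed in the absolutely continuous case, with the single parameter √c. -/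
lemma exp_neg_mul_le_rpow {c x : ℝ} (hc : 0 < c) (hx : 0 ≤ x) :
    Real.exp (-(c * x)) ≤ (1 + √c * x) ^ (-√c) := by
  have h1 : 0 < 1 + √c * x := by positivity
  rw [Real.rpow_def_of_pos h1, Real.exp_le_exp]
  have h2 := Real.log_le_sub_one_of_pos h1
  have h3 : √c * √c = c := Real.mul_self_sqrt hc.le
  have h4 : Real.log (1 + √c * x) * √c ≤ c * x := by
    calc _ ≤ (√c * x) * √c := by gcongr; linarith
      _ = √c * √c * x := by ring
      _ = c * x := by rw [h3]
  linarith

/-- Near φ = 0 the quadratic term gains κ/2 · |φ|², half of which pays for the approximation error.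
On the compact rest of the cube the modulus is below a constant c < 1, uniformly for q near q₀. Both
estimates are instances of exp(-a|φ|²) on a bounded set. -/
lemma NonLattice.localDecay (hM : IsModel D μ) (hG : GrowthBound D μ) (hn : NonLattice D μ)
    {q₀ : E m × E p} (hq₀ : q₀ ∈ interior (jointDomain D μ)) : LocalDecay μ (cube m) q₀ := by
  have := hM.neZero hq₀
  have hs := mem_interior_mgfDomain hq₀
  obtain ⟨κ, hκ, hlow⟩ := exists_tiltedCov_lower hs (hn.posDef hM hq₀)
  obtain ⟨r₁, hr₁, happ⟩ := hM.normMGF_approx hG hq₀ (show 0 < κ / 4 by positivity)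
  -- Keeps 1 - ½ cov non-negative, so that its modulus is itself.
  have hcov0 : ∀ᶠ φ in 𝓝 (0 : E m), tiltedCov (μ q₀.2) q₀.1 φ φ < 2 :=
    (continuous_tiltedCov hs).continuousAt.eventually_lt_const (by
      have := tiltedCov_smul_smul hs 0 (0 : E m)
      simp only [smul_zero] at this
      show tiltedCov (μ q₀.2) q₀.1 0 0 < 2
      rw [this]; norm_num)
  obtain ⟨r₂, hr₂, hcov⟩ := Metric.eventually_nhds_iff_ball.1 hcov0
  set r := min r₁ r₂
  have hr : 0 < r := lt_min hr₁ hr₂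
  have hsmall : ∀ q ∈ Metric.ball q₀ r, ∀ φ : E m, ‖φ‖ < r →
      ‖normMGF μ φ q‖ ≤ Real.exp (-(κ / 4 * ‖φ‖ ^ 2)) := by
    intro q hq φ hφ
    have h1 := happ q (Metric.ball_subset_ball (min_le_left _ _) hq) φ
      (hφ.trans_le (min_le_left _ _))
    have h2 := hcov φ (mem_ball_zero_iff.2 (hφ.trans_le (min_le_right _ _)))
    have h3 := hlow φ
    set cv := tiltedCov (μ q₀.2) q₀.1 φ φ
    have h4 : ‖normMGF μ φ q‖ ≤ ‖normMGF μ φ q - 1 + (1 / 2 * cv : ℝ)‖ + ‖((1 - 1 / 2 * cv : ℝ) : ℂ)‖ := by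
      refine (le_of_eq ?_).trans (norm_add_le _ _)
      congr 1; push_cast; ring
    rw [Complex.norm_real, Real.norm_of_nonneg (by linarith)] at h4
    have h5 := Real.add_one_le_exp (-(κ / 4 * ‖φ‖ ^ 2))
    linarith
  set K := cube m ∩ {φ | r ≤ ‖φ‖}
  have hK : IsCompact K := isCompact_cube.inter_right (isClosed_le continuous_const continuous_norm)
  have hcont : ∀ φ : E m, ContinuousAt (fun z : E m × (E m × E p) => ‖normMGF μ z.1 z.2‖) (φ, q₀) :=
    fun φ => ((hM.contDiffOn_normMGF hG (T := fun φ : E m => φ) contDiff_id).continuousOn.continuousAt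
      ((isOpen_univ.prod isOpen_interior).mem_nhds ⟨mem_univ _, hq₀⟩)).norm
  have hlt : ∀ φ ∈ K, ‖normMGF μ φ q₀‖ < 1 := fun φ hφ => by
    rw [norm_normMGF hM hq₀]
    refine (div_lt_one (hM.jointReal_pos hq₀)).2 (hn q₀ hq₀ φ hφ.1 fun h => ?_)
    have := hφ.2
    simp only [h, mem_ofPred_eq, norm_zero] at this
    linarith
  obtain ⟨c, hc1, hc⟩ : ∃ c < 1, ∀ φ ∈ K, ‖normMGF μ φ q₀‖ < c := by
    rcases K.eq_empty_or_nonempty with h | h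
    · exact ⟨0, by norm_num, by simp [h]⟩
    · have hcK : ContinuousOn (fun φ => ‖normMGF μ φ q₀‖) K := fun φ _ =>
        ((hcont φ).comp_of_eq (f := fun φ => (φ, q₀)) (by fun_prop) rfl).continuousWithinAt
      obtain ⟨u, hu, hmax⟩ := hK.exists_isMaxOn h hcK
      obtain ⟨c, hc, hc1⟩ := exists_between (hlt u hu)
      exact ⟨c, hc1, fun φ hφ => lt_of_le_of_lt (hmax hφ) hc⟩
  have hev : ∀ᶠ q in 𝓝 q₀, ∀ φ ∈ K, ‖normMGF μ φ q‖ < c := by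
    refine hK.eventually_forall_of_forall_eventually fun φ hφ => ?_
    exact ((hcont φ).comp_of_eq (f := fun z : (E m × E p) × E m => (z.2, z.1)) (by fun_prop)
      rfl).eventually_lt_const (hc φ hφ)
  obtain ⟨r₃, hr₃, hfar⟩ := Metric.eventually_nhds_iff_ball.1 hev
  obtain ⟨R, hR⟩ := (isCompact_cube (m := m)).isBounded.exists_norm_le
  -- R bounds the cube, so a|φ|² ≤ 1 - c there, and hence c ≤ 1 - a|φ|² ≤ exp(-a|φ|²).
  set a := min (κ / 4) ((1 - c) / (R ^ 2 + 1))
  have ha : 0 < a := lt_min (by positivity) (div_pos (by linarith) (by positivity))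
  refine ⟨√a, by positivity, min r r₃, lt_min hr hr₃, fun q hq φ hφ => ?_⟩
  refine le_trans ?_ (exp_neg_mul_le_rpow ha (by positivity))
  rcases lt_or_ge ‖φ‖ r with h | h
  · refine (hsmall q (Metric.ball_subset_ball (min_le_left _ _) hq) φ h).trans ?_
    gcongr; exact min_le_left _ _
  · refine (hfar q (Metric.ball_subset_ball (min_le_right _ _) hq) φ ⟨hφ, h⟩).le.trans ?_
    have h1 : a * ‖φ‖ ^ 2 ≤ 1 - c := by
      have h2 : a ≤ (1 - c) / (R ^ 2 + 1) := min_le_right _ _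
      rw [le_div_iff₀ (by positivity)] at h2
      have h3 : ‖φ‖ ^ 2 ≤ R ^ 2 + 1 := by
        have := pow_le_pow_left₀ (norm_nonneg _) (hR φ hφ) 2
        linarith
      exact (mul_le_mul_of_nonneg_left h3 ha.le).trans h2
    have h5 := Real.add_one_le_exp (-(a * ‖φ‖ ^ 2))
    linarith

end Saddlepoint

/-! ### The inversion integral: bounds uniform in n, and its limit -/

namespace Saddlepoint

variable {m p : ℕ} {D : Set (E p)} {μ : E p → Measure (E m)}

/-- By Bernoulli, a power of order n of 1 + δx²/n is at least 1 + ax² with a independent of n, and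
the M-th power of that dominates (1 + x)^M up to a constant. The exponent n - 2 is what remains of
an n-th power after two differentiations. -/
lemma exists_pow_le_of_decay {δ : ℝ} (hδ : 0 < δ) (M : ℕ) :
    ∃ c > 0, ∃ n₀ : ℕ, ∀ n ≥ n₀, ∀ x ≥ 0, ∀ z : ℝ, 0 ≤ z → z ≤ (1 + δ * (x ^ 2 / n)) ^ (-δ) →
      z ^ (n - 2) ≤ c * ((1 + x) ^ M)⁻¹ := by
  set e : ℝ := M + 1 with he
  have he0 : 0 < e := by positivity
  set a := δ ^ 2 / (2 * e)
  have ha : 0 < a := by positivity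
  set b := min 1 a / 2
  have hb : 0 < b := by positivity
  obtain ⟨n₁, hn₁⟩ := exists_nat_ge (2 * e / δ)
  refine ⟨(b ^ M)⁻¹, by positivity, max n₁ 4, fun n hn x hx z hz hzle => ?_⟩
  have hn4 : 4 ≤ n := (le_max_right _ _).trans hn
  have hn' : 2 * e / δ ≤ n := hn₁.trans (by exact_mod_cast (le_max_left _ _).trans hn)
  have hnpos : (0 : ℝ) < n := by positivity
  set y := 1 + δ * (x ^ 2 / n)
  have hy : 1 ≤ y := by simp only [y, le_add_iff_nonneg_right]; positivity
  -- Chosen so that P · δ/n = a is free of n and P · e = δn/2, which is at most δ(n - 2) because n ≥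
  -- 4. For large n also P ≥ 1, as Bernoulli's inequality requires.
  set P := δ * n / (2 * e)
  have hP : 1 ≤ P := by
    rw [div_le_iff₀ hδ] at hn'
    rw [le_div_iff₀ (by positivity)]; linarith
  have h1 : 1 + a * x ^ 2 ≤ y ^ P := by
    have := one_add_mul_self_le_rpow_one_add (s := δ * (x ^ 2 / n))
      (by have : 0 ≤ δ * (x ^ 2 / n) := by positivity
          linarith) hP
    refine le_trans (le_of_eq ?_) this
    simp only [P, a]; field_simp
  have h2 : b * (1 + x) ≤ 1 + a * x ^ 2 := by
    have e1 : min 1 a ≤ 1 := min_le_left _ _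
    have e2 : min 1 a ≤ a := min_le_right _ _
    have e3 : min 1 a * x ^ 2 ≤ a * x ^ 2 := by gcongr
    have e4 : 0 < min 1 a := by positivity
    have e5 : 1 + x ≤ 2 * (1 + x ^ 2) := by nlinarith [sq_nonneg (x - 1)]
    have e6 : min 1 a / 2 * (1 + x) ≤ min 1 a / 2 * (2 * (1 + x ^ 2)) := by gcongr
    simp only [b]; linarith
  have h3 : b ^ M * (1 + x) ^ M ≤ y ^ (δ * ((n : ℝ) - 2)) := by
    rw [← mul_pow]
    calc (b * (1 + x)) ^ M ≤ (y ^ P) ^ M := pow_le_pow_left₀ (by positivity) (h2.trans h1) M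
      _ = y ^ (P * M) := by rw [Real.rpow_mul (by linarith), Real.rpow_natCast]
      _ ≤ y ^ (δ * ((n : ℝ) - 2)) := by
        refine Real.rpow_le_rpow_of_exponent_le hy ?_
        have e1 : (M : ℝ) ≤ e := by simp [he]
        have e2 : P * M ≤ P * e := by gcongr
        have e3 : P * e = δ * (n / 2) := by simp only [P]; field_simp
        have e4 : (4 : ℝ) ≤ n := by exact_mod_cast hn4
        rw [e3] at e2
        exact e2.trans (by gcongr; linarith)
  calc z ^ (n - 2) ≤ (y ^ (-δ)) ^ (n - 2) := pow_le_pow_left₀ hz hzle _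
    _ = (y ^ (δ * ((n : ℝ) - 2)))⁻¹ := by
      rw [← Real.rpow_natCast, ← Real.rpow_mul (by linarith), ← Real.rpow_neg (by linarith)]
      congr 1
      rw [Nat.cast_sub (by omega)]; push_cast; ring
    _ ≤ (b ^ M * (1 + x) ^ M)⁻¹ := inv_anti₀ (by positivity) h3
    _ = _ := mul_inv _ _

/-- The integrand of the inversion formula, at frequency `u / √n`. -/
noncomputable def invKernel (μ : E p → Measure (E m)) (S : Set (E m)) (n : ℕ) (u : E m)
    (q : E m × E p) : ℂ :=
  ((fun u : E m => (√(n : ℝ))⁻¹ • u) ⁻¹' S).indicator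
    (fun u => normMGF μ ((√(n : ℝ))⁻¹ • u) q ^ n) u

/-- The correction factor of the saddlepoint approximation, up to a constant. -/
noncomputable def invFactor (μ : E p → Measure (E m)) (S : Set (E m)) (n : ℕ)
    (q : E m × E p) : ℂ :=
  ∫ u, invKernel μ S n u q

lemma norm_inv_sqrt_smul_sq {F : Type*} [NormedAddCommGroup F] [NormedSpace ℝ F] (n : ℕ) (u : F) :
    ‖(√(n : ℝ))⁻¹ • u‖ ^ 2 = ‖u‖ ^ 2 / n := by
  rw [norm_smul, mul_pow, Real.norm_eq_abs, sq_abs, inv_pow, Real.sq_sqrt (Nat.cast_nonneg n),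
    inv_mul_eq_div]

lemma norm_inv_sqrt_smul_le {F : Type*} [NormedAddCommGroup F] [NormedSpace ℝ F] {n : ℕ}
    (hn : 1 ≤ n) (u : F) : ‖(√(n : ℝ))⁻¹ • u‖ ≤ ‖u‖ := by
  rw [norm_smul, Real.norm_of_nonneg (by positivity)]
  refine mul_le_of_le_one_left (norm_nonneg _) (inv_le_one_of_one_le₀ ?_)
  rw [Real.one_le_sqrt]; exact_mod_cast hn

lemma hasDerivAt_one_add_pow (n : ℕ) (z : ℂ) :
    HasDerivAt (fun z : ℂ => (1 + z) ^ n) (n * (1 + z) ^ (n - 1)) z := by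
  have := ((hasDerivAt_id z).const_add 1).fun_pow n
  rw [mul_one] at this
  exact this

/-- `C²` bounds of the integrand, uniform in `n`. -/
lemma IsModel.exists_c2Bound_invKernel (hM : IsModel D μ) (hG : GrowthBound D μ) {S : Set (E m)}
    {q₀ : E m × E p} (hq₀ : q₀ ∈ interior (jointDomain D μ)) (hS : LocalDecay μ S q₀) :
    ∃ (C : ℝ) (n₀ : ℕ) (r : ℝ), 0 ≤ C ∧ 0 < r ∧ Metric.ball q₀ r ⊆ interior (jointDomain D μ) ∧
      ∀ n ≥ n₀, ∀ u, C2Bound (Metric.ball q₀ r) (invKernel μ S n u)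
        (C * ((1 + ‖u‖) ^ (m + 1))⁻¹) (C * ((1 + ‖u‖) ^ (m + 1))⁻¹)
        (C * ((1 + ‖u‖) ^ (m + 1))⁻¹) := by
  obtain ⟨C, k, r₁, hC, hr₁, hb₁, hN⟩ := hM.exists_c2Bound_normMGF_sub_one hG hq₀
  obtain ⟨δ, hδ, r₂, hr₂, hdec⟩ := hS
  -- The exponent m + 1 is reserved for integrability over ℝᵐ; the rest absorbs the square of the
  -- polynomial of degree k + 2 that the derivatives produce.
  obtain ⟨c, hc, n₁, hpow⟩ := exists_pow_le_of_decay hδ (m + 1 + 2 * (k + 2))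
  set r := min r₁ r₂
  have h1 : Metric.ball q₀ r ⊆ Metric.ball q₀ r₁ := Metric.ball_subset_ball (min_le_left _ _)
  have h2 : Metric.ball q₀ r ⊆ Metric.ball q₀ r₂ := Metric.ball_subset_ball (min_le_right _ _)
  have hΩ : IsOpen (Metric.ball q₀ r) := Metric.isOpen_ball
  refine ⟨c * (1 + C) ^ 2, max n₁ 2, r, by positivity, lt_min hr₁ hr₂, h1.trans hb₁,
    fun n hn u => ?_⟩
  have hn₁ : n₁ ≤ n := (le_max_left _ _).trans hn
  have hn2 : 2 ≤ n := (le_max_right _ _).trans hn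
  set φ := (√(n : ℝ))⁻¹ • u with hφ
  have hG0 : 0 ≤ c * (1 + C) ^ 2 * ((1 + ‖u‖) ^ (m + 1))⁻¹ := by positivity
  by_cases hu : φ ∈ S
  swap
  · have : EqOn (invKernel μ S n u) (fun _ => 0) (Metric.ball q₀ r) := fun q _ =>
      indicator_of_notMem (s := (fun u : E m => (√(n : ℝ))⁻¹ • u) ⁻¹' S) hu _
    exact ((C2Bound.const 0).mono (by simpa using hG0) hG0 hG0).congr hΩ this
  have hker : EqOn (invKernel μ S n u) (fun q => (1 + (normMGF μ φ q - 1)) ^ n)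
      (Metric.ball q₀ r) := fun q _ => by
    simp only [add_sub_cancel]; exact indicator_of_mem (s := (fun u : E m => (√(n : ℝ))⁻¹ • u) ⁻¹' S) hu _
  set A := c * ((1 + ‖u‖) ^ (m + 1 + 2 * (k + 2)))⁻¹ with hA
  have hA0 : 0 ≤ A := by positivity
  have hz1 : ∀ q ∈ Metric.ball q₀ r, ‖1 + (normMGF μ φ q - 1)‖ ≤ 1 := fun q hq => by
    rw [add_sub_cancel]
    refine (hdec q (h2 hq) φ hu).trans (Real.rpow_le_one_of_one_le_of_nonpos ?_ (by linarith))
    simp only [le_add_iff_nonneg_right]; positivity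
  have hzA : ∀ q ∈ Metric.ball q₀ r, ‖1 + (normMGF μ φ q - 1)‖ ^ (n - 2) ≤ A := fun q hq => by
    rw [add_sub_cancel]
    refine hpow n hn₁ ‖u‖ (norm_nonneg _) _ (norm_nonneg _) ?_
    rw [← norm_inv_sqrt_smul_sq]
    exact hdec q (h2 hq) φ hu
  have hzj : ∀ j ≥ n - 2, ∀ q ∈ Metric.ball q₀ r, ‖(1 + (normMGF μ φ q - 1)) ^ j‖ ≤ A :=
    fun j hj q hq => by
      rw [norm_pow]
      exact (pow_le_pow_of_le_one (norm_nonneg _) (hz1 q hq) hj).trans (hzA q hq)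
  have hbase := (hN φ).subset h1
  set B := C * (‖φ‖ ^ 2 * (1 + ‖φ‖) ^ k) with hB
  have hB0 : 0 ≤ B := by positivity
  set w := 1 + ‖u‖ with hw
  have hw1 : 1 ≤ w := by simp [hw]
  -- The decisive cancellation: |φ|² = |u|²/n removes the factor n from differentiating the n-th
  -- power.
  have hnB : n * B ≤ C * w ^ (k + 2) := by
    have e1 : n * B = C * (‖u‖ ^ 2 * (1 + ‖φ‖) ^ k) := by
      rw [hB, norm_inv_sqrt_smul_sq]
      have : (n : ℝ) ≠ 0 := by positivity
      field_simp
    have e2 : ‖u‖ ≤ w := by simp [hw]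
    have e3 : 1 + ‖φ‖ ≤ w := by
      have := norm_inv_sqrt_smul_le (n := n) (by omega) u
      simp only [hw]; linarith
    rw [e1]
    calc _ ≤ C * (w ^ 2 * w ^ k) := by gcongr
      _ = _ := by ring
  have hcomp := hbase.scalar_comp hΩ (h := fun z => (1 + z) ^ n)
    (h' := fun z => n * (1 + z) ^ (n - 1)) (h'' := fun z => n * ((n - 1 : ℕ) * (1 + z) ^ (n - 1 - 1)))
    (c₀ := A) (c₁ := n * A) (c₂ := n ^ 2 * A)
    ((contDiffOn_const.add hbase.1).pow n)
    (fun q _ => hasDerivAt_one_add_pow n _)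
    (fun q _ => (hasDerivAt_one_add_pow (n - 1) _).const_mul (n : ℂ))
    (hzj n (by omega))
    (fun q hq => by
      rw [norm_mul, Complex.norm_natCast]
      exact mul_le_mul_of_nonneg_left (hzj _ (by omega) q hq) (Nat.cast_nonneg _))
    (fun q hq => by
      rw [norm_mul, norm_mul, Complex.norm_natCast, Complex.norm_natCast, sq, mul_assoc]
      have : ((n - 1 : ℕ) : ℝ) ≤ n := by exact_mod_cast Nat.sub_le n 1
      have := hzj (n - 1 - 1) (by omega) q hq
      gcongr)
  have hfin : ∀ x : ℝ, x ≤ A * (1 + C * w ^ (k + 2)) ^ 2 →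
      x ≤ c * (1 + C) ^ 2 * (w ^ (m + 1))⁻¹ := by
    intro x hx
    have e1 : 1 + C * w ^ (k + 2) ≤ (1 + C) * w ^ (k + 2) := by
      have : 1 ≤ w ^ (k + 2) := one_le_pow₀ hw1
      linarith
    calc x ≤ A * ((1 + C) * w ^ (k + 2)) ^ 2 := hx.trans (by gcongr)
      _ = c * (1 + C) ^ 2 * (w ^ (m + 1))⁻¹ := by
        rw [hA, pow_add _ (m + 1), mul_pow, ← pow_mul, mul_comm (k + 2) 2]
        have : w ≠ 0 := by positivity
        field_simp
  have hX : 0 ≤ C * w ^ (k + 2) := by positivity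
  refine (hcomp.mono (hfin _ ?_) (hfin _ ?_) (hfin _ ?_)).congr hΩ hker
  · nlinarith [mul_nonneg hA0 hX]
  · calc n * A * B = A * (n * B) := by ring
      _ ≤ A * (C * w ^ (k + 2)) := by gcongr
      _ ≤ _ := by gcongr; nlinarith
  · have hn1 : (1 : ℝ) ≤ n := by exact_mod_cast (by omega : 1 ≤ n)
    calc n ^ 2 * A * B ^ 2 + n * A * B = A * ((n * B) ^ 2 + n * B) := by ring
      _ ≤ A * ((C * w ^ (k + 2)) ^ 2 + C * w ^ (k + 2)) := by gcongr
      _ ≤ _ := by gcongr; nlinarith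

lemma integrable_inv_one_add_norm_pow :
    Integrable (fun u : E m => ((1 + ‖u‖) ^ (m + 1))⁻¹) := by
  have h := integrable_one_add_norm (E := E m) (μ := volume) (r := (m + 1 : ℕ)) (by simp)
  refine h.congr (ae_of_all _ fun u => ?_)
  simp only
  rw [Real.rpow_neg (by positivity), Real.rpow_natCast]

/-- The indicator restricts u only and so commutes with derivatives in q; what it multiplies is
continuous in u. -/
lemma aestronglyMeasurable_fderiv_indicator {X W F : Type*} [NormedAddCommGroup X]
    [NormedSpace ℝ X] [MeasurableSpace X] [BorelSpace X] [SecondCountableTopology X]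
    [NormedAddCommGroup W] [NormedSpace ℝ W] [NormedAddCommGroup F] [NormedSpace ℝ F]
    {ν : Measure X} {Ω : Set W} (hΩ : IsOpen Ω) {f : X → W → F}
    (hf : ContDiffOn ℝ 2 (fun z : X × W => f z.1 z.2) (univ ×ˢ Ω)) {S : Set X}
    (hS : MeasurableSet S) {q : W} (hq : q ∈ Ω) :
    AEStronglyMeasurable (fun u => S.indicator (fun u => f u q) u) ν ∧
    AEStronglyMeasurable (fun u => fderiv ℝ (fun q => S.indicator (fun u => f u q) u) q) ν ∧
    AEStronglyMeasurable
      (fun u => fderiv ℝ (fderiv ℝ (fun q => S.indicator (fun u => f u q) u)) q) ν := by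
  obtain ⟨c0, c1, c2, -⟩ := continuousOn_fderiv_param isOpen_univ hΩ hf hq
  have hin : ∀ u ∈ S, (fun q => S.indicator (fun u => f u q) u) = f u :=
    fun u hu => funext fun q => indicator_of_mem hu _
  have hout : ∀ u ∉ S, (fun q => S.indicator (fun u => f u q) u) = fun _ => 0 :=
    fun u hu => funext fun q => indicator_of_notMem hu _
  have e1 : (fun u => fderiv ℝ (fun q => S.indicator (fun u => f u q) u) q) = S.indicator
      fun u => fderiv ℝ (f u) q := by
    funext u
    by_cases hu : u ∈ S
    · rw [indicator_of_mem hu, hin u hu]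
    · rw [indicator_of_notMem hu, hout u hu, fderiv_const_apply]
  have e2 : (fun u => fderiv ℝ (fderiv ℝ (fun q => S.indicator (fun u => f u q) u)) q) =
      S.indicator fun u => fderiv ℝ (fderiv ℝ (f u)) q := by
    funext u
    by_cases hu : u ∈ S
    · rw [indicator_of_mem hu, hin u hu]
    · rw [indicator_of_notMem hu, hout u hu, fderiv_fun_const]
      exact fderiv_const_apply 0
  have : TopologicalSpace.PseudoMetrizableSpace (W →L[ℝ] W →L[ℝ] F) :=
    (ContinuousLinearMap.toNormedAddCommGroup (E := W) (F := W →L[ℝ] F)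
      (σ₁₂ := RingHom.id ℝ)).toPseudoMetricSpace.toPseudoEMetricSpace.pseudoMetrizableSpace
  refine ⟨(continuousOn_univ.1 c0).aestronglyMeasurable.indicator hS, ?_, ?_⟩
  · rw [e1]; exact (continuousOn_univ.1 c1).aestronglyMeasurable.indicator hS
  · rw [e2]; exact (continuousOn_univ.1 c2).aestronglyMeasurable.indicator hS

lemma IsModel.measurable_invKernel (hM : IsModel D μ) (hG : GrowthBound D μ) {S : Set (E m)}
    (hS : MeasurableSet S) (n : ℕ) {q : E m × E p} (hq : q ∈ interior (jointDomain D μ)) :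
    AEStronglyMeasurable (fun u => invKernel μ S n u q) ∧
    AEStronglyMeasurable (fun u => fderiv ℝ (invKernel μ S n u) q) ∧
    AEStronglyMeasurable (fun u => fderiv ℝ (fderiv ℝ (invKernel μ S n u)) q) :=
  aestronglyMeasurable_fderiv_indicator
    (f := fun (u : E m) q => normMGF μ ((√(n : ℝ))⁻¹ • u) q ^ n) isOpen_interior
    ((hM.contDiffOn_normMGF hG (T := fun u : E m => (√(n : ℝ))⁻¹ • u) (by fun_prop)).pow n)
    (measurableSet_preimage (measurable_const_smul ((√(n : ℝ))⁻¹)) hS) hq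

/-- Telescoping inside the unit disc. In the central limit argument it reduces n-th powers to an
o(1/n) comparison of their bases. -/
lemma norm_pow_sub_pow_le {z w : ℂ} (hz : ‖z‖ ≤ 1) (hw : ‖w‖ ≤ 1) (n : ℕ) :
    ‖z ^ n - w ^ n‖ ≤ n * ‖z - w‖ := by
  induction n with
  | zero => simp
  | succ n ih =>
    have e : z ^ (n + 1) - w ^ (n + 1) = z ^ n * (z - w) + (z ^ n - w ^ n) * w := by ring
    rw [e]
    refine (norm_add_le _ _).trans ?_
    rw [norm_mul, norm_mul, norm_pow]
    have h1 : ‖z‖ ^ n * ‖z - w‖ ≤ ‖z - w‖ :=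
      mul_le_of_le_one_left (norm_nonneg _) (pow_le_one₀ (norm_nonneg _) hz)
    have h2 : ‖z ^ n - w ^ n‖ * ‖w‖ ≤ n * ‖z - w‖ :=
      (mul_le_of_le_one_right (norm_nonneg _) hw).trans ih
    push_cast; linarith

/-- Central limit theorem for the integrand. -/
lemma IsModel.tendsto_invKernel (hM : IsModel D μ) (hG : GrowthBound D μ) {S : Set (E m)}
    (hS0 : S ∈ 𝓝 0) {q₀ : E m × E p} (hq₀ : q₀ ∈ interior (jointDomain D μ))
    (hS : LocalDecay μ S q₀) (hA : (cgfHess (μ q₀.2) q₀.1).PosDef) (u : E m) :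
    Tendsto (fun z : ℕ × (E m × E p) => invKernel μ S z.1 u z.2) (atTop ×ˢ 𝓝 q₀)
      (𝓝 (Real.exp (-(1 / 2 * tiltedCov (μ q₀.2) q₀.1 u u)) : ℝ)) := by
  have := hM.neZero hq₀
  have hs := mem_interior_mgfDomain hq₀
  set a := 1 / 2 * tiltedCov (μ q₀.2) q₀.1 u u with ha
  have ha0 : 0 ≤ a := by
    obtain ⟨κ, hκ, h⟩ := exists_tiltedCov_lower hs hA
    have := h u
    have : 0 ≤ κ * ‖u‖ ^ 2 := by positivity
    linarith
  obtain ⟨δ, hδ, r₂, hr₂, hdec⟩ := hS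
  rw [Metric.tendsto_nhds]
  intro ε hε
  -- After multiplication by n, the approximation error η|u|²/n contributes at most ε/2.
  set η := ε / (2 * (‖u‖ ^ 2 + 1))
  have hη : 0 < η := by positivity
  obtain ⟨r₁, hr₁, happ⟩ := hM.normMGF_approx hG hq₀ hη
  have hφ : Tendsto (fun n : ℕ => (√(n : ℝ))⁻¹ • u) atTop (𝓝 0) := by
    have : Tendsto (fun n : ℕ => (√(n : ℝ))⁻¹) atTop (𝓝 0) :=
      (Real.tendsto_sqrt_atTop.comp tendsto_natCast_atTop_atTop).inv_tendsto_atTop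
    simpa using this.smul_const u
  have hev1 := (hφ.eventually_mem hS0).and (hφ.eventually_mem (Metric.ball_mem_nhds _ hr₁))
  have hdiv : Tendsto (fun n : ℕ => a ^ 2 / n) atTop (𝓝 0) :=
    tendsto_const_nhds.div_atTop tendsto_natCast_atTop_atTop
  have hev2 := (hdiv.eventually_lt_const (half_pos hε)).and
    ((eventually_ge_atTop 1).and (eventually_ge_atTop ⌈a⌉₊))
  refine ((hev1.and hev2).prod_mk ((Metric.isOpen_ball.eventually_mem (Metric.mem_ball_self (x := q₀) hr₁)).and
    (Metric.isOpen_ball.eventually_mem (Metric.mem_ball_self (x := q₀) hr₂)))).mono ?_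
  rintro ⟨n, q⟩ ⟨⟨⟨h1, h2⟩, h3, h4, h5⟩, h6, h7⟩
  simp only at h1 h2 h3 h4 h5 h6 h7 ⊢
  have hker : invKernel μ S n u q = normMGF μ ((√(n : ℝ))⁻¹ • u) q ^ n :=
    indicator_of_mem (s := (fun u : E m => (√(n : ℝ))⁻¹ • u) ⁻¹' S) h1 _
  set φ := (√(n : ℝ))⁻¹ • u
  have hn : (0 : ℝ) < n := by exact_mod_cast h4
  have han : a / n ≤ 1 := by rw [div_le_one hn]; exact Nat.ceil_le.1 h5
  have ha' : 0 ≤ a / n := by positivity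
  -- Comparison number with wⁿ = exp(-a): both w and `normMGF` at u/√n agree with 1 - a/n up to
  -- o(1/n).
  set w : ℂ := Complex.exp (-(a / n : ℝ))
  have hw : ‖w‖ ≤ 1 := by
    rw [Complex.norm_exp]; simpa using ha'
  have hwn : w ^ n = (Real.exp (-a) : ℝ) := by
    rw [← Complex.exp_nat_mul, Complex.ofReal_exp]
    have : (n : ℂ) ≠ 0 := by exact_mod_cast hn.ne'
    congr 1; push_cast; field_simp
  have hz : ‖normMGF μ φ q‖ ≤ 1 :=
    (hdec q h7 φ h1).trans (Real.rpow_le_one_of_one_le_of_nonpos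
      (by simp only [le_add_iff_nonneg_right]; positivity) (by linarith))
  have e1 : ‖normMGF μ φ q - 1 + (a / n : ℝ)‖ ≤ η * (‖u‖ ^ 2 / n) := by
    have := happ q h6 φ (mem_ball_zero_iff.1 h2)
    rw [norm_inv_sqrt_smul_sq, tiltedCov_smul_smul hs] at this
    convert this using 4
    rw [inv_pow, Real.sq_sqrt hn.le, ha]; ring
  have e2 : ‖w - 1 + (a / n : ℝ)‖ ≤ (a / n) ^ 2 := by
    have := Complex.norm_exp_sub_one_sub_id_le (x := ((-(a / n) : ℝ) : ℂ)) (by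
      rw [Complex.norm_real, norm_neg, Real.norm_of_nonneg ha']; exact han)
    rw [Complex.norm_real, norm_neg, Real.norm_of_nonneg ha'] at this
    convert this using 2
    simp only [w]; push_cast; ring
  rw [hker, dist_eq_norm, ← hwn]
  refine (norm_pow_sub_pow_le hz hw n).trans_lt ?_
  have e3 : ‖normMGF μ φ q - w‖ ≤ η * (‖u‖ ^ 2 / n) + (a / n) ^ 2 := by
    refine le_trans (le_of_eq ?_) ((norm_sub_le _ _).trans (add_le_add e1 e2))
    congr 1; ring
  calc n * ‖normMGF μ φ q - w‖ ≤ n * (η * (‖u‖ ^ 2 / n) + (a / n) ^ 2) := by gcongr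
    _ = η * ‖u‖ ^ 2 + a ^ 2 / n := by field_simp
    _ < ε / 2 + ε / 2 := by
      refine add_lt_add_of_le_of_lt ?_ h3
      simp only [η]
      rw [div_mul_eq_mul_div, div_le_div_iff₀ (by positivity) two_pos]
      nlinarith
    _ = ε := add_halves ε

/-- The limit of `invFactor`. -/
noncomputable def invLimit (μ : E p → Measure (E m)) (q : E m × E p) : ℝ :=
  ∫ u : E m, Real.exp (-(1 / 2 * tiltedCov (μ q.2) q.1 u u))

/-- `C²` bounds for `invFactor`, uniform in `n`, and its limit. -/
lemma IsModel.exists_c2Bound_invFactor (hM : IsModel D μ) (hG : GrowthBound D μ) {S : Set (E m)}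
    (hSm : MeasurableSet S) (hS0 : S ∈ 𝓝 0) {q₀ : E m × E p}
    (hq₀ : q₀ ∈ interior (jointDomain D μ)) (hS : LocalDecay μ S q₀)
    (hA : (cgfHess (μ q₀.2) q₀.1).PosDef) :
    0 < invLimit μ q₀ ∧
    Tendsto (fun z : ℕ × (E m × E p) => invFactor μ S z.1 z.2) (atTop ×ˢ 𝓝 q₀)
      (𝓝 (invLimit μ q₀ : ℝ)) ∧
    ∃ (C : ℝ) (n₀ : ℕ) (r : ℝ), 0 < r ∧ Metric.ball q₀ r ⊆ interior (jointDomain D μ) ∧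
      ∀ n ≥ n₀, C2Bound (Metric.ball q₀ r) (invFactor μ S n) C C C ∧
        ∀ q ∈ Metric.ball q₀ r, Integrable (fun u => invKernel μ S n u q) := by
  obtain ⟨C, n₀, r, hC, hr, hb, hker⟩ := hM.exists_c2Bound_invKernel hG hq₀ hS
  have hint : Integrable (fun u : E m => C * ((1 + ‖u‖) ^ (m + 1))⁻¹) :=
    integrable_inv_one_add_norm_pow.const_mul C
  have hlim : Tendsto (fun z : ℕ × (E m × E p) => invFactor μ S z.1 z.2) (atTop ×ˢ 𝓝 q₀)
      (𝓝 (∫ u : E m, ((Real.exp (-(1 / 2 * tiltedCov (μ q₀.2) q₀.1 u u)) : ℝ) : ℂ))) := by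
    refine tendsto_integral_filter_of_dominated_convergence
      (fun u : E m => C * ((1 + ‖u‖) ^ (m + 1))⁻¹) ?_ ?_ hint
      (ae_of_all _ fun u => hM.tendsto_invKernel hG hS0 hq₀ hS hA u)
    · refine ((eventually_ge_atTop n₀).prod_mk (Metric.isOpen_ball.eventually_mem (Metric.mem_ball_self (x := q₀) hr))).mono ?_
      rintro ⟨n, q⟩ ⟨-, hq⟩
      exact (hM.measurable_invKernel hG hSm n (hb hq)).1
    · refine ((eventually_ge_atTop n₀).prod_mk (Metric.isOpen_ball.eventually_mem (Metric.mem_ball_self (x := q₀) hr))).mono ?_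
      rintro ⟨n, q⟩ ⟨hn, hq⟩
      exact ae_of_all _ fun u => (hker n hn u).2 q hq
  have := hM.neZero hq₀
  have hs := mem_interior_mgfDomain hq₀
  refine ⟨?_, ?_, C * ∫ u : E m, ((1 + ‖u‖) ^ (m + 1))⁻¹, n₀, r, hr, hb, fun n hn => ⟨?_, ?_⟩⟩
  · obtain ⟨κ, hκ, hlow⟩ := exists_tiltedCov_lower hs hA
    have hi : Integrable fun u : E m => Real.exp (-(1 / 2 * tiltedCov (μ q₀.2) q₀.1 u u)) := by
      have h1 : Integrable fun u : E m => Real.exp (-(κ / 2) * ‖u‖ ^ 2) := by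
        have := GaussianFourier.integrable_cexp_neg_mul_sq_norm_add (V := E m) (b := (κ / 2 : ℝ))
          (by simpa using hκ) 0 0
        convert! this.norm using 2 with u
        rw [Complex.norm_exp]
        congr 1
        simp [← Complex.ofReal_pow]
      have hc := continuous_tiltedCov hs
      refine h1.mono' (by exact (hc.const_mul _).neg.rexp.aestronglyMeasurable) (ae_of_all _ fun u => ?_)
      rw [Real.norm_of_nonneg (Real.exp_pos _).le, Real.exp_le_exp]
      have := hlow u
      linarith
    exact integral_exp_pos hi
  · rw [integral_complex_ofReal] at hlim
    exact hlim
  · have hme := fun q (hq : q ∈ Metric.ball q₀ r) => hM.measurable_invKernel hG hSm n (hb hq)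
    have := C2Bound.integral Metric.isOpen_ball (ae_of_all _ (hker n hn))
      (fun q hq => (hme q hq).1) (fun q hq => (hme q hq).2.1) (fun q hq => (hme q hq).2.2)
      hint hint hint
    rwa [integral_const_mul] at this
  · intro q hq
    exact hint.mono' (hM.measurable_invKernel hG hSm n (hb hq)).1
      (ae_of_all _ fun u => (hker n hn u).2 q hq)

end Saddlepoint

namespace Saddlepoint

/-! ### Finite measures with integrable characteristic function -/

section InversionContinuous

open scoped FourierTransform ContDiff

variable {V : Type*} [NormedAddCommGroup V] [InnerProductSpace ℝ V] [FiniteDimensional ℝ V]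
  [MeasurableSpace V] [BorelSpace V] {τ : Measure V}

/-- The inverse Fourier transform of the characteristic function. -/
noncomputable def charFunInv (τ : Measure V) (x : V) : ℂ :=
  𝓕⁻ (fun ξ : V => charFun τ (-(2 * Real.pi) • ξ)) x

lemma integrable_charFun_comp (h : Integrable (charFun τ)) :
    Integrable (fun ξ : V => charFun τ (-(2 * Real.pi) • ξ)) :=
  (integrable_comp_smul_iff volume (charFun τ) (by simp [Real.pi_ne_zero])).2 h

lemma continuous_charFunInv (h : Integrable (charFun τ)) : Continuous (charFunInv τ) :=
  VectorFourier.fourierIntegral_continuous Real.continuous_fourierChar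
    (L := -innerₗ V) (by simpa using! continuous_inner.neg) (integrable_charFun_comp h)

/-- Write ψ as the Fourier transform of its inverse transform, move the transform onto τ by Fubini,
and move the inverse transform back from ψ onto the characteristic function by Fubini again. -/
lemma integral_schwartz_eq [IsFiniteMeasure τ] (h : Integrable (charFun τ)) (ψ : SchwartzMap V ℂ) :
    ∫ x, ψ x ∂τ = ∫ x, charFunInv τ x * ψ x := by
  have h1 := VectorFourier.integral_fourierIntegral_smul_eq_flip (μ := τ) (ν := volume)
    (L := innerₗ V) (f := fun _ : V => (1 : ℂ)) (g := ⇑(𝓕⁻ ψ : SchwartzMap V ℂ)) Real.continuous_fourierChar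
    continuous_inner (integrable_const _) (𝓕⁻ ψ : SchwartzMap V ℂ).integrable
  have h2 := VectorFourier.integral_fourierIntegral_smul_eq_flip (μ := volume) (ν := volume)
    (L := -innerₗ V) (f := fun ξ : V => charFun τ (-(2 * Real.pi) • ξ)) (g := ψ)
    Real.continuous_fourierChar (by simpa using! continuous_inner.neg)
    (integrable_charFun_comp h) ψ.integrable
  have e1 : ∀ ξ : V, VectorFourier.fourierIntegral Real.fourierChar τ (innerₗ V)
      (fun _ : V => (1 : ℂ)) ξ = charFun τ (-(2 * Real.pi) • ξ) := fun ξ => by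
    rw [charFun_apply]
    refine integral_congr_ae (ae_of_all _ fun x => ?_)
    simp only [innerₗ_apply_apply, Circle.smul_def, Real.fourierChar_apply, smul_eq_mul, mul_one,
      inner_smul_right]
    congr 2; push_cast; ring
  have e2 : ∀ x : V, VectorFourier.fourierIntegral Real.fourierChar volume (innerₗ V).flip
      ⇑(𝓕⁻ ψ : SchwartzMap V ℂ) x = ψ x := fun x => by
    have : (innerₗ V).flip = innerₗ V := by ext; simp
    rw [this]
    have h : 𝓕 (𝓕⁻ (ψ : V → ℂ)) = ψ := ψ.continuous.fourier_fourierInv_eq ψ.integrable (by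
      rw [← SchwartzMap.fourier_coe]; exact (𝓕 ψ : SchwartzMap V ℂ).integrable)
    rw [SchwartzMap.fourierInv_coe]
    exact congrFun h x
  have e3 : ∀ x : V, VectorFourier.fourierIntegral Real.fourierChar volume (-innerₗ V).flip
      ψ x = (𝓕⁻ ψ : SchwartzMap V ℂ) x := fun x => by
    have : (-innerₗ V).flip = -innerₗ V := by ext; simp [real_inner_comm]
    rw [this, SchwartzMap.fourierInv_coe]
    rfl
  simp only [e1, e2, smul_eq_mul, one_mul] at h1
  simp only [e3, smul_eq_mul] at h2
  rw [← h1, ← h2]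
  rfl

/-- Conjugating the characteristic function reverses its argument; the substitution ξ ↦ -ξ restores
the integral. -/
lemma star_charFunInv (x : V) : star (charFunInv τ x) = charFunInv τ x := by
  have h1 : ∀ ξ : V, star (charFun τ (-(2 * Real.pi) • ξ)) = charFun τ ((2 * Real.pi) • ξ) := by
    intro ξ
    rw [neg_smul, charFun_neg]
    simp
  set f : V → ℂ := fun v => Complex.exp (↑(2 * Real.pi * inner ℝ v x) * Complex.I) •
      charFun τ (-(2 * Real.pi) • v)
  have h2 : ∀ v, (starRingEnd ℂ) (f v) = f (-v) := fun v => by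
    simp only [f, smul_eq_mul, map_mul, ← Complex.exp_conj, Complex.conj_ofReal, Complex.conj_I]
    rw [show (starRingEnd ℂ) (charFun τ (-(2 * Real.pi) • v)) = charFun τ ((2 * Real.pi) • v)
      from h1 _, smul_neg, neg_smul, neg_neg, inner_neg_left]
    congr 2; push_cast; ring
  rw [charFunInv, Real.fourierInv_eq']
  calc star (∫ v, f v) = ∫ v, (starRingEnd ℂ) (f v) := integral_conj.symm
    _ = ∫ v, f (-v) := by simp only [h2]
    _ = ∫ v, f v := integral_neg_eq_self f _

lemma ofReal_re_charFunInv (x : V) : (((charFunInv τ x).re : ℝ) : ℂ) = charFunInv τ x :=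
  Complex.conj_eq_iff_re.1 (star_charFunInv x)

lemma integral_smooth_eq [IsFiniteMeasure τ] (h : Integrable (charFun τ)) {f : V → ℝ}
    (hf : ContDiff ℝ ∞ f) (hc : HasCompactSupport f) :
    ∫ x, f x ∂τ = ∫ x, (charFunInv τ x).re * f x := by
  have h1 : HasCompactSupport fun x => (f x : ℂ) := hc.comp_left (g := fun x : ℝ => (x : ℂ)) rfl
  have := integral_schwartz_eq h (h1.toSchwartzMap (Complex.ofRealCLM.contDiff.comp hf))
  have e : ∀ x, (h1.toSchwartzMap (Complex.ofRealCLM.contDiff.comp hf)) x = (f x : ℂ) :=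
    fun x => rfl
  have e2 : ∀ x, charFunInv τ x * (f x : ℂ) = (((charFunInv τ x).re * f x : ℝ) : ℂ) := fun x => by
    rw [Complex.ofReal_mul, ofReal_re_charFunInv]
  simp only [e, e2] at this
  rw [integral_complex_ofReal, integral_complex_ofReal] at this
  exact_mod_cast this

/-- A negative value would persist on a ball. Testing against a smooth bump supported there gives a
negative integral on one side of `integral_smooth_eq` and a non-negative one on the other. -/
lemma re_charFunInv_nonneg [IsFiniteMeasure τ] (h : Integrable (charFun τ)) (x : V) :
    0 ≤ (charFunInv τ x).re := by
  by_contra! hlt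
  have hc : Continuous fun x => (charFunInv τ x).re :=
    Complex.continuous_re.comp (continuous_charFunInv h)
  obtain ⟨r, hr, hb⟩ := Metric.eventually_nhds_iff_ball.1 (hc.continuousAt.eventually_lt_const hlt)
  obtain ⟨f, hsupp, hf, hrange⟩ :=
    (Metric.isOpen_ball (x := x) (ε := r)).exists_contDiff_support_eq (n := ⊤)
  have hcs : HasCompactSupport f := by
    refine HasCompactSupport.of_support_subset_isCompact (isCompact_closedBall x r) ?_
    rw [hsupp]; exact Metric.ball_subset_closedBall
  have hf0 : ∀ y, 0 ≤ f y := fun y => (hrange (mem_range_self y)).1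
  have h1 := integral_smooth_eq h hf hcs
  have h2 : 0 ≤ ∫ y, f y ∂τ := integral_nonneg hf0
  have hcont : Continuous fun y => -((charFunInv τ y).re * f y) := (hc.mul hf.continuous).neg
  have h3 : 0 < ∫ y, -((charFunInv τ y).re * f y) := by
    have hle : ∀ y, 0 ≤ -((charFunInv τ y).re * f y) := fun y => by
      by_cases hy : y ∈ Metric.ball x r
      · have := hb y hy; nlinarith [hf0 y]
      · rw [← hsupp, Function.notMem_support] at hy; simp [hy]
    refine hcont.integral_pos_of_hasCompactSupport_nonneg_nonzero ?_ hle (x := x) ?_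
    · exact (hcs.mul_left).neg
    · have : x ∈ Function.support f := by rw [hsupp]; exact Metric.mem_ball_self hr
      simp only [ne_eq, neg_eq_zero, mul_eq_zero, not_or]
      exact ⟨hlt.ne, this⟩
  rw [integral_neg] at h3
  linarith

/-- The two measures have equal integrals of smooth compactly supported functions, which approximate
indicators of bounded open sets. These sets are stable under intersection and generate the Borel
sets. Boundedness is needed since the density is so far only known to be locally integrable. -/
lemma eq_withDensity_charFunInv [IsFiniteMeasure τ] (h : Integrable (charFun τ)) :
    τ = volume.withDensity fun x => ENNReal.ofReal (charFunInv τ x).re := by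
  have hc : Continuous fun x => (charFunInv τ x).re :=
    Complex.continuous_re.comp (continuous_charFunInv h)
  set ρ : Measure V := volume.withDensity fun x => ENNReal.ofReal (charFunInv τ x).re
  have hρfin : ∀ K : Set V, IsCompact K → ρ K < ⊤ := fun K hK => by
    rw [withDensity_apply _ hK.measurableSet]
    refine ((hc.continuousOn.integrableOn_compact (μ := volume) hK).2).trans_le' ?_
    refine lintegral_mono fun x => ?_
    exact Real.ofReal_le_enorm _
  have hint : ∀ f : V → ℝ, Continuous f → ∫ x, f x ∂ρ = ∫ x, (charFunInv τ x).re * f x := by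
    intro f hf
    rw [integral_withDensity_eq_integral_toReal_smul hc.measurable.ennreal_ofReal
      (ae_of_all _ fun _ => ENNReal.ofReal_lt_top)]
    refine integral_congr_ae (ae_of_all _ fun x => ?_)
    simp [ENNReal.toReal_ofReal (re_charFunInv_nonneg h x)]
  have hball : ∀ (U : Set V), IsOpen U → Bornology.IsBounded U → τ U = ρ U := by
    intro U hU hb
    obtain ⟨f, hsupp, hf, hrange⟩ := hU.exists_contDiff_support_eq (n := ⊤)
    have hK : IsCompact (closure U) := hb.isCompact_closure
    have hf0 : ∀ y, 0 ≤ f y := fun y => (hrange (mem_range_self y)).1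
    have hf1 : ∀ y, f y ≤ 1 := fun y => (hrange (mem_range_self y)).2
    -- As f takes values in [0, 1] and is positive exactly on U, these smooth functions increase to
    -- the indicator of U.
    set g : ℕ → V → ℝ := fun k x => 1 - (1 - f x) ^ (k + 1)
    have hg : ∀ k, ContDiff ℝ ∞ (g k) := fun k =>
      contDiff_const.sub ((contDiff_const.sub hf).pow _)
    have hg0 : ∀ k x, x ∉ U → g k x = 0 := fun k x hx => by
      rw [← hsupp, Function.notMem_support] at hx; simp [g, hx]
    have hgc : ∀ k, HasCompactSupport (g k) := fun k =>
      HasCompactSupport.of_support_subset_isCompact hK fun x hx => by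
        by_contra hx'
        exact hx (hg0 k x fun h => hx' (subset_closure h))
    have hglim : ∀ x, Tendsto (fun k => g k x) atTop (𝓝 (U.indicator 1 x)) := fun x => by
      by_cases hx : x ∈ U
      · have h1 : 0 < f x := by
          rw [← hsupp] at hx; exact lt_of_le_of_ne (hf0 x) (Ne.symm hx)
        have h2 := (tendsto_pow_atTop_nhds_zero_of_lt_one (by linarith [hf1 x])
          (by linarith : 1 - f x < 1)).comp (tendsto_add_atTop_nat 1)
        simpa [hx, g, Function.comp_def] using h2.const_sub 1
      · simp [hx, hg0 _ x hx]
    have hgb : ∀ k x, ‖g k x‖ ≤ U.indicator 1 x := fun k x => by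
      by_cases hx : x ∈ U
      · have h1 : 0 ≤ (1 - f x) ^ (k + 1) := pow_nonneg (by linarith [hf1 x]) _
        have h2 : (1 - f x) ^ (k + 1) ≤ 1 := pow_le_one₀ (by linarith [hf1 x]) (by linarith [hf0 x])
        simp only [indicator_of_mem hx, Pi.one_apply, g]
        rw [Real.norm_of_nonneg (by linarith)]; linarith
      · simp [hx, hg0 k x hx]
    have hlim : ∀ (κ : Measure V), κ (closure U) < ⊤ →
        Tendsto (fun k => ∫ x, g k x ∂κ) atTop (𝓝 (κ.real U)) := fun κ hκ => by
      have hU' : κ U < ⊤ := (measure_mono subset_closure).trans_lt hκ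
      have := tendsto_integral_of_dominated_convergence (μ := κ) (F := g) (U.indicator 1)
        (fun k => (hg k).continuous.aestronglyMeasurable)
        ((integrable_indicator_iff hU.measurableSet).2 (by
          simpa using! integrableOn_const hU'.ne))
        (fun k => ae_of_all _ (hgb k)) (ae_of_all _ hglim)
      rwa [integral_indicator_one hU.measurableSet] at this
    have h1 := hlim τ (measure_lt_top _ _)
    have h2 := hlim ρ (hρfin _ hK)
    have h3 : ∀ k, ∫ x, g k x ∂τ = ∫ x, g k x ∂ρ := fun k => by
      rw [integral_smooth_eq h (hg k) (hgc k), hint _ (hg k).continuous]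
    simp only [h3] at h1
    have h4 := tendsto_nhds_unique h1 h2
    exact (measureReal_eq_measureReal_iff (measure_ne_top _ _)
      ((measure_mono subset_closure).trans_lt (hρfin _ hK)).ne).1 h4
  refine Measure.ext_of_generateFrom_of_iUnion {U | IsOpen U ∧ Bornology.IsBounded U}
    (fun k : ℕ => Metric.ball (0 : V) k) ?_ ?_ ?_ ?_ (fun _ => measure_ne_top _ _)
    (fun U hU => hball U hU.1 hU.2)
  · rw [BorelSpace.measurable_eq (α := V), borel]
    refine le_antisymm (MeasurableSpace.generateFrom_le fun U hU => ?_)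
      (MeasurableSpace.generateFrom_mono fun U hU => hU.1)
    have : U = ⋃ k : ℕ, U ∩ Metric.ball (0 : V) k := by
      rw [← inter_iUnion, Metric.iUnion_ball_nat, inter_univ]
    rw [this]
    exact MeasurableSet.iUnion fun k => MeasurableSpace.measurableSet_generateFrom
      ⟨hU.inter Metric.isOpen_ball, Metric.isBounded_ball.subset inter_subset_right⟩
  · rintro U ⟨hU, hb⟩ W ⟨hW, -⟩ -
    exact ⟨hU.inter hW, hb.subset inter_subset_left⟩
  · exact Metric.iUnion_ball_nat 0
  · exact fun k => ⟨Metric.isOpen_ball, Metric.isBounded_ball⟩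

lemma charFunInv_eq (x : V) : charFunInv τ x =
    ((2 * Real.pi) ^ Module.finrank ℝ V)⁻¹ •
      ∫ φ, charFun τ φ * Complex.exp (-((inner ℝ φ x : ℝ) : ℂ) * Complex.I) := by
  have h := Measure.integral_comp_smul (volume : Measure V)
    (fun φ => charFun τ φ * Complex.exp (-((inner ℝ φ x : ℝ) : ℂ) * Complex.I)) (-(2 * Real.pi))
  rw [charFunInv, Real.fourierInv_eq']
  have e : |((-(2 * Real.pi)) ^ Module.finrank ℝ V)⁻¹| = ((2 * Real.pi) ^ Module.finrank ℝ V)⁻¹ := by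
    rw [abs_inv, abs_pow, abs_neg, abs_of_pos Real.two_pi_pos]
  rw [e] at h
  rw [← h]
  refine integral_congr_ae (ae_of_all _ fun v => ?_)
  simp only [smul_eq_mul, inner_smul_left, conj_trivial]
  rw [mul_comm]
  congr 2; push_cast; ring

end InversionContinuous

end Saddlepoint

namespace Saddlepoint

variable {m p : ℕ} {D : Set (E p)} {μ : E p → Measure (E m)}

/-! ### Sums of independent copies -/

section SumLaw

variable {ν : Measure (E m)} [IsProbabilityMeasure ν]

lemma measurable_sum_pi (n : ℕ) : Measurable fun y : Fin n → E m => ∑ i, y i := by fun_prop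

instance isProbabilityMeasure_sumLaw (n : ℕ) : IsProbabilityMeasure (sumLaw ν n) :=
  Measure.isProbabilityMeasure_map (measurable_sum_pi n).aemeasurable

lemma cmgf_sumLaw (n : ℕ) (s φ : E m) : cmgf (sumLaw ν n) s φ = cmgf ν s φ ^ n := by
  rw [cmgf, sumLaw, integral_map (measurable_sum_pi n).aemeasurable
    (by exact (by fun_prop : Continuous fun y : E m => Complex.exp ((inner ℝ s y : ℝ) +
      (inner ℝ φ y : ℝ) * Complex.I)).aestronglyMeasurable)]
  have h := integral_fintype_prod_eq_pow (ι := Fin n) (μ := ν) (𝕜 := ℂ)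
    fun y : E m => Complex.exp ((inner ℝ s y : ℝ) + (inner ℝ φ y : ℝ) * Complex.I)
  rw [Fintype.card_fin] at h
  rw [cmgf, ← h]
  refine integral_congr_ae (ae_of_all _ fun y => ?_)
  simp only [inner_sum]
  rw [← Complex.exp_sum, Finset.sum_add_distrib, ← Finset.sum_mul]
  push_cast; rfl

lemma mgf_sumLaw (n : ℕ) (s : E m) : mgf (sumLaw ν n) s = mgf ν s ^ n := by
  have h := cmgf_sumLaw (ν := ν) n s 0
  have e : ∀ κ : Measure (E m), cmgf κ s 0 = (mgf κ s : ℂ) := fun κ => by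
    rw [mgf, ← integral_complex_ofReal, cmgf]; simp
  rw [e, e] at h
  exact_mod_cast h

lemma cgf_sumLaw (n : ℕ) : cgf (sumLaw ν n) = fun s => n * cgf ν s := by
  funext s; rw [cgf, mgf_sumLaw, Real.log_pow, cgf]

lemma mgfDomain_subset_sumLaw (n : ℕ) : mgfDomain ν ⊆ mgfDomain (sumLaw ν n) := by
  intro s hs
  have h : Integrable (fun y : Fin n → E m => ∏ i, Real.exp (inner ℝ s (y i)))
      (Measure.pi fun _ => ν) := Integrable.fintype_prod (fun _ => hs)
  have hc : Continuous fun y : E m => Real.exp (inner ℝ s y) := by fun_prop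
  rw [mgfDomain, mem_ofPred_eq, sumLaw,
    integrable_map_measure hc.aestronglyMeasurable (measurable_sum_pi n).aemeasurable]
  refine h.congr (ae_of_all _ fun y => ?_)
  simp [inner_sum, Real.exp_sum]

lemma secondPD_const_mul {W : Type*} [NormedAddCommGroup W] [NormedSpace ℝ W] (c : ℝ) (f : W → ℝ)
    (q u v : W) : secondPD (fun r => c * f r) q u v = c * secondPD f q u v := by
  have h : ∀ (g : W → ℝ) (r w : W), lineDeriv ℝ (fun r => c * g r) r w = c * lineDeriv ℝ g r w :=
    fun g r w => by simp only [lineDeriv]; exact deriv_const_mul_field c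
  simp only [secondPD, h]

lemma cgfHess_sumLaw (n : ℕ) (s : E m) : cgfHess (sumLaw ν n) s = (n : ℝ) • cgfHess ν s := by
  ext i j
  simp [cgfHess, cgf_sumLaw, secondPD_const_mul]

/-- `saddlepoint` is an arbitrary choice among solutions. All solutions, including boundary ones,
minimise K(s) - sx, so an interior solution with positive definite Hessian is the only one. -/
lemma IsSaddlepoint.eq_saddlepoint {ν : Measure (E m)} [NeZero ν] {x s : E m}
    (h : IsSaddlepoint ν x s) (hs : s ∈ interior (mgfDomain ν)) (hpos : (cgfHess ν s).PosDef) :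
    saddlepoint ν x = s := by
  have h' : IsSaddlepoint ν x (saddlepoint ν x) := Classical.epsilon_spec ⟨s, h⟩
  exact (eq_of_isMinOn hs h'.1 hpos (fun r hr => h.le hr) (h'.le h.1)).symm

lemma IsSaddlepoint.sumLaw {x s : E m} (h : IsSaddlepoint ν x s)
    (hs : s ∈ interior (mgfDomain ν)) (n : ℕ) :
    IsSaddlepoint (sumLaw ν n) ((n : ℝ) • x) s := by
  refine ⟨mgfDomain_subset_sumLaw n h.1, HasFDerivAt.hasFDerivWithinAt ?_⟩
  have h1 := (h.2.hasFDerivAt (mem_interior_iff_mem_nhds.1 hs)).const_mul (n : ℝ)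
  rw [cgf_sumLaw]
  convert! h1 using 1
  ext v; simp

lemma saddlepoint_sumLaw {x s : E m} (h : IsSaddlepoint ν x s)
    (hs : s ∈ interior (mgfDomain ν)) (hpos : (cgfHess ν s).PosDef) {n : ℕ} (hn : 1 ≤ n) :
    saddlepoint (sumLaw ν n) ((n : ℝ) • x) = s := by
  refine (h.sumLaw hs n).eq_saddlepoint (interior_mono (mgfDomain_subset_sumLaw n) hs) ?_
  rw [cgfHess_sumLaw]
  exact hpos.smul (by exact_mod_cast hn)

lemma zerothSPA_sumLaw {x s : E m} (h : IsSaddlepoint ν x s)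
    (hs : s ∈ interior (mgfDomain ν)) (hpos : (cgfHess ν s).PosDef) {n : ℕ} (hn : 1 ≤ n) :
    zerothSPA (sumLaw ν n) ((n : ℝ) • x) = Real.exp (n * (cgf ν s - inner ℝ s x)) := by
  rw [zerothSPA, saddlepoint_sumLaw h hs hpos hn, cgf_sumLaw, inner_smul_right, mul_sub]

lemma spa_sumLaw {x s : E m} (h : IsSaddlepoint ν x s)
    (hs : s ∈ interior (mgfDomain ν)) (hpos : (cgfHess ν s).PosDef) {n : ℕ} (hn : 1 ≤ n) :
    spa (sumLaw ν n) ((n : ℝ) • x) = Real.exp (n * (cgf ν s - inner ℝ s x)) /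
      (√((2 * Real.pi * n) ^ m) * √(cgfHess ν s).det) := by
  rw [spa, saddlepoint_sumLaw h hs hpos hn, cgf_sumLaw, inner_smul_right, mul_sub, cgfHess_sumLaw,
    smul_smul, Matrix.det_smul, Fintype.card_fin, Real.sqrt_mul (by positivity)]

end SumLaw

/-! ### The inversion formula -/

/-- Substitute φ = u/√n. The n-th power of the generating function is that of the sum, and the n-th
power of the centring phase is the Fourier phase at x = nK₀'. -/
lemma invFactor_eq (S : Set (E m)) (hS : MeasurableSet S) {n : ℕ} {q : E m × E p}
    [IsProbabilityMeasure (μ q.2)] :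
    invFactor μ S n q = (√n ^ m : ℝ) * ((jointReal μ q : ℂ) ^ n)⁻¹ *
      ∫ φ in S, cmgf (sumLaw (μ q.2) n) q.1 φ *
        Complex.exp (-((inner ℝ φ ((n : ℝ) • cgfGrad μ q) : ℝ) : ℂ) * Complex.I) := by
  have h1 := Measure.integral_comp_inv_smul_of_nonneg (volume : Measure (E m))
    (S.indicator fun φ => normMGF μ φ q ^ n) (Real.sqrt_nonneg (n : ℝ))
  rw [finrank_euclideanSpace, Fintype.card_fin, integral_indicator hS] at h1
  have e1 : ∫ φ in S, normMGF μ φ q ^ n = ((jointReal μ q : ℂ) ^ n)⁻¹ *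
      ∫ φ in S, cmgf (sumLaw (μ q.2) n) q.1 φ *
        Complex.exp (-((inner ℝ φ ((n : ℝ) • cgfGrad μ q) : ℝ) : ℂ) * Complex.I) := by
    rw [← integral_const_mul]
    refine integral_congr_ae (ae_of_all _ fun φ => ?_)
    have h2 : jointMoment μ [] (q, φ) = cmgf (μ q.2) q.1 φ := by
      rw [cmgf_eq_expMoment]; rfl
    simp only [normMGF, h2, mul_pow, inv_pow, cmgf_sumLaw, ← Complex.exp_nat_mul, inner_smul_right]
    rw [mul_assoc]
    congr 3
    push_cast; ring
  rw [e1, Complex.real_smul] at h1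
  rw [mul_assoc, ← h1]
  rfl

/-! ### Fourier inversion on the integer lattice -/

section Lattice

lemma integral_exp_int (k : ℤ) :
    ∫ t in Icc (-Real.pi) Real.pi, Complex.exp ((t * k : ℝ) * Complex.I) =
      if k = 0 then (2 * Real.pi : ℂ) else 0 := by
  rw [integral_Icc_eq_integral_Ioc, ← intervalIntegral.integral_of_le (by linarith [Real.pi_pos])]
  split_ifs with hk
  · simp [hk]; ring
  · have hk' : (k : ℂ) * Complex.I ≠ 0 := by simp [hk]
    have h := integral_exp_mul_complex (a := -Real.pi) (b := Real.pi) hk'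
    have e : ∀ t : ℝ, Complex.exp ((t * k : ℝ) * Complex.I) =
        Complex.exp (k * Complex.I * t) := fun t => by congr 1; push_cast; ring
    simp only [e]
    rw [h, div_eq_zero_iff]
    left
    rw [sub_eq_zero, Complex.exp_eq_exp_iff_exists_int]
    exact ⟨k, by push_cast; ring⟩

/-- Orthogonality of characters: the integral factorises over coordinates, and one non-zero
coordinate annihilates the product. -/
lemma integral_cube_exp {z : E m} (hz : z ∈ intLattice m) :
    ∫ φ in cube m, Complex.exp ((inner ℝ φ z : ℝ) * Complex.I) =
      if z = 0 then ((2 * Real.pi : ℝ) ^ m : ℂ) else 0 := by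
  choose k hk using hz
  have hmp := EuclideanSpace.volume_preserving_symm_measurableEquiv_toLp (Fin m)
  have h1 := hmp.setIntegral_preimage_emb (MeasurableEquiv.measurableEmbedding _)
    (fun t : Fin m → ℝ => Complex.exp (((∑ b, t b * z b : ℝ) : ℂ) * Complex.I))
    (Set.pi univ fun _ => Icc (-Real.pi) Real.pi)
  have h2 : ((MeasurableEquiv.toLp 2 (Fin m → ℝ)).symm ⁻¹'
      (Set.pi univ fun _ => Icc (-Real.pi) Real.pi)) = cube m := by
    ext φ; simp [cube, Pi.le_def, forall_and]
  rw [h2] at h1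
  have h3 : ∫ φ in cube m, Complex.exp ((inner ℝ φ z : ℝ) * Complex.I) =
      ∫ t in Set.pi univ fun _ : Fin m => Icc (-Real.pi) Real.pi,
        Complex.exp (((∑ b, t b * z b : ℝ) : ℂ) * Complex.I) := by
    rw [← h1]; simp only [inner_euclidean]; rfl
  rw [h3, volume_pi, Measure.restrict_pi_pi]
  have h4 : ∀ t : Fin m → ℝ, Complex.exp (((∑ b, t b * z b : ℝ) : ℂ) * Complex.I) =
      ∏ b, Complex.exp ((t b * k b : ℝ) * Complex.I) := fun t => by
    rw [← Complex.exp_sum]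
    congr 1
    rw [← Finset.sum_mul]; push_cast; simp only [hk]; push_cast; rfl
  simp only [h4]
  rw [integral_fintype_prod_eq_prod (𝕜 := ℂ)
    (f := fun b t => Complex.exp ((t * k b : ℝ) * Complex.I))]
  simp only [integral_exp_int]
  split_ifs with h0
  · have : ∀ b, k b = 0 := fun b => by
      have : (k b : ℝ) = 0 := by rw [← hk, h0]; rfl
      exact_mod_cast this
    simp [this]
  · obtain ⟨b, hb⟩ : ∃ b, k b ≠ 0 := by
      by_contra! hall
      exact h0 (by ext b; simp [hk, hall])
    exact Finset.prod_eq_zero (Finset.mem_univ b) (by simp [hb])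

lemma measurableSet_intLattice : MeasurableSet (intLattice m) := by
  have : intLattice m = ⋂ i, (fun x : E m => x i) ⁻¹' (range ((↑) : ℤ → ℝ)) := by
    ext x; simp [intLattice, eq_comm]
  rw [this]
  exact MeasurableSet.iInter fun i => (countable_range _).measurableSet.preimage (by fun_prop)

lemma sumLaw_mem_intLattice {ν : Measure (E m)} [IsProbabilityMeasure ν]
    (h : ∀ᵐ y ∂ν, y ∈ intLattice m) (n : ℕ) : ∀ᵐ y ∂sumLaw ν n, y ∈ intLattice m := by
  rw [sumLaw, ae_map_iff (p := (· ∈ intLattice m)) (measurable_sum_pi n).aemeasurable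
    measurableSet_intLattice]
  have h1 : ∀ᵐ y ∂(Measure.pi fun _ : Fin n => ν), ∀ i, y i ∈ intLattice m :=
    ae_all_iff.2 fun i => Measure.tendsto_eval_ae_ae.eventually h
  filter_upwards [h1] with y hy b
  choose k hk using fun i => hy i b
  exact ⟨∑ i, k i, by simp [hk]⟩

/-- Fourier inversion for a law on the integer lattice. -/
lemma integral_cube_cmgf {P : Measure (E m)} [IsFiniteMeasure P] (hP : ∀ᵐ y ∂P, y ∈ intLattice m)
    {s x : E m} (hs : s ∈ mgfDomain P) (hx : x ∈ intLattice m) :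
    ∫ φ in cube m, cmgf P s φ * Complex.exp (-((inner ℝ φ x : ℝ) : ℂ) * Complex.I) =
      ((2 * Real.pi) ^ m * Real.exp (inner ℝ s x) * P.real {x} : ℝ) := by
  have : IsFiniteMeasure (volume.restrict (cube m)) :=
    ⟨by simpa using (isCompact_cube (m := m)).measure_lt_top⟩
  have hint : Integrable (fun z : E m × E m => Complex.exp ((inner ℝ s z.2 : ℝ) +
      (inner ℝ z.1 z.2 : ℝ) * Complex.I) * Complex.exp (-((inner ℝ z.1 x : ℝ) : ℂ) * Complex.I))
      ((volume.restrict (cube m)).prod P) := by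
    have h1 : Integrable (fun z : E m × E m => (1 : ℝ) * Real.exp (inner ℝ s z.2))
        ((volume.restrict (cube m)).prod P) := (integrable_const (1 : ℝ)).mul_prod hs
    refine h1.mono' (Continuous.aestronglyMeasurable (by fun_prop)) (ae_of_all _ fun z => ?_)
    rw [norm_mul, Complex.norm_exp, Complex.norm_exp]
    simp
  have h2 := integral_integral_swap (f := fun φ y => Complex.exp ((inner ℝ s y : ℝ) +
      (inner ℝ φ y : ℝ) * Complex.I) * Complex.exp (-((inner ℝ φ x : ℝ) : ℂ) * Complex.I)) hint
  have h3 : ∀ φ, cmgf P s φ * Complex.exp (-((inner ℝ φ x : ℝ) : ℂ) * Complex.I) =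
      ∫ y, Complex.exp ((inner ℝ s y : ℝ) + (inner ℝ φ y : ℝ) * Complex.I) *
        Complex.exp (-((inner ℝ φ x : ℝ) : ℂ) * Complex.I) ∂P := fun φ =>
    (integral_mul_const _ _).symm
  simp only [h3]
  rw [h2]
  -- After Fubini, orthogonality leaves only the atom y = x.
  have h4 : ∀ᵐ y ∂P, ∫ φ in cube m, Complex.exp ((inner ℝ s y : ℝ) +
      (inner ℝ φ y : ℝ) * Complex.I) * Complex.exp (-((inner ℝ φ x : ℝ) : ℂ) * Complex.I) =
      ({x} : Set (E m)).indicator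
        (fun _ => (((2 * Real.pi) ^ m * Real.exp (inner ℝ s x) : ℝ) : ℂ)) y := by
    filter_upwards [hP] with y hy
    have h5 : y - x ∈ intLattice m := fun b => by
      obtain ⟨k, hk⟩ := hy b
      obtain ⟨l, hl⟩ := hx b
      exact ⟨k - l, by simp [hk, hl]⟩
    have h6 : ∀ φ : E m, Complex.exp ((inner ℝ s y : ℝ) + (inner ℝ φ y : ℝ) * Complex.I) *
        Complex.exp (-((inner ℝ φ x : ℝ) : ℂ) * Complex.I) =
        Complex.exp ((inner ℝ s y : ℝ) : ℂ) *
          Complex.exp ((inner ℝ φ (y - x) : ℝ) * Complex.I) := fun φ => by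
      rw [← Complex.exp_add, ← Complex.exp_add, inner_sub_right]
      congr 1; push_cast; ring
    simp only [h6]
    rw [integral_const_mul, integral_cube_exp h5]
    by_cases hyx : y = x
    · simp [hyx, mul_comm]
    · simp [hyx, sub_eq_zero]
  rw [integral_congr_ae h4, integral_indicator (measurableSet_singleton x), setIntegral_const,
    Complex.real_smul, ← Complex.ofReal_mul, mul_comm]

end Lattice

/-! ### Fourier inversion for densities -/

section Density

/-- Two densities of one measure agree almost everywhere, and continuous functions that do so agree
everywhere; so the choice in `contDensity` is harmless. -/
lemma IsContDensity.contDensity_eq {ν : Measure (E m)} [IsFiniteMeasure ν] {f : E m → ℝ}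
    (h : IsContDensity ν f) : contDensity ν = f := by
  have hex : ∃ f, IsContDensity ν f := ⟨f, h⟩
  have h1 : contDensity ν = hex.choose := by funext x; rw [contDensity, dif_pos hex]
  obtain ⟨hc, h0, hν⟩ := hex.choose_spec
  rw [h1]
  obtain ⟨hc', h0', hν'⟩ := h
  have hfin : ∫⁻ x, ENNReal.ofReal (f x) ≠ ⊤ := by
    have := congrArg (fun κ : Measure (E m) => κ univ) hν'
    simp only [withDensity_apply _ MeasurableSet.univ, Measure.restrict_univ] at this
    rw [← this]; exact measure_ne_top _ _
  have h2 := (withDensity_eq_iff hc'.measurable.ennreal_ofReal.aemeasurable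
    hc.measurable.ennreal_ofReal.aemeasurable hfin).1 (hν'.symm.trans hν)
  have h3 : hex.choose =ᵐ[volume] f := by
    filter_upwards [h2] with x hx
    exact ((ENNReal.ofReal_eq_ofReal_iff (h0' x) (h0 x)).1 hx).symm
  exact (Continuous.ae_eq_iff_eq volume hc hc').1 h3

/-- Fourier inversion for a law whose tilted characteristic function is integrable. -/
lemma contDensity_eq_integral_cmgf {P : Measure (E m)} [IsFiniteMeasure P] {s : E m}
    (hs : s ∈ mgfDomain P) (hF : Integrable (cmgf P s)) (x : E m) :
    ∫ φ in univ, cmgf P s φ * Complex.exp (-((inner ℝ φ x : ℝ) : ℂ) * Complex.I) =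
      ((2 * Real.pi) ^ m * Real.exp (inner ℝ s x) * contDensity P x : ℝ) := by
  have hmeas : Measurable fun y : E m => ENNReal.ofReal (Real.exp (inner ℝ s y)) :=
    (by fun_prop : Continuous fun y : E m => Real.exp (inner ℝ s y)).measurable.ennreal_ofReal
  -- The unnormalised tilted law has `cmgf P s` as its characteristic function. It therefore has a
  -- continuous density, and tilting back by exp(-sy) gives one for P; existence is obtained here,
  -- not assumed.
  set τ := P.withDensity fun y => ENNReal.ofReal (Real.exp (inner ℝ s y))
  have : IsFiniteMeasure τ := isFiniteMeasure_withDensity_ofReal hs.2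
  have hchar : charFun τ = cmgf P s := by
    funext φ
    rw [charFun_apply, integral_withDensity_eq_integral_toReal_smul hmeas
      (ae_of_all _ fun _ => ENNReal.ofReal_lt_top), cmgf]
    refine integral_congr_ae (ae_of_all _ fun y => ?_)
    simp only [ENNReal.toReal_ofReal (Real.exp_pos _).le, Complex.real_smul, Complex.ofReal_exp]
    rw [← Complex.exp_add, real_inner_comm y φ]
  rw [← hchar] at hF
  have hdens : IsContDensity P fun y => Real.exp (-inner ℝ s y) * (charFunInv τ y).re := by
    refine ⟨?_, fun y => mul_nonneg (Real.exp_pos _).le (re_charFunInv_nonneg hF y), ?_⟩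
    · exact (by fun_prop : Continuous fun y : E m => Real.exp (-inner ℝ s y)).mul
        (Complex.continuous_re.comp (continuous_charFunInv hF))
    · have hm2 : Measurable fun y : E m => ENNReal.ofReal (Real.exp (-inner ℝ s y)) :=
        (by fun_prop : Continuous fun y : E m => Real.exp (-inner ℝ s y)).measurable.ennreal_ofReal
      have hm3 : Measurable fun y : E m => ENNReal.ofReal (charFunInv τ y).re :=
        (Complex.continuous_re.comp (continuous_charFunInv hF)).measurable.ennreal_ofReal
      have h1 : τ.withDensity (fun y => ENNReal.ofReal (Real.exp (-inner ℝ s y))) = P := by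
        rw [← withDensity_mul _ hmeas hm2]
        have : ((fun y : E m => ENNReal.ofReal (Real.exp (inner ℝ s y))) *
            fun y => ENNReal.ofReal (Real.exp (-inner ℝ s y))) = 1 := by
          funext y
          simp only [Pi.mul_apply, Pi.one_apply]
          rw [← ENNReal.ofReal_mul (Real.exp_pos _).le, ← Real.exp_add]
          simp
        rw [this, withDensity_one]
      conv_lhs => rw [← h1, eq_withDensity_charFunInv hF]
      rw [← withDensity_mul _ hm3 hm2]
      congr 1
      funext y
      simp only [Pi.mul_apply]
      rw [← ENNReal.ofReal_mul (re_charFunInv_nonneg hF y), mul_comm]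
  rw [hdens.contDensity_eq, Measure.restrict_univ]
  have h2 := charFunInv_eq (τ := τ) x
  rw [hchar, finrank_euclideanSpace, Fintype.card_fin, ← ofReal_re_charFunInv, Complex.real_smul] at h2
  have h3 : ((2 * Real.pi) ^ m : ℝ) ≠ 0 := by positivity
  have h4 : ((((2 * Real.pi) ^ m : ℝ)) : ℂ) ≠ 0 := by exact_mod_cast h3
  have h5 : Real.exp (inner ℝ s x) * (Real.exp (-inner ℝ s x) * (charFunInv τ x).re) =
      (charFunInv τ x).re := by
    rw [← mul_assoc, ← Real.exp_add]; simp
  rw [mul_assoc, h5, Complex.ofReal_mul, h2, Complex.ofReal_inv, mul_inv_cancel_left₀ h4]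

end Density

end Saddlepoint

/-! ### A common interface for the two cases -/

namespace Saddlepoint

variable {m p : ℕ} {D : Set (E p)} {μ : E p → Measure (E m)}

/-- The properties common to the absolutely continuous and the integer-valued case: the likelihood
`L` of admissible observations is obtained by Fourier inversion over the set `S`. -/
structure IsInvertible (D : Set (E p)) (μ : E p → Measure (E m)) (S : Set (E m))
    (L : ℕ → E p → E m → ℝ) (adm : Set (E m)) : Prop where
  measurableSet : MeasurableSet S
  mem_nhds : S ∈ 𝓝 0
  decay : ∀ q ∈ interior (jointDomain D μ), LocalDecay μ S q
  posDef : ∀ q ∈ interior (jointDomain D μ), (cgfHess (μ q.2) q.1).PosDef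
  inversion : ∀ q ∈ interior (jointDomain D μ), ∀ n ≥ 1,
    Integrable (fun u => invKernel μ S n u q) → (n : ℝ) • cgfGrad μ q ∈ adm →
    ∫ φ in S, cmgf (sumLaw (μ q.2) n) q.1 φ *
        Complex.exp (-((inner ℝ φ ((n : ℝ) • cgfGrad μ q) : ℝ) : ℂ) * Complex.I) =
      ((2 * Real.pi) ^ m * Real.exp (inner ℝ q.1 ((n : ℝ) • cgfGrad μ q)) *
        L n q.2 ((n : ℝ) • cgfGrad μ q) : ℝ)

lemma continuous_cmgf {ν : Measure (E m)} [IsFiniteMeasure ν] {s : E m} (hs : s ∈ mgfDomain ν) :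
    Continuous (cmgf ν s) := by
  refine continuous_of_dominated (bound := fun y => Real.exp (inner ℝ s y)) (fun φ => ?_)
    (fun φ => ae_of_all _ fun y => ?_) hs (ae_of_all _ fun y => by fun_prop)
  · exact (by fun_prop : Continuous fun y : E m => Complex.exp ((inner ℝ s y : ℝ) +
      (inner ℝ φ y : ℝ) * Complex.I)).aestronglyMeasurable
  · rw [Complex.norm_exp]; simp

/-- Integrability of the rescaled kernel, available for large n, is that of the tilted
characteristic function of the sum, and this is what provides the continuous density. The lattice
case needs no such premise, as its frequencies fill a compact cube. -/
lemma isInvertible_densityLik (hM : IsModel D μ) (hd : DecayBound D μ) :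
    IsInvertible D μ univ (densityLik μ) univ where
  measurableSet := MeasurableSet.univ
  mem_nhds := univ_mem
  decay _ hq := hd.localDecay hM hq
  posDef _ hq := hd.posDef hM hq
  inversion q hq n hn hint _ := by
    have := hM.isProbabilityMeasure q.2 (interior_subset hq).1
    have hs : q.1 ∈ mgfDomain (sumLaw (μ q.2) n) :=
      mgfDomain_subset_sumLaw n (interior_subset hq).2
    refine contDensity_eq_integral_cmgf hs ?_ _
    have hn0 : (√(n : ℝ))⁻¹ ≠ 0 := by positivity
    have h1 : Integrable fun φ : E m => normMGF μ φ q ^ n := by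
      refine (integrable_comp_smul_iff volume (fun φ : E m => normMGF μ φ q ^ n) hn0).1 ?_
      simpa [invKernel] using hint
    have hM0 : 0 < mgf (μ q.2) q.1 := hM.jointReal_pos hq
    have h2 := h1.norm.const_mul (mgf (μ q.2) q.1 ^ n)
    refine h2.mono' (continuous_cmgf hs).aestronglyMeasurable (ae_of_all _ fun φ => ?_)
    rw [cmgf_sumLaw, norm_pow, norm_pow, norm_normMGF hM hq, div_pow, mul_div_cancel₀]
    positivity

lemma isInvertible_pmfLik (hM : IsModel D μ) (hG : GrowthBound D μ) (hi : IsIntegerValued D μ)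
    (hn : NonLattice D μ) : IsInvertible D μ (cube m) (pmfLik μ) (intLattice m) where
  measurableSet := isCompact_cube.measurableSet
  mem_nhds := cube_mem_nhds
  decay _ hq := hn.localDecay hM hG hq
  posDef _ hq := hn.posDef hM hq
  inversion q hq n _ _ hx := by
    have := hM.isProbabilityMeasure q.2 (interior_subset hq).1
    exact integral_cube_cmgf (sumLaw_mem_intLattice (hi q.2 (interior_subset hq).1) n)
      (mgfDomain_subset_sumLaw n (interior_subset hq).2) hx

/-- The likelihood in terms of the correction factor. -/
lemma IsInvertible.lik_eq {S : Set (E m)} {L : ℕ → E p → E m → ℝ} {adm : Set (E m)}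
    (hI : IsInvertible D μ S L adm) (hM : IsModel D μ) {q : E m × E p}
    (hq : q ∈ interior (jointDomain D μ)) {n : ℕ} (hn : 1 ≤ n)
    (hint : Integrable (fun u => invKernel μ S n u q)) (hadm : (n : ℝ) • cgfGrad μ q ∈ adm) :
    L n q.2 ((n : ℝ) • cgfGrad μ q) = (√n ^ m * (2 * Real.pi) ^ m)⁻¹ *
      (Real.exp (n * (cgf (μ q.2) q.1 - inner ℝ q.1 (cgfGrad μ q))) * (invFactor μ S n q).re) := by
  have := hM.isProbabilityMeasure q.2 (interior_subset hq).1
  have h1 := invFactor_eq S hI.measurableSet (n := n) (q := q) (μ := μ)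
  rw [hI.inversion q hq n hn hint hadm, ← Complex.ofReal_pow, ← Complex.ofReal_inv,
    ← Complex.ofReal_mul, ← Complex.ofReal_mul] at h1
  have hpos := hM.jointReal_pos hq
  have h2 : jointReal μ q ^ n = Real.exp (n * cgf (μ q.2) q.1) := by
    rw [cgf, ← Real.log_pow, Real.exp_log]; rfl
    exact pow_pos hpos n
  rw [h1, Complex.ofReal_re, h2, inner_smul_right, mul_sub, Real.exp_sub]
  have hn' : (√(n : ℝ)) ^ m ≠ 0 := by positivity
  have e1 := (Real.exp_pos (n * cgf (μ q.2) q.1)).ne'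
  have e2 := (Real.exp_pos (n * inner ℝ q.1 (cgfGrad μ q))).ne'
  have e3 := Real.pi_ne_zero
  field_simp

end Saddlepoint

/-! ### The saddlepoint and ψ as C² functions of (y, θ) -/

namespace Saddlepoint

variable {m p : ℕ} {D : Set (E p)} {μ : E p → Measure (E m)}

section SecondDerivative

variable {W : Type*} [NormedAddCommGroup W] [NormedSpace ℝ W] {f : W → ℝ} {Ω : Set W}

lemma secondPD_eq_fderiv (hΩ : IsOpen Ω) (hf : ContDiffOn ℝ 2 f Ω) {q : W} (hq : q ∈ Ω)
    (u v : W) : secondPD f q u v = fderiv ℝ (fderiv ℝ f) q u v := by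
  have h1 : (fun r => lineDeriv ℝ f r v) =ᶠ[𝓝 q] fun r => fderiv ℝ f r v := by
    filter_upwards [hΩ.mem_nhds hq] with r hr
    exact ((hasFDerivAt_of_contDiffOn hΩ hf hr).hasLineDerivAt v).lineDeriv
  rw [secondPD, h1.lineDeriv_eq]
  have h2 : HasFDerivAt (fun r => fderiv ℝ f r v) ((fderiv ℝ (fderiv ℝ f) q).flip v) q := by
    have := (hasFDerivAt_fderiv hΩ hf hq).clm_apply (hasFDerivAt_const v q)
    convert! this using 1
    ext w; simp
  exact (h2.hasLineDerivAt u).lineDeriv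

lemma fderiv_fderiv_comm (hΩ : IsOpen Ω) (hf : ContDiffOn ℝ 2 f Ω) {q : W} (hq : q ∈ Ω)
    (u v : W) : fderiv ℝ (fderiv ℝ f) q u v = fderiv ℝ (fderiv ℝ f) q v u :=
  (hf.contDiffAt (hΩ.mem_nhds hq)).isSymmSndFDerivAt (by simp) u v

end SecondDerivative

lemma IsModel.contDiffOn_jointCGF (hM : IsModel D μ) (hG : GrowthBound D μ) :
    ContDiffOn ℝ 2 (jointCGF μ) (interior (jointDomain D μ)) :=
  (contDiffOn_jointReal hG).log fun _ hq => (hM.jointReal_pos hq).ne'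

lemma inner_cgfGrad {q : E m × E p} (hq : q ∈ interior (jointDomain D μ)) (w : E m) :
    (inner ℝ w (cgfGrad μ q) : ℝ) =
      realMoment (μ q.2) (fun y => inner ℝ w y) q.1 / mgf (μ q.2) q.1 := by
  rw [realMoment_inner (mem_interior_mgfDomain hq), inner_euclidean, Finset.sum_div]
  exact Finset.sum_congr rfl fun b _ => by rw [cgfGrad_apply, mul_div_assoc]

lemma IsModel.fderiv_jointCGF_inl (hM : IsModel D μ) (hG : GrowthBound D μ) {q : E m × E p}
    (hq : q ∈ interior (jointDomain D μ)) (v : E m) :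
    fderiv ℝ (jointCGF μ) q (v, 0) = inner ℝ v (cgfGrad μ q) := by
  have := hM.neZero hq
  have h1 := (hasFDerivAt_of_contDiffOn isOpen_interior (hM.contDiffOn_jointCGF hG)
    hq).hasLineDerivAt (v, 0)
  have h2 : HasLineDerivAt ℝ (jointCGF μ) (inner ℝ v (cgfGrad μ q)) (q.1, q.2) (v, 0) := by
    refine hasLineDerivAt_left_of_section.2 ?_
    rw [inner_cgfGrad hq]
    exact hasLineDerivAt_cgf (mem_interior_mgfDomain hq) v
  exact HasLineDerivAt.unique h1 h2

lemma IsModel.hasFDerivAt_cgf (hM : IsModel D μ) (hG : GrowthBound D μ) {q : E m × E p}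
    (hq : q ∈ interior (jointDomain D μ)) :
    HasFDerivAt (cgf (μ q.2)) (innerSL ℝ (cgfGrad μ q)) q.1 := by
  have h1 := HasFDerivAt.comp (f := fun s => (s, q.2)) q.1
    (hasFDerivAt_of_contDiffOn isOpen_interior (hM.contDiffOn_jointCGF hG) hq)
    (hasFDerivAt_prodMk_left q.1 q.2)
  convert! h1 using 1
  ext v
  simp [hM.fderiv_jointCGF_inl hG hq, real_inner_comm]

/-- At interior points the derivative within the domain is the ordinary gradient. -/
lemma IsModel.isSaddlepoint_iff (hM : IsModel D μ) (hG : GrowthBound D μ) {q : E m × E p}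
    (hq : q ∈ interior (jointDomain D μ)) {y : E m} :
    IsSaddlepoint (μ q.2) y q.1 ↔ cgfGrad μ q = y := by
  have h1 := hM.hasFDerivAt_cgf hG hq
  constructor
  · rintro ⟨-, h⟩
    have h2 := (h.hasFDerivAt (mem_interior_iff_mem_nhds.1 (mem_interior_mgfDomain hq))).unique h1
    exact (innerSL_inj.1 h2).symm
  · rintro rfl
    exact ⟨(interior_subset hq).2, h1.hasFDerivWithinAt⟩

lemma IsModel.fderiv_fderiv_jointCGF_inl (hM : IsModel D μ) (hG : GrowthBound D μ) {q : E m × E p}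
    (hq : q ∈ interior (jointDomain D μ)) (w : E m × E p) (v : E m) :
    fderiv ℝ (fderiv ℝ (jointCGF μ)) q w (v, 0) = inner ℝ v (fderiv ℝ (cgfGrad μ) q w) := by
  have h1 := (hasFDerivAt_fderiv isOpen_interior (hM.contDiffOn_jointCGF hG) hq).clm_apply
    (hasFDerivAt_const ((v, 0) : E m × E p) q)
  have h2 := (hasFDerivAt_const v q).inner ℝ
    (hasFDerivAt_of_contDiffOn isOpen_interior (hM.contDiffOn_cgfGrad hG) hq)
  have h3 : (fun q => fderiv ℝ (jointCGF μ) q (v, 0)) =ᶠ[𝓝 q] fun q => inner ℝ v (cgfGrad μ q) := by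
    filter_upwards [isOpen_interior.mem_nhds hq] with r hr using hM.fderiv_jointCGF_inl hG hr v
  have h4 := congrArg (fun T => T w) (h1.unique (h2.congr_of_eventuallyEq h3))
  simpa using h4

lemma IsModel.inner_fderiv_cgfGrad_inl (hM : IsModel D μ) (hG : GrowthBound D μ) {q : E m × E p}
    (hq : q ∈ interior (jointDomain D μ)) (v w : E m) :
    inner ℝ w (fderiv ℝ (cgfGrad μ) q (v, 0)) = tiltedCov (μ q.2) q.1 v w := by
  have := hM.neZero hq
  have h2 := (hasFDerivAt_const w q).inner ℝ
    (hasFDerivAt_of_contDiffOn isOpen_interior (hM.contDiffOn_cgfGrad hG) hq)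
  have h3 : HasLineDerivAt ℝ (fun q => (inner ℝ w (cgfGrad μ q) : ℝ))
      (tiltedCov (μ q.2) q.1 v w) (q.1, q.2) (v, 0) := by
    refine hasLineDerivAt_left_of_section.2 ?_
    have hs := mem_interior_mgfDomain hq
    refine HasLineDerivAt.congr_of_eventuallyEq (hasLineDerivAt_tiltedMean hs v w) ?_
    have : Continuous fun s : E m => (s, q.2) := by fun_prop
    filter_upwards [this.continuousAt.preimage_mem_nhds (isOpen_interior.mem_nhds hq)] with s hs'
    exact inner_cgfGrad (q := (s, q.2)) hs' w
  have h4 := HasLineDerivAt.unique (h2.hasLineDerivAt (v, 0)) h3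
  simpa using h4

/-- The map `(s, θ) ↦ (K₀'(s; θ), θ)`. -/
noncomputable def gradMap (μ : E p → Measure (E m)) (q : E m × E p) : E m × E p :=
  (cgfGrad μ q, q.2)

/-- The map `(y, θ) ↦ (ŝ₀(θ; y), θ)`. -/
noncomputable def saddleMap (μ : E p → Measure (E m)) (z : E m × E p) : E m × E p :=
  (saddlepoint (μ z.2) z.1, z.2)

/-- Uniqueness of the saddlepoint makes `gradMap` globally injective on the interior of 𝒮, so local
inverses of it must coincide with `saddleMap`. -/
lemma saddleMap_gradMap (hM : IsModel D μ) (hG : GrowthBound D μ) {q : E m × E p}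
    (hq : q ∈ interior (jointDomain D μ)) (hA : (cgfHess (μ q.2) q.1).PosDef) :
    saddleMap μ (gradMap μ q) = q := by
  have := hM.neZero hq
  have h := ((hM.isSaddlepoint_iff hG hq).2 rfl).eq_saddlepoint (mem_interior_mgfDomain hq) hA
  exact Prod.ext h rfl

lemma gradMap_mem_saddleRegion (hM : IsModel D μ) (hG : GrowthBound D μ) {q : E m × E p}
    (hq : q ∈ interior (jointDomain D μ)) : gradMap μ q ∈ saddleRegion D μ :=
  ⟨q.1, (hM.isSaddlepoint_iff hG hq).2 rfl, hq⟩

section SaddleMap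

variable (hM : IsModel D μ) (hG : GrowthBound D μ)
  (hA : ∀ q ∈ interior (jointDomain D μ), (cgfHess (μ q.2) q.1).PosDef)

lemma exists_gradMap_eq (hM : IsModel D μ) (hG : GrowthBound D μ) {z : E m × E p}
    (hz : z ∈ saddleRegion D μ) : ∃ q ∈ interior (jointDomain D μ), gradMap μ q = z := by
  obtain ⟨s, hs, hq⟩ := hz
  exact ⟨(s, z.2), hq, Prod.ext ((hM.isSaddlepoint_iff hG hq).1 hs) rfl⟩

include hM hG hA

lemma saddleMap_mem {z : E m × E p} (hz : z ∈ saddleRegion D μ) :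
    saddleMap μ z ∈ interior (jointDomain D μ) := by
  obtain ⟨q, hq, rfl⟩ := exists_gradMap_eq hM hG hz
  rwa [saddleMap_gradMap hM hG hq (hA q hq)]

lemma gradMap_saddleMap {z : E m × E p} (hz : z ∈ saddleRegion D μ) :
    gradMap μ (saddleMap μ z) = z := by
  obtain ⟨q, hq, rfl⟩ := exists_gradMap_eq hM hG hz
  rw [saddleMap_gradMap hM hG hq (hA q hq)]

/-- Inverse function theorem for `gradMap`: its derivative is block triangular with diagonal blocks
A and the identity, hence injective because A is positive definite. The C² local inverse is
`saddleMap` by uniqueness. -/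
lemma saddleRegion_mem_nhds {z : E m × E p} (hz : z ∈ saddleRegion D μ) :
    saddleRegion D μ ∈ 𝓝 z ∧ ContDiffAt ℝ 2 (saddleMap μ) z := by
  obtain ⟨q, hq, rfl⟩ := exists_gradMap_eq hM hG hz
  have := hM.neZero hq
  have hc := (hM.contDiffOn_cgfGrad hG).contDiffAt (isOpen_interior.mem_nhds hq)
  have hc' : ContDiffAt ℝ 2 (gradMap μ) q := hc.prodMk contDiffAt_snd
  have hd := hasFDerivAt_of_contDiffOn isOpen_interior (hM.contDiffOn_cgfGrad hG) hq
  have hd' : HasFDerivAt (gradMap μ)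
      ((fderiv ℝ (cgfGrad μ) q).prod (ContinuousLinearMap.snd ℝ (E m) (E p))) q :=
    hd.prodMk hasFDerivAt_snd
  set T := (fderiv ℝ (cgfGrad μ) q).prod (ContinuousLinearMap.snd ℝ (E m) (E p))
  have hinj : Function.Injective T := by
    rw [injective_iff_map_eq_zero]
    rintro ⟨v, w⟩ h
    have h1 : fderiv ℝ (cgfGrad μ) q (v, w) = 0 := (Prod.ext_iff.1 h).1
    have h2 : w = 0 := (Prod.ext_iff.1 h).2
    subst h2
    by_contra hv
    have hv0 : v ≠ 0 := fun h => hv (by rw [h]; rfl)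
    have h3 := tiltedCov_pos_of_posDef (mem_interior_mgfDomain hq) (hA q hq) hv0
    rw [← hM.inner_fderiv_cgfGrad_inl hG hq, h1, inner_zero_right] at h3
    exact h3.false
  set e : (E m × E p) ≃L[ℝ] (E m × E p) :=
    (LinearEquiv.ofInjectiveEndo (T : (E m × E p) →ₗ[ℝ] (E m × E p)) hinj).toContinuousLinearEquiv
  have he : HasFDerivAt (gradMap μ) (e : (E m × E p) →L[ℝ] (E m × E p)) q := by
    convert! hd' using 1
  have hn : (2 : WithTop ℕ∞) ≠ 0 := by norm_num
  have hstrict := hc'.hasStrictFDerivAt' he hn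
  have h1 := hstrict.eventually_right_inverse
  have h2 := hstrict.localInverse_tendsto.eventually_mem (isOpen_interior.mem_nhds hq)
  have h3 := hc'.to_localInverse he hn
  constructor
  · filter_upwards [h1, h2] with z hz1 hz2
    rw [← hz1]
    exact gradMap_mem_saddleRegion hM hG hz2
  · refine h3.congr_of_eventuallyEq ?_
    filter_upwards [h1, h2] with z hz1 hz2
    have := saddleMap_gradMap hM hG hz2 (hA _ hz2)
    rw [hz1] at this
    exact this

lemma isOpen_saddleRegion : IsOpen (saddleRegion D μ) :=
  isOpen_iff_mem_nhds.2 fun _ hz => (saddleRegion_mem_nhds hM hG hA hz).1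

lemma contDiffOn_saddleMap : ContDiffOn ℝ 2 (saddleMap μ) (saddleRegion D μ) :=
  fun _ hz => (saddleRegion_mem_nhds hM hG hA hz).2.contDiffWithinAt

end SaddleMap

/-- `K₀(ŝ; θ) - ŝ y` at `(y, θ)`. -/
noncomputable def logZeroth (μ : E p → Measure (E m)) (z : E m × E p) : ℝ :=
  jointCGF μ (saddleMap μ z) - inner ℝ (saddleMap μ z).1 z.1

section LogZeroth

variable (hM : IsModel D μ) (hG : GrowthBound D μ)
  (hA : ∀ q ∈ interior (jointDomain D μ), (cgfHess (μ q.2) q.1).PosDef)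

include hM hG hA

lemma contDiffOn_logZeroth : ContDiffOn ℝ 2 (logZeroth μ) (saddleRegion D μ) := by
  have h := contDiffOn_saddleMap hM hG hA
  exact ((hM.contDiffOn_jointCGF hG).comp h fun _ hz => saddleMap_mem hM hG hA hz).sub
    (h.fst.inner ℝ contDiffOn_fst)

/-- The derivative of the saddlepoint. -/
lemma fderiv_saddleMap {z : E m × E p} (hz : z ∈ saddleRegion D μ) (w : E m × E p) :
    (fderiv ℝ (saddleMap μ) z w).2 = w.2 ∧
      fderiv ℝ (cgfGrad μ) (saddleMap μ z) (fderiv ℝ (saddleMap μ) z w) = w.1 := by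
  have hO := isOpen_saddleRegion hM hG hA
  have h1 := hasFDerivAt_of_contDiffOn hO (contDiffOn_saddleMap hM hG hA) hz
  have h2 := hasFDerivAt_of_contDiffOn isOpen_interior (hM.contDiffOn_cgfGrad hG)
    (saddleMap_mem hM hG hA hz)
  have h3 := (h2.comp z h1).prodMk h1.snd
  have h4 : (fun z => ((cgfGrad μ ∘ saddleMap μ) z, (saddleMap μ z).2)) =ᶠ[𝓝 z] id := by
    filter_upwards [hO.mem_nhds hz] with r hr using gradMap_saddleMap hM hG hA hr
  have h5 := congrArg (fun T => T w) ((h3.congr_of_eventuallyEq h4.symm).unique (hasFDerivAt_id z))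
  exact ⟨(Prod.ext_iff.1 h5).2, (Prod.ext_iff.1 h5).1⟩

/-- Envelope theorem: the contributions of the derivative of ŝ cancel because K₀'(ŝ) = y. -/
lemma fderiv_logZeroth {z : E m × E p} (hz : z ∈ saddleRegion D μ) (w : E m × E p) :
    fderiv ℝ (logZeroth μ) z w = fderiv ℝ (jointCGF μ) (saddleMap μ z) (0, w.2) -
      inner ℝ (saddleMap μ z).1 w.1 := by
  have hO := isOpen_saddleRegion hM hG hA
  have hq := saddleMap_mem hM hG hA hz
  have h1 := hasFDerivAt_of_contDiffOn hO (contDiffOn_saddleMap hM hG hA) hz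
  have h2 := hasFDerivAt_of_contDiffOn isOpen_interior (hM.contDiffOn_jointCGF hG) hq
  have h3 : HasFDerivAt (logZeroth μ) _ z := (h2.comp z h1).sub (h1.fst.inner ℝ hasFDerivAt_fst)
  rw [h3.fderiv]
  obtain ⟨e1, -⟩ := fderiv_saddleMap hM hG hA hz w
  have e2 : fderiv ℝ (saddleMap μ) z w =
      ((fderiv ℝ (saddleMap μ) z w).1, 0) + (0, w.2) := by
    ext1 <;> simp [e1]
  have e3 : cgfGrad μ (saddleMap μ z) = z.1 := (Prod.ext_iff.1 (gradMap_saddleMap hM hG hA hz)).1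
  have e4 := hM.fderiv_jointCGF_inl hG hq (fderiv ℝ (saddleMap μ) z w).1
  have e5 : fderiv ℝ (jointCGF μ) (saddleMap μ z) (fderiv ℝ (saddleMap μ) z w) =
      inner ℝ (fderiv ℝ (saddleMap μ) z w).1 z.1 +
        fderiv ℝ (jointCGF μ) (saddleMap μ z) (0, w.2) := by
    conv_lhs => rw [e2, map_add, e4, e3]
  simp [e5]
  ring

/-- Differentiating the envelope formula once more, the derivative of ŝ enters, but only linearly;
its second derivative is not needed. -/
lemma fderiv_fderiv_logZeroth {z : E m × E p} (hz : z ∈ saddleRegion D μ) (w : E m × E p)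
    (v : E p) :
    fderiv ℝ (fderiv ℝ (logZeroth μ)) z w (0, v) =
      fderiv ℝ (fderiv ℝ (jointCGF μ)) (saddleMap μ z) (fderiv ℝ (saddleMap μ) z w) (0, v) := by
  have hO := isOpen_saddleRegion hM hG hA
  have hq := saddleMap_mem hM hG hA hz
  have h1 := (hasFDerivAt_fderiv hO (contDiffOn_logZeroth hM hG hA) hz).clm_apply
    (hasFDerivAt_const ((0, v) : E m × E p) z)
  have h2 := ((hasFDerivAt_fderiv isOpen_interior (hM.contDiffOn_jointCGF hG) hq).comp z
    (hasFDerivAt_of_contDiffOn hO (contDiffOn_saddleMap hM hG hA) hz)).clm_apply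
    (hasFDerivAt_const ((0, v) : E m × E p) z)
  have h3 : (fun z => fderiv ℝ (logZeroth μ) z (0, v)) =ᶠ[𝓝 z]
      fun z => fderiv ℝ (jointCGF μ) (saddleMap μ z) (0, v) := by
    filter_upwards [hO.mem_nhds hz] with r hr
    rw [fderiv_logZeroth hM hG hA hr]; simp
  have h4 := congrArg (fun T => T w) (h1.unique (h2.congr_of_eventuallyEq h3))
  simpa using h4

end LogZeroth

end Saddlepoint

namespace Saddlepoint

variable {m p : ℕ} {D : Set (E p)} {μ : E p → Measure (E m)}

/-! ### The second derivative in the fully identifiable case -/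

lemma bilin_left_right (T : (E m × E p) →L[ℝ] (E m × E p) →L[ℝ] ℝ) (t : E m) (w : E p) :
    T (t, 0) (0, w) = t.ofLp ⬝ᵥ (Matrix.of fun i j => T (unitVec i, 0) (0, unitVec j)).mulVec w.ofLp := by
  have h1 : T (t, 0) (0, w) = ∑ i, ∑ j, t i * (w j * T (unitVec i, 0) (0, unitVec j)) := by
    have e1 : ((t, 0) : E m × E p) = ∑ i, t i • ((unitVec i, 0) : E m × E p) := by
      have : ∑ i, t i • ((unitVec i, 0) : E m × E p) =
          ContinuousLinearMap.inl ℝ (E m) (E p) (∑ i, t i • unitVec i) := by simp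
      rw [this, sum_unitVec]; rfl
    have e2 : ((0, w) : E m × E p) = ∑ j, w j • ((0, unitVec j) : E m × E p) := by
      have : ∑ j, w j • ((0, unitVec j) : E m × E p) =
          ContinuousLinearMap.inr ℝ (E m) (E p) (∑ j, w j • unitVec j) := by simp
      rw [this, sum_unitVec]; rfl
    rw [e1, e2]
    simp only [map_sum, map_smul, sum_apply, smul_apply, smul_eq_mul, Finset.mul_sum]
    rw [Finset.sum_comm]
    exact Finset.sum_congr rfl fun i _ => Finset.sum_congr rfl fun j _ => by ring
  rw [h1]
  simp only [dotProduct, Matrix.mulVec, Matrix.of_apply, Finset.mul_sum]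
  exact Finset.sum_congr rfl fun i _ => Finset.sum_congr rfl fun j _ => by ring

lemma bilin_right_right (T : (E m × E p) →L[ℝ] (E m × E p) →L[ℝ] ℝ) (v w : E p) :
    T (0, v) (0, w) = v.ofLp ⬝ᵥ (Matrix.of fun i j => T (0, unitVec i) (0, unitVec j)).mulVec w.ofLp := by
  have h1 : T (0, v) (0, w) = ∑ i, ∑ j, v i * (w j * T (0, unitVec i) (0, unitVec j)) := by
    have e2 : ∀ w : E p, ((0, w) : E m × E p) = ∑ j, w j • ((0, unitVec j) : E m × E p) := by
      intro w
      have : ∑ j, w j • ((0, unitVec j) : E m × E p) =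
          ContinuousLinearMap.inr ℝ (E m) (E p) (∑ j, w j • unitVec j) := by simp
      rw [this, sum_unitVec]; rfl
    rw [e2 v, e2 w]
    simp only [map_sum, map_smul, sum_apply, smul_apply, smul_eq_mul, Finset.mul_sum]
    rw [Finset.sum_comm]
    exact Finset.sum_congr rfl fun i _ => Finset.sum_congr rfl fun j _ => by ring
  rw [h1]
  simp only [dotProduct, Matrix.mulVec, Matrix.of_apply, Finset.mul_sum]
  exact Finset.sum_congr rfl fun i _ => Finset.sum_congr rfl fun j _ => by ring

section Identifiable

variable {s₀ : E m} {θ₀ : E p} {y₀ : E m} (hM : IsModel D μ) (hG : GrowthBound D μ)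
  (hA : ∀ q ∈ interior (jointDomain D μ), (cgfHess (μ q.2) q.1).PosDef)
  (hF : FullyIdentifiable D μ s₀ θ₀ y₀)

include hF

lemma FullyIdentifiable.mem_saddleRegion : (y₀, θ₀) ∈ saddleRegion D μ :=
  ⟨s₀, hF.saddlepoint_eq, hF.mem_interior⟩

include hM hG

lemma FullyIdentifiable.gradMap_eq : gradMap μ (s₀, θ₀) = (y₀, θ₀) :=
  Prod.ext ((hM.isSaddlepoint_iff hG hF.mem_interior).1 hF.saddlepoint_eq) rfl

include hA

lemma FullyIdentifiable.saddleMap_eq : saddleMap μ (y₀, θ₀) = (s₀, θ₀) := by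
  rw [← hF.gradMap_eq hM hG]
  exact saddleMap_gradMap hM hG hF.mem_interior (hA _ hF.mem_interior)

lemma FullyIdentifiable.fderiv_logZeroth (v : E p) :
    fderiv ℝ (logZeroth μ) (y₀, θ₀) (0, v) = 0 := by
  rw [Saddlepoint.fderiv_logZeroth hM hG hA hF.mem_saddleRegion, hF.saddleMap_eq hM hG hA,
    inner_zero_right, sub_zero]
  have h1 := hasFDerivAt_of_contDiffOn isOpen_interior (hM.contDiffOn_jointCGF hG) hF.mem_interior
  have h2 : ∀ j, fderiv ℝ (jointCGF μ) (s₀, θ₀) (0, unitVec j) = 0 := fun j => by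
    rw [← (h1.hasLineDerivAt _).lineDeriv]; exact hF.critical j
  have : ((0, v) : E m × E p) = ∑ j, v j • ((0, unitVec j) : E m × E p) := by
    have : ∑ j, v j • ((0, unitVec j) : E m × E p) =
        ContinuousLinearMap.inr ℝ (E m) (E p) (∑ j, v j • unitVec j) := by simp
    rw [this, sum_unitVec]; rfl
  rw [show ((0 : E m), ((0, v) : E m × E p).2) = ((0, v) : E m × E p) from rfl, this, map_sum]
  exact Finset.sum_eq_zero fun j _ => by rw [map_smul, h2, smul_zero]

/-- The differentiated saddlepoint equation is v = At + Bw', with t the derivative of ŝ. Inserting t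
= A⁻¹(v - Bw') into Bᵀt + Cw', where C is the θ-Hessian of K₀, gives BᵀA⁻¹v + Hw'. -/
lemma FullyIdentifiable.fderiv_fderiv_logZeroth (v : E m) (w' w : E p) :
    fderiv ℝ (fderiv ℝ (logZeroth μ)) (y₀, θ₀) (v, w') (0, w) =
      w.ofLp ⬝ᵥ (((matB μ s₀ θ₀).transpose * (matA μ s₀ θ₀)⁻¹).mulVec v.ofLp +
        (matH μ s₀ θ₀).mulVec w'.ofLp) := by
  have hz := hF.mem_saddleRegion
  have hq := hF.mem_interior
  rw [Saddlepoint.fderiv_fderiv_logZeroth hM hG hA hz]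
  obtain ⟨e1, e2⟩ := fderiv_saddleMap hM hG hA hz (v, w')
  rw [hF.saddleMap_eq hM hG hA] at e2 ⊢
  set τ := fderiv ℝ (saddleMap μ) (y₀, θ₀) (v, w')
  set t := τ.1
  have hτ : τ = (t, 0) + (0, w') := by ext1 <;> simp [t, e1]
  set T := fderiv ℝ (fderiv ℝ (jointCGF μ)) (s₀, θ₀)
  have hcd := hM.contDiffOn_jointCGF hG
  have hsymm : ∀ a b, T a b = T b a := fun a b => fderiv_fderiv_comm isOpen_interior hcd hq a b
  have hB : (Matrix.of fun i j => T (unitVec i, 0) (0, unitVec j)) = matB μ s₀ θ₀ := by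
    ext i j
    exact (secondPD_eq_fderiv isOpen_interior hcd hq _ _).symm
  set Cm := Matrix.of fun i j => T (0, unitVec i) (0, unitVec j) with hCm
  have hH : matH μ s₀ θ₀ = Cm - (matB μ s₀ θ₀).transpose * (matA μ s₀ θ₀)⁻¹ * matB μ s₀ θ₀ := by
    rw [matH]
    congr 1
    ext i j
    exact secondPD_eq_fderiv isOpen_interior hcd hq _ _
  have hCs : Cm.transpose = Cm := by
    ext i j; exact hsymm _ _
  have := hM.neZero hq
  have hs := mem_interior_mgfDomain hq
  have key : v.ofLp = (matA μ s₀ θ₀).mulVec t.ofLp + (matB μ s₀ θ₀).mulVec w'.ofLp := by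
    have h1 : ∀ a : E m, a.ofLp ⬝ᵥ v.ofLp = a.ofLp ⬝ᵥ (matA μ s₀ θ₀).mulVec t.ofLp +
        a.ofLp ⬝ᵥ (matB μ s₀ θ₀).mulVec w'.ofLp := fun a => by
      have h2 := hM.fderiv_fderiv_jointCGF_inl hG hq τ a
      rw [e2] at h2
      have h3 : T (t, 0) (a, 0) = a.ofLp ⬝ᵥ (matA μ s₀ θ₀).mulVec t.ofLp := by
        rw [hM.fderiv_fderiv_jointCGF_inl hG hq, hM.inner_fderiv_cgfGrad_inl hG hq,
          tiltedCov_comm, tiltedCov_eq_dotProduct hs]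
        rfl
      have h4 : T (0, w') (a, 0) = a.ofLp ⬝ᵥ (matB μ s₀ θ₀).mulVec w'.ofLp := by
        rw [hsymm, bilin_left_right, hB]
      have h5 : T τ (a, 0) = T (t, 0) (a, 0) + T (0, w') (a, 0) := by
        rw [hτ, map_add]; rfl
      rw [← h3, ← h4, ← h5, h2, inner_euclidean]
      rfl
    funext i
    have h2 := h1 (unitVec i)
    simpa [unitVec] using h2
  have hinv : (matA μ s₀ θ₀)⁻¹ * matA μ s₀ θ₀ = 1 := by
    refine Matrix.nonsing_inv_mul _ ?_
    exact ((hA _ hq).isUnit.map Matrix.detMonoidHom)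
  have h6 : T τ (0, w) = T (t, 0) (0, w) + T (0, w') (0, w) := by
    rw [hτ, map_add]; rfl
  rw [h6, bilin_left_right, bilin_right_right, hB, ← hCm, hH, key, Matrix.mulVec_add,
    Matrix.mulVec_mulVec, Matrix.mulVec_mulVec, Matrix.mul_assoc _ _ (matA μ s₀ θ₀), hinv,
    Matrix.mul_one, Matrix.sub_mulVec, add_assoc, add_sub_cancel, dotProduct_add,
    Matrix.dotProduct_mulVec, Matrix.dotProduct_mulVec, ← Matrix.mulVec_transpose,
    ← Matrix.mulVec_transpose, hCs, dotProduct_comm, dotProduct_comm (Cm.mulVec _)]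

end Identifiable

/-! ### Expansion of the likelihoods -/

/-- Near `z₀`, the likelihood of `x = n y` is `aₙ exp(n ψ(y, θ) + eₙ(y, θ))` with `C²` bounds of
`eₙ` that are uniform in `n`. -/
def LikExpansion (D : Set (E p)) (μ : E p → Measure (E m)) (ℓ : ℕ → E p → E m → ℝ)
    (adm : Set (E m)) (z₀ : E m × E p) : Prop :=
  ∃ (r : ℝ) (C : ℝ) (n₀ : ℕ) (e : ℕ → E m × E p → ℝ) (a : ℕ → ℝ), 0 < r ∧ (∀ n ≥ n₀, 0 < a n) ∧
    Metric.ball z₀ r ⊆ saddleRegion D μ ∧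
    ∀ n ≥ n₀, C2Bound (Metric.ball z₀ r) (e n) C C C ∧ ∀ z ∈ Metric.ball z₀ r,
      (n : ℝ) • z.1 ∈ adm → ℓ n z.2 ((n : ℝ) • z.1) = a n * Real.exp (n * logZeroth μ z + e n z)

section Expansion

variable (hM : IsModel D μ) (hG : GrowthBound D μ)

include hM

lemma contDiffOn_cgfHess (hG : GrowthBound D μ) (i j : Fin m) :
    ContDiffOn ℝ 2 (fun q : E m × E p => cgfHess (μ q.2) q.1 i j) (interior (jointDomain D μ)) := by
  have h1 : ContDiffOn ℝ 2 (fun q => (jointMoment μ [i, j] (q, 0)).re / jointReal μ q)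
      (interior (jointDomain D μ)) := (Complex.reCLM.contDiff.comp_contDiffOn
    (contDiffOn_jointMoment_section hG (j := [i, j]) (by simp) 0)).fun_div (contDiffOn_jointReal hG)
    fun q hq => (hM.jointReal_pos hq).ne'
  refine (h1.sub ((hM.contDiffOn_cgfGrad_apply hG i).mul
    (hM.contDiffOn_cgfGrad_apply hG j))).congr fun q hq => ?_
  have := hM.neZero hq
  have h2 : cgfHess (μ q.2) q.1 i j = tiltedCov (μ q.2) q.1 (unitVec i) (unitVec j) :=
    secondPD_cgf (mem_interior_mgfDomain hq) _ _
  have h3 := (hM.jointReal_pos hq).ne'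
  simp only [jointMoment_pair hM hq, ← Complex.ofReal_mul, Complex.ofReal_re]
  rw [h2, mul_div_cancel_right₀ _ h3, add_sub_cancel_right]

variable (hA : ∀ q ∈ interior (jointDomain D μ), (cgfHess (μ q.2) q.1).PosDef)

include hA hG

lemma exists_saddle_ball {z₀ : E m × E p} (hz₀ : z₀ ∈ saddleRegion D μ) {r : ℝ} (hr : 0 < r) :
    ∃ B, ∃ r' > 0, Metric.ball z₀ r' ⊆ saddleRegion D μ ∧
      C2Bound (Metric.ball z₀ r') (saddleMap μ) B B B ∧
      MapsTo (saddleMap μ) (Metric.ball z₀ r') (Metric.ball (saddleMap μ z₀) r) := by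
  obtain ⟨B, r₁, hr₁, hb, hB⟩ := exists_ball_c2Bound (isOpen_saddleRegion hM hG hA)
    (contDiffOn_saddleMap hM hG hA) hz₀
  have hc := (saddleRegion_mem_nhds hM hG hA hz₀).2.continuousAt
  obtain ⟨r₂, hr₂, hb₂⟩ := Metric.continuousAt_iff.1 hc r hr
  have h1 : Metric.ball z₀ (min r₁ r₂) ⊆ Metric.ball z₀ r₁ :=
    Metric.ball_subset_ball (min_le_left _ _)
  exact ⟨B, min r₁ r₂, lt_min hr₁ hr₂, h1.trans hb, hB.subset h1,
    fun z hz => hb₂ (Metric.ball_subset_ball (min_le_right _ _) hz)⟩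

lemma zerothLik_eq {z : E m × E p} (hz : z ∈ saddleRegion D μ) {n : ℕ} (hn : 1 ≤ n) :
    zerothLik μ n z.2 ((n : ℝ) • z.1) = Real.exp (n * logZeroth μ z) := by
  obtain ⟨q, hq, rfl⟩ := exists_gradMap_eq hM hG hz
  have := hM.isProbabilityMeasure q.2 (interior_subset hq).1
  have h : IsSaddlepoint (μ q.2) (cgfGrad μ q) q.1 := (hM.isSaddlepoint_iff hG hq).2 rfl
  have h1 := zerothSPA_sumLaw h (mem_interior_mgfDomain hq) (hA q hq) hn
  rw [logZeroth, saddleMap_gradMap hM hG hq (hA q hq)]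
  exact h1

lemma spaLik_eq {z : E m × E p} (hz : z ∈ saddleRegion D μ) {n : ℕ} (hn : 1 ≤ n) :
    spaLik μ n z.2 ((n : ℝ) • z.1) = Real.exp (n * logZeroth μ z) /
      (√((2 * Real.pi * n) ^ m) *
        √(cgfHess (μ (saddleMap μ z).2) (saddleMap μ z).1).det) := by
  obtain ⟨q, hq, rfl⟩ := exists_gradMap_eq hM hG hz
  have := hM.isProbabilityMeasure q.2 (interior_subset hq).1
  have h : IsSaddlepoint (μ q.2) (cgfGrad μ q) q.1 := (hM.isSaddlepoint_iff hG hq).2 rfl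
  have h1 := spa_sumLaw h (mem_interior_mgfDomain hq) (hA q hq) hn
  rw [logZeroth, saddleMap_gradMap hM hG hq (hA q hq)]
  exact h1

lemma likExpansion_zerothLik {z₀ : E m × E p} (hz₀ : z₀ ∈ saddleRegion D μ) :
    LikExpansion D μ (zerothLik μ) univ z₀ := by
  obtain ⟨r, hr, hb⟩ := Metric.isOpen_iff.1 (isOpen_saddleRegion hM hG hA) z₀ hz₀
  refine ⟨r, 0, 1, fun _ _ => 0, fun _ => 1, hr, fun _ _ => one_pos, hb, fun n hn => ⟨?_, fun z hz _ => ?_⟩⟩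
  · simpa using C2Bound.const (Ω := Metric.ball z₀ r) (0 : ℝ)
  · rw [zerothLik_eq hM hG hA (hb hz) hn]; simp

/-- The powers of 2πn go into aₙ. What is left, the logarithm of the root of det K₀'' at the
saddlepoint, is C² and does not depend on n. -/
lemma likExpansion_spaLik {z₀ : E m × E p} (hz₀ : z₀ ∈ saddleRegion D μ) :
    LikExpansion D μ (spaLik μ) univ z₀ := by
  have hdet : ContDiffOn ℝ 2 (fun q : E m × E p => -Real.log √(cgfHess (μ q.2) q.1).det)
      (interior (jointDomain D μ)) := by
    have h1 : ContDiffOn ℝ 2 (fun q : E m × E p => (cgfHess (μ q.2) q.1).det)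
        (interior (jointDomain D μ)) := by
      simp only [Matrix.det_apply']
      exact ContDiffOn.sum fun σ _ => contDiffOn_const.mul
        (contDiffOn_prod fun i _ => contDiffOn_cgfHess hM hG _ _)
    exact ((h1.sqrt fun q hq => (hA q hq).det_pos.ne').log fun q hq =>
      (Real.sqrt_pos.2 (hA q hq).det_pos).ne').neg
  have hd := hdet.comp (contDiffOn_saddleMap hM hG hA) fun z hz => saddleMap_mem hM hG hA hz
  obtain ⟨C, r, hr, hb, hC⟩ := exists_ball_c2Bound (isOpen_saddleRegion hM hG hA) hd hz₀
  refine ⟨r, C, 1, fun _ z => -Real.log √(cgfHess (μ (saddleMap μ z).2) (saddleMap μ z).1).det,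
    fun n => (√((2 * Real.pi * n) ^ m))⁻¹, hr, fun n hn => ?_, hb,
    fun n hn => ⟨hC, fun z hz _ => ?_⟩⟩
  · have : (0 : ℝ) < n := by exact_mod_cast hn
    have := Real.pi_pos
    positivity
  · have hq := saddleMap_mem hM hG hA (hb hz)
    have h3 : 0 < √(cgfHess (μ (saddleMap μ z).2) (saddleMap μ z).1).det :=
      Real.sqrt_pos.2 (hA _ hq).det_pos
    rw [spaLik_eq hM hG hA (hb hz) hn, Real.exp_add, Real.exp_neg, Real.exp_log h3,
      div_eq_mul_inv, mul_inv, mul_left_comm]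

/-- Here eₙ is the logarithm of the real part of `invFactor` at the saddlepoint. The C² bounds of
`invFactor` pass through the logarithm because its real part stays in a compact subset of (0, ∞). -/
lemma likExpansion_of_isInvertible {S : Set (E m)} {L : ℕ → E p → E m → ℝ} {adm : Set (E m)}
    (hI : IsInvertible D μ S L adm) {z₀ : E m × E p} (hz₀ : z₀ ∈ saddleRegion D μ) :
    LikExpansion D μ L adm z₀ := by
  have hq₀ := saddleMap_mem hM hG hA hz₀
  obtain ⟨hpos, hlim, C, n₁, r₁, hr₁, hb₁, hC⟩ := hM.exists_c2Bound_invFactor hG hI.measurableSet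
    hI.mem_nhds hq₀ (hI.decay _ hq₀) (hA _ hq₀)
  set ℓ := invLimit μ (saddleMap μ z₀)
  -- Convergence is along the product filter, so one neighbourhood of the saddlepoint serves all
  -- large n; this makes the lower bound ℓ/2 uniform.
  have hev := Metric.tendsto_nhds.1 hlim (ℓ / 2) (by positivity)
  obtain ⟨P, hP, Q, hQ, hPQ⟩ := Filter.eventually_prod_iff.1 hev
  obtain ⟨n₂, hn₂⟩ := Filter.eventually_atTop.1 hP
  obtain ⟨r₂, hr₂, hb₂⟩ := Metric.eventually_nhds_iff_ball.1 hQ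
  set r := min r₁ r₂
  have hs1 : Metric.ball (saddleMap μ z₀) r ⊆ Metric.ball (saddleMap μ z₀) r₁ :=
    Metric.ball_subset_ball (min_le_left _ _)
  have hs2 : Metric.ball (saddleMap μ z₀) r ⊆ Metric.ball (saddleMap μ z₀) r₂ :=
    Metric.ball_subset_ball (min_le_right _ _)
  obtain ⟨B, r', hr', hb', hB, hmaps⟩ := exists_saddle_ball hM hG hA hz₀ (lt_min hr₁ hr₂)
  have hre : ∀ n ≥ n₂, ∀ q ∈ Metric.ball (saddleMap μ z₀) r,
      ℓ / 2 < (invFactor μ S n q).re ∧ (invFactor μ S n q).re < 3 * ℓ / 2 := by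
    intro n hn q hq
    have h1 := hPQ (hn₂ n hn) (hb₂ q (hs2 hq))
    have h2 := (Complex.abs_re_le_norm (invFactor μ S n q - (ℓ : ℂ))).trans_lt
      (by rwa [dist_eq_norm] at h1)
    simp only [Complex.sub_re, Complex.ofReal_re] at h2
    rw [abs_lt] at h2
    constructor <;> linarith [h2.1, h2.2]
  have hlog : ∀ n ≥ max n₁ n₂, C2Bound (Metric.ball (saddleMap μ z₀) r)
      (fun q => Real.log (invFactor μ S n q).re) (|Real.log (ℓ / 2)| + |Real.log (3 * ℓ / 2)|)
      ((ℓ / 2)⁻¹ * C) (((ℓ / 2) ^ 2)⁻¹ * C ^ 2 + (ℓ / 2)⁻¹ * C) := by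
    intro n hn
    have h1 := ((hC n ((le_max_left _ _).trans hn)).1.subset hs1).clm_comp Metric.isOpen_ball
      Complex.reCLM
    rw [Complex.reCLM_norm, one_mul] at h1
    have h2 := hre n ((le_max_right _ _).trans hn)
    have hp : ∀ q ∈ Metric.ball (saddleMap μ z₀) r, 0 < (invFactor μ S n q).re := fun q hq =>
      (by positivity : (0 : ℝ) < ℓ / 2).trans (h2 q hq).1
    refine h1.scalar_comp (h := Real.log) (h' := fun x => x⁻¹) (h'' := fun x => -(x ^ 2)⁻¹)
      Metric.isOpen_ball (h1.1.log fun q hq => (hp q hq).ne')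
      (fun q hq => Real.hasDerivAt_log (hp q hq).ne') (fun q hq => hasDerivAt_inv (hp q hq).ne')
      (fun q hq => ?_) (fun q hq => ?_) (fun q hq => ?_)
    · have e1 := Real.log_le_log (by positivity) (h2 q hq).1.le
      have e2 := Real.log_le_log (hp q hq) (h2 q hq).2.le
      simp only [Complex.reCLM_apply]
      rw [Real.norm_eq_abs, abs_le]
      constructor
      · linarith [neg_abs_le (Real.log (ℓ / 2)), abs_nonneg (Real.log (3 * ℓ / 2))]
      · linarith [le_abs_self (Real.log (3 * ℓ / 2)), abs_nonneg (Real.log (ℓ / 2))]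
    · simp only [Complex.reCLM_apply]
      rw [Real.norm_of_nonneg (inv_nonneg.2 (hp q hq).le)]
      exact inv_anti₀ (by positivity) (h2 q hq).1.le
    · simp only [Complex.reCLM_apply]
      rw [norm_neg, Real.norm_of_nonneg (by positivity)]
      exact inv_anti₀ (by positivity) (pow_le_pow_left₀ (by positivity) (h2 q hq).1.le 2)
  set c₀ := |Real.log (ℓ / 2)| + |Real.log (3 * ℓ / 2)|
  set c₁ := (ℓ / 2)⁻¹ * C
  set c₂ := ((ℓ / 2) ^ 2)⁻¹ * C ^ 2 + (ℓ / 2)⁻¹ * C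
  refine ⟨r', max c₀ (max (c₁ * B) (c₂ * B ^ 2 + c₁ * B)), max (max n₁ n₂) 1,
    fun n z => Real.log (invFactor μ S n (saddleMap μ z)).re,
    fun n => (√n ^ m * (2 * Real.pi) ^ m)⁻¹, hr', fun n hn => ?_, hb', fun n hn => ⟨?_, ?_⟩⟩
  · have : (0 : ℝ) < n := by exact_mod_cast (le_max_right _ _).trans hn
    have := Real.pi_pos
    positivity
  · exact ((hlog n ((le_max_left _ _).trans hn)).comp Metric.isOpen_ball Metric.isOpen_ball hB
      hmaps).mono (le_max_left _ _) ((le_max_left _ _).trans (le_max_right _ _))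
      ((le_max_right _ _).trans (le_max_right _ _))
  · intro z hz hadm
    have hn' := (le_max_left _ _).trans hn
    have hq := saddleMap_mem hM hG hA (hb' hz)
    have h1 : cgfGrad μ (saddleMap μ z) = z.1 :=
      (Prod.ext_iff.1 (gradMap_saddleMap hM hG hA (hb' hz))).1
    have h2 := hI.lik_eq hM hq ((le_max_right _ _).trans hn)
      ((hC n ((le_max_left _ _).trans hn')).2 _ (hs1 (hmaps hz))) (by rwa [h1])
    rw [h1] at h2
    have h3 := (hre n ((le_max_right _ _).trans hn') _ (hmaps hz)).1
    rw [Real.exp_add, Real.exp_log ((by positivity : (0 : ℝ) < ℓ / 2).trans h3)]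
    have h4 : logZeroth μ z = cgf (μ z.2) (saddleMap μ z).1 - inner ℝ (saddleMap μ z).1 z.1 := rfl
    rw [h4]
    exact h2

end Expansion

end Saddlepoint

namespace Saddlepoint

variable {m p : ℕ} {D : Set (E p)} {μ : E p → Measure (E m)}

/-! ### Gradients -/

/-- The logarithm of the likelihood of `x = n y` is `log aₙ + n ψ(y, θ) + eₙ(y, θ)` on `Ω`, for
`n ≥ n₀`, where the derivatives of `eₙ` are bounded by `C`. -/
def ExpandsOn (μ : E p → Measure (E m)) (ℓ : ℕ → E p → E m → ℝ) (adm : Set (E m))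
    (Ω : Set (E m × E p)) (C : ℝ) (n₀ : ℕ) (e : ℕ → E m × E p → ℝ) (a : ℕ → ℝ) : Prop :=
  ∀ n ≥ n₀, 0 < a n ∧ C2Bound Ω (e n) C C C ∧ ∀ z ∈ Ω, (n : ℝ) • z.1 ∈ adm →
    ℓ n z.2 ((n : ℝ) • z.1) = a n * Real.exp (n * logZeroth μ z + e n z)

variable {ℓ : ℕ → E p → E m → ℝ} {adm : Set (E m)} {Ω : Set (E m × E p)} {C : ℝ} {n₀ : ℕ}
  {e : ℕ → E m × E p → ℝ} {a : ℕ → ℝ}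

lemma ExpandsOn.mono (h : ExpandsOn μ ℓ adm Ω C n₀ e a) {Ω' : Set (E m × E p)} (hΩ : Ω' ⊆ Ω)
    {C' : ℝ} (hC : C ≤ C') {n₁ : ℕ} (hn : n₀ ≤ n₁) : ExpandsOn μ ℓ adm Ω' C' n₁ e a :=
  fun n hn' => ⟨(h n (hn.trans hn')).1, ((h n (hn.trans hn')).2.1.mono hC hC hC).subset hΩ,
    fun z hz => (h n (hn.trans hn')).2.2 z (hΩ hz)⟩

lemma LikExpansion.exists_expandsOn {z₀ : E m × E p} (h : LikExpansion D μ ℓ adm z₀) :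
    ∃ r > 0, Metric.ball z₀ r ⊆ saddleRegion D μ ∧
      ∃ C n₀ e a, ExpandsOn μ ℓ adm (Metric.ball z₀ r) C n₀ e a := by
  obtain ⟨r, C, n₀, e, a, hr, ha, hb, h⟩ := h
  exact ⟨r, hr, hb, C, n₀, e, a, fun n hn => ⟨ha n hn, h n hn⟩⟩

lemma norm_comp_inr_le {F : E m × E p →L[ℝ] ℝ} :
    ‖F.comp (ContinuousLinearMap.inr ℝ (E m) (E p))‖ ≤ ‖F‖ :=
  (F.opNorm_comp_le _).trans
    (mul_le_of_le_one_right (norm_nonneg F) (ContinuousLinearMap.norm_inr_le_one ℝ (E m) (E p)))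

lemma norm_gradient_sub_le {f g : E p → ℝ} {f' h' : E p →L[ℝ] ℝ} {θ : E p} {c : ℝ}
    (hg : HasFDerivAt g f' θ) (hf : HasFDerivAt f (f' + h') θ) (hc : ‖h'‖ ≤ c) :
    ‖gradient g θ - gradient f θ‖ ≤ c := by
  rw [gradient, gradient, hg.fderiv, hf.fderiv, ← map_sub, LinearIsometryEquiv.norm_map]
  simpa using hc

lemma hasFDerivAt_section {f : E m × E p → ℝ} (hΩ : IsOpen Ω) (hf : ContDiffOn ℝ 2 f Ω) {y : E m}
    {θ : E p} (hz : (y, θ) ∈ Ω) : HasFDerivAt (fun θ' => f (y, θ'))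
      ((fderiv ℝ f (y, θ)).comp (ContinuousLinearMap.inr ℝ (E m) (E p))) θ :=
  HasFDerivAt.comp (f := fun θ' => (y, θ')) θ (hasFDerivAt_of_contDiffOn hΩ hf hz)
    (hasFDerivAt_prodMk_right y θ)

section Gradient

variable (hM : IsModel D μ) (hG : GrowthBound D μ)
  (hA : ∀ q ∈ interior (jointDomain D μ), (cgfHess (μ q.2) q.1).PosDef)

include hM hG hA

/-- The logarithms differ by eₙ plus a constant in θ, so the difference of the gradients is the
θ-gradient of eₙ. -/
lemma ExpandsOn.gradient (h : ExpandsOn μ ℓ adm Ω C n₀ e a) (hΩ : IsOpen Ω)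
    (hsub : Ω ⊆ saddleRegion D μ) {n : ℕ} (hn : max n₀ 1 ≤ n) {y : E m} {θ : E p}
    (hz : (y, θ) ∈ Ω) (hadm : (n : ℝ) • y ∈ adm) :
    0 < ℓ n θ ((n : ℝ) • y) ∧ DifferentiableAt ℝ (fun θ' => Real.log (ℓ n θ' ((n : ℝ) • y))) θ ∧
      DifferentiableAt ℝ (fun θ' => Real.log (zerothLik μ n θ' ((n : ℝ) • y))) θ ∧
      ‖gradient (fun θ' => Real.log (zerothLik μ n θ' ((n : ℝ) • y))) θ -
        gradient (fun θ' => Real.log (ℓ n θ' ((n : ℝ) • y))) θ‖ ≤ C := by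
  obtain ⟨ha, hC, heq⟩ := h n ((le_max_left _ _).trans hn)
  have hev : ∀ᶠ θ' in 𝓝 θ, (y, θ') ∈ Ω :=
    (by fun_prop : Continuous fun θ' : E p => (y, θ')).continuousAt.eventually_mem (hΩ.mem_nhds hz)
  have h1 := (hasFDerivAt_section (y := y) hΩ
    ((contDiffOn_logZeroth hM hG hA).mono hsub) hz).const_mul (n : ℝ)
  have h2 := hasFDerivAt_section (y := y) hΩ hC.1 hz
  have h3 : (fun θ' => Real.log (zerothLik μ n θ' ((n : ℝ) • y))) =ᶠ[𝓝 θ]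
      fun θ' => n * logZeroth μ (y, θ') := by
    filter_upwards [hev] with θ' hθ'
    rw [zerothLik_eq hM hG hA (hsub hθ') ((le_max_right _ _).trans hn), Real.log_exp]
  have h4 : (fun θ' => Real.log (ℓ n θ' ((n : ℝ) • y))) =ᶠ[𝓝 θ]
      fun θ' => n * logZeroth μ (y, θ') + e n (y, θ') + Real.log (a n) := by
    filter_upwards [hev] with θ' hθ'
    rw [heq _ hθ' hadm, Real.log_mul ha.ne' (Real.exp_ne_zero _), Real.log_exp, add_comm]
  have h5 := h1.congr_of_eventuallyEq h3
  have h6 := ((h1.add h2).add_const (Real.log (a n))).congr_of_eventuallyEq h4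
  refine ⟨?_, h6.differentiableAt, h5.differentiableAt, ?_⟩
  · rw [heq _ hz hadm]; positivity
  · exact norm_gradient_sub_le h5 h6 (norm_comp_inr_le.trans (hC.le₁ _ hz))

/-- Induction over the compact set: the constants of finitely many local expansions are combined by
maxima. -/
lemma gradientConclusion (h : ∀ z ∈ saddleRegion D μ, LikExpansion D μ ℓ adm z) :
    GradientConclusion D μ ℓ adm := by
  intro K hK hKc
  refine hKc.induction_on (p := fun s => ∃ (n₀ : ℕ) (c : ℝ), ∀ n ≥ n₀, ∀ y θ, (y, θ) ∈ s →
    (n : ℝ) • y ∈ adm → 0 < ℓ n θ ((n : ℝ) • y) ∧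
      DifferentiableAt ℝ (fun θ' => Real.log (ℓ n θ' ((n : ℝ) • y))) θ ∧
      DifferentiableAt ℝ (fun θ' => Real.log (zerothLik μ n θ' ((n : ℝ) • y))) θ ∧
      ‖gradient (fun θ' => Real.log (zerothLik μ n θ' ((n : ℝ) • y))) θ -
        gradient (fun θ' => Real.log (ℓ n θ' ((n : ℝ) • y))) θ‖ ≤ c) ?_ ?_ ?_ ?_
  · exact ⟨0, 0, by simp⟩
  · rintro s t hst ⟨n₀, c, h⟩
    exact ⟨n₀, c, fun n hn y θ hz => h n hn y θ (hst hz)⟩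
  · rintro s t ⟨n₀, c, h⟩ ⟨n₁, c', h'⟩
    refine ⟨max n₀ n₁, max c c', fun n hn y θ hz hadm => ?_⟩
    rcases hz with hz | hz
    · obtain ⟨h1, h2, h3, h4⟩ := h n ((le_max_left _ _).trans hn) y θ hz hadm
      exact ⟨h1, h2, h3, h4.trans (le_max_left _ _)⟩
    · obtain ⟨h1, h2, h3, h4⟩ := h' n ((le_max_right _ _).trans hn) y θ hz hadm
      exact ⟨h1, h2, h3, h4.trans (le_max_right _ _)⟩
  · intro z hz
    obtain ⟨r, hr, hb, C, n₀, e, a, hE⟩ := (h z (hK hz)).exists_expandsOn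
    exact ⟨Metric.ball z r, mem_nhdsWithin_of_mem_nhds (Metric.ball_mem_nhds z hr), max n₀ 1, C,
      fun n hn y θ hz' hadm => hE.gradient hM hG hA Metric.isOpen_ball hb hn hz' hadm⟩

end Gradient

end Saddlepoint

namespace Saddlepoint

/-! ### Strongly concave functions with a parameter -/

section StrongConcave

variable {Y P : Type*} [NormedAddCommGroup Y] [NormedSpace ℝ Y] [NormedAddCommGroup P]
  [NormedSpace ℝ P] {Ω : Set (Y × P)} {f g : Y × P → ℝ} {κ : ℝ}

/-- `f` is `C²` on `Ω` and strongly concave with constant `κ` in its second argument. -/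
structure StrongConcaveSnd (κ : ℝ) (f : Y × P → ℝ) (Ω : Set (Y × P)) : Prop where
  contDiffOn : ContDiffOn ℝ 2 f Ω
  le : ∀ z ∈ Ω, ∀ w, fderiv ℝ (fderiv ℝ f) z (0, w) (0, w) ≤ -κ * ‖w‖ ^ 2

/-- `θ` is a critical point of `f (y, ·)`. -/
def IsCritSnd (f : Y × P → ℝ) (y : Y) (θ : P) : Prop := ∀ w, fderiv ℝ f (y, θ) (0, w) = 0

/-- On the segment, f minus its tangent plus κ/2 · t²‖v‖² has non-positive second derivative and
zero slope at t = 0, so it is antitone. -/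
lemma StrongConcaveSnd.quadratic_upper (h : StrongConcaveSnd κ f Ω) (hΩ : IsOpen Ω)
    (hc : Convex ℝ Ω) {y : Y} {θ v : P} (h₀ : (y, θ) ∈ Ω) (h₁ : (y, θ + v) ∈ Ω) :
    f (y, θ + v) ≤ f (y, θ) + fderiv ℝ f (y, θ) (0, v) - κ / 2 * ‖v‖ ^ 2 := by
  have hmem : ∀ t ∈ Icc (0 : ℝ) 1, (y, θ) + t • ((0, v) : Y × P) ∈ Ω := fun t ht => by
    have := hc h₀ h₁ (sub_nonneg.2 ht.2) ht.1 (by ring)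
    convert this using 1
    ext1
    · simp only [Prod.fst_add, Prod.smul_fst, smul_zero, add_zero]
      rw [← add_smul]; simp
    · simp only [Prod.snd_add, Prod.smul_snd, smul_add]
      rw [← add_assoc, ← add_smul]; simp
  have hd : ∀ t ∈ Icc (0 : ℝ) 1, HasDerivAt (fun t : ℝ => f ((y, θ) + t • ((0, v) : Y × P)))
      (fderiv ℝ f ((y, θ) + t • ((0, v) : Y × P)) (0, v)) t := fun t ht => by
    have h1 : HasDerivAt (fun t : ℝ => (y, θ) + t • ((0, v) : Y × P)) (0, v) t := by
      simpa using ((hasDerivAt_id t).smul_const ((0, v) : Y × P)).const_add (y, θ)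
    exact (hasFDerivAt_of_contDiffOn hΩ h.1 (hmem t ht)).comp_hasDerivAt t h1
  have hd2 : ∀ t ∈ Icc (0 : ℝ) 1,
      HasDerivAt (fun t : ℝ => fderiv ℝ f ((y, θ) + t • ((0, v) : Y × P)) (0, v))
      (fderiv ℝ (fderiv ℝ f) ((y, θ) + t • ((0, v) : Y × P)) (0, v) (0, v)) t := fun t ht => by
    have h1 : HasDerivAt (fun t : ℝ => (y, θ) + t • ((0, v) : Y × P)) (0, v) t := by
      simpa using ((hasDerivAt_id t).smul_const ((0, v) : Y × P)).const_add (y, θ)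
    have h2 := (hasFDerivAt_fderiv hΩ h.1 (hmem t ht)).comp_hasDerivAt t h1
    simpa using h2.clm_apply (hasDerivAt_const t ((0, v) : Y × P))
  set a := fderiv ℝ f (y, θ) (0, v) with ha
  have hk1 : ∀ t ∈ Icc (0 : ℝ) 1, HasDerivAt
      (fun t : ℝ => f ((y, θ) + t • ((0, v) : Y × P)) - t * a + t ^ 2 * (κ / 2 * ‖v‖ ^ 2))
      (fderiv ℝ f ((y, θ) + t • ((0, v) : Y × P)) (0, v) - a + t * (κ * ‖v‖ ^ 2)) t :=
    fun t ht => (((hd t ht).sub ((hasDerivAt_id t).mul_const a)).add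
      ((hasDerivAt_pow 2 t).mul_const _)).congr_deriv (by simp; ring)
  have hk2 : ∀ t ∈ Icc (0 : ℝ) 1, HasDerivAt
      (fun t : ℝ => fderiv ℝ f ((y, θ) + t • ((0, v) : Y × P)) (0, v) - a + t * (κ * ‖v‖ ^ 2))
      (fderiv ℝ (fderiv ℝ f) ((y, θ) + t • ((0, v) : Y × P)) (0, v) (0, v) + κ * ‖v‖ ^ 2) t :=
    fun t ht => (((hd2 t ht).sub_const a).add
      ((hasDerivAt_id t).mul_const (κ * ‖v‖ ^ 2))).congr_deriv (by simp)
  have hi : interior (Icc (0 : ℝ) 1) ⊆ Icc 0 1 := interior_subset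
  have hanti2 := antitoneOn_of_hasDerivWithinAt_nonpos (convex_Icc (0 : ℝ) 1)
    (fun t ht => (hk2 t ht).continuousAt.continuousWithinAt)
    (fun t ht => (hk2 t (hi ht)).hasDerivWithinAt) (fun t ht => by
      have := h.2 _ (hmem t (hi ht)) v
      linarith)
  have hanti1 := antitoneOn_of_hasDerivWithinAt_nonpos (convex_Icc (0 : ℝ) 1)
    (fun t ht => (hk1 t ht).continuousAt.continuousWithinAt)
    (fun t ht => (hk1 t (hi ht)).hasDerivWithinAt) (fun t ht => by
      have := hanti2 (left_mem_Icc.2 zero_le_one) (hi ht) (hi ht).1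
      simpa [ha] using this)
  have := hanti1 (left_mem_Icc.2 zero_le_one) (right_mem_Icc.2 zero_le_one) zero_le_one
  simp at this
  linarith

lemma StrongConcaveSnd.le_of_isCrit (h : StrongConcaveSnd κ f Ω) (hΩ : IsOpen Ω)
    (hc : Convex ℝ Ω) {y : Y} {θ θ' : P} (h₀ : (y, θ) ∈ Ω) (h₁ : (y, θ') ∈ Ω)
    (hcr : IsCritSnd f y θ) : f (y, θ') ≤ f (y, θ) - κ / 2 * ‖θ' - θ‖ ^ 2 := by
  have := h.quadratic_upper hΩ hc (v := θ' - θ) h₀ (by rwa [add_sub_cancel])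
  rwa [hcr, add_zero, add_sub_cancel] at this

/-- Adding the quadratic upper bounds based at the exact critical point θ and at the nearly critical
θ' cancels the values of f and leaves κ‖θ - θ'‖² ≤ c‖θ - θ'‖. All stability estimates for maximisers
come from here. -/
lemma StrongConcaveSnd.norm_sub_le (h : StrongConcaveSnd κ f Ω) (hΩ : IsOpen Ω)
    (hc : Convex ℝ Ω) {y : Y} {θ θ' : P} (h₀ : (y, θ) ∈ Ω) (h₁ : (y, θ') ∈ Ω)
    (hcr : IsCritSnd f y θ) {c : ℝ} (hc₀ : 0 ≤ c)
    (hd : ∀ w, |fderiv ℝ f (y, θ') (0, w)| ≤ c * ‖w‖) : κ * ‖θ - θ'‖ ≤ c := by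
  have h1 := h.le_of_isCrit hΩ hc h₀ h₁ hcr
  have h2 := h.quadratic_upper hΩ hc (v := θ - θ') h₁ (by rwa [add_sub_cancel])
  rw [add_sub_cancel] at h2
  rw [norm_sub_rev] at h1
  have h3 := (le_abs_self _).trans (hd (θ - θ'))
  rcases (norm_nonneg (θ - θ')).eq_or_lt with h4 | h4
  · rwa [← h4, mul_zero]
  · nlinarith

/-- On the sphere the linear gain is at most cρ, which is less than the loss κρ²/2, so a maximiser
over the closed ball lies in its interior. -/
lemma StrongConcaveSnd.exists_isCrit [FiniteDimensional ℝ P] (h : StrongConcaveSnd κ f Ω)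
    (hΩ : IsOpen Ω) (hc : Convex ℝ Ω) {y : Y} {θ₀ : P} {ρ c : ℝ} (hρ : 0 < ρ)
    (hsub : ∀ θ ∈ Metric.closedBall θ₀ ρ, (y, θ) ∈ Ω)
    (hd : ∀ w, |fderiv ℝ f (y, θ₀) (0, w)| ≤ c * ‖w‖) (hcκ : 2 * c < κ * ρ) :
    ∃ θ ∈ Metric.ball θ₀ ρ, IsCritSnd f y θ := by
  have hcont : ContinuousOn (fun θ => f (y, θ)) (Metric.closedBall θ₀ ρ) :=
    h.1.continuousOn.comp (by fun_prop) hsub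
  obtain ⟨θ, hθ, hmax⟩ := (isCompact_closedBall θ₀ ρ).exists_isMaxOn
    ⟨θ₀, Metric.mem_closedBall_self hρ.le⟩ hcont
  have h0 := hsub θ₀ (Metric.mem_closedBall_self hρ.le)
  have hlt : θ ∈ Metric.ball θ₀ ρ := by
    by_contra hcon
    have hn : ‖θ - θ₀‖ = ρ := by
      rw [Metric.mem_ball, not_lt] at hcon
      rw [← dist_eq_norm]
      exact le_antisymm hθ hcon
    have h1 := h.quadratic_upper hΩ hc (v := θ - θ₀) h0 (by rw [add_sub_cancel]; exact hsub θ hθ)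
    have h2 := (le_abs_self _).trans (hd (θ - θ₀))
    have h3 : f (y, θ₀) ≤ f (y, θ) := hmax (Metric.mem_closedBall_self hρ.le)
    rw [add_sub_cancel, hn] at h1
    rw [hn] at h2
    nlinarith
  refine ⟨θ, hlt, fun w => ?_⟩
  have h1 : IsLocalMax (fun θ => f (y, θ)) θ := by
    filter_upwards [Metric.isOpen_ball.mem_nhds hlt] with θ' hθ'
    exact hmax (Metric.ball_subset_closedBall hθ')
  have h2 : HasFDerivAt (fun θ => f (y, θ)) _ θ :=
    HasFDerivAt.comp (f := fun θ' => (y, θ')) θ (hasFDerivAt_of_contDiffOn hΩ h.1 (hsub θ hθ))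
      (hasFDerivAt_prodMk_right y θ)
  simpa using congrArg (fun T => T w) (h1.hasFDerivAt_eq_zero h2)

lemma StrongConcaveSnd.eq_of_isCrit (h : StrongConcaveSnd κ f Ω) (hκ : 0 < κ) (hΩ : IsOpen Ω)
    (hc : Convex ℝ Ω) {y : Y} {θ θ' : P} (h₀ : (y, θ) ∈ Ω) (h₁ : (y, θ') ∈ Ω)
    (hcr : IsCritSnd f y θ) (hcr' : IsCritSnd f y θ') : θ = θ' := by
  have h1 := h.norm_sub_le hΩ hc h₀ h₁ hcr (c := 0) le_rfl fun w => by rw [hcr' w]; simp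
  have h2 : ‖θ - θ'‖ ≤ 0 := by
    by_contra! h3
    nlinarith
  exact sub_eq_zero.1 (norm_le_zero_iff.1 h2)

/-- The critical point depends continuously on the parameter. -/
lemma StrongConcaveSnd.continuousOn_crit (h : StrongConcaveSnd κ f Ω) (hκ : 0 < κ) (hΩ : IsOpen Ω)
    (hc : Convex ℝ Ω) {V : Set Y} {U : Set P} (hVU : V ×ˢ U ⊆ Ω) {τ : Y → P}
    (hτ : ∀ y ∈ V, τ y ∈ U ∧ IsCritSnd f y (τ y)) : ContinuousOn τ V := by
  intro y hy
  obtain ⟨h1, h2⟩ := hτ y hy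
  have h3 : ContinuousWithinAt (fun y' => (fderiv ℝ f (y', τ y)).comp
      (ContinuousLinearMap.inr ℝ Y P)) V y :=
    (((contDiffOn_fderiv hΩ h.1).continuousOn.continuousAt
      (hΩ.mem_nhds (hVU ⟨hy, h1⟩))).comp (f := fun y' => (y', τ y)) (x := y)
      (by fun_prop)).continuousWithinAt.clm_comp continuousWithinAt_const
  have h4 : (fderiv ℝ f (y, τ y)).comp (ContinuousLinearMap.inr ℝ Y P) = 0 := by
    ext w; simpa using h2 w
  have h5 := h3.norm
  rw [ContinuousWithinAt, h4, norm_zero] at h5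
  rw [ContinuousWithinAt, tendsto_iff_norm_sub_tendsto_zero]
  refine squeeze_zero' (.of_forall fun _ => norm_nonneg _) ?_
    (by simpa using h5.const_mul κ⁻¹)
  filter_upwards [self_mem_nhdsWithin] with y' hy'
  rw [le_inv_mul_iff₀ hκ]
  refine h.norm_sub_le hΩ hc (hVU ⟨hy', (hτ y' hy').1⟩) (hVU ⟨hy', h1⟩) (hτ y' hy').2
    (norm_nonneg _) fun w => ?_
  have := ((fderiv ℝ f (y', τ y)).comp (ContinuousLinearMap.inr ℝ Y P)).le_opNorm w
  simpa using this

lemma exists_strongConcaveSnd_of_le (hΩ : IsOpen Ω) (hf : ContDiffOn ℝ 2 f Ω) {z₀ : Y × P}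
    (hz₀ : z₀ ∈ Ω) (hκ : 0 < κ)
    (h : ∀ w, fderiv ℝ (fderiv ℝ f) z₀ (0, w) (0, w) ≤ -κ * ‖w‖ ^ 2) :
    ∃ r > 0, Metric.ball z₀ r ⊆ Ω ∧ StrongConcaveSnd (κ / 2) f (Metric.ball z₀ r) := by
  have h0 : ContinuousAt (fun z => fderiv ℝ (fderiv ℝ f) z - fderiv ℝ (fderiv ℝ f) z₀) z₀ :=
    ((continuousOn_fderiv_fderiv hΩ hf).continuousAt (hΩ.mem_nhds hz₀)).sub continuousAt_const
  have h1 := (continuous_norm (E := Y × P →L[ℝ] Y × P →L[ℝ] ℝ)).continuousAt.comp h0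
  have h2 := h1.eventually_lt_const (u := κ / 2) <| by
    rw [Function.comp_apply, show fderiv ℝ (fderiv ℝ f) z₀ - fderiv ℝ (fderiv ℝ f) z₀ = 0 from
      sub_self (G := Y × P →L[ℝ] Y × P →L[ℝ] ℝ) _]
    exact (norm_zero (E := Y × P →L[ℝ] Y × P →L[ℝ] ℝ)).trans_lt (half_pos hκ)
  obtain ⟨r, hr, hb⟩ := Metric.eventually_nhds_iff_ball.1 (h2.and (hΩ.eventually_mem hz₀))
  refine ⟨r, hr, fun z hz => (hb z hz).2, hf.mono fun z hz => (hb z hz).2, fun z hz w => ?_⟩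
  have h3 := ContinuousLinearMap.le_opNorm₂ (fderiv ℝ (fderiv ℝ f) z - fderiv ℝ (fderiv ℝ f) z₀)
    (0, w) (0, w)
  have h4 : ‖((0, w) : Y × P)‖ = ‖w‖ := by simp [Prod.norm_def]
  rw [h4, sub_apply, sub_apply, Real.norm_eq_abs, mul_assoc] at h3
  have h5 := (le_abs_self _).trans h3
  have h6 : _ ≤ κ / 2 * (‖w‖ * ‖w‖) := h5.trans (mul_le_mul_of_nonneg_right (hb z hz).1.le
    (mul_nonneg (norm_nonneg w) (norm_nonneg w)))
  nlinarith [h w]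

end StrongConcave

end Saddlepoint

namespace Saddlepoint

variable {m p : ℕ} {D : Set (E p)} {μ : E p → Measure (E m)}
  {ℓ : ℕ → E p → E m → ℝ} {adm : Set (E m)} {Ω : Set (E m × E p)} {C κ : ℝ} {n₀ : ℕ}
  {e : ℕ → E m × E p → ℝ} {a : ℕ → ℝ}

/-! ### Local maximisers -/

/-- The normalised log-likelihood `ψ + eₙ / n`. -/
noncomputable def normLogLik (μ : E p → Measure (E m)) (e : ℕ → E m × E p → ℝ) (n : ℕ)
    (z : E m × E p) : ℝ :=
  logZeroth μ z + (n : ℝ)⁻¹ * e n z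

lemma ExpandsOn.lik_eq (h : ExpandsOn μ ℓ adm Ω C n₀ e a) {n : ℕ} (hn : n₀ ≤ n) (hn1 : 1 ≤ n)
    {z : E m × E p} (hz : z ∈ Ω) (hadm : (n : ℝ) • z.1 ∈ adm) :
    ℓ n z.2 ((n : ℝ) • z.1) = a n * Real.exp (n * normLogLik μ e n z) := by
  have : (n : ℝ) ≠ 0 := by positivity
  rw [(h n hn).2.2 z hz hadm, normLogLik, mul_add, mul_inv_cancel_left₀ this]

section

lemma ExpandsOn.c2Bound_smul (h : ExpandsOn μ ℓ adm Ω C n₀ e a) (hΩ : IsOpen Ω) {n : ℕ}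
    (hn : n₀ ≤ n) : C2Bound Ω (fun z => (n : ℝ)⁻¹ * e n z) (C / n) (C / n) (C / n) := by
  have := (h n hn).2.1.const_smul hΩ ((n : ℝ)⁻¹)
  simpa [div_eq_inv_mul] using this

variable (h : ExpandsOn μ ℓ adm Ω C n₀ e a) (hΩ : IsOpen Ω)
  (hψ : ContDiffOn ℝ 2 (logZeroth μ) Ω) {n : ℕ} (hn : n₀ ≤ n)

include h hΩ hψ hn

lemma ExpandsOn.contDiffOn_normLogLik : ContDiffOn ℝ 2 (normLogLik μ e n) Ω :=
  hψ.add (h.c2Bound_smul hΩ hn).1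

lemma ExpandsOn.abs_fderiv_sub_le {z : E m × E p} (hz : z ∈ Ω) (w : E p) :
    |fderiv ℝ (normLogLik μ e n) z (0, w) - fderiv ℝ (logZeroth μ) z (0, w)| ≤ C / n * ‖w‖ := by
  have h1 := h.c2Bound_smul hΩ hn
  have h2 := (hasFDerivAt_of_contDiffOn hΩ hψ hz).add (hasFDerivAt_of_contDiffOn hΩ h1.1 hz)
  have h3 : fderiv ℝ (normLogLik μ e n) z = _ := h2.fderiv
  rw [h3, add_apply, add_sub_cancel_left]
  refine (h1.norm_apply_le hz (0, w)).trans_eq ?_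
  simp [Prod.norm_def]

lemma ExpandsOn.strongConcaveSnd (hκ : StrongConcaveSnd (2 * κ) (logZeroth μ) Ω)
    (hnκ : C / n ≤ κ) : StrongConcaveSnd κ (normLogLik μ e n) Ω := by
  refine ⟨h.contDiffOn_normLogLik hΩ hψ hn, fun z hz w => ?_⟩
  have h1 := h.c2Bound_smul hΩ hn
  have h2 : fderiv ℝ (normLogLik μ e n) =ᶠ[𝓝 z] fun z =>
      fderiv ℝ (logZeroth μ) z + fderiv ℝ (fun z => (n : ℝ)⁻¹ * e n z) z := by
    filter_upwards [hΩ.mem_nhds hz] with r hr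
    exact ((hasFDerivAt_of_contDiffOn hΩ hψ hr).add (hasFDerivAt_of_contDiffOn hΩ h1.1 hr)).fderiv
  have h3 := ((hasFDerivAt_fderiv hΩ hψ hz).add
    (hasFDerivAt_fderiv hΩ h1.1 hz)).congr_of_eventuallyEq h2
  rw [h3.fderiv, add_apply, add_apply]
  have h4 := hκ.2 z hz w
  have h5 := (le_abs_self _).trans (h1.norm_apply₂_le hz (0, w) (0, w))
  have h6 : ‖((0, w) : E m × E p)‖ = ‖w‖ := by simp [Prod.norm_def]
  rw [h6] at h5
  nlinarith [sq_nonneg ‖w‖, mul_le_mul_of_nonneg_right hnκ (sq_nonneg ‖w‖)]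

end

/-- For fixed n and y the likelihood is an increasing function of `normLogLik`, and for a function
that is strongly concave on a convex set containing the slice, local maxima are exactly the critical
points, of which there is at most one. -/
lemma ExpandsOn.isUniqueLocalMaxIn_iff (h : ExpandsOn μ ℓ adm Ω C n₀ e a) (hΩ : IsOpen Ω)
    (hc : Convex ℝ Ω) (hκ : StrongConcaveSnd (2 * κ) (logZeroth μ) Ω) (hκ0 : 0 < κ) {n : ℕ}
    (hn : n₀ ≤ n) (hn1 : 1 ≤ n) (hnκ : C / n ≤ κ) {y : E m} (hadm : (n : ℝ) • y ∈ adm)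
    {U : Set (E p)} (hU : IsOpen U) (hyU : ∀ θ ∈ U, (y, θ) ∈ Ω) {θ : E p} :
    IsUniqueLocalMaxIn (fun θ => ℓ n θ ((n : ℝ) • y)) U θ ↔
      θ ∈ U ∧ IsCritSnd (normLogLik μ e n) y θ := by
  have hS := h.strongConcaveSnd hΩ hκ.1 hn hκ hnκ
  have ha := (h n hn).1
  have hn0 : (0 : ℝ) < n := by exact_mod_cast hn1
  have hmono : ∀ θ ∈ U, ∀ θ' ∈ U, (ℓ n θ ((n : ℝ) • y) ≤ ℓ n θ' ((n : ℝ) • y) ↔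
      normLogLik μ e n (y, θ) ≤ normLogLik μ e n (y, θ')) := by
    intro θ hθ θ' hθ'
    rw [h.lik_eq hn hn1 (hyU θ hθ) hadm, h.lik_eq hn hn1 (hyU θ' hθ') hadm,
      mul_le_mul_iff_right₀ ha, Real.exp_le_exp, mul_le_mul_iff_right₀ hn0]
  have hcrit : ∀ θ ∈ U, IsLocalMax (fun θ => ℓ n θ ((n : ℝ) • y)) θ ↔
      IsCritSnd (normLogLik μ e n) y θ := by
    intro θ hθ
    constructor
    · intro hmax
      have h1 : IsLocalMax (fun θ => normLogLik μ e n (y, θ)) θ := by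
        filter_upwards [hmax, hU.mem_nhds hθ] with θ' h2 h3
        exact (hmono θ' h3 θ hθ).1 h2
      intro w
      simpa using congrArg (fun T => T w)
        (h1.hasFDerivAt_eq_zero (hasFDerivAt_section (y := y) hΩ hS.1 (hyU θ hθ)))
    · intro hcr
      filter_upwards [hU.mem_nhds hθ] with θ' h3
      refine (hmono θ' h3 θ hθ).2 ((hS.le_of_isCrit hΩ hc (hyU θ hθ) (hyU θ' h3) hcr).trans ?_)
      have : 0 ≤ κ / 2 * ‖θ' - θ‖ ^ 2 := by positivity
      linarith
  have huniq : ∀ θ ∈ U, ∀ θ' ∈ U, IsCritSnd (normLogLik μ e n) y θ →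
      IsCritSnd (normLogLik μ e n) y θ' → θ = θ' := fun θ hθ θ' hθ' =>
    hS.eq_of_isCrit hκ0 hΩ hc (hyU θ hθ) (hyU θ' hθ')
  constructor
  · rintro ⟨h1, h2, -⟩
    exact ⟨h1, (hcrit θ h1).1 h2⟩
  · rintro ⟨h1, h2⟩
    exact ⟨h1, (hcrit θ h1).2 h2, fun θ' h3 h4 => huniq θ' h3 θ h1 ((hcrit θ' h3).1 h4) h2⟩

/-- A neighbourhood `V × U` of `z₀` on which the critical points of all normalised log-likelihoods
with error bound `C` exist, for `n ≥ n₁`. -/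
structure LocalRegion (D : Set (E p)) (μ : E p → Measure (E m)) (z₀ : E m × E p) (r ρ δ κ C : ℝ)
    (n₁ : ℕ) : Prop where
  pos : 0 < ρ ∧ 0 < δ ∧ 0 < κ ∧ 1 ≤ n₁
  lt : ρ < r ∧ δ ≤ r
  subset : Metric.ball z₀ r ⊆ saddleRegion D μ
  concave : StrongConcaveSnd (2 * κ) (logZeroth μ) (Metric.ball z₀ r)
  error : ∀ n ≥ n₁, C / n ≤ κ
  crit : ∀ (ℓ : ℕ → E p → E m → ℝ) (adm : Set (E m)) (e : ℕ → E m × E p → ℝ) (a : ℕ → ℝ),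
    ExpandsOn μ ℓ adm (Metric.ball z₀ r) C n₁ e a → ∀ n ≥ n₁, ∀ y ∈ Metric.ball z₀.1 δ,
      ∃ θ ∈ Metric.ball z₀.2 ρ, IsCritSnd (normLogLik μ e n) y θ

lemma ball_prod_subset {z₀ : E m × E p} {r ρ δ : ℝ} (h₁ : δ ≤ r) (h₂ : ρ ≤ r) :
    Metric.ball z₀.1 δ ×ˢ Metric.ball z₀.2 ρ ⊆ Metric.ball z₀ r := by
  rw [← ball_prod_same z₀.1 z₀.2 r]
  exact prod_mono (Metric.ball_subset_ball h₁) (Metric.ball_subset_ball h₂)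

lemma exists_localRegion {z₀ : E m × E p} {r : ℝ} (hr : 0 < r)
    (hsub : Metric.ball z₀ r ⊆ saddleRegion D μ)
    (hκ : StrongConcaveSnd (2 * κ) (logZeroth μ) (Metric.ball z₀ r)) (hκ0 : 0 < κ)
    (hcr : IsCritSnd (logZeroth μ) z₀.1 z₀.2) (C : ℝ) (n₀ : ℕ) :
    ∃ ρ δ n₁, n₀ ≤ n₁ ∧ LocalRegion D μ z₀ r ρ δ κ C n₁ := by
  have hΩ : IsOpen (Metric.ball z₀ r) := Metric.isOpen_ball
  have hz₀ : z₀ ∈ Metric.ball z₀ r := Metric.mem_ball_self hr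
  have h3 : ContinuousAt (fun y' => (fderiv ℝ (logZeroth μ) (y', z₀.2)).comp
      (ContinuousLinearMap.inr ℝ (E m) (E p))) z₀.1 :=
    ContinuousAt.clm_comp (((contDiffOn_fderiv hΩ hκ.1).continuousOn.continuousAt
      (hΩ.mem_nhds hz₀)).comp (f := fun y' => (y', z₀.2)) (x := z₀.1)
      (by fun_prop)) continuousAt_const
  have h4 : (fderiv ℝ (logZeroth μ) (z₀.1, z₀.2)).comp (ContinuousLinearMap.inr ℝ (E m) (E p)) = 0 := by
    ext w; simpa using hcr w
  have h5 := h3.norm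
  rw [ContinuousAt, h4, norm_zero] at h5
  -- With ρ = r/2, the gradient of ψ at (y, θ₀) and the gradient of eₙ/n each get the budget κρ/8.
  -- The total κρ/4 satisfies the requirement 2c < κρ of `StrongConcaveSnd.exists_isCrit`.
  obtain ⟨δ, hδ, h6⟩ := Metric.eventually_nhds_iff_ball.1
    (h5.eventually (gt_mem_nhds (by positivity : 0 < κ * (r / 2) / 8)))
  have h7 : Tendsto (fun n : ℕ => C / n) atTop (𝓝 0) := tendsto_const_div_atTop_nhds_zero_nat C
  obtain ⟨N, hN⟩ := eventually_atTop.1 ((h7.eventually (gt_mem_nhds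
    (by positivity : 0 < κ * (r / 2) / 8))).and (h7.eventually (gt_mem_nhds hκ0)))
  refine ⟨r / 2, min δ r, max n₀ (max N 1), le_max_left _ _, ⟨by positivity, lt_min hδ hr, hκ0,
    (le_max_right _ _).trans (le_max_right _ _)⟩, ⟨by linarith, min_le_right _ _⟩, hsub, hκ,
    fun n hn => (hN n ((le_max_left _ _).trans ((le_max_right _ _).trans hn))).2.le, ?_⟩
  intro ℓ adm e a h n hn y hy
  have hNn := hN n ((le_max_left _ _).trans ((le_max_right _ _).trans hn))
  have hS := h.strongConcaveSnd hΩ hκ.1 hn hκ hNn.2.le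
  have hy' : y ∈ Metric.ball z₀.1 r := Metric.ball_subset_ball (min_le_right _ _) hy
  have hmem : ∀ θ ∈ Metric.ball z₀.2 r, (y, θ) ∈ Metric.ball z₀ r := fun θ hθ =>
    ball_prod_subset le_rfl le_rfl ⟨hy', hθ⟩
  refine hS.exists_isCrit hΩ (convex_ball z₀ r) (by positivity) (c := κ * (r / 2) / 4)
    (fun θ hθ => hmem θ (Metric.closedBall_subset_ball (by linarith) hθ)) (fun w => ?_) ?_
  · have e1 := h.abs_fderiv_sub_le hΩ hκ.1 hn (hmem z₀.2 (Metric.mem_ball_self hr)) w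
    have e2 := ((fderiv ℝ (logZeroth μ) (y, z₀.2)).comp
      (ContinuousLinearMap.inr ℝ (E m) (E p))).le_opNorm w
    have e3 := h6 y (Metric.ball_subset_ball (min_le_left _ _) hy)
    simp only [ContinuousLinearMap.coe_comp, Function.comp_apply, ContinuousLinearMap.inr_apply,
      Real.norm_eq_abs] at e2
    have e4 := mul_le_mul_of_nonneg_right e3.le (norm_nonneg w)
    have e5 := mul_le_mul_of_nonneg_right hNn.1.le (norm_nonneg w)
    have e6 := abs_add_le (fderiv ℝ (normLogLik μ e n) (y, z₀.2) (0, w) -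
      fderiv ℝ (logZeroth μ) (y, z₀.2) (0, w)) (fderiv ℝ (logZeroth μ) (y, z₀.2) (0, w))
    rw [sub_add_cancel] at e6
    linarith
  · nlinarith [mul_pos hκ0 hr]

namespace LocalRegion

variable {z₀ : E m × E p} {r ρ δ : ℝ} {n₁ : ℕ} (R : LocalRegion D μ z₀ r ρ δ κ C n₁)

include R

lemma prod_subset : Metric.ball z₀.1 δ ×ˢ Metric.ball z₀.2 ρ ⊆ Metric.ball z₀ r :=
  ball_prod_subset R.lt.2 R.lt.1.le

lemma isUniqueLocalMaxIn_iff (h : ExpandsOn μ ℓ adm (Metric.ball z₀ r) C n₁ e a) {n : ℕ}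
    (hn : n₁ ≤ n) {y : E m} (hy : y ∈ Metric.ball z₀.1 δ) (hadm : (n : ℝ) • y ∈ adm) {θ : E p} :
    IsUniqueLocalMaxIn (fun θ => ℓ n θ ((n : ℝ) • y)) (Metric.ball z₀.2 ρ) θ ↔
      θ ∈ Metric.ball z₀.2 ρ ∧ IsCritSnd (normLogLik μ e n) y θ :=
  h.isUniqueLocalMaxIn_iff Metric.isOpen_ball (convex_ball _ _) R.concave R.pos.2.2.1 hn
    (R.pos.2.2.2.trans hn) (R.error n hn) hadm Metric.isOpen_ball
    fun _ hθ => R.prod_subset ⟨hy, hθ⟩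

/-- The critical points of `normLogLik` exist for every y in the ball, whether ny is admissible or
not, and depend continuously on y; extension by 0 outside the ball is then measurable. -/
lemma exists_isMLEIn (h : ExpandsOn μ ℓ adm (Metric.ball z₀ r) C n₁ e a) :
    ∃ T, IsMLEIn ℓ adm (Metric.ball z₀.2 ρ) (Metric.ball z₀.1 δ) n₁ T := by
  classical
  choose! τ hτ using fun (n : ℕ) (hn : n ≥ n₁) (y : E m) (hy : y ∈ Metric.ball z₀.1 δ) =>
    R.crit ℓ adm e a h n hn y hy
  have hcont : ∀ n ≥ n₁, ContinuousOn (τ n) (Metric.ball z₀.1 δ) := fun n hn =>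
    (h.strongConcaveSnd Metric.isOpen_ball R.concave.1 hn R.concave
      (R.error n hn)).continuousOn_crit R.pos.2.2.1 Metric.isOpen_ball (convex_ball _ _)
      R.prod_subset (hτ n hn)
  refine ⟨fun n x => if n₁ ≤ n then
    (Metric.ball z₀.1 δ).piecewise (τ n) 0 ((n : ℝ)⁻¹ • x) else 0, fun n => ?_,
    fun n hn y hy hadm => ?_⟩
  · by_cases hn : n₁ ≤ n
    · simp only [hn, if_true]
      exact ((hcont n hn).measurable_piecewise continuousOn_const
        Metric.isOpen_ball.measurableSet).comp (measurable_const_smul _)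
    · simp only [hn, if_false]
      exact measurable_const
  · have hn0 : (n : ℝ) ≠ 0 := by
      have := R.pos.2.2.2.trans hn
      positivity
    rw [R.isUniqueLocalMaxIn_iff h hn hy hadm]
    beta_reduce
    rw [if_pos (show n₁ ≤ n from hn), inv_smul_smul₀ hn0,
      piecewise_eq_of_mem _ _ _ hy]
    exact hτ n hn y hy

/-- Both log-likelihood gradients are within C/n of that of ψ, so the maximiser of one is critical
for the other up to 2C/n. -/
lemma norm_sub_le (h : ExpandsOn μ ℓ adm (Metric.ball z₀ r) C n₁ e a)
    {ℓ' : ℕ → E p → E m → ℝ} {adm' : Set (E m)} {e' : ℕ → E m × E p → ℝ} {a' : ℕ → ℝ}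
    (h' : ExpandsOn μ ℓ' adm' (Metric.ball z₀ r) C n₁ e' a') (hC : 0 ≤ C) {n : ℕ} (hn : n₁ ≤ n)
    {y : E m} (hy : y ∈ Metric.ball z₀.1 δ) {θ θ' : E p} (hθ : θ ∈ Metric.ball z₀.2 ρ)
    (hθ' : θ' ∈ Metric.ball z₀.2 ρ) (hcr : IsCritSnd (normLogLik μ e n) y θ)
    (hcr' : IsCritSnd (normLogLik μ e' n) y θ') : ‖θ - θ'‖ ≤ 2 * C / κ / n := by
  have hκ := R.pos.2.2.1
  have hz' : (y, θ') ∈ Metric.ball z₀ r := R.prod_subset ⟨hy, hθ'⟩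
  have hz : (y, θ) ∈ Metric.ball z₀ r := R.prod_subset ⟨hy, hθ⟩
  have hb : ∀ w : E p, |fderiv ℝ (normLogLik μ e n) (y, θ') (0, w)| ≤ 2 * C / n * ‖w‖ := fun w => by
    have e1 := h.abs_fderiv_sub_le Metric.isOpen_ball R.concave.1 hn hz' w
    have e2 := h'.abs_fderiv_sub_le Metric.isOpen_ball R.concave.1 hn hz' w
    rw [hcr' w, zero_sub, abs_neg] at e2
    have e3 := abs_add_le (fderiv ℝ (normLogLik μ e n) (y, θ') (0, w) -
      fderiv ℝ (logZeroth μ) (y, θ') (0, w)) (fderiv ℝ (logZeroth μ) (y, θ') (0, w))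
    rw [sub_add_cancel] at e3
    calc _ ≤ _ := e3
      _ ≤ C / n * ‖w‖ + C / n * ‖w‖ := add_le_add e1 e2
      _ = _ := by ring
  have h1 := (h.strongConcaveSnd Metric.isOpen_ball R.concave.1 hn R.concave
    (R.error n hn)).norm_sub_le Metric.isOpen_ball (convex_ball _ _) hz
    hz' hcr (by positivity) hb
  have h2 : 2 * C / κ / n = 2 * C / n / κ := div_right_comm _ _ _
  rw [h2, le_div_iff₀ hκ, mul_comm]
  exact h1

/-- Linearisation of the critical point. -/
lemma norm_sub_linear_le (h : ExpandsOn μ ℓ adm (Metric.ball z₀ r) C n₁ e a) (hC : 0 ≤ C)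
    (hcr₀ : IsCritSnd (logZeroth μ) z₀.1 z₀.2) (G : E m →L[ℝ] E p)
    (hGv : ∀ v w, fderiv ℝ (fderiv ℝ (logZeroth μ)) z₀ (v, G v) (0, w) = 0) {ε : ℝ} (hε : 0 < ε) :
    ∃ δ' > 0, ∀ n ≥ n₁, ∀ v : E m, ‖v‖ < δ' → ∀ θ ∈ Metric.ball z₀.2 ρ,
      IsCritSnd (normLogLik μ e n) (z₀.1 + v) θ → ‖θ - z₀.2 - G v‖ ≤ ε * ‖v‖ + C / κ / n := by
  have hκ := R.pos.2.2.1
  have hr : 0 < r := R.pos.1.trans R.lt.1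
  have hd := hasFDerivAt_fderiv Metric.isOpen_ball R.concave.1 (Metric.mem_ball_self hr)
  rw [hasFDerivAt_iff_isLittleO_nhds_zero, Asymptotics.isLittleO_iff] at hd
  -- Makes c‖(v, Gv)‖ at most κε‖v‖.
  set c := κ * ε / (1 + ‖G‖) with hc
  have hG0 : 0 < 1 + ‖G‖ := by positivity
  have hc0 : 0 < c := by positivity
  obtain ⟨d, hd0, hd1⟩ := Metric.eventually_nhds_iff_ball.1 (hd hc0)
  refine ⟨min (d / (1 + ‖G‖)) (min (r / (1 + ‖G‖)) δ),
    lt_min (by positivity) (lt_min (by positivity) R.pos.2.1), fun n hn v hv θ hθ hcr => ?_⟩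
  have hv1 := (lt_div_iff₀ hG0).1 (hv.trans_le (min_le_left _ _))
  have hv2 := (lt_div_iff₀ hG0).1
    (hv.trans_le ((min_le_right _ _).trans (min_le_left _ _)))
  have hv3 := hv.trans_le ((min_le_right _ _).trans (min_le_right _ _))
  have hvG : ‖((v, G v) : E m × E p)‖ ≤ ‖v‖ * (1 + ‖G‖) := by
    rw [Prod.norm_def]
    refine max_le ?_ ((G.le_opNorm v).trans ?_) <;>
    nlinarith [norm_nonneg v, norm_nonneg G]
  have hy : z₀.1 + v ∈ Metric.ball z₀.1 δ := by simpa using hv3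
  have hz' : (z₀.1 + v, z₀.2 + G v) ∈ Metric.ball z₀ r := by
    have : (z₀.1 + v, z₀.2 + G v) = z₀ + (v, G v) := rfl
    rw [this, Metric.mem_ball, dist_self_add_left]
    exact hvG.trans_lt hv2
  have h1 := hd1 (v, G v) (by rw [mem_ball_zero_iff]; exact hvG.trans_lt hv1)
  -- The predicted point θ₀ + Gv is almost critical: by the choice of G the first-order term of the
  -- gradient of ψ vanishes there, leaving κε‖v‖ from Taylor and C/n from eₙ.
  have h2 := (h.strongConcaveSnd Metric.isOpen_ball R.concave.1 hn R.concave
      (R.error n hn)).norm_sub_le Metric.isOpen_ball (convex_ball _ _) (R.prod_subset ⟨hy, hθ⟩)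
      hz' hcr (c := κ * ε * ‖v‖ + C / n) (by positivity) fun w => by
    have e1 := h.abs_fderiv_sub_le Metric.isOpen_ball R.concave.1 hn hz' w
    have e2 := ContinuousLinearMap.le_opNorm (fderiv ℝ (logZeroth μ) (z₀ + (v, G v)) -
      fderiv ℝ (logZeroth μ) z₀ - fderiv ℝ (fderiv ℝ (logZeroth μ)) z₀ (v, G v)) (0, w)
    have e3 : fderiv ℝ (logZeroth μ) z₀ (0, w) = 0 := hcr₀ w
    rw [sub_apply, sub_apply, e3, hGv, sub_zero, sub_zero, Real.norm_eq_abs] at e2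
    have e4 : ‖((0, w) : E m × E p)‖ = ‖w‖ := by simp [Prod.norm_def]
    rw [e4] at e2
    have e5 : |fderiv ℝ (logZeroth μ) (z₀.1 + v, z₀.2 + G v) (0, w)| ≤ κ * ε * ‖v‖ * ‖w‖ := by
      refine e2.trans (mul_le_mul_of_nonneg_right (h1.trans ?_) (norm_nonneg w))
      refine (mul_le_mul_of_nonneg_left hvG hc0.le).trans_eq ?_
      rw [hc]; field_simp
    have e6 := abs_add_le (fderiv ℝ (normLogLik μ e n) (z₀.1 + v, z₀.2 + G v) (0, w) -
      fderiv ℝ (logZeroth μ) (z₀.1 + v, z₀.2 + G v) (0, w))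
      (fderiv ℝ (logZeroth μ) (z₀.1 + v, z₀.2 + G v) (0, w))
    rw [sub_add_cancel] at e6
    linarith
  rw [sub_sub]
  have h3 : κ * ‖θ - (z₀.2 + G v)‖ ≤ κ * (ε * ‖v‖ + C / κ / n) := by
    refine h2.trans_eq ?_
    field_simp
  exact le_of_mul_le_mul_left h3 hκ

end LocalRegion

end Saddlepoint

namespace Saddlepoint

/-! ### Convergence in distribution -/

section Distribution

variable {Ω Ω' F : Type*} [MeasurableSpace Ω] [MeasurableSpace Ω'] [NormedAddCommGroup F]
  [MeasurableSpace F] [BorelSpace F] [SecondCountableTopology F]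
  {Q : ℕ → Measure Ω} [∀ n, IsProbabilityMeasure (Q n)] {γ : Measure Ω'} [IsProbabilityMeasure γ]
  {X Y : ℕ → Ω → F} {Z : Ω' → F}

/-- Slutsky's argument on bounded Lipschitz test functions: where Y and X differ by less than η the
Lipschitz constant applies, and the remaining event has probability at most η. -/
lemma tendstoInDistribution_of_norm_sub (hX : TendstoInDistribution X atTop Z Q γ)
    (hXm : ∀ n, Measurable (X n)) (hYm : ∀ n, Measurable (Y n))
    (h : ∀ η > 0, ∀ᶠ n in atTop, (Q n).real {ω | η ≤ ‖Y n ω - X n ω‖} ≤ η) :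
    TendstoInDistribution Y atTop Z Q γ := by
  refine ⟨fun n => (hYm n).aemeasurable, hX.aemeasurable_limit, ?_⟩
  refine tendsto_iff_forall_lipschitz_integral_tendsto.2 ?_
  rintro f ⟨M, hM⟩ ⟨K, hK⟩
  have hf : Continuous f := hK.continuous
  have h0 := tendsto_iff_forall_lipschitz_integral_tendsto.1 hX.tendsto f ⟨M, hM⟩ ⟨K, hK⟩
  simp only [ProbabilityMeasure.coe_mk] at h0 ⊢
  have hbd : ∀ x, ‖f x‖ ≤ ‖f 0‖ + M := fun x => by
    have h1 := hM x 0
    have h2 := norm_sub_norm_le (f x) (f 0)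
    rw [← dist_eq_norm] at h2
    linarith
  have hint : ∀ (W : ℕ → Ω → F), (∀ n, Measurable (W n)) → ∀ n,
      Integrable (fun ω => f (W n ω)) (Q n) := fun W hW n =>
    .of_bound (hf.measurable.comp (hW n)).aestronglyMeasurable _ (.of_forall fun _ => hbd _)
  have hM0 : 0 ≤ M := dist_nonneg.trans (hM 0 0)
  have hdiff : Tendsto (fun n => ∫ ω, f ω ∂((Q n).map (Y n)) - ∫ ω, f ω ∂((Q n).map (X n))) atTop
      (𝓝 0) := by
    rw [Metric.tendsto_nhds]
    intro ε hε
    have hη : 0 < ε / (2 * (K + M + 1)) := by positivity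
    filter_upwards [h _ hη] with n hn
    set η := ε / (2 * (K + M + 1)) with hηdef
    rw [integral_map (hYm n).aemeasurable hf.aestronglyMeasurable,
      integral_map (hXm n).aemeasurable hf.aestronglyMeasurable,
      ← integral_sub (hint Y hYm n) (hint X hXm n), dist_zero_right]
    have hms : MeasurableSet {ω | η ≤ ‖Y n ω - X n ω‖} :=
      measurableSet_le measurable_const ((hYm n).sub (hXm n)).norm
    have hle : ∀ ω, ‖f (Y n ω) - f (X n ω)‖ ≤
        K * η + {ω | η ≤ ‖Y n ω - X n ω‖}.indicator (fun _ => M) ω := fun ω => by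
      by_cases hω : η ≤ ‖Y n ω - X n ω‖
      · rw [indicator_of_mem (s := {ω | η ≤ ‖Y n ω - X n ω‖}) hω, ← dist_eq_norm]
        have := hM (Y n ω) (X n ω)
        have : (0 : ℝ) ≤ K * η := by positivity
        linarith
      · rw [indicator_of_notMem (s := {ω | η ≤ ‖Y n ω - X n ω‖}) hω, add_zero, ← dist_eq_norm]
        refine (hK.dist_le_mul _ _).trans ?_
        rw [dist_eq_norm]
        exact mul_le_mul_of_nonneg_left (not_le.1 hω).le K.2
    have h2 : ‖∫ ω, f (Y n ω) - f (X n ω) ∂(Q n)‖ ≤ K * η + M * η := by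
      refine (norm_integral_le_of_norm_le ((integrable_const _).add
        ((integrable_const M).indicator hms)) (.of_forall hle)).trans ?_
      rw [integral_add' (integrable_const _) ((integrable_const M).indicator hms),
        integral_indicator_const _ hms]
      simp only [integral_const, probReal_univ, one_mul, smul_eq_mul]
      refine add_le_add le_rfl ?_
      rw [mul_comm]
      exact mul_le_mul_of_nonneg_left hn hM0
    refine h2.trans_lt ?_
    rw [← add_mul, hηdef, mul_div_assoc', div_lt_iff₀ (by positivity)]
    nlinarith [K.2, mul_nonneg K.2 hε.le, mul_nonneg hM0 hε.le]
  simpa using hdiff.add h0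

/-- Tightness of the limit passes to the sequence by the portmanteau inequality for closed sets.
Using R + 1 gives a closed set inside the complement of the closed ball of radius R. -/
lemma exists_eventually_norm_le [NormedSpace ℝ F] [FiniteDimensional ℝ F]
    (hX : TendstoInDistribution X atTop Z Q γ) (hXm : ∀ n, Measurable (X n)) {η : ℝ} (hη : 0 < η) :
    ∃ R > 0, ∀ᶠ n in atTop, (Q n).real {ω | R ≤ ‖X n ω‖} ≤ η := by
  have : ProperSpace F := FiniteDimensional.proper_real F
  have := Measure.isProbabilityMeasure_map (μ := γ) hX.aemeasurable_limit
  have h1 := tendsto_measure_compl_closedBall_of_isTightMeasureSet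
    (isTightMeasureSet_singleton (μ := γ.map Z)) (0 : F)
  simp only [mem_singleton_iff, iSup_iSup_eq_left] at h1
  obtain ⟨R, hR1, hR⟩ := ((h1.eventually (gt_mem_nhds (ENNReal.ofReal_pos.2 hη))).and
    (eventually_gt_atTop 0)).exists
  refine ⟨R + 1, by linarith, ?_⟩
  have hcl : IsClosed {x : F | R + 1 ≤ ‖x‖} := isClosed_le continuous_const continuous_norm
  have h2 := ProbabilityMeasure.limsup_measure_closed_le_of_tendsto hX.tendsto hcl
  have h3 : γ.map Z {x : F | R + 1 ≤ ‖x‖} < ENNReal.ofReal η := by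
    refine (measure_mono fun x hx => ?_).trans_lt hR1
    simp only [mem_compl_iff, Metric.mem_closedBall, dist_zero_right, not_le]
    have : R + 1 ≤ ‖x‖ := hx
    linarith
  filter_upwards [eventually_lt_of_limsup_lt (h2.trans_lt h3)] with n hn
  simp only [ProbabilityMeasure.coe_mk] at hn
  rw [Measure.map_apply (hXm n) hcl.measurableSet] at hn
  exact ENNReal.toReal_le_of_le_ofReal hη.le hn.le

end Distribution

/-- The delta method. With z the standardised observation, multiplying the linearisation error by √n
gives ε‖z‖ + c/√n, which is small on the event that ‖z‖ stays below the tightness radius. -/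
lemma tendstoInDistribution_of_linearisation {m : ℕ} {F : Type*} [NormedAddCommGroup F]
    [NormedSpace ℝ F] [MeasurableSpace F] [BorelSpace F] [SecondCountableTopology F]
    {Q : ℕ → Measure (E m)} [∀ n, IsProbabilityMeasure (Q n)] {γ : Measure (E m)}
    [IsProbabilityMeasure γ] {T : ℕ → E m → F} (hT : ∀ n, Measurable (T n)) {t₀ : F} {y₀ : E m}
    (G : E m →L[ℝ] F) {c : ℝ} {n₁ : ℕ}
    (hlin : ∀ ε > 0, ∃ δ > 0, ∀ n ≥ n₁, ∀ᵐ x ∂(Q n), ‖(n : ℝ)⁻¹ • x - y₀‖ < δ →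
      ‖T n x - t₀ - G ((n : ℝ)⁻¹ • x - y₀)‖ ≤ ε * ‖(n : ℝ)⁻¹ • x - y₀‖ + c / n)
    (hZ : TendstoInDistribution (fun (n : ℕ) (x : E m) => (√(n : ℝ))⁻¹ • (x - (n : ℝ) • y₀)) atTop
      (id : E m → E m) Q γ) :
    TendstoInDistribution (fun (n : ℕ) (x : E m) => √(n : ℝ) • (T n x - t₀)) atTop (fun z => G z)
      Q γ := by
  have hZm : ∀ n : ℕ, Measurable fun x : E m => (√(n : ℝ))⁻¹ • (x - (n : ℝ) • y₀) := fun n => by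
    fun_prop
  refine tendstoInDistribution_of_norm_sub (hZ.continuous_comp G.continuous)
    (fun n => G.continuous.measurable.comp (hZm n))
    (fun n => ((hT n).sub_const t₀).const_smul _) fun η hη => ?_
  obtain ⟨R, hR, hev⟩ := exists_eventually_norm_le hZ hZm hη
  -- With ε = η/(2R) the term ε‖z‖ is below η/2 whenever ‖z‖ < R.
  obtain ⟨δ, hδ, hlin⟩ := hlin (η / (2 * R)) (by positivity)
  have hsq : Tendsto (fun n : ℕ => √(n : ℝ)) atTop atTop :=
    Real.tendsto_sqrt_atTop.comp tendsto_natCast_atTop_atTop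
  have h1 : Tendsto (fun n : ℕ => R / √(n : ℝ)) atTop (𝓝 0) := hsq.const_div_atTop R
  have h2 : Tendsto (fun n : ℕ => c / √(n : ℝ)) atTop (𝓝 0) := hsq.const_div_atTop c
  filter_upwards [hev, h1.eventually (gt_mem_nhds hδ), h2.eventually (gt_mem_nhds (half_pos hη)),
    eventually_ge_atTop (max n₁ 1)] with n hn hn1 hn2 hn3
  refine le_trans (ENNReal.toReal_mono (measure_ne_top _ _) (measure_mono_ae ?_)) hn
  filter_upwards [hlin n ((le_max_left _ _).trans hn3)] with x hx hx1
  have hn0 : (0 : ℝ) < n := by exact_mod_cast (le_max_right _ _).trans hn3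
  have hs : 0 < √(n : ℝ) := Real.sqrt_pos.2 hn0
  have hss : √(n : ℝ) * √(n : ℝ) = n := Real.mul_self_sqrt hn0.le
  have hv : (n : ℝ)⁻¹ • x - y₀ = (√(n : ℝ))⁻¹ • (√(n : ℝ))⁻¹ • (x - (n : ℝ) • y₀) := by
    rw [smul_smul, ← mul_inv, hss, smul_sub, inv_smul_smul₀ hn0.ne']
  by_contra hcon
  have hlt : ‖(√(n : ℝ))⁻¹ • (x - (n : ℝ) • y₀)‖ < R := not_le.1 hcon
  have h5 : η ≤ ‖√(n : ℝ) • (T n x - t₀) - G ((√(n : ℝ))⁻¹ • (x - (n : ℝ) • y₀))‖ := hx1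
  set z := (√(n : ℝ))⁻¹ • (x - (n : ℝ) • y₀)
  clear_value z
  have hnv : ‖(n : ℝ)⁻¹ • x - y₀‖ = ‖z‖ / √(n : ℝ) := by
    rw [hv, norm_smul, norm_inv, Real.norm_of_nonneg hs.le, inv_mul_eq_div]
  have h3 := hx (by rw [hnv]; exact (div_lt_div_of_pos_right hlt hs).trans hn1)
  have h4 : √(n : ℝ) • (T n x - t₀) - G z =
      √(n : ℝ) • (T n x - t₀ - G ((n : ℝ)⁻¹ • x - y₀)) := by
    rw [hv, map_smul, smul_sub _ (T n x - t₀), smul_inv_smul₀ hs.ne']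
  rw [h4, norm_smul, Real.norm_of_nonneg hs.le] at h5
  have h6 := h5.trans (mul_le_mul_of_nonneg_left h3 hs.le)
  have h7 : √(n : ℝ) * (η / (2 * R) * ‖(n : ℝ)⁻¹ • x - y₀‖ + c / n) =
      η / (2 * R) * ‖z‖ + c / √(n : ℝ) := by
    rw [hnv, mul_add, mul_div_assoc' _ c]
    congr 1
    · field_simp
    · rw [div_eq_div_iff hn0.ne' hs.ne', mul_right_comm, hss, mul_comm]
  rw [h7] at h6
  have h8 : η / (2 * R) * ‖z‖ < η / (2 * R) * R := by gcongr
  have h9 : η / (2 * R) * R = η / 2 := by field_simp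
  linarith

/-- A matrix as a continuous linear map between Euclidean spaces. -/
noncomputable def matCLM {m p : ℕ} (M : Matrix (Fin p) (Fin m) ℝ) : E m →L[ℝ] E p :=
  LinearMap.toContinuousLinearMap (Matrix.toLpLin 2 2 M)

lemma ofLp_matCLM {m p : ℕ} (M : Matrix (Fin p) (Fin m) ℝ) (x : E m) :
    (matCLM M x).ofLp = M.mulVec x.ofLp := rfl

lemma inner_eq_dotProduct {m : ℕ} (x y : E m) : (inner ℝ x y : ℝ) = x.ofLp ⬝ᵥ y.ofLp := by
  rw [inner_euclidean]; rfl

/-- S may be singular, so characteristic functions are compared rather than densities. -/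
lemma map_multivariateGaussian {m p : ℕ} (M : Matrix (Fin p) (Fin m) ℝ)
    {S : Matrix (Fin m) (Fin m) ℝ} (hS : S.PosSemidef) :
    (multivariateGaussian 0 S).map (matCLM M) = multivariateGaussian 0 (M * S * M.transpose) := by
  have hS' : (M * S * M.transpose).PosSemidef := by
    simpa using hS.mul_mul_conjTranspose_same M
  have := Measure.isProbabilityMeasure_map (μ := multivariateGaussian 0 S)
    (matCLM M).continuous.aemeasurable
  refine Measure.ext_of_charFun (funext fun t => ?_)
  have h1 : ∀ x, (inner ℝ (matCLM M x) t : ℝ) = inner ℝ x (matCLM M.transpose t) := fun x => by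
    rw [inner_eq_dotProduct, inner_eq_dotProduct, ofLp_matCLM, ofLp_matCLM, Matrix.mulVec_transpose,
      dotProduct_comm, Matrix.dotProduct_mulVec, dotProduct_comm]
  have h2 : charFun ((multivariateGaussian 0 S).map (matCLM M)) t =
      charFun (multivariateGaussian 0 S) (matCLM M.transpose t) := by
    rw [charFun_apply, charFun_apply, integral_map (matCLM M).continuous.aemeasurable (by fun_prop)]
    simp_rw [h1]
  rw [h2, charFun_multivariateGaussian hS, charFun_multivariateGaussian hS', ofLp_matCLM]
  simp only [inner_zero_right]
  congr 3
  rw [← Matrix.mulVec_mulVec, ← Matrix.mulVec_mulVec, Matrix.dotProduct_mulVec t.ofLp,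
    Matrix.mulVec_transpose]

lemma tendstoInDistribution_congr_limit {ι Ω Ω' Ω'' F : Type*} [MeasurableSpace Ω]
    [MeasurableSpace Ω'] [MeasurableSpace Ω''] [TopologicalSpace F] [MeasurableSpace F]
    [OpensMeasurableSpace F] {l : Filter ι} {Q : ι → Measure Ω} [∀ n, IsProbabilityMeasure (Q n)]
    {γ : Measure Ω'} [IsProbabilityMeasure γ] {γ' : Measure Ω''} [IsProbabilityMeasure γ']
    {X : ι → Ω → F} {Z : Ω' → F} {Z' : Ω'' → F} (h : TendstoInDistribution X l Z Q γ)
    (hZ' : AEMeasurable Z' γ') (heq : γ.map Z = γ'.map Z') : TendstoInDistribution X l Z' Q γ' := by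
  refine ⟨h.1, hZ', ?_⟩
  have he : (⟨γ'.map Z', Measure.isProbabilityMeasure_map hZ'⟩ : ProbabilityMeasure F) =
      ⟨γ.map Z, Measure.isProbabilityMeasure_map h.aemeasurable_limit⟩ := Subtype.ext heq.symm
  exact (congrArg (fun ν => Tendsto (β := ProbabilityMeasure F) _ l (𝓝 ν)) he).mpr h.tendsto

end Saddlepoint

namespace Saddlepoint

variable {m p : ℕ} {D : Set (E p)} {μ : E p → Measure (E m)}
  {ℓ : ℕ → E p → E m → ℝ} {adm : Set (E m)} {s₀ : E m} {θ₀ : E p} {y₀ : E m}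

/-! ### Maximum likelihood estimators in the fully identifiable case -/

namespace FullyIdentifiable

lemma matH_symm (hF : FullyIdentifiable D μ s₀ θ₀ y₀) :
    (matH μ s₀ θ₀).transpose = matH μ s₀ θ₀ := by
  have := hF.negDef.isHermitian
  rw [Matrix.IsHermitian, Matrix.conjTranspose_eq_transpose_of_trivial, Matrix.transpose_neg,
    neg_inj] at this
  exact this

lemma isUnit_det_matH (hF : FullyIdentifiable D μ s₀ θ₀ y₀) : IsUnit (matH μ s₀ θ₀).det := by
  have h := hF.negDef.isUnit.neg
  rw [neg_neg] at h
  exact h.map Matrix.detMonoidHom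

variable (hM : IsModel D μ) (hG : GrowthBound D μ)
  (hA : ∀ q ∈ interior (jointDomain D μ), (cgfHess (μ q.2) q.1).PosDef)
  (hF : FullyIdentifiable D μ s₀ θ₀ y₀)

include hM hG hA hF

lemma exists_strongConcaveSnd : ∃ κ > 0, ∃ r > 0, Metric.ball (y₀, θ₀) r ⊆ saddleRegion D μ ∧
    StrongConcaveSnd (2 * κ) (logZeroth μ) (Metric.ball (y₀, θ₀) r) := by
  have hO := isOpen_saddleRegion hM hG hA
  have hcd := contDiffOn_logZeroth hM hG hA
  obtain ⟨κ, hκ, hpos⟩ := exists_pos_mul_sq_le (F := E p)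
    (f := fun v => v.ofLp ⬝ᵥ (-matH μ s₀ θ₀).mulVec v.ofLp)
    (by simp only [dotProduct, Matrix.mulVec]; fun_prop)
    (fun t v => by
      simp only [WithLp.ofLp_smul, Matrix.mulVec_smul, dotProduct_smul, smul_dotProduct,
        smul_eq_mul]
      ring)
    (fun v hv => by
      have := hF.negDef.dotProduct_mulVec_pos (x := v.ofLp) (by simpa using hv)
      simpa using this)
  obtain ⟨r, hr, hb, hS⟩ := exists_strongConcaveSnd_of_le hO hcd hF.mem_saddleRegion hκ
    fun w => by
      have h1 := hF.fderiv_fderiv_logZeroth hM hG hA 0 w w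
      have h2 := hpos w
      rw [WithLp.ofLp_zero, Matrix.mulVec_zero, zero_add] at h1
      rw [Matrix.neg_mulVec, dotProduct_neg] at h2
      rw [h1]
      linarith
  -- Passing from the point to a ball halves κ, and 2 · κ/4 = κ/2.
  exact ⟨κ / 4, by positivity, r, hr, hb, by convert hS using 1; ring⟩

/-- Radius, error constant and threshold are chosen in common for the three likelihoods, so that the
same U and V serve all of them. -/
lemma exists_localRegion (hL : LikExpansion D μ ℓ adm (y₀, θ₀)) : ∃ r ρ δ κ C n₁, 0 ≤ C ∧
    LocalRegion D μ (y₀, θ₀) r ρ δ κ C n₁ ∧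
    (∃ e a, ExpandsOn μ ℓ adm (Metric.ball (y₀, θ₀) r) C n₁ e a) ∧
    (∃ e a, ExpandsOn μ (spaLik μ) univ (Metric.ball (y₀, θ₀) r) C n₁ e a) ∧
    ∃ e a, ExpandsOn μ (zerothLik μ) univ (Metric.ball (y₀, θ₀) r) C n₁ e a := by
  obtain ⟨κ, hκ, r₀, hr₀, hb₀, hS⟩ := exists_strongConcaveSnd hM hG hA hF
  obtain ⟨r₁, hr₁, -, C₁, n₁, e₁, a₁, h₁⟩ := hL.exists_expandsOn
  obtain ⟨r₂, hr₂, -, C₂, n₂, e₂, a₂, h₂⟩ :=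
    (likExpansion_spaLik hM hG hA hF.mem_saddleRegion).exists_expandsOn
  obtain ⟨r₃, hr₃, -, C₃, n₃, e₃, a₃, h₃⟩ :=
    (likExpansion_zerothLik hM hG hA hF.mem_saddleRegion).exists_expandsOn
  set r := min (min r₀ r₁) (min r₂ r₃)
  have hr : 0 < r := lt_min (lt_min hr₀ hr₁) (lt_min hr₂ hr₃)
  have hle₀ : r ≤ r₀ := (min_le_left _ _).trans (min_le_left _ _)
  have hle₁ : r ≤ r₁ := (min_le_left _ _).trans (min_le_right _ _)
  have hle₂ : r ≤ r₂ := (min_le_right _ _).trans (min_le_left _ _)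
  have hle₃ : r ≤ r₃ := (min_le_right _ _).trans (min_le_right _ _)
  have hsub : ∀ {r'}, r ≤ r' → Metric.ball (y₀, θ₀) r ⊆ Metric.ball (y₀, θ₀) r' :=
    fun h => Metric.ball_subset_ball h
  obtain ⟨ρ, δ, N, hN, R⟩ := Saddlepoint.exists_localRegion (κ := κ) hr ((hsub hle₀).trans hb₀)
    ⟨hS.1.mono (hsub hle₀), fun z hz => hS.2 z (hsub hle₀ hz)⟩ hκ
    (fun w => hF.fderiv_logZeroth hM hG hA w) (max (max 0 C₁) (max C₂ C₃))
    (max n₁ (max n₂ n₃))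
  refine ⟨r, ρ, δ, κ, _, N, (le_max_left _ _).trans (le_max_left _ _), R, ⟨e₁, a₁, h₁.mono
    (hsub hle₁) ((le_max_right _ _).trans (le_max_left _ _)) ((le_max_left _ _).trans hN)⟩,
    ⟨e₂, a₂, h₂.mono (hsub hle₂) ((le_max_left _ _).trans (le_max_right _ _))
      (((le_max_left _ _).trans (le_max_right _ _)).trans hN)⟩,
    ⟨e₃, a₃, h₃.mono (hsub hle₃) ((le_max_right _ _).trans (le_max_right _ _))
      (((le_max_right _ _).trans (le_max_right _ _)).trans hN)⟩⟩

end FullyIdentifiable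

lemma ball_subset_of_localRegion {z₀ : E m × E p} {r ρ δ κ C : ℝ} {n₁ : ℕ}
    (R : LocalRegion D μ z₀ r ρ δ κ C n₁) : Metric.ball z₀.2 ρ ⊆ D := fun θ hθ => by
  obtain ⟨s, -, hs⟩ := R.subset (R.prod_subset
    (show (z₀.1, θ) ∈ _ from ⟨Metric.mem_ball_self R.pos.2.1, hθ⟩))
  exact (interior_subset hs).1

/-- The derivative of the limiting critical point with respect to `y`. -/
noncomputable def sensitivity (μ : E p → Measure (E m)) (s₀ : E m) (θ₀ : E p) :
    Matrix (Fin p) (Fin m) ℝ :=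
  -((matH μ s₀ θ₀)⁻¹ * (matB μ s₀ θ₀).transpose * (matA μ s₀ θ₀)⁻¹)

lemma FullyIdentifiable.fderiv_fderiv_sensitivity (hM : IsModel D μ) (hG : GrowthBound D μ)
    (hA : ∀ q ∈ interior (jointDomain D μ), (cgfHess (μ q.2) q.1).PosDef)
    (hF : FullyIdentifiable D μ s₀ θ₀ y₀) (v : E m) (w : E p) :
    fderiv ℝ (fderiv ℝ (logZeroth μ)) (y₀, θ₀) (v, matCLM (sensitivity μ s₀ θ₀) v) (0, w) = 0 := by
  rw [hF.fderiv_fderiv_logZeroth hM hG hA, ofLp_matCLM, Matrix.mulVec_mulVec, sensitivity,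
    Matrix.mul_neg, Matrix.mul_assoc (matH μ s₀ θ₀)⁻¹, ← Matrix.mul_assoc (matH μ s₀ θ₀),
    Matrix.mul_nonsing_inv _ hF.isUnit_det_matH, Matrix.one_mul, Matrix.neg_mulVec,
    add_neg_cancel, dotProduct_zero]

lemma FullyIdentifiable.sensitivity_mul_mul_transpose
    (hA : ∀ q ∈ interior (jointDomain D μ), (cgfHess (μ q.2) q.1).PosDef)
    (hF : FullyIdentifiable D μ s₀ θ₀ y₀) (S : Matrix (Fin m) (Fin m) ℝ) :
    sensitivity μ s₀ θ₀ * S * (sensitivity μ s₀ θ₀).transpose =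
      (matH μ s₀ θ₀)⁻¹ * (matB μ s₀ θ₀).transpose * (matA μ s₀ θ₀)⁻¹ * S *
        (matA μ s₀ θ₀)⁻¹ * matB μ s₀ θ₀ * (matH μ s₀ θ₀)⁻¹ := by
  have hAs : (matA μ s₀ θ₀).transpose = matA μ s₀ θ₀ := by
    have := (hA _ hF.mem_interior).isHermitian
    rwa [Matrix.IsHermitian, Matrix.conjTranspose_eq_transpose_of_trivial] at this
  rw [sensitivity, Matrix.transpose_neg, Matrix.mul_neg, Matrix.neg_mul, Matrix.neg_mul, neg_neg,
    Matrix.transpose_mul, Matrix.transpose_mul, Matrix.transpose_transpose,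
    Matrix.transpose_nonsing_inv, Matrix.transpose_nonsing_inv, hAs, hF.matH_symm]
  simp only [Matrix.mul_assoc]

namespace LocalRegion

variable {z₀ : E m × E p} {r ρ δ κ C : ℝ} {n₁ : ℕ} (R : LocalRegion D μ z₀ r ρ δ κ C n₁)
  {e : ℕ → E m × E p → ℝ} {a : ℕ → ℝ}

include R

/-- Linearisation of the local maximiser. -/
lemma isMLEIn_norm_sub_linear_le (h : ExpandsOn μ ℓ adm (Metric.ball z₀ r) C n₁ e a) (hC : 0 ≤ C)
    (hcr₀ : IsCritSnd (logZeroth μ) z₀.1 z₀.2) (G : E m →L[ℝ] E p)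
    (hGv : ∀ v w, fderiv ℝ (fderiv ℝ (logZeroth μ)) z₀ (v, G v) (0, w) = 0) {T : ℕ → E m → E p}
    (hT : IsMLEIn ℓ adm (Metric.ball z₀.2 ρ) (Metric.ball z₀.1 δ) n₁ T) {ε : ℝ} (hε : 0 < ε) :
    ∃ δ' > 0, ∀ n ≥ n₁, ∀ x ∈ adm, ‖(n : ℝ)⁻¹ • x - z₀.1‖ < δ' →
      ‖T n x - z₀.2 - G ((n : ℝ)⁻¹ • x - z₀.1)‖ ≤ ε * ‖(n : ℝ)⁻¹ • x - z₀.1‖ + C / κ / n := by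
  obtain ⟨δ', hδ', hlin⟩ := R.norm_sub_linear_le h hC hcr₀ G hGv hε
  refine ⟨min δ' δ, lt_min hδ' R.pos.2.1, fun n hn x hx hlt => ?_⟩
  have hn0 : (n : ℝ) ≠ 0 := by
    have := R.pos.2.2.2.trans hn
    positivity
  have hy : (n : ℝ)⁻¹ • x ∈ Metric.ball z₀.1 δ := by
    rw [mem_ball_iff_norm]; exact hlt.trans_le (min_le_right _ _)
  have hxn : (n : ℝ) • (n : ℝ)⁻¹ • x = x := smul_inv_smul₀ hn0 x
  have h1 := (R.isUniqueLocalMaxIn_iff h hn hy (by rwa [hxn])).1 (hT.2 n hn _ hy (by rwa [hxn]))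
  rw [hxn] at h1
  exact hlin n hn _ (hlt.trans_le (min_le_left _ _)) _ h1.1 (by rw [add_sub_cancel]; exact h1.2)

end LocalRegion

lemma norm_prodMk₃_le {F : Type*} [NormedAddCommGroup F] {a b c : F} {t : ℝ} (ha : ‖a‖ ≤ t)
    (hb : ‖b‖ ≤ t) (hc : ‖c‖ ≤ t) : ‖(a, b, c)‖ ≤ t :=
  norm_prod_le_iff.2 ⟨ha, norm_prod_le_iff.2 ⟨hb, hc⟩⟩

/-- The triple of maximisers has the linearisation G × G × G, with the same G in each entry since
the leading term ψ is shared. One application of the delta method gives joint convergence to a limit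
on the diagonal. -/
lemma LocalRegion.samplingConclusion (hM : IsModel D μ) (hG : GrowthBound D μ)
    (hA : ∀ q ∈ interior (jointDomain D μ), (cgfHess (μ q.2) q.1).PosDef)
    (hF : FullyIdentifiable D μ s₀ θ₀ y₀) {r ρ δ κ C : ℝ} {n₁ : ℕ}
    (R : LocalRegion D μ (y₀, θ₀) r ρ δ κ C n₁) (hC : 0 ≤ C)
    {e e₁ e₀ : ℕ → E m × E p → ℝ} {a a₁ a₀ : ℕ → ℝ}
    (h : ExpandsOn μ ℓ adm (Metric.ball (y₀, θ₀) r) C n₁ e a)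
    (h₁ : ExpandsOn μ (spaLik μ) univ (Metric.ball (y₀, θ₀) r) C n₁ e₁ a₁)
    (h₀ : ExpandsOn μ (zerothLik μ) univ (Metric.ball (y₀, θ₀) r) C n₁ e₀ a₀)
    {T T₁ T₀ : ℕ → E m → E p} (hT : IsMLEIn ℓ adm (Metric.ball θ₀ ρ) (Metric.ball y₀ δ) n₁ T)
    (hT₁ : IsMLEIn (spaLik μ) univ (Metric.ball θ₀ ρ) (Metric.ball y₀ δ) n₁ T₁)
    (hT₀ : IsMLEIn (zerothLik μ) univ (Metric.ball θ₀ ρ) (Metric.ball y₀ δ) n₁ T₀) :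
    SamplingConclusion μ adm s₀ θ₀ y₀ T T₁ T₀ := by
  intro S Q hS hadm hZ
  have hcr : IsCritSnd (logZeroth μ) y₀ θ₀ := fun w => hF.fderiv_logZeroth hM hG hA w
  set G := matCLM (sensitivity μ s₀ θ₀)
  have hGv := hF.fderiv_fderiv_sensitivity hM hG hA
  have hmeas : ∀ n, Measurable fun x => (T n x, T₁ n x, T₀ n x) := fun n =>
    (hT.1 n).prodMk ((hT₁.1 n).prodMk (hT₀.1 n))
  have key := tendstoInDistribution_of_linearisation (Q := fun n => (Q n : Measure (E m)))
    hmeas (t₀ := (θ₀, θ₀, θ₀)) (G.prod (G.prod G)) (c := C / κ) (n₁ := n₁) (fun ε hε => by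
      obtain ⟨d, hd, hl⟩ := R.isMLEIn_norm_sub_linear_le h hC hcr G hGv hT hε
      obtain ⟨d₁, hd₁, hl₁⟩ := R.isMLEIn_norm_sub_linear_le h₁ hC hcr G hGv hT₁ hε
      obtain ⟨d₀, hd₀, hl₀⟩ := R.isMLEIn_norm_sub_linear_le h₀ hC hcr G hGv hT₀ hε
      refine ⟨min d (min d₁ d₀), lt_min hd (lt_min hd₁ hd₀), fun n hn => ?_⟩
      filter_upwards [hadm n] with x hx hlt
      exact norm_prodMk₃_le (hl n hn x hx (hlt.trans_le (min_le_left _ _)))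
        (hl₁ n hn x (mem_univ _) (hlt.trans_le ((min_le_right _ _).trans (min_le_left _ _))))
        (hl₀ n hn x (mem_univ _) (hlt.trans_le ((min_le_right _ _).trans (min_le_right _ _))))) hZ
  have hdiag : Measurable fun z : E p => (z, z, z) := by fun_prop
  refine tendstoInDistribution_congr_limit key hdiag.aemeasurable ?_
  rw [← hF.sensitivity_mul_mul_transpose hA, ← map_multivariateGaussian _ hS, Measure.map_map hdiag G.continuous.measurable]
  rfl

lemma mleConclusion (hM : IsModel D μ) (hG : GrowthBound D μ)
    (hA : ∀ q ∈ interior (jointDomain D μ), (cgfHess (μ q.2) q.1).PosDef)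
    (hF : FullyIdentifiable D μ s₀ θ₀ y₀) (hL : LikExpansion D μ ℓ adm (y₀, θ₀)) :
    MLEConclusion D μ ℓ adm s₀ θ₀ y₀ := by
  obtain ⟨r, ρ, δ, κ, C, n₁, hC, R, ⟨e, a, h⟩, ⟨e₁, a₁, h₁⟩, ⟨e₀, a₀, h₀⟩⟩ :=
    hF.exists_localRegion hM hG hA hL
  have hUD : Metric.ball θ₀ ρ ⊆ D := ball_subset_of_localRegion (z₀ := (y₀, θ₀)) R
  have hsub : Metric.ball y₀ δ ×ˢ Metric.ball θ₀ ρ ⊆ Metric.ball (y₀, θ₀) r := R.prod_subset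
  have hpos : ∀ n ≥ n₁, ∀ y ∈ Metric.ball y₀ δ, ∀ θ ∈ Metric.ball θ₀ ρ, (n : ℝ) • y ∈ adm →
      0 < ℓ n θ ((n : ℝ) • y) := by
    intro n hn y hy θ hθ hadm
    have hz : (y, θ) ∈ Metric.ball (y₀, θ₀) r := hsub ⟨hy, hθ⟩
    have h1 := (h n hn).2.2 (y, θ) hz hadm
    exact lt_of_lt_of_eq (mul_pos (h n hn).1 (Real.exp_pos _)) h1.symm
  have hex := R.exists_isMLEIn h
  have hex₁ := R.exists_isMLEIn h₁
  have hex₀ := R.exists_isMLEIn h₀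
  have hdist : ∀ (T T₀ : ℕ → E m → E p), IsMLEIn ℓ adm (Metric.ball θ₀ ρ) (Metric.ball y₀ δ) n₁ T →
      IsMLEIn (zerothLik μ) univ (Metric.ball θ₀ ρ) (Metric.ball y₀ δ) n₁ T₀ →
      ∀ n ≥ n₁, ∀ y ∈ Metric.ball y₀ δ, (n : ℝ) • y ∈ adm →
        ‖T₀ n ((n : ℝ) • y) - T n ((n : ℝ) • y)‖ ≤ 2 * C / κ / n := by
    intro T T₀ hT hT₀ n hn y hy hadm
    have e1 := (R.isUniqueLocalMaxIn_iff h hn hy hadm).1 (hT.2 n hn y hy hadm)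
    have e2 := (R.isUniqueLocalMaxIn_iff h₀ hn hy (mem_univ _)).1 (hT₀.2 n hn y hy (mem_univ _))
    exact R.norm_sub_le h₀ h hC hn hy e2.1 e1.1 e2.2 e1.2
  refine ⟨Metric.ball θ₀ ρ, Metric.ball y₀ δ, n₁, 2 * C / κ, Metric.isOpen_ball,
    Metric.mem_ball_self R.pos.1, hUD, Metric.isOpen_ball, Metric.mem_ball_self R.pos.2.1,
    hsub.trans R.subset, hpos, hex, hex₁, hex₀, fun T T₁ T₀ hT hT₁ hT₀ =>
    ⟨hdist T T₀ hT hT₀, R.samplingConclusion hM hG hA hF hC h h₁ h₀ hT hT₁ hT₀⟩⟩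

end Saddlepoint

namespace Saddlepoint

variable {m p : ℕ}

/-! ### Gaussian integrals and the Laplace approximation -/

lemma integrable_exp_neg_mul_sq_norm {b : ℝ} (hb : 0 < b) :
    Integrable fun x : E p => Real.exp (-b * ‖x‖ ^ 2) := by
  have h := (GaussianFourier.integrable_cexp_neg_mul_sq_norm_add (V := E p) (b := b)
    (by simpa using hb) 0 0).re
  refine h.congr (.of_forall fun x => ?_)
  have : -(b : ℂ) * (‖x‖ : ℂ) ^ 2 + 0 * ((inner ℝ (0 : E p) x : ℝ) : ℂ) =
      ((-b * ‖x‖ ^ 2 : ℝ) : ℂ) := by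
    push_cast; ring
  simp only [this, ← Complex.ofReal_exp]
  exact Complex.ofReal_re _

lemma integral_exp_neg_mul_sq_norm_pos {b : ℝ} (hb : 0 < b) :
    0 < ∫ x : E p, Real.exp (-b * ‖x‖ ^ 2) :=
  integral_exp_pos (integrable_exp_neg_mul_sq_norm hb)

/-- Compares characteristic functions. The normaliser is the same complex Gaussian integral at t =
0, so its value is never needed. -/
lemma stdGaussian_eq_withDensity :
    stdGaussian (E p) = volume.withDensity fun x => ENNReal.ofReal
      ((∫ x : E p, Real.exp (-(1 / 2) * ‖x‖ ^ 2))⁻¹ * Real.exp (-(1 / 2) * ‖x‖ ^ 2)) := by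
  set Z := ∫ x : E p, Real.exp (-(1 / 2) * ‖x‖ ^ 2) with hZ
  have hZ0 : 0 < Z := integral_exp_neg_mul_sq_norm_pos (by norm_num)
  have hi : Integrable fun x : E p => Z⁻¹ * Real.exp (-(1 / 2) * ‖x‖ ^ 2) :=
    (integrable_exp_neg_mul_sq_norm (by norm_num)).const_mul _
  have hfin : IsFiniteMeasure (volume.withDensity fun x : E p => ENNReal.ofReal
      (Z⁻¹ * Real.exp (-(1 / 2) * ‖x‖ ^ 2))) := isFiniteMeasure_withDensity_ofReal hi.2
  have hF : ∀ t : E p, ∫ x : E p, Complex.exp (-(1 / 2 : ℂ) * ‖x‖ ^ 2 +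
      Complex.I * (inner ℝ t x : ℝ)) = Z * Complex.exp (-‖t‖ ^ 2 / 2) := by
    have h1 := fun t : E p => GaussianFourier.integral_cexp_neg_mul_sq_norm_add (V := E p)
      (b := 1 / 2) (by norm_num) Complex.I t
    have h2 : (Z : ℂ) = (Real.pi / (1 / 2 : ℂ)) ^ (Module.finrank ℝ (E p) / 2 : ℂ) := by
      have h3 := h1 0
      simp only [inner_zero_left, Complex.ofReal_zero, mul_zero, add_zero, norm_zero, ne_eq,
        OfNat.ofNat_ne_zero, not_false_eq_true, zero_pow, zero_div, Complex.exp_zero, mul_one] at h3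
      rw [← h3, hZ, ← integral_complex_ofReal]
      congr 1
      ext x
      push_cast
      rfl
    intro t
    rw [h1, h2, Complex.I_sq]
    congr 2
    ring
  refine Measure.ext_of_charFun (funext fun t => ?_)
  rw [charFun_stdGaussian, charFun_apply, integral_withDensity_eq_integral_toReal_smul
    (by fun_prop) (.of_forall fun _ => ENNReal.ofReal_lt_top)]
  have h4 : ∀ x : E p, (ENNReal.ofReal (Z⁻¹ * Real.exp (-(1 / 2) * ‖x‖ ^ 2))).toReal •
      Complex.exp ((inner ℝ x t : ℝ) * Complex.I) = (Z : ℂ)⁻¹ *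
        Complex.exp (-(1 / 2 : ℂ) * ‖x‖ ^ 2 + Complex.I * (inner ℝ t x : ℝ)) := fun x => by
    rw [ENNReal.toReal_ofReal (by positivity), Complex.exp_add, real_inner_comm,
      Complex.real_smul, mul_comm Complex.I]
    push_cast
    ring
  simp_rw [h4]
  rw [integral_const_mul, hF, inv_mul_cancel_left₀ (by exact_mod_cast hZ0.ne')]

lemma integral_stdGaussian (g : E p → ℝ) :
    ∫ x, g x ∂stdGaussian (E p) = (∫ x : E p, Real.exp (-(1 / 2) * ‖x‖ ^ 2))⁻¹ *
      ∫ x, Real.exp (-(1 / 2) * ‖x‖ ^ 2) * g x := by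
  rw [stdGaussian_eq_withDensity, integral_withDensity_eq_integral_toReal_smul
    (by fun_prop) (.of_forall fun _ => ENNReal.ofReal_lt_top), ← integral_const_mul]
  refine integral_congr_ae (.of_forall fun x => ?_)
  have := integral_exp_neg_mul_sq_norm_pos (p := p) (b := 1 / 2) (by norm_num)
  beta_reduce
  rw [ENNReal.toReal_ofReal (by positivity), smul_eq_mul, mul_assoc]

/-- A square root of a covariance matrix with inverse `M`. -/
lemma exists_mul_transpose_eq_inv {M : Matrix (Fin p) (Fin p) ℝ} (hM : M.PosDef) :
    ∃ r : Matrix (Fin p) (Fin p) ℝ, r * r.transpose = M⁻¹ ∧ r.transpose * M * r = 1 := by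
  open scoped MatrixOrder in
  obtain ⟨B, hB⟩ := CStarAlgebra.nonneg_iff_eq_star_mul_self.mp hM.inv.posSemidef.nonneg
  rw [Matrix.star_eq_conjTranspose, Matrix.conjTranspose_eq_transpose_of_trivial] at hB
  have h1 : B.transpose * (B * M) = 1 := by
    rw [← Matrix.mul_assoc, ← hB]
    exact Matrix.nonsing_inv_mul _ (hM.isUnit.map Matrix.detMonoidHom)
  refine ⟨B.transpose, by rw [Matrix.transpose_transpose]; exact hB.symm, ?_⟩
  rw [Matrix.transpose_transpose]
  exact mul_eq_one_comm.1 h1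

/-- Only existence of a positive Jacobian factor independent of F matters: it cancels in normalised
integrals. -/
lemma integral_affine {r : Matrix (Fin p) (Fin p) ℝ} (hr : r.det ≠ 0) {t : ℝ} (ht : t ≠ 0)
    (θ₀ : E p) :
    ∃ c : ℝ, 0 < c ∧ ∀ F : E p → ℝ, ∫ x, F (θ₀ + t • matCLM r x) = c * ∫ θ, F θ := by
  have hdet : LinearMap.det (t • Matrix.toLpLin 2 2 r) ≠ 0 := by
    rw [LinearMap.det_smul, LinearMap.det_toLpLin]
    exact mul_ne_zero (pow_ne_zero _ ht) hr
  set L := LinearEquiv.ofIsUnitDet (v := EuclideanSpace.basisFun (Fin p) ℝ |>.toBasis)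
    (v' := EuclideanSpace.basisFun (Fin p) ℝ |>.toBasis) (f := t • Matrix.toLpLin 2 2 r)
    (by rw [LinearMap.det_toMatrix]; exact hdet.isUnit)
  refine ⟨|(LinearMap.det (t • Matrix.toLpLin 2 2 r))⁻¹|, abs_pos.2 (inv_ne_zero hdet),
    fun F => ?_⟩
  have h1 := Measure.map_linearMap_addHaar_eq_smul_addHaar (volume : Measure (E p)) hdet
  have h2 : MeasurableEmbedding (t • Matrix.toLpLin 2 2 r) :=
    L.toContinuousLinearEquiv.toHomeomorph.measurableEmbedding
  have h3 := h2.integral_map (μ := volume) (fun u => F (θ₀ + u))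
  rw [h1, integral_smul_measure, ENNReal.toReal_ofReal (abs_nonneg _), integral_add_left_eq_self,
    smul_eq_mul] at h3
  exact h3.symm

/-- The Laplace approximation: if `Wₙ` is concentrated near `θ₀` at the scale `1 / √n`, where it
has the shape of a Gaussian density, then the normalised integrals converge to Gaussian ones. -/
lemma tendsto_laplace {l : Filter ℕ} [l.IsCountablyGenerated] (hl : l ≤ atTop)
    {M : Matrix (Fin p) (Fin p) ℝ} (hM : M.PosDef) {W : ℕ → E p → ℝ} {θ₀ : E p} {b κ w : ℝ}
    (hκ : 0 < κ) (hw : 0 < w) (hmeas : ∀ᶠ n in l, Measurable (W n))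
    (hbound : ∀ᶠ n : ℕ in l, ∀ θ, |W n θ| ≤ b * Real.exp (-κ * (n * ‖θ - θ₀‖ ^ 2)))
    (hlim : ∀ u : E p, Tendsto (fun n : ℕ => W n (θ₀ + (√(n : ℝ))⁻¹ • u)) l
      (𝓝 (w * Real.exp (-(1 / 2) * (u.ofLp ⬝ᵥ M.mulVec u.ofLp)))))
    {g : E p → ℝ} (hg : Continuous g) {B : ℝ} (hgB : ∀ x, |g x| ≤ B) :
    Tendsto (fun n : ℕ => (∫ θ, W n θ)⁻¹ * ∫ θ, W n θ * g (√(n : ℝ) • (θ - θ₀))) l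
      (𝓝 (∫ x, g x ∂multivariateGaussian 0 M⁻¹)) := by
  -- The substitution θ = θ₀ + n^(-1/2) r x with rᵀMr = 1 turns the limiting weight into the
  -- standard Gaussian one.
  obtain ⟨r, hr, hr1⟩ := exists_mul_transpose_eq_inv hM
  have hrdet : r.det ≠ 0 := by
    intro h
    have := congrArg Matrix.det hr1
    rw [Matrix.det_mul, h, mul_zero, Matrix.det_one] at this
    exact zero_ne_one this
  have hquad : ∀ x : E p, (matCLM r x).ofLp ⬝ᵥ M.mulVec (matCLM r x).ofLp = ‖x‖ ^ 2 := fun x => by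
    rw [ofLp_matCLM, ← real_inner_self_eq_norm_sq, inner_eq_dotProduct, Matrix.mulVec_mulVec,
      ← Matrix.vecMul_transpose, ← Matrix.dotProduct_mulVec, Matrix.mulVec_mulVec,
      ← Matrix.mul_assoc, hr1, Matrix.one_mulVec]
  -- From |rx|² ≥ c|x|² the hypothesis on W yields an integrable Gaussian majorant in x.
  obtain ⟨c, hc, hlow⟩ := exists_pos_mul_sq_le (F := E p) (f := fun x => ‖matCLM r x‖ ^ 2)
    (by fun_prop) (fun t v => by rw [map_smul, norm_smul, mul_pow, Real.norm_eq_abs, sq_abs])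
    (fun v hv => by
      have h1 : matCLM r v ≠ 0 := fun h => by
        have := hquad v
        rw [h] at this
        simp only [WithLp.ofLp_zero, zero_dotProduct] at this
        exact hv (norm_eq_zero.1 ((pow_eq_zero_iff two_ne_zero).1 this.symm))
      positivity)
  have hn0 : ∀ᶠ n : ℕ in l, (0 : ℝ) < n :=
    hl ((eventually_gt_atTop 0).mono fun n hn => by exact_mod_cast hn)
  have key : ∀ g : E p → ℝ, Continuous g → ∀ B, (∀ x, |g x| ≤ B) →
      Tendsto (fun n : ℕ => ∫ x, W n (θ₀ + (√(n : ℝ))⁻¹ • matCLM r x) * g (matCLM r x)) l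
      (𝓝 (∫ x, w * Real.exp (-(1 / 2) * ‖x‖ ^ 2) * g (matCLM r x))) := by
    intro g hg B hgB
    refine tendsto_integral_filter_of_dominated_convergence
      (fun x => b * B * Real.exp (-(κ * c) * ‖x‖ ^ 2)) ?_ ?_
      ((integrable_exp_neg_mul_sq_norm (by positivity)).const_mul _) (.of_forall fun x => ?_)
    · filter_upwards [hmeas] with n hn
      exact ((hn.comp (by fun_prop)).mul (by fun_prop)).aestronglyMeasurable
    · filter_upwards [hbound, hn0] with n hn hn1
      refine .of_forall fun x => ?_
      have h1 := hn (θ₀ + (√(n : ℝ))⁻¹ • matCLM r x)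
      have h2 : (n : ℝ) * ‖(√(n : ℝ))⁻¹ • matCLM r x‖ ^ 2 = ‖matCLM r x‖ ^ 2 := by
        rw [norm_smul, mul_pow, norm_inv, inv_pow, Real.norm_of_nonneg (Real.sqrt_nonneg _),
          Real.sq_sqrt hn1.le, mul_inv_cancel_left₀ hn1.ne']
      rw [add_sub_cancel_left, h2] at h1
      have hb : 0 ≤ b := by
        have := (abs_nonneg _).trans h1
        exact nonneg_of_mul_nonneg_left this (Real.exp_pos _)
      have h3 : Real.exp (-κ * ‖matCLM r x‖ ^ 2) ≤ Real.exp (-(κ * c) * ‖x‖ ^ 2) := by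
        rw [Real.exp_le_exp]
        nlinarith [mul_le_mul_of_nonneg_left (hlow x) hκ.le]
      rw [norm_mul, Real.norm_eq_abs, Real.norm_eq_abs]
      calc _ ≤ b * Real.exp (-(κ * c) * ‖x‖ ^ 2) * B :=
            mul_le_mul (h1.trans (mul_le_mul_of_nonneg_left h3 hb)) (hgB _) (abs_nonneg _)
              (by positivity)
        _ = _ := by ring
    · have h1 := hlim (matCLM r x)
      rw [hquad] at h1
      exact h1.mul_const _
  have hgauss : ∫ x, g x ∂multivariateGaussian 0 M⁻¹ =
      (∫ x : E p, w * Real.exp (-(1 / 2) * ‖x‖ ^ 2) * 1)⁻¹ *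
        ∫ x, w * Real.exp (-(1 / 2) * ‖x‖ ^ 2) * g (matCLM r x) := by
    have h1 := map_multivariateGaussian r (Matrix.PosSemidef.one (n := Fin p) (R := ℝ))
    rw [Matrix.mul_one, hr, multivariateGaussian_zero_one] at h1
    rw [← h1, integral_map (matCLM r).continuous.aemeasurable hg.aestronglyMeasurable,
      integral_stdGaussian]
    simp only [mul_one, mul_assoc, integral_const_mul]
    rw [mul_inv, mul_mul_mul_comm, inv_mul_cancel₀ hw.ne', one_mul]
  rw [hgauss]
  have hZ : (∫ x : E p, w * Real.exp (-(1 / 2) * ‖x‖ ^ 2) * 1) ≠ 0 := by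
    simp only [mul_one, integral_const_mul]
    exact (mul_pos hw (integral_exp_neg_mul_sq_norm_pos (by norm_num))).ne'
  -- Numerator and denominator are the cases g and 1 of the same limit; the Jacobian, which depends
  -- on n, drops out of their ratio.
  refine (((key (fun _ => 1) continuous_const 1 (by simp)).inv₀ hZ).mul
    (key g hg B hgB)).congr' ?_
  filter_upwards [hn0] with n hn
  have hs : √(n : ℝ) ≠ 0 := (Real.sqrt_pos.2 hn).ne'
  obtain ⟨c', hc', hF⟩ := integral_affine hrdet (inv_ne_zero hs) θ₀
  have h1 := hF fun θ => W n θ * 1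
  have h2 := hF fun θ => W n θ * g (√(n : ℝ) • (θ - θ₀))
  simp only [add_sub_cancel_left, smul_inv_smul₀ hs] at h2
  rw [h1, h2, mul_inv, mul_mul_mul_comm, inv_mul_cancel₀ hc'.ne', one_mul]
  simp only [mul_one]

/-- Second-order Taylor expansion at a critical point. -/
lemma tendsto_div_sq_of_hasDerivAt {φ φ' : ℝ → ℝ} {h : ℝ}
    (h1 : ∀ᶠ t in 𝓝 0, HasDerivAt φ (φ' t) t) (h0 : φ' 0 = 0) (h2 : HasDerivAt φ' h 0) :
    Tendsto (fun t => (φ t - φ 0) / t ^ 2) (𝓝[>] 0) (𝓝 (h / 2)) := by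
  have hle : 𝓝[>] (0 : ℝ) ≤ 𝓝 0 := nhdsWithin_le_nhds
  refine HasDerivAt.lhopital_zero_nhdsGT (f' := φ') (g' := fun t => 2 * t)
    ((h1.filter_mono hle).mono fun t ht => ht.sub_const _)
    (.of_forall fun t => by simpa using hasDerivAt_pow 2 t) ?_ ?_ ?_ ?_
  · filter_upwards [self_mem_nhdsWithin] with t ht
    exact mul_ne_zero two_ne_zero (ne_of_gt ht)
  · have : Tendsto (fun t => φ t - φ 0) (𝓝 0) (𝓝 (φ 0 - φ 0)) :=
      (h1.self_of_nhds.continuousAt.sub continuousAt_const)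
    rw [sub_self] at this
    exact this.mono_left hle
  · have : Tendsto (fun t : ℝ => t ^ 2) (𝓝 0) (𝓝 (0 ^ 2)) := (continuous_pow 2).continuousAt
    rw [zero_pow two_ne_zero] at this
    exact this.mono_left hle
  · have h3 := (hasDerivAt_iff_tendsto_slope.1 h2).mono_left
      (nhdsWithin_mono 0 fun t (ht : 0 < t) => ht.ne')
    refine (h3.div_const 2).congr' ?_
    filter_upwards [self_mem_nhdsWithin] with t ht
    have : t ≠ 0 := ne_of_gt ht
    rw [slope_def_field, h0]
    field_simp
    ring

end Saddlepoint

namespace Saddlepoint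

variable {m p : ℕ} {D : Set (E p)} {μ : E p → Measure (E m)}

/-! ### Posterior distributions -/

/-- The factor b is constant in θ and cancels, so the posterior only sees G, which will be the
likelihood ratio against θ₀. -/
lemma posterior_eq_smul_withDensity {ρ : Measure (E p)} {f : E p → ℝ} (hf : Measurable f)
    (hf0 : ∀ θ, 0 ≤ f θ) (hρ : ρ = volume.withDensity fun θ => ENNReal.ofReal (f θ))
    {U : Set (E p)} (hU : MeasurableSet U) {ℓ G : E p → ℝ} {b : ℝ} (hb : 0 < b)
    (hG : Measurable G) (hG0 : ∀ θ, 0 ≤ G θ) (hGU : ∀ θ ∉ U, G θ = 0)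
    (hℓ : ∀ θ ∈ U, ℓ θ = b * G θ) (hint : ∫ θ, f θ * G θ ≠ 0) :
    posterior ρ ℓ U = (ENNReal.ofReal (∫ θ, f θ * G θ))⁻¹ •
      volume.withDensity fun θ => ENNReal.ofReal (f θ * G θ) := by
  have hfG : Measurable fun θ => f θ * G θ := hf.mul hG
  have h0 : ∀ θ, 0 ≤ f θ * G θ := fun θ => mul_nonneg (hf0 θ) (hG0 θ)
  have h1 : (ρ.restrict U).withDensity (fun θ => ENNReal.ofReal (ℓ θ)) =
      ENNReal.ofReal b • volume.withDensity fun θ => ENNReal.ofReal (f θ * G θ) := by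
    rw [← withDensity_indicator hU, hρ]
    have e1 : U.indicator (fun θ => ENNReal.ofReal (ℓ θ)) = fun θ => ENNReal.ofReal (b * G θ) := by
      ext θ
      by_cases hθ : θ ∈ U
      · rw [indicator_of_mem hθ, hℓ θ hθ]
      · rw [indicator_of_notMem hθ, hGU θ hθ, mul_zero, ENNReal.ofReal_zero]
    rw [e1, ← withDensity_mul _ (by fun_prop) (by fun_prop), ← withDensity_smul _ (by fun_prop)]
    congr 1
    ext θ
    rw [Pi.mul_apply, Pi.smul_apply, smul_eq_mul, ← ENNReal.ofReal_mul (hf0 θ),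
      ← ENNReal.ofReal_mul hb.le]
    congr 1
    ring
  -- A Bochner integral that is not zero witnesses integrability, as the integral of a
  -- non-integrable function is 0 by convention.
  have h2 : ∫⁻ θ, ENNReal.ofReal (f θ * G θ) = ENNReal.ofReal (∫ θ, f θ * G θ) :=
    (ofReal_integral_eq_lintegral_ofReal (by_contra fun h => hint (integral_undef h))
      (.of_forall h0)).symm
  have h3 : ∫⁻ θ in U, ENNReal.ofReal (ℓ θ) ∂ρ =
      ENNReal.ofReal b * ENNReal.ofReal (∫ θ, f θ * G θ) := by
    rw [← h2, ← setLIntegral_univ, ← withDensity_apply _ MeasurableSet.univ, h1,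
      Measure.smul_apply, withDensity_apply _ MeasurableSet.univ, setLIntegral_univ, smul_eq_mul]
  have hb' : ENNReal.ofReal b ≠ 0 := by simpa using hb
  rw [posterior, h1, h3, smul_smul, ENNReal.mul_inv (.inl hb') (.inl ENNReal.ofReal_ne_top),
    mul_right_comm, ENNReal.inv_mul_cancel hb' ENNReal.ofReal_ne_top, one_mul]

lemma integral_smul_withDensity {W : E p → ℝ} (hW : Measurable W) (hW0 : ∀ θ, 0 ≤ W θ)
    (g : E p → ℝ) : ∫ θ, g θ ∂((ENNReal.ofReal (∫ θ, W θ))⁻¹ •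
      volume.withDensity fun θ => ENNReal.ofReal (W θ)) = (∫ θ, W θ)⁻¹ * ∫ θ, W θ * g θ := by
  rw [integral_smul_measure, integral_withDensity_eq_integral_toReal_smul (by fun_prop)
    (.of_forall fun _ => ENNReal.ofReal_lt_top), ENNReal.toReal_inv,
    ENNReal.toReal_ofReal (integral_nonneg hW0), smul_eq_mul]
  simp only [ENNReal.toReal_ofReal (hW0 _), smul_eq_mul]

lemma isProbabilityMeasure_smul_withDensity {W : E p → ℝ} (hW0 : ∀ θ, 0 ≤ W θ)
    (hint : ∫ θ, W θ ≠ 0) : IsProbabilityMeasure ((ENNReal.ofReal (∫ θ, W θ))⁻¹ •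
      volume.withDensity fun θ => ENNReal.ofReal (W θ)) := by
  refine ⟨?_⟩
  have hpos : 0 < ∫ θ, W θ := lt_of_le_of_ne (integral_nonneg hW0) hint.symm
  rw [Measure.smul_apply, withDensity_apply _ MeasurableSet.univ, setLIntegral_univ,
    ← ofReal_integral_eq_lintegral_ofReal (by_contra fun h => hint (integral_undef h))
      (.of_forall hW0), smul_eq_mul]
  exact ENNReal.inv_mul_cancel (by simpa using hpos) ENNReal.ofReal_ne_top

lemma posteriorLimit_of_laplace {l : Filter ℕ} [l.IsCountablyGenerated] (hl : l ≤ atTop)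
    {M : Matrix (Fin p) (Fin p) ℝ} (hM : M.PosDef) {ρ : Measure (E p)} {f : E p → ℝ}
    (hf : Measurable f) (hf0 : ∀ θ, 0 ≤ f θ)
    (hρ : ρ = volume.withDensity fun θ => ENNReal.ofReal (f θ)) {U : Set (E p)}
    (hU : MeasurableSet U) {θ₀ : E p} {ℓ G : ℕ → E p → ℝ} {b : ℕ → ℝ} {B κ w : ℝ}
    (hκ : 0 < κ) (hw : 0 < w)
    (hG : ∀ᶠ n in l, 0 < b n ∧ Measurable (G n) ∧ (∀ θ, 0 ≤ G n θ) ∧ (∀ θ ∉ U, G n θ = 0) ∧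
      ∀ θ ∈ U, ℓ n θ = b n * G n θ)
    (hbound : ∀ᶠ n : ℕ in l, ∀ θ, |f θ * G n θ| ≤ B * Real.exp (-κ * (n * ‖θ - θ₀‖ ^ 2)))
    (hlim : ∀ u : E p, Tendsto (fun n : ℕ => f (θ₀ + (√(n : ℝ))⁻¹ • u) *
      G n (θ₀ + (√(n : ℝ))⁻¹ • u)) l
      (𝓝 (w * Real.exp (-(1 / 2) * (u.ofLp ⬝ᵥ M.mulVec u.ofLp))))) :
    PosteriorLimit l ρ ℓ U θ₀ M⁻¹ := by
  have hlap := fun {g : E p → ℝ} (hg : Continuous g) {K : ℝ} (hK : ∀ x, |g x| ≤ K) =>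
    tendsto_laplace hl hM (W := fun n θ => f θ * G n θ) hκ hw
      (hG.mono fun n h => hf.mul h.2.1) hbound hlim hg hK
  -- For g = 1 the Laplace ratio tends to 1. With 0⁻¹ = 0 it would be 0 if the normaliser vanished,
  -- so the normaliser is eventually non-zero.
  have hne : ∀ᶠ n in l, ∫ θ, f θ * G n θ ≠ 0 := by
    have h1 := hlap (g := fun _ => 1) continuous_const (K := 1) (by simp)
    simp only [mul_one, integral_const, probReal_univ, smul_eq_mul] at h1
    refine (h1.eventually_ne one_ne_zero).mono fun n hn h => hn ?_
    rw [h, mul_zero]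
  have hpost : ∀ᶠ n in l, posterior ρ (ℓ n) U = (ENNReal.ofReal (∫ θ, f θ * G n θ))⁻¹ •
      volume.withDensity fun θ => ENNReal.ofReal (f θ * G n θ) := by
    filter_upwards [hG, hne] with n hn h
    exact posterior_eq_smul_withDensity hf hf0 hρ hU hn.1 hn.2.1 hn.2.2.1 hn.2.2.2.1 hn.2.2.2.2 h
  -- A Dirac mass fills in for the n at which the posterior is not a probability measure; these do
  -- not affect the limit.
  choose P hP' using fun n => show ∃ P : ProbabilityMeasure (E p),
      IsProbabilityMeasure (posterior ρ (ℓ n) U) → (P : Measure (E p)) = posterior ρ (ℓ n) U by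
    by_cases h : IsProbabilityMeasure (posterior ρ (ℓ n) U)
    · exact ⟨⟨_, h⟩, fun _ => rfl⟩
    · exact ⟨⟨Measure.dirac 0, inferInstance⟩, fun h' => absurd h' h⟩
  have hP : ∀ᶠ n in l, (P n : Measure (E p)) = posterior ρ (ℓ n) U := by
    filter_upwards [hG, hne, hpost] with n hn h h2
    refine hP' n ?_
    rw [h2]
    exact isProbabilityMeasure_smul_withDensity (fun θ => mul_nonneg (hf0 θ) (hn.2.2.1 θ)) h
  have hmeas : ∀ n : ℕ, Measurable fun θ : E p => √(n : ℝ) • (θ - θ₀) := fun n => by fun_prop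
  refine ⟨P, hP, ⟨fun n => (hmeas n).aemeasurable, aemeasurable_id, ?_⟩⟩
  refine ProbabilityMeasure.tendsto_iff_forall_integral_tendsto.2 fun g => ?_
  simp only [ProbabilityMeasure.coe_mk, Measure.map_id]
  refine (hlap g.continuous (K := ‖g‖) g.norm_coe_le_norm).congr' ?_
  filter_upwards [hG, hpost, hP] with n hn h2 h3
  rw [integral_map (hmeas n).aemeasurable g.continuous.aestronglyMeasurable, h3, h2,
    integral_smul_withDensity (W := fun θ => f θ * G n θ) (hf.mul hn.2.1) fun θ => mul_nonneg (hf0 θ) (hn.2.2.1 θ)]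

lemma tendsto_inv_sqrt_nhdsGT {l : Filter ℕ} (hl : l ≤ atTop) :
    Tendsto (fun n : ℕ => (√(n : ℝ))⁻¹) l (𝓝[>] 0) := by
  refine Tendsto.mono_left ?_ hl
  exact tendsto_inv_atTop_nhdsGT_zero.comp (Real.tendsto_sqrt_atTop.comp tendsto_natCast_atTop_atTop)

section

variable {ℓ : ℕ → E p → E m → ℝ} {adm : Set (E m)} {s₀ y₀ : E m} {θ₀ : E p} {r κ C : ℝ} {n₁ : ℕ}
  {e : ℕ → E m × E p → ℝ} {a : ℕ → ℝ}

/-- The likelihood ratio `ℓₙ(θ) / ℓₙ(θ₀)` on `U`. -/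
noncomputable def likRatio (μ : E p → Measure (E m)) (e : ℕ → E m × E p → ℝ) (y₀ : E m) (θ₀ : E p)
    (U : Set (E p)) (n : ℕ) : E p → ℝ :=
  U.indicator fun θ => Real.exp (n * (logZeroth μ (y₀, θ) - logZeroth μ (y₀, θ₀)) +
    (e n (y₀, θ) - e n (y₀, θ₀)))

/-- Second-order Taylor expansion of ψ along u at the critical point θ₀, with step t = 1/√n and
hence n = 1/t². -/
lemma tendsto_mul_logZeroth_sub (hM : IsModel D μ) (hG : GrowthBound D μ)
    (hA : ∀ q ∈ interior (jointDomain D μ), (cgfHess (μ q.2) q.1).PosDef)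
    (hF : FullyIdentifiable D μ s₀ θ₀ y₀) {l : Filter ℕ} (hl : l ≤ atTop) (u : E p) :
    Tendsto (fun n : ℕ => (n : ℝ) * (logZeroth μ (y₀, θ₀ + (√(n : ℝ))⁻¹ • u) -
      logZeroth μ (y₀, θ₀))) l (𝓝 (u.ofLp ⬝ᵥ (matH μ s₀ θ₀).mulVec u.ofLp / 2)) := by
  have hO := isOpen_saddleRegion hM hG hA
  have hcd := contDiffOn_logZeroth hM hG hA
  have hz := hF.mem_saddleRegion
  have hline : ∀ t : ℝ, HasDerivAt (fun t : ℝ => (y₀, θ₀ + t • u)) ((0, u) : E m × E p) t :=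
    fun t => (hasDerivAt_const t y₀).prodMk
      (by simpa using ((hasDerivAt_id t).smul_const u).const_add θ₀)
  have hmem : ∀ᶠ t : ℝ in 𝓝 0, (y₀, θ₀ + t • u) ∈ saddleRegion D μ := by
    refine (hline 0).continuousAt.preimage_mem_nhds (hO.mem_nhds ?_)
    simpa using hz
  have hd : ∀ᶠ t : ℝ in 𝓝 0, HasDerivAt (fun t => logZeroth μ (y₀, θ₀ + t • u))
      (fderiv ℝ (logZeroth μ) (y₀, θ₀ + t • u) (0, u)) t := hmem.mono fun t ht =>
    HasFDerivAt.comp_hasDerivAt (f := fun t : ℝ => (y₀, θ₀ + t • u)) t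
      (hasFDerivAt_of_contDiffOn hO hcd ht) (hline t)
  have hd2 : HasDerivAt (fun t : ℝ => fderiv ℝ (logZeroth μ) (y₀, θ₀ + t • u) (0, u))
      (fderiv ℝ (fderiv ℝ (logZeroth μ)) (y₀, θ₀) (0, u) (0, u)) 0 := by
    have h2 : HasFDerivAt (fderiv ℝ (logZeroth μ)) (fderiv ℝ (fderiv ℝ (logZeroth μ)) (y₀, θ₀))
        (y₀, θ₀ + (0 : ℝ) • u) := by
      rw [zero_smul, add_zero]
      exact hasFDerivAt_fderiv hO hcd hz
    have h3 := HasFDerivAt.comp_hasDerivAt (f := fun t : ℝ => (y₀, θ₀ + t • u)) (0 : ℝ) h2 (hline 0)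
    simpa using h3.clm_apply (hasDerivAt_const 0 ((0, u) : E m × E p))
  have h1 := tendsto_div_sq_of_hasDerivAt (φ := fun t => logZeroth μ (y₀, θ₀ + t • u))
    (φ' := fun t => fderiv ℝ (logZeroth μ) (y₀, θ₀ + t • u) (0, u))
    (h := fderiv ℝ (fderiv ℝ (logZeroth μ)) (y₀, θ₀) (0, u) (0, u))
    hd (by simpa using hF.fderiv_logZeroth hM hG hA u) hd2
  rw [hF.fderiv_fderiv_logZeroth hM hG hA, WithLp.ofLp_zero, Matrix.mulVec_zero, zero_add] at h1
  refine (h1.comp (tendsto_inv_sqrt_nhdsGT hl)).congr fun n => ?_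
  simp only [Function.comp_apply, zero_smul, add_zero, inv_pow, Real.sq_sqrt (Nat.cast_nonneg n),
    div_inv_eq_mul, mul_comm]

/-- The gradient of eₙ is bounded uniformly in n, so eₙ varies by O(1/√n) over the distance |u|/√n.
-/
lemma tendsto_error_sub (hC : ∀ n ≥ n₁, C2Bound (Metric.ball (y₀, θ₀) r) (e n) C C C) (hr : 0 < r)
    {l : Filter ℕ} (hl : l ≤ atTop) (u : E p) :
    Tendsto (fun n : ℕ => e n (y₀, θ₀ + (√(n : ℝ))⁻¹ • u) - e n (y₀, θ₀)) l (𝓝 0) := by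
  have h0 : Tendsto (fun n : ℕ => ‖(√(n : ℝ))⁻¹ • u‖) l (𝓝 0) := by
    have := (((tendsto_inv_sqrt_nhdsGT hl).mono_right nhdsWithin_le_nhds).smul_const u).norm
    simpa using this
  have h1 := h0.const_mul C
  rw [mul_zero] at h1
  refine squeeze_zero_norm' ?_ h1
  filter_upwards [h0.eventually (gt_mem_nhds hr), (eventually_ge_atTop n₁).filter_mono hl]
    with n h2 h3
  have hz : (y₀, θ₀) ∈ Metric.ball (y₀, θ₀) r := Metric.mem_ball_self hr
  have hz' : (y₀, θ₀ + (√(n : ℝ))⁻¹ • u) ∈ Metric.ball (y₀, θ₀) r := by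
    rw [← ball_prod_same]
    exact ⟨Metric.mem_ball_self hr, by simpa using h2⟩
  have h4 := (convex_ball (y₀, θ₀) r).norm_image_sub_le_of_norm_fderiv_le (𝕜 := ℝ)
    (fun z hz => (hasFDerivAt_of_contDiffOn Metric.isOpen_ball (hC n h3).1 hz).differentiableAt)
    (fun z hz => (hC n h3).le₁ z hz) hz hz'
  refine h4.trans_eq ?_
  congr 1
  rw [Prod.mk_sub_mk, sub_self, add_sub_cancel_left, Prod.norm_def]
  simp

/-- On the scale 1/√n only the quadratic term of nψ survives in the likelihood ratio. Strong
concavity on the whole ball prevents mass away from θ₀ from contributing. -/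
lemma posteriorLimit_of_expandsOn (hM : IsModel D μ) (hG : GrowthBound D μ)
    (hA : ∀ q ∈ interior (jointDomain D μ), (cgfHess (μ q.2) q.1).PosDef)
    (hF : FullyIdentifiable D μ s₀ θ₀ y₀) (hr : 0 < r) (hκ : 0 < κ)
    (hS : StrongConcaveSnd (2 * κ) (logZeroth μ) (Metric.ball (y₀, θ₀) r))
    (h : ExpandsOn μ ℓ adm (Metric.ball (y₀, θ₀) r) C n₁ e a) {prior : Measure (E p)}
    {f : E p → ℝ} (hf : Measurable f) (hf0 : ∀ θ, 0 ≤ f θ)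
    (hprior : prior = volume.withDensity fun θ => ENNReal.ofReal (f θ))
    (hfc : ContinuousAt f θ₀) (hfpos : 0 < f θ₀) {ρ : ℝ} (hρ : 0 < ρ) (hρr : ρ ≤ r) {B : ℝ}
    (hfB : ∀ θ ∈ Metric.ball θ₀ ρ, f θ ≤ B) {l : Filter ℕ} [l.IsCountablyGenerated]
    (hl : l ≤ atTop) (hadm : ∀ᶠ n : ℕ in l, (n : ℝ) • y₀ ∈ adm) :
    PosteriorLimit l prior (fun n θ => ℓ n θ ((n : ℝ) • y₀)) (Metric.ball θ₀ ρ) θ₀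
      (-(matH μ s₀ θ₀)⁻¹) := by
  set U := Metric.ball θ₀ ρ
  have hUo : IsOpen U := Metric.isOpen_ball
  have hUz : ∀ θ ∈ U, (y₀, θ) ∈ Metric.ball (y₀, θ₀) r := fun θ hθ => by
    rw [← ball_prod_same]
    exact ⟨Metric.mem_ball_self hr, Metric.ball_subset_ball hρr hθ⟩
  have hθU : θ₀ ∈ U := Metric.mem_ball_self hρ
  have hz := hUz θ₀ hθU
  have hB : 0 < B := hfpos.trans_le (hfB θ₀ hθU)
  have hev : ∀ᶠ n in l, n₁ ≤ n := (eventually_ge_atTop n₁).filter_mono hl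
  rw [show -(matH μ s₀ θ₀)⁻¹ = (-matH μ s₀ θ₀)⁻¹ from (Matrix.inv_eq_left_inv (by
    rw [neg_mul_neg, Matrix.nonsing_inv_mul _ hF.isUnit_det_matH])).symm]
  refine posteriorLimit_of_laplace hl hF.negDef hf hf0 hprior hUo.measurableSet (w := f θ₀)
    (G := likRatio μ e y₀ θ₀ U) (B := B * Real.exp (2 * C)) (κ := κ)
    (b := fun n => a n * Real.exp (n * logZeroth μ (y₀, θ₀) + e n (y₀, θ₀))) hκ hfpos ?_ ?_ ?_
  · filter_upwards [hev, hadm] with n hn hx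
    refine ⟨mul_pos (h n hn).1 (Real.exp_pos _), ?_, fun θ => indicator_nonneg
      (fun _ _ => (Real.exp_pos _).le) θ, fun θ hθ => indicator_of_notMem hθ _, fun θ hθ => ?_⟩
    · have hc : ContinuousOn (fun θ => Real.exp (n * (logZeroth μ (y₀, θ) -
          logZeroth μ (y₀, θ₀)) + (e n (y₀, θ) - e n (y₀, θ₀)))) U := by
        have hp : ContinuousOn (fun θ : E p => (y₀, θ)) U := by fun_prop
        have e1 := hS.1.continuousOn.comp hp hUz
        have e2 := (h n hn).2.1.1.continuousOn.comp hp hUz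
        exact (((e1.sub continuousOn_const).const_mul (n : ℝ)).add
          (e2.sub continuousOn_const)).rexp
      classical
      rw [likRatio, ← piecewise_eq_indicator]
      exact hc.measurable_piecewise continuousOn_const hUo.measurableSet
    · rw [(h n hn).2.2 (y₀, θ) (hUz θ hθ) hx, likRatio, indicator_of_mem hθ, mul_assoc,
        ← Real.exp_add]
      congr 2
      ring
  -- Strong concavity with constant 2κ at the critical point gives exp(-κn‖θ - θ₀‖²); the two values
  -- of eₙ add at most 2C to the exponent, and B bounds the prior density.
  · filter_upwards [hev] with n hn θ
    by_cases hθ : θ ∈ U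
    · have e1 := hS.le_of_isCrit Metric.isOpen_ball (convex_ball _ _) hz (hUz θ hθ)
        fun w => hF.fderiv_logZeroth hM hG hA w
      have e2 := abs_le.1 ((h n hn).2.1.le₀ (y₀, θ) (hUz θ hθ))
      have e3 := abs_le.1 ((h n hn).2.1.le₀ (y₀, θ₀) hz)
      rw [likRatio, indicator_of_mem hθ, abs_of_nonneg (mul_nonneg (hf0 θ) (Real.exp_pos _).le),
        mul_assoc, ← Real.exp_add]
      refine mul_le_mul (hfB θ hθ) (Real.exp_le_exp.2 ?_) (Real.exp_pos _).le hB.le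
      have e4 := mul_le_mul_of_nonneg_left e1 (Nat.cast_nonneg (α := ℝ) n)
      linarith
    · rw [likRatio, indicator_of_notMem hθ, mul_zero, abs_zero]
      positivity
  · intro u
    have ht : Tendsto (fun n : ℕ => θ₀ + (√(n : ℝ))⁻¹ • u) l (𝓝 θ₀) := by
      have := (((tendsto_inv_sqrt_nhdsGT hl).mono_right nhdsWithin_le_nhds).smul_const u).const_add θ₀
      simpa using this
    have h1 := (tendsto_mul_logZeroth_sub hM hG hA hF hl u).add
      (tendsto_error_sub (fun n hn => (h n hn).2.1) hr hl u)
    have h2 := (hfc.tendsto.comp ht).mul (Real.continuous_exp.continuousAt.tendsto.comp h1)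
    rw [add_zero] at h2
    have h3 : -(1 / 2 : ℝ) * (u.ofLp ⬝ᵥ (-matH μ s₀ θ₀).mulVec u.ofLp) =
        u.ofLp ⬝ᵥ (matH μ s₀ θ₀).mulVec u.ofLp / 2 := by
      rw [Matrix.neg_mulVec, dotProduct_neg]; ring
    rw [h3]
    refine h2.congr' ?_
    filter_upwards [ht.eventually (hUo.mem_nhds hθU)] with n (hn : θ₀ + (√(n : ℝ))⁻¹ • u ∈ U)
    rw [likRatio, indicator_of_mem hn]
    rfl

end

lemma posteriorConclusion {ℓ : ℕ → E p → E m → ℝ} {adm : Set (E m)} {s₀ y₀ : E m} {θ₀ : E p}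
    (hM : IsModel D μ) (hG : GrowthBound D μ)
    (hA : ∀ q ∈ interior (jointDomain D μ), (cgfHess (μ q.2) q.1).PosDef)
    (hF : FullyIdentifiable D μ s₀ θ₀ y₀) (hL : LikExpansion D μ ℓ adm (y₀, θ₀)) :
    PosteriorConclusion D μ ℓ adm s₀ θ₀ y₀ := by
  intro prior f _ _ hf hf0 hprior hfc hfpos
  obtain ⟨r, ρ, δ, κ, C, n₁, -, R, ⟨e, a, h⟩, ⟨e₁, a₁, h₁⟩, ⟨e₀, a₀, h₀⟩⟩ :=
    hF.exists_localRegion hM hG hA hL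
  -- The prior density is only known to be continuous at θ₀, so U is shrunk until the density is
  -- bounded on it.
  obtain ⟨d, hd, hfd⟩ := Metric.eventually_nhds_iff_ball.1
    (hfc.tendsto.eventually (gt_mem_nhds (lt_add_one (f θ₀))))
  have hρ : 0 < ρ := R.pos.1
  have hρr : ρ < r := R.lt.1
  have hUD : Metric.ball θ₀ ρ ⊆ D := ball_subset_of_localRegion (z₀ := (y₀, θ₀)) R
  have hmin : 0 < min ρ d := lt_min hρ hd
  have hB : ∀ θ ∈ Metric.ball θ₀ (min ρ d), f θ ≤ f θ₀ + 1 := fun θ hθ =>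
    (hfd θ (Metric.ball_subset_ball (min_le_right _ _) hθ)).le
  have hlim := fun {ℓ' : ℕ → E p → E m → ℝ} {adm' : Set (E m)} {e' : ℕ → E m × E p → ℝ}
      {a' : ℕ → ℝ} (h' : ExpandsOn μ ℓ' adm' (Metric.ball (y₀, θ₀) r) C n₁ e' a') {l : Filter ℕ}
      [l.IsCountablyGenerated] (hl : l ≤ atTop) (hadm : ∀ᶠ n : ℕ in l, (n : ℝ) • y₀ ∈ adm') =>
    posteriorLimit_of_expandsOn hM hG hA hF (hρ.trans hρr) R.pos.2.2.1 R.concave h' hf hf0 hprior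
      hfc hfpos hmin ((min_le_left _ _).trans hρr.le) hB hl hadm
  refine ⟨Metric.ball θ₀ (min ρ d), Metric.isOpen_ball, Metric.mem_ball_self hmin,
    (Metric.ball_subset_ball (min_le_left _ _)).trans hUD, hlim h₀ le_rfl (by simp),
    hlim h₁ le_rfl (by simp), hlim h inf_le_left ?_⟩
  exact mem_inf_of_right (mem_principal_self _)

end Saddlepoint

/-! ### Assembly of the conclusions -/

namespace Saddlepoint

lemma conclusions_of_isInvertible {m p : ℕ} {D : Set (E p)} {μ : E p → Measure (E m)}
    (hM : IsModel D μ) (hG : GrowthBound D μ) {S : Set (E m)} {L : ℕ → E p → E m → ℝ}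
    {adm : Set (E m)} (hI : IsInvertible D μ S L adm) :
    GradientConclusion D μ L adm ∧ ∀ (s₀ : E m) (θ₀ : E p) (y₀ : E m),
      FullyIdentifiable D μ s₀ θ₀ y₀ →
      MLEConclusion D μ L adm s₀ θ₀ y₀ ∧ PosteriorConclusion D μ L adm s₀ θ₀ y₀ := by
  have hL := fun {z : E m × E p} (hz : z ∈ saddleRegion D μ) =>
    likExpansion_of_isInvertible hM hG hI.posDef hI hz
  refine ⟨gradientConclusion hM hG hI.posDef fun z hz => hL hz, fun s₀ θ₀ y₀ hF => ?_⟩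
  exact ⟨mleConclusion hM hG hI.posDef hF (hL hF.mem_saddleRegion),
    posteriorConclusion hM hG hI.posDef hF (hL hF.mem_saddleRegion)⟩

end Saddlepoint

theorem mainTheorem9 :
    -- absolutely continuous case
    (∀ (m p : ℕ) (D : Set (Saddlepoint.E p)) (μ : Saddlepoint.E p → Measure (Saddlepoint.E m)),
      Saddlepoint.IsModel D μ → Saddlepoint.DecayBound D μ → Saddlepoint.GrowthBound D μ →
      Saddlepoint.GradientConclusion D μ (Saddlepoint.densityLik μ) univ ∧
      ∀ (s₀ : Saddlepoint.E m) (θ₀ : Saddlepoint.E p) (y₀ : Saddlepoint.E m),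
        Saddlepoint.FullyIdentifiable D μ s₀ θ₀ y₀ →
        Saddlepoint.MLEConclusion D μ (Saddlepoint.densityLik μ) univ s₀ θ₀ y₀ ∧
        Saddlepoint.PosteriorConclusion D μ (Saddlepoint.densityLik μ) univ s₀ θ₀ y₀) ∧
    -- integer-valued case
    (∀ (m p : ℕ) (D : Set (Saddlepoint.E p)) (μ : Saddlepoint.E p → Measure (Saddlepoint.E m)),
      Saddlepoint.IsModel D μ → Saddlepoint.IsIntegerValued D μ → Saddlepoint.NonLattice D μ →
      Saddlepoint.GrowthBound D μ →
      Saddlepoint.GradientConclusion D μ (Saddlepoint.pmfLik μ) (Saddlepoint.intLattice m) ∧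
      ∀ (s₀ : Saddlepoint.E m) (θ₀ : Saddlepoint.E p) (y₀ : Saddlepoint.E m),
        Saddlepoint.FullyIdentifiable D μ s₀ θ₀ y₀ →
        Saddlepoint.MLEConclusion D μ (Saddlepoint.pmfLik μ) (Saddlepoint.intLattice m) s₀ θ₀ y₀ ∧
        Saddlepoint.PosteriorConclusion D μ (Saddlepoint.pmfLik μ) (Saddlepoint.intLattice m)
          s₀ θ₀ y₀) ∧
    -- exponential families
    (∀ (m : ℕ) (base : Measure (Saddlepoint.E m)) (h ρ : Saddlepoint.E m → ℝ)
      (N : Set (Saddlepoint.E m)), IsOpen N → Measurable h → (∀ x, 0 ≤ h x) →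
      (∀ η ∈ N, IsProbabilityMeasure (Saddlepoint.expFamLaw base h ρ η)) →
      ∀ x : Saddlepoint.E m, 0 < h x →
      (∀ η ∈ N, ∃ s, Saddlepoint.IsSaddlepoint (Saddlepoint.expFamLaw base h ρ η) x s) →
      (∀ η ∈ N,
        IsMaxOn (fun η' => Saddlepoint.zerothSPA (Saddlepoint.expFamLaw base h ρ η') x) N η ↔
          IsMaxOn (fun η' => Saddlepoint.expFamLik h ρ η' x) N η) ∧
      ((∀ η ∈ N, ∀ s ∈ interior (Saddlepoint.mgfDomain (Saddlepoint.expFamLaw base h ρ η)),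
          (Saddlepoint.cgfHess (Saddlepoint.expFamLaw base h ρ η) s).PosDef) →
        ∀ η₁ ∈ N, ∀ η₂ ∈ N,
          IsMaxOn (fun η' => Saddlepoint.zerothSPA (Saddlepoint.expFamLaw base h ρ η') x) N η₁ →
          IsMaxOn (fun η' => Saddlepoint.expFamLik h ρ η' x) N η₂ → η₁ = η₂)) := by
  refine ⟨fun m p D μ hM hd hG => ?_, fun m p D μ hM hi hn hG => ?_,
    fun m base h ρ N hN hh hpos hprob x hx hsad =>
      Saddlepoint.exponential_family base h ρ N hN hh hpos hprob x hx hsad⟩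
  · exact Saddlepoint.conclusions_of_isInvertible hM hG (Saddlepoint.isInvertible_densityLik hM hd)
  · exact Saddlepoint.conclusions_of_isInvertible hM hG
      (Saddlepoint.isInvertible_pmfLik hM hG hi hn)
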